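/- Consider the word RAM with words of $\Theta(\log n)$ bits and unit-cost instructions, where the input string is given in read-only memory that is not counted as space. Let $c\ge 0$ be a constant integer and let $\varepsilon>0$ be an arbitrarily small constant; the constants in the $\mathcal O$-bounds and in the word length, as well as the algorithms, may depend on $c$ and $\varepsilon$ only. For a string $T$ of length $n$ over the alphabet $\{0,\dots,n^c\}$ and positions $i,j$ of $T$, let $\mathrm{LCE}(i,j)$ denote the length of the longest common prefix of the suffixes of $T$ starting at positions $i$ and $j$. For every string $T$ of length $n\ge 1$ over $\{0,\dots,n^c\}$ and every integer $\tau$ with $1\le\tau\le n$, there is a deterministic data structure that uses $\mathcal O(n/\tau)$ words of space and answers every query $\mathrm{LCE}(i,j)$ correctly in $\mathcal O(\tau)$ worst-case time. Given $T$, $n$ and $\tau$, the data structure can be constructed by a deterministic algorithm in $\mathcal O(n^{2+\varepsilon})$ time using $\mathcal O(n/\tau)$ words of space. -/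

import Mathlib

namespace LCE

/-! ### Longest common extensions -/

/-- The length of the longest common prefix of two strings. -/
def lcp : List ℕ → List ℕ → ℕ
  | a :: x, b :: y => if a = b then lcp x y + 1 else 0
  | _, _ => 0

/-- `lce T i j` is the length of the longest common prefix of the suffixes of `T` starting at
positions `i` and `j` (positions are counted from `0`). -/
def lce (T : List ℕ) (i j : ℕ) : ℕ := lcp (T.drop i) (T.drop j)

/-! ### The word RAM with a read-only input string

The machine has a working memory of `s` words of `w` bits each; the input string `T` lies in a
separate read-only memory.  Every instruction costs one unit of time.  An access to an address
outside of the working memory, an access to a position outside of the input, and an attempt to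
write a number which does not fit into a word are faults: the machine crashes without halting.
There is no source of randomness. -/

/-- Binary operations on words (on natural numbers; `sub` is truncated, division by zero gives
zero). -/
inductive BinOp
  | add | sub | mul | div | mod | land | lor | xor | shl | shr

def BinOp.eval : BinOp → ℕ → ℕ → ℕ
  | .add, x, y => x + y
  | .sub, x, y => x - y
  | .mul, x, y => x * y
  | .div, x, y => x / y
  | .mod, x, y => x % y
  | .land, x, y => x &&& y
  | .lor, x, y => x ||| y
  | .xor, x, y => x ^^^ y
  | .shl, x, y => x <<< y
  | .shr, x, y => x >>> y

/-- Instructions.  Here `M` is the working memory and `T` the input; the arguments of an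
instruction are constants of the program. -/
inductive Instr
  /-- `M[a] := v` -/
  | const (a v : ℕ)
  /-- `M[a] := M[b]` -/
  | copy (a b : ℕ)
  /-- `M[a] := M[M[b]]` -/
  | load (a b : ℕ)
  /-- `M[M[a]] := M[b]` -/
  | store (a b : ℕ)
  /-- `M[a] := T[M[b]]` -/
  | input (a b : ℕ)
  /-- `M[a] := M[b] o M[d]` -/
  | op (o : BinOp) (a b d : ℕ)
  /-- `goto l` -/
  | jump (l : ℕ)
  /-- `if M[a] = M[b] then goto l` -/
  | jumpEq (a b l : ℕ)
  /-- `if M[a] < M[b] then goto l` -/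
  | jumpLt (a b l : ℕ)

/-- A program is a finite list of instructions; it halts when control leaves the list. -/
abbrev Program := List Instr

/-- Contents of the working memory; only the cells with address less than `s` are accessible. -/
abbrev Memory := ℕ → ℕ

structure Config where
  pc : ℕ
  mem : Memory

/-- Read the cell `a`. -/
def get (s : ℕ) (m : Memory) (a : ℕ) : Option ℕ :=
  if a < s then some (m a) else none

/-- Write `v` into the cell `a`. -/
def put (w s : ℕ) (m : Memory) (a v : ℕ) : Option Memory :=
  if a < s ∧ v < 2 ^ w then some (Function.update m a v) else none

/-- The effect of one instruction; `none` is a fault. -/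
def exec (T : List ℕ) (w s : ℕ) : Instr → Config → Option Config
  | .const a v, ⟨pc, m⟩ => do
      return ⟨pc + 1, ← put w s m a v⟩
  | .copy a b, ⟨pc, m⟩ => do
      let x ← get s m b
      return ⟨pc + 1, ← put w s m a x⟩
  | .load a b, ⟨pc, m⟩ => do
      let x ← get s m b
      let y ← get s m x
      return ⟨pc + 1, ← put w s m a y⟩
  | .store a b, ⟨pc, m⟩ => do
      let x ← get s m a
      let y ← get s m b
      return ⟨pc + 1, ← put w s m x y⟩
  | .input a b, ⟨pc, m⟩ => do
      let x ← get s m b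
      let y ← T[x]?
      return ⟨pc + 1, ← put w s m a y⟩
  | .op o a b d, ⟨pc, m⟩ => do
      let x ← get s m b
      let y ← get s m d
      return ⟨pc + 1, ← put w s m a (o.eval x y)⟩
  | .jump l, ⟨_, m⟩ => some ⟨l, m⟩
  | .jumpEq a b l, ⟨pc, m⟩ => do
      let x ← get s m a
      let y ← get s m b
      return ⟨if x = y then l else pc + 1, m⟩
  | .jumpLt a b l, ⟨pc, m⟩ => do
      let x ← get s m a
      let y ← get s m b
      return ⟨if x < y then l else pc + 1, m⟩

/-- One step of the program `P`; `none` if `P` has halted or the instruction faults. -/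
def step (P : Program) (T : List ℕ) (w s : ℕ) (c : Config) : Option Config :=
  P[c.pc]?.bind fun I => exec T w s I c

/-- Exactly `k` steps of the program `P`. -/
def steps (P : Program) (T : List ℕ) (w s : ℕ) : ℕ → Config → Option Config
  | 0, c => some c
  | k + 1, c => (step P T w s c).bind (steps P T w s k)

/-- On the machine with `s` words of `w` bits and input `T`, the program `P`, started with the
memory contents `m`, halts without a fault after exactly `k` steps with the memory contents
`m'`. -/
def HaltsIn (P : Program) (T : List ℕ) (w s k : ℕ) (m m' : Memory) : Prop :=
  ∃ pc, steps P T w s k ⟨0, m⟩ = some ⟨pc, m'⟩ ∧ P.length ≤ pc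

/-- Two arguments are passed to a program in the cells `0` and `1`. -/
def setArgs (m : Memory) (x y : ℕ) : Memory :=
  Function.update (Function.update m 0 x) 1 y

/-- Started from the memory contents `m`, the queries of the given sequence are answered one after
the other by the program `query`, each one correctly (with the answer in cell `0`) and within `t`
steps.  Each query works on the memory that the previous one has left. -/
def Answers (query : Program) (T : List ℕ) (w s t : ℕ) : Memory → List (ℕ × ℕ) → Prop
  | _, [] => True
  | m, (i, j) :: qs => ∃ k ≤ t, ∃ m', HaltsIn query T w s k (setArgs m i j) m' ∧
      m' 0 = lce T i j ∧ Answers query T w s t m' qs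

end LCE

set_option linter.constructorNameAsVariable false

/-! The structure rests on a sparse set B of positions, called boundaries, with two properties.
Locality (`Loc`): whether a position belongs to B depends only on the text within distance 14τ.
Determinacy (`Det`): if the texts at i and j agree on 32τ symbols and neither meets a boundary from
distance 16τ on, they go on agreeing. If B has O(n/τ) elements, one stores B in increasing order,
the lexicographic order of the suffixes that start in B, the common prefix lengths of neighbouring
suffixes, and a linear-space structure for range minima in constant time.

A query compares 32τ symbols directly. If they all agree, it looks up the first boundaries behind i
+ 16τ and j + 16τ. Up to the smaller of their two offsets the texts agree by determinacy
(`agree_of_succ`). If the offsets coincide, a range minimum between the ranks of the two boundaries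
gives the rest. If they differ, locality forces a mismatch within the next 14τ symbols unless the
text ends first (`mlen_lt_of_succ`), so a direct comparison finishes.

To obtain B, cut the text into n/τ aligned blocks of length τ. The initial boundaries are the
occurrences of blocks that are not followed by another occurrence of the same block within distance
τ/2. Without boundaries, an occurrence is continued by a chain of overlapping ones whose shifts are
forced, which gives determinacy (`base_det`). Each block contributes O(n/τ) boundaries, so there are
about (n/τ)² too coarsely counted boundaries (`card_base`), and about log(n/τ) halvings are needed.

The halvings are J phases of six levels with a length threshold that doubles from phase to phase.
Call the stretch between adjacent boundaries a phrase, and a boundary active if both of its phrases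
are within the threshold. An even level removes the active boundaries between commuting phrases. The
runs that merge are periodic, so determinacy survives (`Det.thin_even`), and afterwards adjacent
short phrases are different words (`seg_ne_of_thin`). An odd level gives each phrase an identifier
of O(log n) bits that differs between unequal neighbours (`pid_ne`), labels it by the parity of the
bits that the identifier shares with a seed, and removes the active boundaries between labels 0 and
1. No two removed boundaries are adjacent, so determinacy survives again (`Det.thin_odd`). A good
seed removes a quarter of the active boundaries. Three odd levels per phase halve the bound on the
cardinality (`card_lvl_phase`), and the locality radii form a geometric sum (`radius_le`).

Good seeds are found deterministically by fixing one bit after the other, always siding with the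
majority (`SeedInv.step`, `SeedInv.final`). The intermediate levels are too large to be stored.
Every round therefore recomputes them in a single pass over the text, in which each level remembers
only its last three boundaries. A pass takes O(n² log n) time and there are O(log² n) passes, so the
time is O(n² log³ n), which is O(n^(2+ε)) (`buildCost_le`, `log_add_one_le`).

The algorithms are written in a small structured language whose clock counts loop iterations.
Compilation preserves results and costs a constant factor in time (`Run.code_correct`); correctness
and iteration counts are proved together by weakest preconditions, with `wp_while` charging the
loops. -/

namespace LCE

/-! ### A structured language for the word RAM

Programs work on named variables and on named arrays of a common length.  The state carries a clock
that counts iterations of loops; every other statement takes time bounded by the length of the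
program. -/

/-- Variables of structured programs; `i` and `j` are the two argument cells. -/
inductive Var
  | i | j | n | tau | m | h | J | o | lam | tgt | y | a | flag | z | q
  | x0 | x1 | x | ell | d | lim | pa | pb | keep | p0 | p1 | p2 | pid | idu | idw | r | s
  | la | lb | dotr | dotu | dot | more | c0 | c1 | c01 | c10 | bit | s0 | s1 | s2 | N | k | lo | hi
  | mid | t | b | nb | cur | acc | e | len | res | u1 | u2 | nlam
  deriving DecidableEq

/-- Arrays of structured programs. -/
inductive Arr
  | last | W0 | W1 | W2 | seed | P | SA | RK | L | MK | LG | ST | BLK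
  deriving DecidableEq

theorem Var.ctorIdx_injective : Function.Injective Var.ctorIdx :=
  Function.LeftInverse.injective Var.ofNat_ctorIdx

theorem Arr.ctorIdx_injective : Function.Injective Arr.ctorIdx :=
  Function.LeftInverse.injective Arr.ofNat_ctorIdx

/-- Memory layout: variables occupy cells below 80, with the arguments `i` and `j` in cells 0 and 1;
cells 80 to 95 are scratch space for expressions; entry k of the array with index a lies in cell 96
+ 16 k + a, so the arrays are interleaved. -/
theorem Var.ctorIdx_lt (x : Var) : x.ctorIdx < 80 := by cases x <;> decide

theorem Arr.ctorIdx_lt (a : Arr) : a.ctorIdx < 16 := by cases a <;> decide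

inductive Expr
  | var (x : Var)
  | lit (k : ℕ)
  | op (o : BinOp) (e₁ e₂ : Expr)
  | inp (e : Expr)
  | arr (a : Arr) (e : Expr)

inductive Cond
  | eq (e₁ e₂ : Expr)
  | lt (e₁ e₂ : Expr)

inductive Stmt
  | assign (x : Var) (e : Expr)
  | store (a : Arr) (e₁ e₂ : Expr)
  | seq (p q : Stmt)
  | ite (c : Cond) (p q : Stmt)
  | while (c : Cond) (p : Stmt)

instance : Add Expr := ⟨.op .add⟩
instance : Sub Expr := ⟨.op .sub⟩
instance : Mul Expr := ⟨.op .mul⟩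
instance : Div Expr := ⟨.op .div⟩
instance : Mod Expr := ⟨.op .mod⟩
instance (k : ℕ) : OfNat Expr k := ⟨.lit k⟩

prefix:max "♯" => Expr.var
infix:60 "≔" => Stmt.assign
infixr:55 ";;" => Stmt.seq

structure St where
  v : Var → ℕ
  a : Arr → ℕ → ℕ
  clk : ℕ

def St.set (σ : St) (x : Var) (k : ℕ) : St := ⟨Function.update σ.v x k, σ.a, σ.clk⟩

def St.setA (σ : St) (b : Arr) (i k : ℕ) : St :=
  ⟨σ.v, Function.update σ.a b (Function.update (σ.a b) i k), σ.clk⟩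

def St.tick (σ : St) : St := ⟨σ.v, σ.a, σ.clk + 1⟩

@[simp] theorem St.set_v (σ : St) (x : Var) (k : ℕ) (y : Var) :
    (σ.set x k).v y = if y = x then k else σ.v y := by
  simp [St.set, Function.update_apply]
@[simp] theorem St.set_a (σ : St) (x : Var) (k : ℕ) : (σ.set x k).a = σ.a := rfl
@[simp] theorem St.set_clk (σ : St) (x : Var) (k : ℕ) : (σ.set x k).clk = σ.clk := rfl
@[simp] theorem St.setA_v (σ : St) (b : Arr) (i k : ℕ) : (σ.setA b i k).v = σ.v := rfl
@[simp] theorem St.setA_a (σ : St) (b : Arr) (i k : ℕ) (b' : Arr) (i' : ℕ) :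
    (σ.setA b i k).a b' i' = if b' = b then (if i' = i then k else σ.a b i') else σ.a b' i' := by
  by_cases h : b' = b
  · subst h; simp [St.setA, Function.update_apply]
  · simp [St.setA, h]
@[simp] theorem St.setA_clk (σ : St) (b : Arr) (i k : ℕ) : (σ.setA b i k).clk = σ.clk := rfl
@[simp] theorem St.tick_v (σ : St) : σ.tick.v = σ.v := rfl
@[simp] theorem St.tick_a (σ : St) : σ.tick.a = σ.a := rfl
@[simp] theorem St.tick_clk (σ : St) : σ.tick.clk = σ.clk + 1 := rfl

/-- The machine on which structured programs run: the input, the bound on the contents of a word, and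
the length of the arrays. -/
structure Env where
  T : List ℕ
  W : ℕ
  Z : ℕ

def Expr.eval (E : Env) (σ : St) : Expr → ℕ
  | .var x => σ.v x
  | .lit k => k
  | .op o e₁ e₂ => o.eval (e₁.eval E σ) (e₂.eval E σ)
  | .inp e => E.T.getD (e.eval E σ) 0
  | .arr a e => σ.a a (e.eval E σ)

/-- The expression can be evaluated without a fault. -/
def Expr.ok (E : Env) (σ : St) : Expr → Prop
  | .var _ => True
  | .lit k => k < E.W
  | .op o e₁ e₂ => e₁.ok E σ ∧ e₂.ok E σ ∧ o.eval (e₁.eval E σ) (e₂.eval E σ) < E.W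
  | .inp e => e.ok E σ ∧ e.eval E σ < E.T.length
  | .arr _ e => e.ok E σ ∧ e.eval E σ < E.Z

def Cond.eval (E : Env) (σ : St) : Cond → Prop
  | .eq e₁ e₂ => e₁.eval E σ = e₂.eval E σ
  | .lt e₁ e₂ => e₁.eval E σ < e₂.eval E σ

def Cond.ok (E : Env) (σ : St) : Cond → Prop
  | .eq e₁ e₂ => e₁.ok E σ ∧ e₂.ok E σ
  | .lt e₁ e₂ => e₁.ok E σ ∧ e₂.ok E σ

/-- Big-step semantics. -/
inductive Run (E : Env) : Stmt → St → St → Prop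
  | assign {x e σ} : e.ok E σ → e.eval E σ < E.W → Run E (.assign x e) σ (σ.set x (e.eval E σ))
  | store {a e₁ e₂ σ} : e₁.ok E σ → e₂.ok E σ → e₁.eval E σ < E.Z → e₂.eval E σ < E.W →
      Run E (.store a e₁ e₂) σ (σ.setA a (e₁.eval E σ) (e₂.eval E σ))
  | seq {p q σ σ₁ σ₂} : Run E p σ σ₁ → Run E q σ₁ σ₂ → Run E (.seq p q) σ σ₂
  | iteT {c p q σ σ₁} : c.ok E σ → c.eval E σ → Run E p σ σ₁ → Run E (.ite c p q) σ σ₁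
  | iteF {c p q σ σ₁} : c.ok E σ → ¬ c.eval E σ → Run E q σ σ₁ → Run E (.ite c p q) σ σ₁
  | whileT {c p σ σ₁ σ₂} : c.ok E σ → c.eval E σ → Run E p σ.tick σ₁ → Run E (.while c p) σ₁ σ₂ →
      Run E (.while c p) σ σ₂
  | whileF {c p σ} : c.ok E σ → ¬ c.eval E σ → Run E (.while c p) σ σ

theorem Run.clk_le {E : Env} {p : Stmt} {σ σ' : St} (h : Run E p σ σ') : σ.clk ≤ σ'.clk := by
  induction h with
  | assign => simp
  | store => simp
  | seq _ _ h1 h2 => exact h1.trans h2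
  | iteT _ _ _ h => exact h
  | iteF _ _ _ h => exact h
  | whileT _ _ _ _ h1 h2 => simp at h1; omega
  | whileF => exact le_rfl

/-! ### Compilation -/

/-- Code that evaluates an expression into the cell `t`; the cells after `t` are scratch space. -/
def Expr.code : Expr → ℕ → List Instr
  | .var x, t => [.copy t x.ctorIdx]
  | .lit k, t => [.const t k]
  | .op o e₁ e₂, t => e₁.code t ++ (e₂.code (t + 1) ++ [.op o t t (t + 1)])
  | .inp e, t => e.code t ++ [.input t t]
  | .arr a e, t => e.code t ++ [.const (t + 1) 16, .op .mul t t (t + 1),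
      .const (t + 1) (96 + a.ctorIdx), .op .add t t (t + 1), .load t t]

/-- Number of scratch cells used by the code of the expression. An array access needs at least two,
because the second one holds the constants of the address computation. -/
def Expr.depth : Expr → ℕ
  | .var _ => 1
  | .lit _ => 1
  | .op _ e₁ e₂ => max e₁.depth (e₂.depth + 1)
  | .inp e => e.depth
  | .arr _ e => max e.depth 2

theorem Expr.depth_pos (e : Expr) : 1 ≤ e.depth := by
  induction e <;> simp [Expr.depth] <;> omega

/-- Code that jumps to `l` if the condition holds. -/
def Cond.code : Cond → ℕ → List Instr
  | .eq e₁ e₂, l => e₁.code 80 ++ (e₂.code 81 ++ [.jumpEq 80 81 l])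
  | .lt e₁ e₂, l => e₁.code 80 ++ (e₂.code 81 ++ [.jumpLt 80 81 l])

def Cond.depth : Cond → ℕ
  | .eq e₁ e₂ => max e₁.depth (e₂.depth + 1)
  | .lt e₁ e₂ => max e₁.depth (e₂.depth + 1)

def Stmt.depth : Stmt → ℕ
  | .assign _ e => e.depth
  | .store _ e₁ e₂ => max (e₁.depth + 1) (max (e₂.depth + 2) 3)
  | .seq p q => max p.depth q.depth
  | .ite c p q => max c.depth (max p.depth q.depth)
  | .while c p => max c.depth p.depth

def Cond.size : Cond → ℕ
  | .eq e₁ e₂ => (e₁.code 80).length + ((e₂.code 81).length + 1)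
  | .lt e₁ e₂ => (e₁.code 80).length + ((e₂.code 81).length + 1)

def Stmt.size : Stmt → ℕ
  | .assign _ e => (e.code 80).length + 1
  | .store _ e₁ e₂ => (e₁.code 80).length + ((e₂.code 81).length + 5)
  | .seq p q => p.size + q.size
  | .ite c p q => c.size + (q.size + (1 + p.size))
  | .while c p => c.size + (1 + (p.size + 1))

/-- Compilation of a statement to code placed at the address `o`. -/
def Stmt.code : Stmt → ℕ → List Instr
  | .assign x e, _ => e.code 80 ++ [.copy x.ctorIdx 80]
  | .store a e₁ e₂, _ => e₁.code 80 ++ (e₂.code 81 ++ [.const 82 16, .op .mul 80 80 82,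
      .const 82 (96 + a.ctorIdx), .op .add 80 80 82, .store 80 81])
  | .seq p q, o => p.code o ++ q.code (o + p.size)
  | .ite c p q, o => c.code (o + c.size + q.size + 1) ++ (q.code (o + c.size) ++
      ([.jump (o + c.size + q.size + 1 + p.size)] ++ p.code (o + c.size + q.size + 1)))
  | .while c p, o => c.code (o + c.size + 1) ++ ([.jump (o + c.size + 1 + p.size + 1)] ++
      (p.code (o + c.size + 1) ++ [.jump o]))

theorem Cond.length_code (c : Cond) (l : ℕ) : (c.code l).length = c.size := by
  cases c <;> simp [Cond.code, Cond.size]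

theorem Stmt.length_code (p : Stmt) (o : ℕ) : (p.code o).length = p.size := by
  induction p generalizing o <;> simp_all [Stmt.code, Stmt.size, Cond.length_code] <;>
    omega

def CodeAt (P : Program) (o : ℕ) (l : List Instr) : Prop :=
  ∀ i < l.length, P[o + i]? = l[i]?

theorem CodeAt.append {P : Program} {o : ℕ} {l₁ l₂ : List Instr} (h : CodeAt P o (l₁ ++ l₂)) :
    CodeAt P o l₁ ∧ CodeAt P (o + l₁.length) l₂ := by
  refine ⟨fun i hi => ?_, fun i hi => ?_⟩
  · rw [h i (by simp; omega), List.getElem?_append_left hi]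
  · have := h (l₁.length + i) (by simp; omega)
    rw [add_assoc, this, List.getElem?_append_right (by omega)]
    congr 1; omega

theorem steps_add (P : Program) (T : List ℕ) (w s : ℕ) (a b : ℕ) (c : Config) :
    steps P T w s (a + b) c = (steps P T w s a c).bind (steps P T w s b) := by
  induction a generalizing c with
  | zero => simp [steps]
  | succ a ih =>
    rw [Nat.succ_add]
    simp only [steps]
    cases step P T w s c with
    | none => rfl
    | some c' => simpa using ih c'

/-- `P` leads from one configuration to another one in exactly `k` steps. -/
def Reach (P : Program) (T : List ℕ) (w s k : ℕ) (c c' : Config) : Prop :=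
  steps P T w s k c = some c'

theorem Reach.trans {P : Program} {T : List ℕ} {w s a b : ℕ} {c c' c'' : Config}
    (h : Reach P T w s a c c') (h' : Reach P T w s b c' c'') : Reach P T w s (a + b) c c'' := by
  unfold Reach at *
  rw [steps_add, h]; exact h'

theorem Reach.one {P : Program} {T : List ℕ} {w s o : ℕ} {I : Instr} {m : Memory} {c' : Config}
    (h : CodeAt P o [I]) (he : exec T w s I ⟨o, m⟩ = some c') : Reach P T w s 1 ⟨o, m⟩ c' := by
  have := h 0 (by simp)
  simp at this
  simp [Reach, steps, step, this, he]

/-- A memory represents a state of a structured program. -/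
structure Rep (E : Env) (σ : St) (m : Memory) : Prop where
  var : ∀ x : Var, m x.ctorIdx = σ.v x
  arr : ∀ (a : Arr) (i : ℕ), i < E.Z → m (96 + i * 16 + a.ctorIdx) = σ.a a i
  var_lt : ∀ x, σ.v x < E.W
  arr_lt : ∀ (a : Arr) (i : ℕ), i < E.Z → σ.a a i < E.W

/-- Cells 80 to 95 carry no part of the state, so evaluating expressions there does not disturb the
representation. -/
theorem Rep.congr {E : Env} {σ : St} {m m' : Memory} (h : Rep E σ m)
    (hm : ∀ a, (a < 80 ∨ 96 ≤ a) → m' a = m a) : Rep E σ m' where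
  var x := by rw [hm _ (Or.inl x.ctorIdx_lt), h.var]
  arr a i hi := by rw [hm _ (Or.inr (by omega)), h.arr a i hi]
  var_lt := h.var_lt
  arr_lt := h.arr_lt

/-- The machine is large enough for the environment. -/
structure Fits (E : Env) (w s : ℕ) : Prop where
  word : E.W = 2 ^ w
  space : 96 + 16 * E.Z ≤ s
  -- Addresses of array entries and the layout constants all fit into a word.
  addr : 96 + 16 * E.Z + 128 ≤ E.W
  input : ∀ x ∈ E.T, x < E.W

theorem Fits.getD_lt {E : Env} {w s : ℕ} (hf : Fits E w s) (i : ℕ) : E.T.getD i 0 < E.W := by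
  have := hf.addr
  rw [List.getD_eq_getElem?_getD]
  cases h : E.T[i]? with
  | none => simp; omega
  | some x => simpa using hf.input x (List.mem_of_getElem? h)

theorem Expr.eval_lt {E : Env} {w s : ℕ} (hf : Fits E w s) {σ : St} {m : Memory} (hr : Rep E σ m)
    (e : Expr) (h : e.ok E σ) : e.eval E σ < E.W := by
  cases e with
  | var x => exact hr.var_lt x
  | lit k => exact h
  | op o e₁ e₂ => exact h.2.2
  | inp e => exact hf.getD_lt _
  | arr a e => exact hr.arr_lt a _ h.2

/-- The code has no jumps, so the number of steps is its length. Cells below `t` are preserved,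
which protects the value of a left operand while the right operand is evaluated one cell higher. -/
theorem Expr.code_correct {E : Env} {w s : ℕ} (hf : Fits E w s) {P : Program} {σ : St} (e : Expr)
    {o t : ℕ} {m : Memory} (hr : Rep E σ m) (hc : CodeAt P o (e.code t)) (ht : 80 ≤ t)
    (hd : t + e.depth ≤ 96) (hok : e.ok E σ) :
    ∃ m', Reach P E.T w s (e.code t).length ⟨o, m⟩ ⟨o + (e.code t).length, m'⟩ ∧
      m' t = e.eval E σ ∧ ∀ a, (a < t ∨ 96 ≤ a) → m' a = m a := by
  have hsp := hf.space
  have had := hf.addr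
  induction e generalizing o t m with
  | var x =>
    have hx := x.ctorIdx_lt
    simp [Expr.depth] at hd
    refine ⟨Function.update m t (σ.v x), ?_, by simp [Expr.eval], fun a ha => ?_⟩
    · refine Reach.one hc ?_
      have a1 : t < s := by omega
      have a2 : x.ctorIdx < s := by omega
      simp [exec, get, put, hr.var x, ← hf.word, hr.var_lt x, a1, a2, Expr.code]
    · rw [Function.update_of_ne]; omega
  | lit k =>
    simp [Expr.depth] at hd
    simp [Expr.ok] at hok
    refine ⟨Function.update m t k, ?_, by simp [Expr.eval], fun a ha => ?_⟩
    · refine Reach.one hc ?_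
      have a1 : t < s := by omega
      simp [exec, put, ← hf.word, hok, a1, Expr.code]
    · rw [Function.update_of_ne]; omega
  | op b e₁ e₂ ih₁ ih₂ =>
    simp only [Expr.depth] at hd
    obtain ⟨h1, h2, h3⟩ := hok
    have hp := e₂.depth_pos
    obtain ⟨hc1, hc2⟩ := CodeAt.append hc
    obtain ⟨hc2, hc3⟩ := CodeAt.append hc2
    obtain ⟨m1, r1, v1, f1⟩ := ih₁ hr hc1 ht (by omega) h1
    have hr1 : Rep E σ m1 := hr.congr fun a ha => f1 a (by omega)
    obtain ⟨m2, r2, v2, f2⟩ := ih₂ hr1 hc2 (by omega) (by omega) h2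
    refine ⟨Function.update m2 t (b.eval (e₁.eval E σ) (e₂.eval E σ)), ?_, by simp [Expr.eval],
      fun a ha => ?_⟩
    · have r3 := Reach.one (T := E.T) (w := w) (s := s) (m := m2) hc3
        (c' := ⟨_, Function.update m2 t (b.eval (e₁.eval E σ) (e₂.eval E σ))⟩) (by
          have ht' : m2 t = e₁.eval E σ := by rw [f2 t (by omega), v1]
          have a1 : t < s := by omega
          have a2 : t + 1 < s := by omega
          simp [exec, get, put, ht', v2, ← hf.word, h3, a1, a2]
          rfl)
      have := (r1.trans r2).trans r3
      simp only [Expr.code, List.length_append, List.length_singleton]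
      simpa only [add_assoc] using this
    · rw [Function.update_of_ne (by omega), f2 a (by omega), f1 a (by omega)]
  | inp e ih =>
    simp only [Expr.depth] at hd
    obtain ⟨h1, h2⟩ := hok
    obtain ⟨hc1, hc2⟩ := CodeAt.append hc
    obtain ⟨m1, r1, v1, f1⟩ := ih hr hc1 ht hd h1
    have hp := e.depth_pos
    have a1 : t < s := by omega
    have a2 := hf.getD_lt (e.eval E σ)
    refine ⟨Function.update m1 t (E.T.getD (e.eval E σ) 0), ?_, by simp [Expr.eval],
      fun a ha => ?_⟩
    · have r3 := Reach.one (T := E.T) (w := w) (s := s) (m := m1) hc2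
        (c' := ⟨_, Function.update m1 t (E.T.getD (e.eval E σ) 0)⟩) (by
          rw [List.getD_eq_getElem _ _ h2] at a2 ⊢
          simp [exec, get, put, v1, ← hf.word, a1, a2, h2]
          rfl)
      have := r1.trans r3
      simp only [Expr.code, List.length_append, List.length_singleton]
      simpa only [add_assoc] using this
    · rw [Function.update_of_ne (by omega), f1 a ha]
  | arr b e ih =>
    simp only [Expr.depth] at hd
    obtain ⟨h1, h2⟩ := hok
    obtain ⟨hc1, hc2⟩ := CodeAt.append hc
    obtain ⟨m1, r1, v1, f1⟩ := ih hr hc1 ht (by omega) h1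
    have hr1 : Rep E σ m1 := hr.congr fun a ha => f1 a (by omega)
    have hb := b.ctorIdx_lt
    have hv := hr.arr_lt b _ h2
    have hm := hr1.arr b _ h2
    set i := e.eval E σ with hi
    set v := σ.a b i with hvdef
    have a1 : t < s := by omega
    have a2 : t + 1 < s := by omega
    have b1 : i * 16 < E.W := by omega
    have b2 : i * 16 + (96 + b.ctorIdx) < E.W := by omega
    have b3 : i * 16 + (96 + b.ctorIdx) < s := by omega
    have b4 : 96 + b.ctorIdx < E.W := by omega
    have b5 : (16 : ℕ) < E.W := by omega
    have c1 : i * 16 + (96 + b.ctorIdx) ≠ t := by omega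
    have c2 : i * 16 + (96 + b.ctorIdx) ≠ t + 1 := by omega
    have hm' : m1 (i * 16 + (96 + b.ctorIdx)) = v := by rw [← hm]; congr 1; omega
    rw [show ([.const (t + 1) 16, .op .mul t t (t + 1),
      .const (t + 1) (96 + b.ctorIdx), .op .add t t (t + 1), .load t t] : List Instr) =
      [.const (t + 1) 16] ++ ([.op .mul t t (t + 1)] ++ ([.const (t + 1) (96 + b.ctorIdx)] ++
        ([.op .add t t (t + 1)] ++ [.load t t]))) from rfl] at hc2
    obtain ⟨k1, hc2⟩ := CodeAt.append hc2
    obtain ⟨k2, hc2⟩ := CodeAt.append hc2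
    obtain ⟨k3, hc2⟩ := CodeAt.append hc2
    obtain ⟨k4, k5⟩ := CodeAt.append hc2
    have r2 := Reach.one (T := E.T) (w := w) (s := s) (m := m1) k1
      (c' := ⟨_, Function.update m1 (t + 1) 16⟩) (by
        simp [exec, put, ← hf.word, a2, b5]; rfl)
    have r3 := Reach.one (T := E.T) (w := w) (s := s) k2 (m := Function.update m1 (t + 1) 16)
      (c' := ⟨_, Function.update (Function.update m1 (t + 1) 16) t (i * 16)⟩) (by
        simp [exec, get, put, BinOp.eval, ← hf.word, a1, a2, v1, b1]; rfl)
    set m3 := Function.update (Function.update m1 (t + 1) 16) t (i * 16) with hm3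
    have r4 := Reach.one (T := E.T) (w := w) (s := s) k3 (m := m3)
      (c' := ⟨_, Function.update m3 (t + 1) (96 + b.ctorIdx)⟩) (by
        simp [exec, put, ← hf.word, a2, b4]; rfl)
    have e3 : m3 t = i * 16 := by simp [hm3]
    set m4 := Function.update m3 (t + 1) (96 + b.ctorIdx) with hm4
    have e4 : m4 t = i * 16 := by simp [hm4, e3]
    have e4' : m4 (t + 1) = 96 + b.ctorIdx := by simp [hm4]
    have r5 := Reach.one (T := E.T) (w := w) (s := s) k4 (m := m4)
      (c' := ⟨_, Function.update m4 t (i * 16 + (96 + b.ctorIdx))⟩) (by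
        simp [exec, get, put, BinOp.eval, ← hf.word, a1, a2, e4, e4', b2]; rfl)
    set m5 := Function.update m4 t (i * 16 + (96 + b.ctorIdx)) with hm5
    have e5 : m5 (i * 16 + (96 + b.ctorIdx)) = v := by
      simp [hm5, hm4, hm3, Function.update_of_ne c1, Function.update_of_ne c2, hm']
    have e5' : m5 t = i * 16 + (96 + b.ctorIdx) := by simp [hm5]
    have r6 := Reach.one (T := E.T) (w := w) (s := s) k5 (m := m5)
      (c' := ⟨_, Function.update m5 t v⟩) (by
        simp [exec, get, put, ← hf.word, a1, e5', e5, b3, hv]; rfl)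
    refine ⟨Function.update m5 t v, ?_, by simp [Expr.eval, hvdef, hi], fun a ha => ?_⟩
    · have := ((((r1.trans r2).trans r3).trans r4).trans r5).trans r6
      simp only [Expr.code, List.length_append, List.length_cons, List.length_nil, zero_add]
      simpa only [add_assoc] using this
    · have d1 : a ≠ t := by omega
      have d2 : a ≠ t + 1 := by omega
      simp [hm5, hm4, hm3, Function.update_of_ne d1, Function.update_of_ne d2, f1 a ha]

theorem Cond.code_correct {E : Env} {w s : ℕ} (hf : Fits E w s) {P : Program} {σ : St} (c : Cond)
    {o l : ℕ} {m : Memory} (hr : Rep E σ m) (hc : CodeAt P o (c.code l))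
    (hd : 80 + c.depth ≤ 96) (hok : c.ok E σ) :
    ∃ m' pc, Reach P E.T w s c.size ⟨o, m⟩ ⟨pc, m'⟩ ∧ Rep E σ m' ∧
      (c.eval E σ → pc = l) ∧ (¬ c.eval E σ → pc = o + c.size) := by
  have hsp := hf.space
  rcases c with ⟨e₁, e₂⟩ | ⟨e₁, e₂⟩
  all_goals
    simp only [Cond.depth] at hd
    obtain ⟨h1, h2⟩ := hok
    obtain ⟨hc1, hc2⟩ := CodeAt.append hc
    obtain ⟨hc2, hc3⟩ := CodeAt.append hc2
    obtain ⟨m1, r1, v1, f1⟩ := e₁.code_correct hf hr hc1 le_rfl (by omega) h1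
    have hr1 : Rep E σ m1 := hr.congr fun a ha => f1 a (by omega)
    obtain ⟨m2, r2, v2, f2⟩ := e₂.code_correct hf hr1 hc2 (by omega) (by omega) h2
    have ht' : m2 80 = e₁.eval E σ := by rw [f2 80 (by omega), v1]
    have a1 : 80 < s := by omega
    have a2 : 81 < s := by omega
    have hr2 : Rep E σ m2 := hr1.congr fun a ha => f2 a (by omega)
  · have r3 := Reach.one (T := E.T) (w := w) (s := s) (m := m2) hc3
      (c' := ⟨if e₁.eval E σ = e₂.eval E σ then l else _, m2⟩) (by
        simp [exec, get, ht', v2, a1, a2]; rfl)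
    refine ⟨m2, _, by simpa only [Cond.size, add_assoc] using (r1.trans r2).trans r3, hr2,
      fun h => ?_, fun h => ?_⟩
    · simp only [Cond.eval] at h; simp [h]
    · simp only [Cond.eval] at h; simp [h, Cond.size]
  · have r3 := Reach.one (T := E.T) (w := w) (s := s) (m := m2) hc3
      (c' := ⟨if e₁.eval E σ < e₂.eval E σ then l else _, m2⟩) (by
        simp [exec, get, ht', v2, a1, a2]; rfl)
    refine ⟨m2, _, by simpa only [Cond.size, add_assoc] using (r1.trans r2).trans r3, hr2,
      fun h => ?_, fun h => ?_⟩
    · simp only [Cond.eval] at h; simp [h]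
    · simp only [Cond.eval] at h; simp [h, Cond.size]

theorem Rep.set {E : Env} {σ : St} {m : Memory} (h : Rep E σ m) (x : Var) {k : ℕ} (hk : k < E.W) :
    Rep E (σ.set x k) (Function.update m x.ctorIdx k) where
  var y := by
    by_cases hy : y = x
    · subst hy; simp
    · rw [Function.update_of_ne (fun e => hy (Var.ctorIdx_injective e)), h.var]; simp [hy]
  arr a i hi := by
    have := x.ctorIdx_lt
    rw [Function.update_of_ne (by omega), h.arr a i hi]; rfl
  var_lt y := by
    by_cases hy : y = x
    · subst hy; simpa using hk
    · simpa [hy] using h.var_lt y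
  arr_lt := h.arr_lt

theorem Rep.setA {E : Env} {σ : St} {m : Memory} (h : Rep E σ m) (b : Arr) {i k : ℕ}
    (hk : k < E.W) : Rep E (σ.setA b i k) (Function.update m (96 + i * 16 + b.ctorIdx) k) where
  var y := by
    have := y.ctorIdx_lt
    rw [Function.update_of_ne (by omega), h.var]; rfl
  arr a i' hi := by
    have ha := a.ctorIdx_lt
    have hb := b.ctorIdx_lt
    by_cases hy : a = b
    · subst hy
      by_cases hii : i' = i
      · subst hii; simp
      · rw [Function.update_of_ne (by omega), h.arr a i' hi]; simp [hii]
    · have : a.ctorIdx ≠ b.ctorIdx := fun e => hy (Arr.ctorIdx_injective e)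
      rw [Function.update_of_ne (by omega), h.arr a i' hi]; simp [hy]
  var_lt := h.var_lt
  arr_lt a i' hi := by
    have := h.arr_lt a i' hi
    simp only [St.setA_a]
    split_ifs with h1 h2
    · exact hk
    · subst h1; exact this
    · exact this

/-- Compiled code simulates the big-step semantics; its running time is bounded by the product of its
length and the number of iterations of loops. -/
theorem Run.code_correct {E : Env} {w s : ℕ} (hf : Fits E w s) {P : Program} {p : Stmt} {σ σ' : St}
    (h : Run E p σ σ') : ∀ {o : ℕ} {m : Memory}, Rep E σ m → CodeAt P o (p.code o) →
      80 + p.depth ≤ 96 →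
      ∃ k m', Reach P E.T w s k ⟨o, m⟩ ⟨o + p.size, m'⟩ ∧ Rep E σ' m' ∧
        k ≤ p.size * (σ'.clk - σ.clk + 1) := by
  have hsp := hf.space
  have had := hf.addr
  induction h with
  | @assign x e σ h1 h2 =>
    intro o m hr hc hd
    simp only [Stmt.depth] at hd
    obtain ⟨hc1, hc2⟩ := CodeAt.append hc
    obtain ⟨m1, r1, v1, f1⟩ := e.code_correct hf hr hc1 le_rfl (by omega) h1
    have hx := x.ctorIdx_lt
    have hr1 : Rep E σ m1 := hr.congr fun a ha => f1 a (by omega)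
    have a1 : 80 < s := by omega
    have a2 : x.ctorIdx < s := by omega
    have r2 := Reach.one (T := E.T) (w := w) (s := s) (m := m1) hc2
      (c' := ⟨_, Function.update m1 x.ctorIdx (e.eval E σ)⟩) (by
        simp [exec, get, put, ← hf.word, v1, a1, a2, h2]; rfl)
    exact ⟨_, _, r1.trans r2, hr1.set x h2, by simp [Stmt.size]⟩
  | @store b e₁ e₂ σ h1 h2 h3 h4 =>
    intro o m hr hc hd
    simp only [Stmt.depth] at hd
    obtain ⟨hc1, hc2⟩ := CodeAt.append hc
    obtain ⟨hc2, hc3⟩ := CodeAt.append hc2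
    obtain ⟨m1, r1, v1, f1⟩ := e₁.code_correct hf hr hc1 le_rfl (by omega) h1
    have hr1 : Rep E σ m1 := hr.congr fun a ha => f1 a (by omega)
    obtain ⟨m2, r2, v2, f2⟩ := e₂.code_correct hf hr1 hc2 (by omega) (by omega) h2
    have hr2 : Rep E σ m2 := hr1.congr fun a ha => f2 a (by omega)
    have hb := b.ctorIdx_lt
    have v1' : m2 80 = e₁.eval E σ := by rw [f2 80 (by omega), v1]
    set i := e₁.eval E σ with hi
    set v := e₂.eval E σ with hv
    rw [show ([.const 82 16, .op .mul 80 80 82,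
      .const 82 (96 + b.ctorIdx), .op .add 80 80 82, .store 80 81] : List Instr) =
      [.const 82 16] ++ ([.op .mul 80 80 82] ++ ([.const 82 (96 + b.ctorIdx)] ++
        ([.op .add 80 80 82] ++ [.store 80 81]))) from rfl] at hc3
    obtain ⟨k1, hc3⟩ := CodeAt.append hc3
    obtain ⟨k2, hc3⟩ := CodeAt.append hc3
    obtain ⟨k3, hc3⟩ := CodeAt.append hc3
    obtain ⟨k4, k5⟩ := CodeAt.append hc3
    have a0 : 80 < s := by omega
    have a1 : 81 < s := by omega
    have a2 : 82 < s := by omega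
    have b1 : i * 16 < E.W := by omega
    have b2 : i * 16 + (96 + b.ctorIdx) < E.W := by omega
    have b3 : i * 16 + (96 + b.ctorIdx) < s := by omega
    have b4 : 96 + b.ctorIdx < E.W := by omega
    have b5 : (16 : ℕ) < E.W := by omega
    have q1 := Reach.one (T := E.T) (w := w) (s := s) (m := m2) k1
      (c' := ⟨_, Function.update m2 82 16⟩) (by
        simp [exec, put, ← hf.word, a2, b5]; rfl)
    set m3 := Function.update m2 82 16 with hm3
    have q2 := Reach.one (T := E.T) (w := w) (s := s) k2 (m := m3)
      (c' := ⟨_, Function.update m3 80 (i * 16)⟩) (by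
        simp [exec, get, put, BinOp.eval, ← hf.word, hm3, a0, a2, v1', b1]; rfl)
    set m4 := Function.update m3 80 (i * 16) with hm4
    have q3 := Reach.one (T := E.T) (w := w) (s := s) k3 (m := m4)
      (c' := ⟨_, Function.update m4 82 (96 + b.ctorIdx)⟩) (by
        simp [exec, put, ← hf.word, a2, b4]; rfl)
    set m5 := Function.update m4 82 (96 + b.ctorIdx) with hm5
    have q4 := Reach.one (T := E.T) (w := w) (s := s) k4 (m := m5)
      (c' := ⟨_, Function.update m5 80 (i * 16 + (96 + b.ctorIdx))⟩) (by
        simp [exec, get, put, BinOp.eval, ← hf.word, hm5, hm4, a0, a2, b2]; rfl)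
    set m6 := Function.update m5 80 (i * 16 + (96 + b.ctorIdx)) with hm6
    have q5 := Reach.one (T := E.T) (w := w) (s := s) k5 (m := m6)
      (c' := ⟨_, Function.update m6 (i * 16 + (96 + b.ctorIdx)) v⟩) (by
        have e1 : m6 81 = v := by simp [hm6, hm5, hm4, hm3, v2]
        have e0 : m6 80 = i * 16 + (96 + b.ctorIdx) := by simp [hm6]
        simp [exec, get, put, ← hf.word, e0, e1, a0, a1, b3, h4]
        rfl)
    rw [show i * 16 + (96 + b.ctorIdx) = 96 + i * 16 + b.ctorIdx by omega] at q5
    have hr6 : Rep E σ m6 := hr2.congr fun a ha => by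
      simp [hm6, hm5, hm4, hm3, Function.update_of_ne (show a ≠ 80 by omega),
        Function.update_of_ne (show a ≠ 82 by omega)]
    refine ⟨(Stmt.store b e₁ e₂).size, _, ?_, hr6.setA b h4, ?_⟩
    · simpa only [Stmt.size, add_assoc, Nat.reduceAdd] using
        (((((r1.trans r2).trans q1).trans q2).trans q3).trans q4).trans q5
    · simp [Stmt.size]
  | @seq p q σ σ₁ σ₂ h1 h2 ih1 ih2 =>
    intro o m hr hc hd
    simp only [Stmt.depth] at hd
    obtain ⟨hc1, hc2⟩ := CodeAt.append hc
    rw [Stmt.length_code] at hc2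
    obtain ⟨k1, m1, r1, hr1, b1⟩ := ih1 hr hc1 (by omega)
    obtain ⟨k2, m2, r2, hr2, b2⟩ := ih2 hr1 hc2 (by omega)
    refine ⟨_, _, by simpa only [Stmt.size, add_assoc] using r1.trans r2, hr2, ?_⟩
    have c1 := h1.clk_le
    have c2 := h2.clk_le
    have d1 : σ₁.clk - σ.clk + 1 ≤ σ₂.clk - σ.clk + 1 := by omega
    have d2 : σ₂.clk - σ₁.clk + 1 ≤ σ₂.clk - σ.clk + 1 := by omega
    have e1 := Nat.mul_le_mul_left p.size d1
    have e2 := Nat.mul_le_mul_left q.size d2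
    simp only [Stmt.size, add_mul]
    omega
  | @iteT c p q σ σ₁ h1 h2 h3 ih =>
    intro o m hr hc hd
    simp only [Stmt.depth] at hd
    obtain ⟨hc1, hc2⟩ := CodeAt.append hc
    obtain ⟨hc2, hc3⟩ := CodeAt.append hc2
    obtain ⟨hc3, hc4⟩ := CodeAt.append hc3
    simp only [Cond.length_code, Stmt.length_code, List.length_singleton] at hc2 hc3 hc4
    obtain ⟨m1, pc, r1, hr1, e1, -⟩ := c.code_correct hf hr hc1 (by omega) h1
    rw [e1 h2] at r1
    obtain ⟨k2, m2, r2, hr2, b2⟩ := ih hr1 hc4 (by omega)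
    refine ⟨c.size + k2, m2, ?_, hr2, ?_⟩
    · have := r1.trans r2
      simp only [Stmt.size]
      convert this using 2; omega
    · simp only [Stmt.size]
      have : c.size * 1 ≤ c.size * (σ₁.clk - σ.clk + 1) := Nat.mul_le_mul_left _ (by omega)
      nlinarith
  | @iteF c p q σ σ₁ h1 h2 h3 ih =>
    intro o m hr hc hd
    simp only [Stmt.depth] at hd
    obtain ⟨hc1, hc2⟩ := CodeAt.append hc
    obtain ⟨hc2, hc3⟩ := CodeAt.append hc2
    obtain ⟨hc3, hc4⟩ := CodeAt.append hc3
    simp only [Cond.length_code, Stmt.length_code, List.length_singleton] at hc2 hc3 hc4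
    obtain ⟨m1, pc, r1, hr1, -, e1⟩ := c.code_correct hf hr hc1 (by omega) h1
    rw [e1 h2] at r1
    obtain ⟨k2, m2, r2, hr2, b2⟩ := ih hr1 hc2 (by omega)
    have r3 := Reach.one (T := E.T) (w := w) (s := s) (m := m2) hc3
      (c' := ⟨_, m2⟩) (by simp only [exec]; rfl)
    refine ⟨c.size + k2 + 1, m2, ?_, hr2, ?_⟩
    · have := (r1.trans r2).trans r3
      simp only [Stmt.size]
      convert this using 2; omega
    · simp only [Stmt.size]
      have : (c.size + 1) * 1 ≤ (c.size + 1) * (σ₁.clk - σ.clk + 1) :=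
        Nat.mul_le_mul_left _ (by omega)
      nlinarith
  | @whileT c p σ σ₁ σ₂ h1 h2 h3 h4 ih1 ih2 =>
    intro o m hr hc hd
    have hd' := hd
    have hc' := hc
    simp only [Stmt.depth] at hd
    obtain ⟨hc1, hc2⟩ := CodeAt.append hc
    obtain ⟨hc2, hc3⟩ := CodeAt.append hc2
    obtain ⟨hc3, hc4⟩ := CodeAt.append hc3
    simp only [Cond.length_code, Stmt.length_code, List.length_singleton] at hc2 hc3 hc4
    obtain ⟨m1, pc, r1, hr1, e1, -⟩ := c.code_correct hf hr hc1 (by omega) h1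
    rw [e1 h2] at r1
    obtain ⟨k2, m2, r2, hr2, b2⟩ := ih1 (m := m1) ⟨hr1.var, hr1.arr, hr1.var_lt,
      hr1.arr_lt⟩ hc3 (by omega)
    have r3 := Reach.one (T := E.T) (w := w) (s := s) (m := m2) hc4
      (c' := ⟨o, m2⟩) (by simp only [exec])
    obtain ⟨k4, m4, r4, hr4, b4⟩ := ih2 hr2 hc' hd'
    refine ⟨c.size + k2 + 1 + k4, m4, ((r1.trans r2).trans r3).trans r4, hr4, ?_⟩
    have c1 := h3.clk_le
    have c2 := h4.clk_le
    simp only [St.tick_clk] at b2 c1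
    obtain ⟨u, hu⟩ := Nat.exists_eq_add_of_le c1
    obtain ⟨v, hv⟩ := Nat.exists_eq_add_of_le c2
    have e1 : σ₁.clk - (σ.clk + 1) = u := by omega
    have e2 : σ₂.clk - σ₁.clk = v := by omega
    have e3 : σ₂.clk - σ.clk = u + v + 1 := by omega
    rw [e1] at b2
    rw [e2] at b4
    rw [e3]
    simp only [Stmt.size] at b4 ⊢
    nlinarith
  | @whileF c p σ h1 h2 =>
    intro o m hr hc hd
    simp only [Stmt.depth] at hd
    obtain ⟨hc1, hc2⟩ := CodeAt.append hc
    obtain ⟨hc2, hc3⟩ := CodeAt.append hc2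
    simp only [Cond.length_code, List.length_singleton] at hc2 hc3
    obtain ⟨m1, pc, r1, hr1, -, e1⟩ := c.code_correct hf hr hc1 (by omega) h1
    rw [e1 h2] at r1
    have r3 := Reach.one (T := E.T) (w := w) (s := s) (m := m1) hc2
      (c' := ⟨_, m1⟩) (by simp only [exec]; rfl)
    refine ⟨c.size + 1, m1, ?_, hr1, ?_⟩
    · simpa only [Stmt.size, add_assoc] using r1.trans r3
    · simp [Stmt.size]

end LCE

namespace LCE

/-! ### Weakest preconditions -/

/-- From `σ`, the program `p` terminates without a fault in a state that satisfies `Q`. -/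
def wp (E : Env) (p : Stmt) (Q : St → Prop) (σ : St) : Prop := ∃ σ', Run E p σ σ' ∧ Q σ'

theorem wp_assign {E : Env} {x : Var} {e : Expr} {Q : St → Prop} {σ : St} :
    wp E (.assign x e) Q σ ↔ e.ok E σ ∧ e.eval E σ < E.W ∧ Q (σ.set x (e.eval E σ)) := by
  constructor
  · rintro ⟨σ', h, hq⟩; cases h with | assign h1 h2 => exact ⟨h1, h2, hq⟩
  · rintro ⟨h1, h2, h3⟩; exact ⟨_, .assign h1 h2, h3⟩

theorem wp_store {E : Env} {a : Arr} {e₁ e₂ : Expr} {Q : St → Prop} {σ : St} :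
    wp E (.store a e₁ e₂) Q σ ↔ e₁.ok E σ ∧ e₂.ok E σ ∧ e₁.eval E σ < E.Z ∧ e₂.eval E σ < E.W ∧
      Q (σ.setA a (e₁.eval E σ) (e₂.eval E σ)) := by
  constructor
  · rintro ⟨σ', h, hq⟩; cases h with | store h1 h2 h3 h4 => exact ⟨h1, h2, h3, h4, hq⟩
  · rintro ⟨h1, h2, h3, h4, h5⟩; exact ⟨_, .store h1 h2 h3 h4, h5⟩

theorem wp_seq {E : Env} {p q : Stmt} {Q : St → Prop} {σ : St} :
    wp E (.seq p q) Q σ ↔ wp E p (fun σ' => wp E q Q σ') σ := by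
  constructor
  · rintro ⟨σ', h, hq⟩; cases h with | seq h1 h2 => exact ⟨_, h1, _, h2, hq⟩
  · rintro ⟨σ', h1, σ'', h2, h3⟩; exact ⟨_, .seq h1 h2, h3⟩

theorem wp_ite {E : Env} {c : Cond} {p q : Stmt} {Q : St → Prop} {σ : St} :
    wp E (.ite c p q) Q σ ↔ c.ok E σ ∧ (c.eval E σ → wp E p Q σ) ∧ (¬ c.eval E σ → wp E q Q σ) := by
  constructor
  · rintro ⟨σ', h, hq⟩
    cases h with
    | iteT h1 h2 h3 => exact ⟨h1, fun _ => ⟨_, h3, hq⟩, fun h => absurd h2 h⟩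
    | iteF h1 h2 h3 => exact ⟨h1, fun h => absurd h h2, fun _ => ⟨_, h3, hq⟩⟩
  · rintro ⟨h1, h2, h3⟩
    by_cases h : c.eval E σ
    · obtain ⟨σ', h4, h5⟩ := h2 h; exact ⟨σ', .iteT h1 h h4, h5⟩
    · obtain ⟨σ', h4, h5⟩ := h3 h; exact ⟨σ', .iteF h1 h h4, h5⟩

theorem wp.mono {E : Env} {p : Stmt} {Q Q' : St → Prop} {σ : St} (h : wp E p Q σ)
    (hq : ∀ σ', Q σ' → Q' σ') : wp E p Q' σ := by
  obtain ⟨σ', h1, h2⟩ := h; exact ⟨σ', h1, hq _ h2⟩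

/-- Variables that a program may change. -/
def Stmt.vars : Stmt → List Var
  | .assign x _ => [x]
  | .store _ _ _ => []
  | .seq p q => p.vars ++ q.vars
  | .ite _ p q => p.vars ++ q.vars
  | .while _ p => p.vars

/-- Arrays that a program may change. -/
def Stmt.arrs : Stmt → List Arr
  | .assign _ _ => []
  | .store a _ _ => [a]
  | .seq p q => p.arrs ++ q.arrs
  | .ite _ p q => p.arrs ++ q.arrs
  | .while _ p => p.arrs

/-- `σ'` agrees with `σ` outside of the given variables and arrays. -/
structure Frame (vs : List Var) (as : List Arr) (σ σ' : St) : Prop where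
  v : ∀ x, x ∉ vs → σ'.v x = σ.v x
  a : ∀ b, b ∉ as → σ'.a b = σ.a b

theorem Frame.refl (vs : List Var) (as : List Arr) (σ : St) : Frame vs as σ σ :=
  ⟨fun _ _ => rfl, fun _ _ => rfl⟩

theorem Frame.trans {vs : List Var} {as : List Arr} {σ₁ σ₂ σ₃ : St} (h : Frame vs as σ₁ σ₂)
    (h' : Frame vs as σ₂ σ₃) : Frame vs as σ₁ σ₃ :=
  ⟨fun x hx => (h'.v x hx).trans (h.v x hx), fun x hx => (h'.a x hx).trans (h.a x hx)⟩

theorem Frame.mono {vs vs' : List Var} {as as' : List Arr} {σ₁ σ₂ : St} (h : Frame vs as σ₁ σ₂)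
    (hv : vs ⊆ vs') (ha : as ⊆ as') : Frame vs' as' σ₁ σ₂ :=
  ⟨fun x hx => h.v x fun hh => hx (hv hh), fun x hx => h.a x fun hh => hx (ha hh)⟩

theorem Frame.tick (vs : List Var) (as : List Arr) (σ : St) : Frame vs as σ σ.tick :=
  ⟨fun _ _ => rfl, fun _ _ => rfl⟩

theorem Frame.set {vs : List Var} (as : List Arr) (σ : St) {x : Var} (k : ℕ) (hx : x ∈ vs) :
    Frame vs as σ (σ.set x k) :=
  ⟨fun y hy => by rw [St.set_v, if_neg (by rintro rfl; exact hy hx)], fun _ _ => rfl⟩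

theorem Frame.setA (vs : List Var) {as : List Arr} (σ : St) {b : Arr} (i k : ℕ) (hb : b ∈ as) :
    Frame vs as σ (σ.setA b i k) :=
  ⟨fun _ _ => rfl, fun y hy => by
    funext i'
    rw [St.setA_a, if_neg (by rintro rfl; exact hy hb)]⟩

theorem Run.frame {E : Env} {p : Stmt} {σ σ' : St} (h : Run E p σ σ') :
    Frame p.vars p.arrs σ σ' := by
  induction h with
  | assign => exact ⟨fun x hx => by simp [Stmt.vars] at hx; simp [hx], fun _ _ => rfl⟩
  | store => exact ⟨fun _ _ => rfl, fun x hx => by simp [Stmt.arrs] at hx; funext i; simp [hx]⟩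
  | seq _ _ h1 h2 =>
    exact (h1.mono (List.subset_append_left _ _) (List.subset_append_left _ _)).trans
      (h2.mono (List.subset_append_right _ _) (List.subset_append_right _ _))
  | iteT _ _ _ h => exact h.mono (List.subset_append_left _ _) (List.subset_append_left _ _)
  | iteF _ _ _ h => exact h.mono (List.subset_append_right _ _) (List.subset_append_right _ _)
  | whileT _ _ _ _ h1 h2 => exact ((Frame.tick _ _ _).trans h1).trans h2
  | whileF => exact Frame.refl _ _ _

theorem wp.frame {E : Env} {p : Stmt} {Q : St → Prop} {σ : St} (h : wp E p Q σ) :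
    wp E p (fun σ' => Q σ' ∧ Frame p.vars p.arrs σ σ') σ := by
  obtain ⟨σ', h1, h2⟩ := h; exact ⟨σ', h1, h2, h1.frame⟩

/-- Rule for loops: `μ` bounds the number of the remaining iterations, and `c` the cost of one
iteration. -/
theorem wp_while {E : Env} {cd : Cond} {p : Stmt} {Q : St → Prop} {σ : St} (I : St → Prop)
    (μ : St → ℕ) (c : ℕ) (h0 : I σ)
    (hok : ∀ σ', Frame p.vars p.arrs σ σ' → I σ' → cd.ok E σ')
    (hstep : ∀ σ', Frame p.vars p.arrs σ σ' → I σ' → cd.eval E σ' →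
      wp E p (fun σ'' => I σ'' ∧ μ σ'' < μ σ' ∧ σ''.clk ≤ σ'.clk + c) σ'.tick)
    (hexit : ∀ σ', Frame p.vars p.arrs σ σ' → I σ' → ¬ cd.eval E σ' → σ'.clk ≤ σ.clk + μ σ * c →
      Q σ') :
    wp E (.while cd p) Q σ := by
  -- The clock plus `c` times the measure never increases from one iteration to the next; at the
  -- exit this is the bound on the clock. The induction is on a bound for the measure.
  have key : ∀ (k : ℕ) (σ' : St), μ σ' ≤ k → Frame p.vars p.arrs σ σ' → I σ' →
      σ'.clk + μ σ' * c ≤ σ.clk + μ σ * c → wp E (.while cd p) Q σ' := by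
    intro k
    induction k with
    | zero =>
      intro σ' hk hf hi hc
      by_cases hcd : cd.eval E σ'
      · obtain ⟨σ'', -, -, h, -⟩ := hstep σ' hf hi hcd
        omega
      · exact ⟨σ', .whileF (hok σ' hf hi) hcd, hexit σ' hf hi hcd (le_trans (by omega) hc)⟩
    | succ k ih =>
      intro σ' hk hf hi hc
      by_cases hcd : cd.eval E σ'
      · obtain ⟨σ'', hr, h1, h2, h3⟩ := hstep σ' hf hi hcd
        obtain ⟨σ₃, hr3, h4⟩ := ih σ'' (by omega) ((hf.trans (Frame.tick _ _ _)).trans hr.frame) h1 (by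
          have : (μ σ'' + 1) * c ≤ μ σ' * c := Nat.mul_le_mul_right c h2
          rw [add_mul] at this
          omega)
        exact ⟨σ₃, .whileT (hok σ' hf hi) hcd hr hr3, h4⟩
      · exact ⟨σ', .whileF (hok σ' hf hi) hcd, hexit σ' hf hi hcd (le_trans (by omega) hc)⟩
  exact key _ σ le_rfl (Frame.refl _ _ _) h0 le_rfl

/-- The input as a function. -/
def Env.f (E : Env) (x : ℕ) : ℕ := E.T.getD x 0

theorem Expr.eval_add (E : Env) (σ : St) (e₁ e₂ : Expr) :
    (e₁ + e₂).eval E σ = e₁.eval E σ + e₂.eval E σ := rfl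
theorem Expr.eval_sub (E : Env) (σ : St) (e₁ e₂ : Expr) :
    (e₁ - e₂).eval E σ = e₁.eval E σ - e₂.eval E σ := rfl
theorem Expr.eval_mul (E : Env) (σ : St) (e₁ e₂ : Expr) :
    (e₁ * e₂).eval E σ = e₁.eval E σ * e₂.eval E σ := rfl
theorem Expr.eval_div (E : Env) (σ : St) (e₁ e₂ : Expr) :
    (e₁ / e₂).eval E σ = e₁.eval E σ / e₂.eval E σ := rfl
theorem Expr.eval_mod (E : Env) (σ : St) (e₁ e₂ : Expr) :
    (e₁ % e₂).eval E σ = e₁.eval E σ % e₂.eval E σ := rfl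
theorem Expr.eval_shl (E : Env) (σ : St) (e₁ e₂ : Expr) :
    (Expr.op .shl e₁ e₂).eval E σ = e₁.eval E σ * 2 ^ e₂.eval E σ := by
  simp [Expr.eval, BinOp.eval, Nat.shiftLeft_eq]
theorem Expr.eval_shr (E : Env) (σ : St) (e₁ e₂ : Expr) :
    (Expr.op .shr e₁ e₂).eval E σ = e₁.eval E σ / 2 ^ e₂.eval E σ := by
  simp [Expr.eval, BinOp.eval, Nat.shiftRight_eq_div_pow]
theorem Expr.eval_ofNat (E : Env) (σ : St) (k : ℕ) :
    (no_index (OfNat.ofNat k : Expr)).eval E σ = OfNat.ofNat k := rfl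
theorem Expr.eval_var (E : Env) (σ : St) (x : Var) : (Expr.var x).eval E σ = σ.v x := rfl
theorem Expr.eval_lit (E : Env) (σ : St) (k : ℕ) : (Expr.lit k).eval E σ = k := rfl
theorem Expr.eval_inp (E : Env) (σ : St) (e : Expr) :
    (Expr.inp e).eval E σ = E.f (e.eval E σ) := rfl
theorem Expr.eval_arr (E : Env) (σ : St) (a : Arr) (e : Expr) :
    (Expr.arr a e).eval E σ = σ.a a (e.eval E σ) := rfl
theorem Expr.ok_add (E : Env) (σ : St) (e₁ e₂ : Expr) :
    (e₁ + e₂).ok E σ ↔ e₁.ok E σ ∧ e₂.ok E σ ∧ e₁.eval E σ + e₂.eval E σ < E.W := Iff.rfl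
theorem Expr.ok_sub (E : Env) (σ : St) (e₁ e₂ : Expr) :
    (e₁ - e₂).ok E σ ↔ e₁.ok E σ ∧ e₂.ok E σ ∧ e₁.eval E σ - e₂.eval E σ < E.W := Iff.rfl
theorem Expr.ok_mul (E : Env) (σ : St) (e₁ e₂ : Expr) :
    (e₁ * e₂).ok E σ ↔ e₁.ok E σ ∧ e₂.ok E σ ∧ e₁.eval E σ * e₂.eval E σ < E.W := Iff.rfl
theorem Expr.ok_div (E : Env) (σ : St) (e₁ e₂ : Expr) :
    (e₁ / e₂).ok E σ ↔ e₁.ok E σ ∧ e₂.ok E σ ∧ e₁.eval E σ / e₂.eval E σ < E.W := Iff.rfl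
theorem Expr.ok_mod (E : Env) (σ : St) (e₁ e₂ : Expr) :
    (e₁ % e₂).ok E σ ↔ e₁.ok E σ ∧ e₂.ok E σ ∧ e₁.eval E σ % e₂.eval E σ < E.W := Iff.rfl
theorem Expr.ok_shl (E : Env) (σ : St) (e₁ e₂ : Expr) : (Expr.op .shl e₁ e₂).ok E σ ↔
    e₁.ok E σ ∧ e₂.ok E σ ∧ e₁.eval E σ * 2 ^ e₂.eval E σ < E.W := by
  rw [← Expr.eval_shl]; exact Iff.rfl
theorem Expr.ok_shr (E : Env) (σ : St) (e₁ e₂ : Expr) : (Expr.op .shr e₁ e₂).ok E σ ↔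
    e₁.ok E σ ∧ e₂.ok E σ ∧ e₁.eval E σ / 2 ^ e₂.eval E σ < E.W := by
  rw [← Expr.eval_shr]; exact Iff.rfl
theorem Expr.ok_ofNat (E : Env) (σ : St) (k : ℕ) :
    (no_index (OfNat.ofNat k : Expr)).ok E σ ↔ OfNat.ofNat k < E.W := Iff.rfl
theorem Expr.ok_var (E : Env) (σ : St) (x : Var) : (Expr.var x).ok E σ ↔ True := Iff.rfl
theorem Expr.ok_lit (E : Env) (σ : St) (k : ℕ) : (Expr.lit k).ok E σ ↔ k < E.W := Iff.rfl
theorem Expr.ok_inp (E : Env) (σ : St) (e : Expr) :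
    (Expr.inp e).ok E σ ↔ e.ok E σ ∧ e.eval E σ < E.T.length := Iff.rfl
theorem Expr.ok_arr (E : Env) (σ : St) (a : Arr) (e : Expr) :
    (Expr.arr a e).ok E σ ↔ e.ok E σ ∧ e.eval E σ < E.Z := Iff.rfl
theorem Cond.eval_eq (E : Env) (σ : St) (e₁ e₂ : Expr) :
    (Cond.eq e₁ e₂).eval E σ ↔ e₁.eval E σ = e₂.eval E σ := Iff.rfl
theorem Cond.eval_lt (E : Env) (σ : St) (e₁ e₂ : Expr) :
    (Cond.lt e₁ e₂).eval E σ ↔ e₁.eval E σ < e₂.eval E σ := Iff.rfl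
theorem Cond.ok_eq (E : Env) (σ : St) (e₁ e₂ : Expr) :
    (Cond.eq e₁ e₂).ok E σ ↔ e₁.ok E σ ∧ e₂.ok E σ := Iff.rfl
theorem Cond.ok_lt (E : Env) (σ : St) (e₁ e₂ : Expr) :
    (Cond.lt e₁ e₂).ok E σ ↔ e₁.ok E σ ∧ e₂.ok E σ := Iff.rfl

attribute [simp] wp_assign wp_store wp_seq wp_ite
  Expr.eval_add Expr.eval_sub Expr.eval_mul Expr.eval_div Expr.eval_mod Expr.eval_shl Expr.eval_shr
  Expr.eval_ofNat Expr.eval_var Expr.eval_lit Expr.eval_inp Expr.eval_arr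
  Expr.ok_add Expr.ok_sub Expr.ok_mul Expr.ok_div Expr.ok_mod Expr.ok_shl Expr.ok_shr
  Expr.ok_ofNat Expr.ok_var Expr.ok_lit Expr.ok_inp Expr.ok_arr
  Cond.eval_eq Cond.eval_lt Cond.ok_eq Cond.ok_lt Stmt.vars Stmt.arrs

/-! ### Comparing two substrings of the input -/

/-- Length of the longest common prefix of the substrings of `f` of length `L` at `a` and `b`. -/
def mlen (f : ℕ → ℕ) (a b : ℕ) : ℕ → ℕ
  | 0 => 0
  | L + 1 => if f a = f b then mlen f (a + 1) (b + 1) L + 1 else 0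

theorem mlen_le (f : ℕ → ℕ) (a b L : ℕ) : mlen f a b L ≤ L := by
  induction L generalizing a b with
  | zero => simp [mlen]
  | succ L ih => simp only [mlen]; split_ifs <;> [exact Nat.succ_le_succ (ih _ _); omega]

theorem mlen_eq (f : ℕ → ℕ) (a b L : ℕ) {t : ℕ} (ht : t < mlen f a b L) : f (a + t) = f (b + t) := by
  induction L generalizing a b t with
  | zero => simp [mlen] at ht
  | succ L ih =>
    simp only [mlen] at ht
    split_ifs at ht with h
    · cases t with
      | zero => simpa using h
      | succ t =>
        have := ih (a + 1) (b + 1) (t := t) (by omega)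
        rwa [Nat.add_right_comm a, Nat.add_right_comm b] at this
    · omega

theorem mlen_ne (f : ℕ → ℕ) (a b L : ℕ) (h : mlen f a b L < L) :
    f (a + mlen f a b L) ≠ f (b + mlen f a b L) := by
  induction L generalizing a b with
  | zero => omega
  | succ L ih =>
    simp only [mlen] at h ⊢
    split_ifs at h ⊢ with h'
    · have := ih (a + 1) (b + 1) (by omega)
      rwa [Nat.add_right_comm a, Nat.add_right_comm b] at this
    · simpa using h'

/-- Agreement before `d` and a mismatch at `d`, or the end of the range, determine the length; later
evaluations of `mlen` mostly exhibit these two facts. -/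
theorem mlen_unique {f : ℕ → ℕ} {a b L d : ℕ} (hd : d ≤ L) (h : ∀ t < d, f (a + t) = f (b + t))
    (hne : d < L → f (a + d) ≠ f (b + d)) : mlen f a b L = d := by
  have h1 := mlen_le f a b L
  rcases lt_trichotomy (mlen f a b L) d with hl | hl | hl
  · exact absurd (h _ hl) (mlen_ne f a b L (by omega))
  · exact hl
  · exact absurd (mlen_eq f a b L hl) (hne (by omega))

theorem mlen_eq_iff {f : ℕ → ℕ} {a b L : ℕ} :
    mlen f a b L = L ↔ ∀ t < L, f (a + t) = f (b + t) :=
  ⟨fun h _ ht => mlen_eq f a b L (by rwa [h]), fun h => mlen_unique le_rfl h (by omega)⟩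

/-- `d := mlen pa pb lim` -/
def lcpCode : Stmt :=
  .d ≔ 0 ;;
  .while (.lt ♯.d ♯.lim)
    -- A mismatch leaves the loop by lowering `lim` to `d`. The invariant hence reads `lim < L` as
    -- the record of a mismatch at `d`.
    (.ite (.eq (.inp (♯.pa + ♯.d)) (.inp (♯.pb + ♯.d))) (.d ≔ ♯.d + 1) (.lim ≔ ♯.d))

theorem wp_lcpCode {E : Env} {σ : St} {a b L : ℕ} (ha : σ.v .pa = a) (hb : σ.v .pb = b)
    (hL : σ.v .lim = L) (hla : a + L ≤ E.T.length) (hlb : b + L ≤ E.T.length)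
    (hW : 2 * E.T.length + 2 ≤ E.W) {Q : St → Prop}
    (hq : ∀ σ', Frame [.d, .lim] [] σ σ' → σ'.v .d = mlen E.f a b L → σ'.clk ≤ σ.clk + L →
      Q σ') : wp E lcpCode Q σ := by
  simp only [lcpCode, wp_seq, wp_assign]
  refine ⟨by simp; omega, by simp; omega, ?_⟩
  refine wp_while (fun σ' => σ'.v .d ≤ σ'.v .lim ∧ σ'.v .lim ≤ L ∧ (∀ t < σ'.v .d, E.f (a + t) = E.f (b + t)) ∧
      (σ'.v .lim < L → σ'.v .d = σ'.v .lim ∧ E.f (a + σ'.v .d) ≠ E.f (b + σ'.v .d)))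
    (fun σ' => σ'.v .lim - σ'.v .d) 1 ?_ ?_ ?_ ?_
  · simp [hL]
  · simp
  · rintro σ' hf ⟨h1, h2, h3, h4⟩ hc
    have e1 : σ'.v .pa = a := by simp [hf.v, ha]
    have e2 : σ'.v .pb = b := by simp [hf.v, hb]
    simp at hc
    simp only [wp_ite, wp_assign]
    simp [e1, e2]
    refine ⟨by omega, fun h => ⟨by omega, by omega, ⟨by omega, h2, ?_, by omega⟩, by omega⟩,
      fun h => ⟨by omega, ⟨h2.trans' h1, h3, fun _ => h⟩, by omega⟩⟩
    intro t ht
    rcases lt_or_eq_of_le ht with h' | h'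
    · exact h3 t h'
    · subst h'; exact h
  · rintro σ' hf ⟨h1, h2, h3, h4⟩ hc hclk
    simp at hc
    refine hq σ' ⟨fun x hx => ?_, fun x hx => ?_⟩ (mlen_unique (by omega) h3 ?_).symm (by simpa [hL] using hclk)
    · simp at hx
      rw [hf.v x (by simp [hx])]; simp [hx]
    · rw [hf.a x (by simp)]; simp
    · intro h; exact (h4 (by omega)).2

end LCE

/-! ### Combinatorics of boundary sets: commuting words, labels, thinning, locality -/

namespace LCE

/-! ### Segments of a text and commutation of words -/

/-- The word `F a, …, F (b - 1)`. -/
def seg (F : ℕ → ℕ) (a b : ℕ) : List ℕ := (List.range (b - a)).map fun t => F (a + t)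

theorem seg_length (F : ℕ → ℕ) (a b : ℕ) : (seg F a b).length = b - a := by simp [seg]

theorem seg_getElem (F : ℕ → ℕ) (a b t : ℕ) (h : t < (seg F a b).length) :
    (seg F a b)[t] = F (a + t) := by simp [seg]

theorem seg_append (F : ℕ → ℕ) {a b c : ℕ} (h : a ≤ b) (h' : b ≤ c) :
    seg F a b ++ seg F b c = seg F a c := by
  refine List.ext_getElem (by simp [seg]; omega) fun t h1 h2 => ?_
  rw [List.getElem_append]
  split_ifs with h3
  · rw [seg_getElem, seg_getElem]
  · rw [seg_getElem, seg_getElem]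
    rw [seg_length] at h3 ⊢
    congr 1; omega

theorem seg_congr {F : ℕ → ℕ} {a b a' b' : ℕ} (hl : b - a = b' - a')
    (h : ∀ t < b - a, F (a + t) = F (a' + t)) : seg F a b = seg F a' b' := by
  refine List.ext_getElem (by simp [seg_length, hl]) fun t h1 h2 => ?_
  rw [seg_getElem, seg_getElem]
  exact h t (by simpa [seg_length] using h1)

/-- A word that commutes with a non-empty word `b` is a prefix of a power of `b`. -/
theorem getElem_of_append_comm {a b : List ℕ} (h : a ++ b = b ++ a) (hb : 0 < b.length) (t : ℕ)
    (ht : t < a.length) : a[t] = b[t % b.length]'(Nat.mod_lt _ hb) := by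
  induction t using Nat.strong_induction_on with
  | _ t ih =>
    have h1 : a[t] = (a ++ b)[t]'(by simp; omega) := by rw [List.getElem_append_left ht]
    have h2 : (a ++ b)[t]'(by simp; omega) = (b ++ a)[t]'(by simp; omega) := by
      simp only [h]
    rw [h1, h2]
    by_cases hlt : t < b.length
    · rw [List.getElem_append_left hlt]
      congr 1; exact (Nat.mod_eq_of_lt hlt).symm
    · rw [List.getElem_append_right (by omega), ih (t - b.length) (by omega)]
      congr 1; exact (Nat.mod_eq_sub_mod (by omega)).symm

/-- Both `a ++ c` and `c ++ a` commute with `b`, so both are prefixes of the infinite power of `b`;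
having equal length, they coincide. -/
theorem append_comm_trans {a b c : List ℕ} (h : a ++ b = b ++ a) (h' : b ++ c = c ++ b)
    (hb : 0 < b.length) : a ++ c = c ++ a := by
  have h1 : (a ++ c) ++ b = b ++ (a ++ c) := by
    rw [List.append_assoc, ← h', ← List.append_assoc, h, List.append_assoc]
  have h2 : (c ++ a) ++ b = b ++ (c ++ a) := by
    rw [List.append_assoc, h, ← List.append_assoc, ← h', List.append_assoc]
  refine List.ext_getElem (by simp; omega) fun t ht ht' => ?_
  rw [getElem_of_append_comm h1 hb, getElem_of_append_comm h2 hb]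

/-! ### Neighbours in a set of boundaries -/

open Classical in
/-- The largest element of `B` below `x`, or `0`. -/
noncomputable def pre (B : Set ℕ) (x : ℕ) : ℕ := Nat.findGreatest (· ∈ B) (x - 1)

/-- The smallest element of `B` above `x`. -/
noncomputable def suc (B : Set ℕ) (x : ℕ) : ℕ := sInf {z | x < z ∧ z ∈ B}

theorem pre_eq {B : Set ℕ} {x y : ℕ} (hy : y ∈ B) (hyx : y < x)
    (h : ∀ c, y < c → c < x → c ∉ B) : pre B x = y := by
  classical
  unfold pre
  rw [Nat.findGreatest_eq_iff]
  exact ⟨by omega, fun _ => hy, fun {c} h1 h2 => h c h1 (by omega)⟩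

theorem pre_lt (B : Set ℕ) {x : ℕ} (hx : 0 < x) : pre B x < x := by
  classical
  have : pre B x ≤ x - 1 := Nat.findGreatest_le _
  omega

theorem pre_mem {B : Set ℕ} {x : ℕ} (h : pre B x ≠ 0) : pre B x ∈ B := by
  classical
  exact Nat.findGreatest_of_ne_zero (P := (· ∈ B)) (n := x - 1) (m := pre B x) rfl h

theorem le_pre {B : Set ℕ} {x c : ℕ} (hc : c ∈ B) (h : c < x) : c ≤ pre B x := by
  classical
  exact Nat.le_findGreatest (P := (· ∈ B)) (by omega) hc

theorem notMem_of_pre_lt {B : Set ℕ} {x c : ℕ} (h : pre B x < c) (h' : c < x) : c ∉ B := fun hc => by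
  have := le_pre hc h'; omega

theorem suc_le {B : Set ℕ} {x z : ℕ} (hz : z ∈ B) (h : x < z) : suc B x ≤ z :=
  Nat.sInf_le ⟨h, hz⟩

theorem suc_spec {B : Set ℕ} (hB : ∀ x, ∃ z ∈ B, x < z) (x : ℕ) : x < suc B x ∧ suc B x ∈ B := by
  obtain ⟨z, hz, hxz⟩ := hB x
  exact Nat.sInf_mem (s := {z | x < z ∧ z ∈ B}) ⟨z, hxz, hz⟩

theorem suc_eq {B : Set ℕ} {x z : ℕ} (hz : z ∈ B) (hxz : x < z)
    (h : ∀ c, x < c → c < z → c ∉ B) : suc B x = z := by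
  refine le_antisymm (suc_le hz hxz) ?_
  refine le_csInf ⟨z, hxz, hz⟩ fun c hc => ?_
  by_contra hlt
  exact h c hc.1 (by omega) hc.2

theorem notMem_of_lt_suc {B : Set ℕ} {x c : ℕ} (h : x < c) (h' : c < suc B x) : c ∉ B := fun hc => by
  have := suc_le hc h; omega

theorem suc_pre {B : Set ℕ} {x : ℕ} (hx : x ∈ B) (h0 : 0 < x) : suc B (pre B x) = x :=
  suc_eq hx (pre_lt B h0) fun _ h1 h2 => notMem_of_pre_lt h1 h2

theorem pre_suc {B : Set ℕ} (hB : ∀ x, ∃ z ∈ B, x < z) {x : ℕ} (hx : x ∈ B) :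
    pre B (suc B x) = x :=
  pre_eq hx (suc_spec hB x).1 fun _ h1 h2 => notMem_of_lt_suc h1 h2

/-! ### Labels of phrases -/

/-- Number of common one bits of `r` and `u`. -/
def dot (r u : ℕ) : ℕ :=
  if h : r = 0 then 0 else (r % 2) * (u % 2) + dot (r / 2) (u / 2)
  decreasing_by exact Nat.div_lt_self (Nat.pos_of_ne_zero h) (by norm_num)

theorem dot_zero (u : ℕ) : dot 0 u = 0 := by rw [dot]; simp

theorem dot_rec (r u : ℕ) : dot r u = (r % 2) * (u % 2) + dot (r / 2) (u / 2) := by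
  by_cases h : r = 0
  · subst h; simp [dot_zero]
  · rw [dot]; simp [h]

/-- Adding a new top bit to a seed changes the label of an identifier by exactly the corresponding
bit of the identifier. The greedy choice of seeds rests on this. -/
theorem dot_add_two_pow (k : ℕ) (r u : ℕ) (h : r < 2 ^ k) :
    dot (r + 2 ^ k) u = dot r u + u / 2 ^ k % 2 := by
  induction k generalizing r u with
  | zero =>
    have : r = 0 := by simpa using h
    subst this
    rw [dot_rec]; simp [dot_zero]
  | succ k ih =>
    rw [dot_rec, dot_rec r]
    have h1 : (r + 2 ^ (k + 1)) / 2 = r / 2 + 2 ^ k := by rw [pow_succ]; omega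
    have h2 : (r + 2 ^ (k + 1)) % 2 = r % 2 := by rw [pow_succ]; omega
    rw [h1, h2, ih _ _ (by rw [pow_succ] at h; omega), Nat.div_div_eq_div_mul, ← pow_succ', add_assoc]

/-- The symbol at offset `d` of the phrase `[a, b)`, or `0` behind its end. -/
def sym (F : ℕ → ℕ) (a b d : ℕ) : ℕ := if d = b - a then 0 else F (a + d) + 1

/-- Identifier of the phrase `[x1, x)` whose left neighbour is `[x0, x1)`: the position of the first
difference to the left neighbour, and the symbol there. -/
def pid (F : ℕ → ℕ) (o l x0 x1 x : ℕ) : ℕ :=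
  let d := if x1 ≤ x0 + l then mlen F x0 x1 (min (x1 - x0) (x - x1)) else 0
  2 * (d + o * sym F x1 x d) + 1

/-- Equal identifiers mean equal offsets and equal symbols. The offset in the right identifier is
that of the first difference between the two phrases, so the left phrase cannot have the same symbol
there unless the phrases are equal. The symbol 0 behind the end of a phrase settles the case that
one phrase is a proper prefix of the other. -/
theorem pid_ne {F : ℕ → ℕ} {o l x0 x1 x x2 : ℕ} (h1 : x1 < x) (h2 : x < x2) (hl : x ≤ x1 + l)
    (hlo : l < o) (hne : seg F x1 x ≠ seg F x x2) : pid F o l x0 x1 x ≠ pid F o l x1 x x2 := by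
  intro h
  simp only [pid, if_pos hl] at h
  set d' := if x1 ≤ x0 + l then mlen F x0 x1 (min (x1 - x0) (x - x1)) else 0 with hd'
  set d := mlen F x1 x (min (x - x1) (x2 - x)) with hd
  have b1 : d' ≤ x - x1 := by
    rw [hd']; split_ifs
    · exact (mlen_le _ _ _ _).trans (min_le_right _ _)
    · omega
  have b2 : d ≤ min (x - x1) (x2 - x) := mlen_le _ _ _ _
  have h' : d' + o * sym F x1 x d' = d + o * sym F x x2 d := by omega
  -- Both offsets are at most `l < o`, so they are the residues modulo `o` and can be decoded.
  have e1 : d' = d := by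
    have := congrArg (· % o) h'
    simpa [Nat.add_mul_mod_self_left, Nat.mod_eq_of_lt (show d' < o by omega),
      Nat.mod_eq_of_lt (show d < o by omega)] using this
  rw [e1] at h' b1
  have e2 : sym F x1 x d = sym F x x2 d := by
    have : o * sym F x1 x d = o * sym F x x2 d := by omega
    exact Nat.eq_of_mul_eq_mul_left (by omega) this
  unfold sym at e2
  split_ifs at e2 with c1 c2 c2
  · apply hne
    have : d = min (x - x1) (x2 - x) := by omega
    refine seg_congr (by omega) fun t ht => mlen_eq F x1 x (min (x - x1) (x2 - x)) ?_
    omega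
  · have := mlen_ne F x1 x (min (x - x1) (x2 - x)) (by omega)
    rw [← hd] at this
    exact this (by omega)

/-! ### Thinning out boundaries -/

/-- The boundary `x` with neighbours `x0 < x1 < x < z` is removed: both adjacent phrases have length at
most `l`, and they commute (if `lam` is even) or they are labelled `0` and `1` (if `lam` is odd). -/
def rule (F : ℕ → ℕ) (o l lam r x0 x1 x z : ℕ) : Prop :=
  x ≤ x1 + l ∧ z ≤ x + l ∧
    if lam % 2 = 0 then seg F x1 x ++ seg F x z = seg F x z ++ seg F x1 x
    else dot r (pid F o l x0 x1 x) % 2 < dot r (pid F o l x1 x z) % 2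

/-- The boundaries that survive. -/
def thin (F : ℕ → ℕ) (o l lam r : ℕ) (B : Set ℕ) : Set ℕ :=
  {x ∈ B | ¬ rule F o l lam r (pre B (pre B x)) (pre B x) x (suc B x)}

/-- Boundaries of a text in `[o, o + n)`, together with sentinels. -/
structure Adm (o n : ℕ) (B : Set ℕ) : Prop where
  le : ∀ x ∈ B, o ≤ x
  -- Sentinels are isolated: a phrase of length at most `n` never ends at a sentinel.
  real : ∀ x ∈ B, ∀ y ∈ B, x < y → y ≤ x + n → y < o + n
  sent : ∀ k, 3 ≤ k → k * o ∈ B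

theorem Adm.inf {o n : ℕ} {B : Set ℕ} (h : Adm o n B) (ho : n < o) (x : ℕ) : ∃ z ∈ B, x < z :=
  ⟨(x + 3) * o, h.sent _ (by omega), by nlinarith⟩

/-- The value 0 stands for a missing left neighbour. It is more than `n` away from every boundary,
so a short left phrase has a genuine boundary at its beginning. -/
theorem Adm.pre_mem {o n l x : ℕ} {B : Set ℕ} (h : Adm o n B) (ho : n < o) (hl : l ≤ n) (hx : x ∈ B)
    (hs : x ≤ pre B x + l) : pre B x ∈ B := by
  have := h.le x hx
  exact LCE.pre_mem (by omega)

/-- A sentinel survives because the phrase on its left is longer than the threshold. -/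
theorem Adm.thin {o n : ℕ} {B : Set ℕ} (h : Adm o n B) (ho : n < o) {F : ℕ → ℕ} {l lam r : ℕ}
    (hl : l ≤ n) : Adm o n (thin F o l lam r B) where
  le x hx := h.le x hx.1
  real x hx y hy := h.real x hx.1 y hy.1
  sent k hk := by
    have hm := h.sent k hk
    refine ⟨hm, fun hr => ?_⟩
    have hr := hr.1
    have h1 := h.pre_mem ho hl hm hr
    have h2 := pre_lt B (x := k * o) (by have := h.le _ hm; omega)
    have := h.real _ h1 _ hm h2 (by omega)
    nlinarith

/-- The text looks the same around `x` and around `y`, up to distance `c`. -/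
structure AgreeAt (F : ℕ → ℕ) (o n c x y : ℕ) : Prop where
  xl : o + c ≤ x
  yl : o + c ≤ y
  xr : x + c ≤ o + n
  yr : y + c ≤ o + n
  eq : ∀ t < 2 * c, F (x - c + t) = F (y - c + t)

theorem AgreeAt.symm {F : ℕ → ℕ} {o n c x y : ℕ} (h : AgreeAt F o n c x y) : AgreeAt F o n c y x :=
  ⟨h.yl, h.xl, h.yr, h.xr, fun t ht => (h.eq t ht).symm⟩

theorem AgreeAt.point {F : ℕ → ℕ} {o n c x y u : ℕ} (h : AgreeAt F o n c x y) (h1 : x ≤ u + c)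
    (h2 : u < x + c) : F u = F (u + y - x) := by
  have := h.eq (u + c - x) (by omega)
  have := h.xl
  have := h.yl
  convert h.eq (u + c - x) (by omega) using 2 <;> omega

theorem AgreeAt.shift {F : ℕ → ℕ} {o n c c' x y u : ℕ} (h : AgreeAt F o n (c + c') x y)
    (h1 : x ≤ u + c') (h2 : u ≤ x + c') : AgreeAt F o n c u (u + y - x) := by
  obtain ⟨a1, a2, a3, a4, a5⟩ := h
  refine ⟨by omega, by omega, by omega, by omega, fun t ht => ?_⟩
  convert a5 (u + c' - x + t) (by omega) using 2 <;> omega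

/-- Membership in `B` depends only on the text up to distance `c`. -/
def Loc (F : ℕ → ℕ) (o n : ℕ) (B : Set ℕ) (c : ℕ) : Prop :=
  ∀ x y, AgreeAt F o n c x y → x ∈ B → y ∈ B

theorem mlen_congr {F : ℕ → ℕ} {a b a' b' L : ℕ} (ha : ∀ t < L, F (a + t) = F (a' + t))
    (hb : ∀ t < L, F (b + t) = F (b' + t)) : mlen F a b L = mlen F a' b' L := by
  have h1 := mlen_le F a' b' L
  refine mlen_unique h1 (fun t ht => ?_) fun h => ?_
  · rw [ha t (by omega), hb t (by omega)]; exact mlen_eq _ _ _ _ ht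
  · rw [ha _ h, hb _ h]; exact mlen_ne _ _ _ _ h

theorem sym_congr {F : ℕ → ℕ} {a b a' b' d : ℕ} (hl : b - a = b' - a') (hd : d ≤ b - a)
    (h : ∀ t < b - a, F (a + t) = F (a' + t)) : sym F a b d = sym F a' b' d := by
  unfold sym
  rw [hl]
  split_ifs with h1
  · rfl
  · rw [h d (by omega)]

/-- The rule for `x` involves the neighbours at distance at most `l` on both sides, and the second
left neighbour only if it lies within a further `l`. All of this happens within distance `2 * l` of
`x`, where membership in `B` is itself transferred with radius `c`. -/
theorem Loc.thin {F : ℕ → ℕ} {o n c l lam r : ℕ} {B : Set ℕ} (hB : Loc F o n B c) (ha : Adm o n B)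
    (ho : n < o) (hl : l ≤ n) : Loc F o n (thin F o l lam r B) (c + 2 * l) := by
  rintro x y hxy ⟨hx, hnr⟩
  have hy : y ∈ B := hB _ _ (by simpa using hxy.shift (u := x) (by omega) (by omega)) hx
  refine ⟨hy, fun hr => hnr ?_⟩
  obtain ⟨r1, r2, r3⟩ := hr
  have tr : ∀ u, y ≤ u + 2 * l → u ≤ y + 2 * l → u ∈ B → u + x - y ∈ B := fun u h1 h2 hu =>
    hB _ _ (hxy.symm.shift h1 h2) hu
  have tr' : ∀ u, x ≤ u + 2 * l → u ≤ x + 2 * l → u ∈ B → u + y - x ∈ B := fun u h1 h2 hu =>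
    hB _ _ (hxy.shift h1 h2) hu
  have hxo := ha.le x hx
  have hyo := ha.le y hy
  set y1 := pre B y with hy1
  set y2 := suc B y with hy2
  have m1 : y1 ∈ B := ha.pre_mem ho hl hy r1
  have l1 : y1 < y := pre_lt B (by omega)
  obtain ⟨l2, m2⟩ : y < y2 ∧ y2 ∈ B := suc_spec (ha.inf ho) y
  have e1 : pre B x = y1 + x - y := by
    refine pre_eq (tr _ (by omega) (by omega) m1) (by omega) fun d h1 h2 hd => ?_
    exact notMem_of_pre_lt (B := B) (x := y) (c := d + y - x) (by omega) (by omega)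
      (tr' d (by omega) (by omega) hd)
  have e2 : suc B x = y2 + x - y := by
    refine suc_eq (tr _ (by omega) (by omega) m2) (by omega) fun d h1 h2 hd => ?_
    exact notMem_of_lt_suc (B := B) (x := y) (c := d + y - x) (by omega) (by omega)
      (tr' d (by omega) (by omega) hd)
  have pt : ∀ u, y ≤ u + 2 * l → u < y + 2 * l → F u = F (u + x - y) := fun u h1 h2 =>
    hxy.symm.point (by omega) (by omega)
  set y0 := pre B y1 with hy0
  set x1 := y1 + x - y with hx1
  have hy1o := ha.le y1 m1
  have mx1 : x1 ∈ B := tr _ (by omega) (by omega) m1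
  have hx1o := ha.le x1 mx1
  have e0 : y1 ≤ y0 + l → pre B x1 = y0 + x - y := fun hs => by
    have m0 : y0 ∈ B := ha.pre_mem ho hl m1 hs
    have l0 : y0 < y1 := pre_lt B (by omega)
    refine pre_eq (tr _ (by omega) (by omega) m0) (by omega) fun d h1 h2 hd => ?_
    exact notMem_of_pre_lt (B := B) (x := y1) (c := d + y - x) (by omega) (by omega)
      (tr' d (by omega) (by omega) hd)
  -- Read backwards: if the second left neighbour is far away at `y`, it is far away at `x`, and
  -- then both identifiers ignore it and use offset 0.
  have e0' : x1 ≤ pre B x1 + l → y1 ≤ y0 + l := fun hs => by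
    have m0 := ha.pre_mem ho hl mx1 hs
    have l0 := pre_lt B (x := x1) (by omega)
    have := le_pre (tr' _ (by omega) (by omega) m0) (show pre B x1 + y - x < y1 by omega)
    omega
  have s1 : seg F x1 x = seg F y1 y := by
    refine seg_congr (by omega) fun t ht => ?_
    rw [pt (y1 + t) (by omega) (by omega)]
    congr 1; omega
  have s2 : seg F x (suc B x) = seg F y y2 := by
    rw [e2]
    refine seg_congr (by omega) fun t ht => ?_
    rw [pt (y + t) (by omega) (by omega)]
    congr 1; omega
  have p1 : pid F o l (pre B x1) x1 x = pid F o l y0 y1 y := by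
    have hsym : ∀ d ≤ y - y1, sym F y1 y d = sym F x1 x d := fun d hd =>
      sym_congr (by omega) hd fun t ht => by
        rw [pt (y1 + t) (by omega) (by omega)]
        congr 1; omega
    unfold pid
    by_cases hs : y1 ≤ y0 + l
    · have l0 : y0 < y1 := pre_lt B (by omega)
      rw [e0 hs, if_pos hs, if_pos (by omega)]
      have hm : mlen F y0 y1 (min (y1 - y0) (y - y1)) =
          mlen F (y0 + x - y) x1 (min (x1 - (y0 + x - y)) (x - x1)) := by
        rw [show x1 - (y0 + x - y) = y1 - y0 by omega, show x - x1 = y - y1 by omega]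
        refine mlen_congr (fun t ht => ?_) fun t ht => ?_
        · rw [pt (y0 + t) (by omega) (by omega)]
          congr 1; omega
        · rw [pt (y1 + t) (by omega) (by omega)]
          congr 1; omega
      dsimp only
      rw [← hm, hsym _ ((mlen_le _ _ _ _).trans (min_le_right _ _))]
    · rw [if_neg hs, if_neg fun h => hs (e0' h)]
      dsimp only
      rw [hsym 0 (by omega)]
  have p2 : pid F o l x1 x (suc B x) = pid F o l y1 y y2 := by
    have hm : mlen F y1 y (min (y - y1) (y2 - y)) = mlen F x1 x (min (x - x1) (suc B x - x)) := by
      rw [e2, show x - x1 = y - y1 by omega, show y2 + x - y - x = y2 - y by omega]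
      refine mlen_congr (fun t ht => ?_) fun t ht => ?_
      · rw [pt (y1 + t) (by omega) (by omega)]
        congr 1; omega
      · rw [pt (y + t) (by omega) (by omega)]
        congr 1; omega
    unfold pid
    rw [if_pos r1, if_pos (show x ≤ x1 + l by omega), ← hm]
    have : sym F y y2 (mlen F y1 y (min (y - y1) (y2 - y))) =
        sym F x (suc B x) (mlen F y1 y (min (y - y1) (y2 - y))) := by
      rw [e2]
      refine sym_congr (by omega) ((mlen_le _ _ _ _).trans (min_le_right _ _)) fun t ht => ?_
      rw [pt (y + t) (by omega) (by omega)]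
      congr 1; omega
    dsimp only
    rw [this]
  rw [e1]
  refine ⟨by omega, by omega, ?_⟩
  rw [s1, s2, p1, p2]
  exact r3

/-! ### Runs of commuting phrases -/

/-- Between two survivors every boundary has been removed, so adjacent phrases commute. Since
commutation with a common non-empty word is transitive, every phrase of the stretch commutes with
the first one, and so does their concatenation. -/
theorem seg_comm_chain {F : ℕ → ℕ} {o l lam r n : ℕ} {B : Set ℕ} (ha : Adm o n B) (ho : n < o)
    (hlam : lam % 2 = 0) {x1 e : ℕ} (hx1 : x1 ∈ B)
    (hrem : ∀ y ∈ B, x1 < y → y < e → y ∉ thin F o l lam r B) :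
    ∀ y ∈ B, x1 ≤ y → y < e →
      seg F x1 (suc B x1) ++ seg F x1 (suc B y) = seg F x1 (suc B y) ++ seg F x1 (suc B x1) ∧
      seg F x1 (suc B x1) ++ seg F y (suc B y) = seg F y (suc B y) ++ seg F x1 (suc B x1) := by
  intro y
  induction y using Nat.strong_induction_on with
  | _ y ih =>
    intro hy hle hlt
    rcases Nat.eq_or_lt_of_le hle with rfl | hlt'
    · exact ⟨rfl, rfl⟩
    · have hyo := ha.le y hy
      have h1 := le_pre hx1 hlt'
      have h2 := pre_lt B (x := y) (by omega)
      have hx1o := ha.le x1 hx1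
      have hm : pre B y ∈ B := pre_mem (by omega)
      obtain ⟨i1, i2⟩ := ih _ h2 hm h1 (by omega)
      rw [suc_pre hy (by omega)] at i1 i2
      have hr : rule F o l lam r (pre B (pre B y)) (pre B y) y (suc B y) := by
        by_contra hn
        exact hrem y hy hlt' hlt ⟨hy, hn⟩
      have hr3 := hr.2.2
      rw [if_pos hlam] at hr3
      have i3 := append_comm_trans i2 hr3 (by rw [seg_length]; omega)
      have hs := (suc_spec (ha.inf ho) y).1
      refine ⟨?_, i3⟩
      rw [← seg_append F hle hs.le, ← List.append_assoc, i1, List.append_assoc, i3,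
        List.append_assoc]

/-- Suppose two adjacent merged phrases are equal. The original phrase on the left of `x` commutes
with the left merged phrase, and the original one on its right with the right merged phrase. Through
the common word the two original phrases commute, so the rule would have removed `x`. -/
theorem seg_ne_of_thin {F : ℕ → ℕ} {o l lam r n : ℕ} {B : Set ℕ} (ha : Adm o n B) (ho : n < o)
    (hl : l ≤ n) (hlam : lam % 2 = 0) {x : ℕ} (hx : x ∈ thin F o l lam r B)
    (h1 : x ≤ pre (thin F o l lam r B) x + l) (h2 : suc (thin F o l lam r B) x ≤ x + l) :
    seg F (pre (thin F o l lam r B) x) x ≠ seg F x (suc (thin F o l lam r B) x) := by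
  set B' := thin F o l lam r B with hB'
  have ha' : Adm o n B' := ha.thin ho hl
  intro heq
  have hxB : x ∈ B := hx.1
  have hxo := ha.le x hxB
  set x1 := pre B' x with hx1
  set x2 := suc B' x with hx2
  have mx1 : x1 ∈ B' := ha'.pre_mem ho hl hx h1
  have lx1 : x1 < x := pre_lt B' (by omega)
  obtain ⟨lx2, mx2⟩ : x < x2 ∧ x2 ∈ B' := suc_spec (ha'.inf ho) x
  have hx1o := ha.le x1 mx1.1
  have c1 := le_pre mx1.1 lx1
  have c2 := pre_lt B (x := x) (by omega)
  have m1 : pre B x ∈ B := pre_mem (by omega)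
  have k1 := seg_comm_chain ha ho hlam mx1.1 (e := x)
    (fun y _ h h' => notMem_of_pre_lt h h') (pre B x) m1 c1 c2
  rw [suc_pre hxB (by omega)] at k1
  have c3 := le_pre hxB lx2
  have c4 := pre_lt B (x := x2) (by omega)
  have m2 : pre B x2 ∈ B := pre_mem (by omega)
  have k2 := seg_comm_chain ha ho hlam hxB (e := x2)
    (fun y _ h h' => notMem_of_lt_suc h h') (pre B x2) m2 c3 c4
  rw [suc_pre mx2.1 (by omega)] at k2
  have d1 := (suc_spec (ha.inf ho) x1).1
  have d2 := (suc_spec (ha.inf ho) x).1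
  have g1 := append_comm_trans k1.1.symm k1.2 (by rw [seg_length]; omega)
  rw [heq] at g1
  have g2 := append_comm_trans g1.symm k2.1.symm (by rw [seg_length]; omega)
  refine hx.2 ⟨by omega, ?_, ?_⟩
  · have := suc_le mx2.1 lx2; omega
  · rw [if_pos hlam]; exact g2

end LCE

/-! ### Determinacy: the text between boundaries is forced -/

namespace LCE

/-! ### Continuations without boundaries are determined by their beginnings -/

/-- If the texts at `i` and `j` agree on `32 τ` symbols, they agree as long as both of them meet no
boundary from distance `16 τ` on. -/
def Det (F : ℕ → ℕ) (o n τ : ℕ) (B : Set ℕ) : Prop :=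
  ∀ i j g, o ≤ i → o ≤ j → i + g ≤ o + n → j + g ≤ o + n →
    (∀ t < 32 * τ, F (i + t) = F (j + t)) →
    (∀ x ∈ B, i + 16 * τ ≤ x → i + g ≤ x) → (∀ x ∈ B, j + 16 * τ ≤ x → j + g ≤ x) →
    ∀ t < g, F (i + t) = F (j + t)

/-- A removed boundary has label 0 on its left and 1 on its right, so neither adjacent boundary has
the pattern for removal. If a stretch of length above 32τ without survivors contained a removed
boundary, its right neighbour would have to lie behind the stretch and its left neighbour before
distance 16τ. These two are at most 2τ apart, so there is none, and `B` itself has no boundary in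
the stretch. -/
theorem Det.thin_odd {F : ℕ → ℕ} {o n τ l lam r : ℕ} {B : Set ℕ} (hd : Det F o n τ B)
    (ha : Adm o n B) (ho : n < o) (hln : l ≤ n) (hl : l ≤ τ) (hlam : lam % 2 ≠ 0) :
    Det F o n τ (thin F o l lam r B) := by
  intro i j g hi hj hig hjg hA h1 h2
  by_cases hg : g ≤ 32 * τ
  · exact fun t ht => hA t (by omega)
  have key : ∀ i, o ≤ i → (∀ x ∈ thin F o l lam r B, i + 16 * τ ≤ x → i + g ≤ x) →
      ∀ x ∈ B, i + 16 * τ ≤ x → i + g ≤ x := by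
    intro i hi h1 x hx hix
    by_contra hlt
    have hr : rule F o l lam r (pre B (pre B x)) (pre B x) x (suc B x) := by
      by_contra hn
      exact hlt (h1 x ⟨hx, hn⟩ hix)
    obtain ⟨r1, r2, r3⟩ := hr
    rw [if_neg hlam] at r3
    have hxo := ha.le x hx
    have m1 : pre B x ∈ B := ha.pre_mem ho hln hx r1
    obtain ⟨l2, m2⟩ := suc_spec (ha.inf ho) x
    have hx1o := ha.le _ m1
    have n1 : pre B x ∈ thin F o l lam r B := by
      refine ⟨m1, fun hr => ?_⟩
      have := hr.2.2
      rw [if_neg hlam, suc_pre hx (by omega)] at this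
      omega
    have n2 : suc B x ∈ thin F o l lam r B := by
      refine ⟨m2, fun hr => ?_⟩
      have := hr.2.2
      rw [if_neg hlam, pre_suc (ha.inf ho) hx] at this
      omega
    have a2 := h1 _ n2 (by omega)
    have a1 := pre_lt B (x := x) (by omega)
    by_cases hc : i + 16 * τ ≤ pre B x
    · have := h1 _ n1 hc; omega
    · omega
  exact hd i j g hi hj hig hjg hA (key i hi h1) (key j hj h2)

/-- The word from `x1` to the first boundary `z` behind `t` commutes with the first phrase. Reading
the symbol of `t` in the two products gives the same symbol one phrase length earlier. -/
theorem periodic_of_thin_even {F : ℕ → ℕ} {o l lam r n : ℕ} {B : Set ℕ} (ha : Adm o n B) (ho : n < o)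
    (hlam : lam % 2 = 0) {x1 e : ℕ} (hx1 : x1 ∈ B)
    (hrem : ∀ y ∈ B, x1 < y → y < e → y ∉ thin F o l lam r B) {t : ℕ} (ht : suc B x1 ≤ t)
    (hte : t < e) : F t = F (t - (suc B x1 - x1)) := by
  have hx1o := ha.le x1 hx1
  have hs := suc_spec (ha.inf ho) x1
  have h1 := le_pre hs.2 (show suc B x1 < t + 1 by omega)
  have hm : pre B (t + 1) ∈ B := pre_mem (by omega)
  have h2 := pre_lt B (x := t + 1) (by omega)
  have h3 : t < suc B (pre B (t + 1)) := by
    by_contra hlt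
    have h4 := suc_spec (ha.inf ho) (pre B (t + 1))
    have := le_pre h4.2 (show _ < t + 1 by omega)
    omega
  obtain ⟨k, -⟩ := seg_comm_chain ha ho hlam hx1 hrem _ hm (by omega) (by omega)
  set z := suc B (pre B (t + 1)) with hz
  set p := suc B x1 - x1 with hp
  have e1 : (seg F x1 z ++ seg F x1 (suc B x1))[t - x1]'(by simp [seg_length]; omega) = F t := by
    rw [List.getElem_append_left (by rw [seg_length]; omega), seg_getElem]
    congr 1; omega
  have e2 : (seg F x1 (suc B x1) ++ seg F x1 z)[t - x1]'(by simp [seg_length]; omega) =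
      F (t - p) := by
    rw [List.getElem_append_right (by rw [seg_length]; omega), seg_getElem, seg_length]
    congr 1; omega
  rw [← e1, ← e2]
  simp only [k]

/-- Take the first removed boundary `x` from distance 16τ on, and the boundary before it. Locality
copies both of them to the other text, since the texts agree around them. Behind `x` both texts have
the same period, the length of this phrase, so agreement on the first 32τ symbols propagates to the
whole stretch. If no boundary was removed in either stretch, the hypothesis on `B` applies directly.
-/
theorem Det.thin_even {F : ℕ → ℕ} {o n τ l lam r c : ℕ} {B : Set ℕ} (hd : Det F o n τ B)
    (hloc : Loc F o n B c) (hc : c ≤ 14 * τ) (hτ : 1 ≤ τ)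
    (ha : Adm o n B) (ho : n < o) (hln : l ≤ n) (hl : l ≤ τ) (hlam : lam % 2 = 0) :
    Det F o n τ (thin F o l lam r B) := by
  intro i j g hi hj hig hjg hA h1 h2
  by_cases hg : g ≤ 32 * τ
  · exact fun t ht => hA t (by omega)
  have key : ∀ i j, o ≤ i → o ≤ j → i + g ≤ o + n → j + g ≤ o + n →
      (∀ t < 32 * τ, F (i + t) = F (j + t)) →
      (∀ x ∈ thin F o l lam r B, i + 16 * τ ≤ x → i + g ≤ x) →
      (∀ x ∈ thin F o l lam r B, j + 16 * τ ≤ x → j + g ≤ x) →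
      (∃ x ∈ B, i + 16 * τ ≤ x ∧ x < i + g) → ∀ t < g, F (i + t) = F (j + t) := by
    intro i j hi hj hig hjg hA h1 h2 hex
    classical
    set x := Nat.find hex with hxdef
    obtain ⟨hx, hix, hxg⟩ : x ∈ B ∧ i + 16 * τ ≤ x ∧ x < i + g := Nat.find_spec hex
    have hmin : ∀ y ∈ B, i + 16 * τ ≤ y → x ≤ y := fun y hy hiy => by
      by_contra hlt
      exact Nat.find_min hex (m := y) (by omega) ⟨hy, hiy, by omega⟩
    have hr : rule F o l lam r (pre B (pre B x)) (pre B x) x (suc B x) := by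
      by_contra hn
      have := h1 x ⟨hx, hn⟩ hix; omega
    have r1 := hr.1
    have hxo := ha.le x hx
    have m1 : pre B x ∈ B := ha.pre_mem ho hln hx r1
    have l1 := pre_lt B (x := x) (by omega)
    have l1' : pre B x < i + 16 * τ := by
      by_contra hn
      have := hmin _ m1 (by omega); omega
    -- Neighbourhoods of radius at most 14τ around these positions stay between `i + τ` and `i + 31
    -- * τ`, inside the part that is known to agree.
    have tr : ∀ u, i + 15 * τ ≤ u → u ≤ i + 17 * τ → AgreeAt F o n c u (u + j - i) :=
      fun u hu hu' => ⟨by omega, by omega, by omega, by omega, fun t ht => by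
        have := hA (u - c + t - i) (by omega)
        convert this using 2 <;> omega⟩
    have hx' : x + j - i ∈ B := hloc _ _ (tr x (by omega) (by omega)) hx
    have m1' : pre B x + j - i ∈ B := hloc _ _ (tr _ (by omega) (by omega)) m1
    have s1 : suc B (pre B x) = x := suc_pre hx (by omega)
    have s2 : suc B (pre B x + j - i) = x + j - i := by
      refine suc_eq hx' (by omega) fun d hd1 hd2 hd => ?_
      refine notMem_of_pre_lt (B := B) (x := x) (c := d + i - j) (by omega) (by omega) ?_
      have := (tr (d + i - j) (by omega) (by omega)).symm
      rw [show d + i - j + j - i = d by omega] at this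
      exact hloc _ _ this hd
    have P1 : ∀ t, x ≤ t → t < i + g → F t = F (t - (x - pre B x)) := fun t ht hte => by
      have := periodic_of_thin_even (F := F) (l := l) (r := r) ha ho hlam m1 (e := i + g)
        (fun y hy hy1 hy2 hy3 => by
          by_cases hyi : i + 16 * τ ≤ y
          · have := h1 y hy3 hyi; omega
          · exact notMem_of_pre_lt hy1 (by omega) hy) (t := t) (by omega) hte
      rwa [s1] at this
    have P2 : ∀ t, x + j - i ≤ t → t < j + g → F t = F (t - (x - pre B x)) := fun t ht hte => by
      have := periodic_of_thin_even (F := F) (l := l) (r := r) ha ho hlam m1' (e := j + g)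
        (fun y hy hy1 hy2 hy3 => by
          by_cases hyi : j + 16 * τ ≤ y
          · have := h2 y hy3 hyi; omega
          · exact notMem_of_lt_suc hy1 (by omega) hy) (t := t) (by omega) hte
      rwa [s2, show x + j - i - (pre B x + j - i) = x - pre B x by omega] at this
    intro t
    induction t using Nat.strong_induction_on with
    | _ t ih =>
      intro ht
      by_cases hlt : t < 32 * τ
      · exact hA t hlt
      · rw [P1 (i + t) (by omega) (by omega), P2 (j + t) (by omega) (by omega)]
        have := ih (t - (x - pre B x)) (by omega) (by omega)
        convert this using 2 <;> omega
  by_cases hex : ∃ x ∈ B, i + 16 * τ ≤ x ∧ x < i + g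
  · exact key i j hi hj hig hjg hA h1 h2 hex
  by_cases hex' : ∃ x ∈ B, j + 16 * τ ≤ x ∧ x < j + g
  · exact fun t ht => (key j i hj hi hjg hig (fun t ht => (hA t ht).symm) h2 h1 hex' t ht).symm
  push Not at hex hex'
  exact hd i j g hi hj hig hjg hA hex hex'

/-! ### Block occurrences -/

/-- The text has at `y` an occurrence of its `a`-th block of length `τ`. -/
def Occ (f : ℕ → ℕ) (n τ a y : ℕ) : Prop := y + τ ≤ n ∧ ∀ t < τ, f (a * τ + t) = f (y + t)

/-- Occurrences of blocks that are not followed by an overlapping occurrence of the same block. -/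
def Last (f : ℕ → ℕ) (n τ y : ℕ) : Prop :=
  ∃ a < n / τ, Occ f n τ a y ∧ ∀ d, 1 ≤ d → d ≤ τ / 2 → ¬ Occ f n τ a (y + d)

/-- The initial boundaries, in shifted coordinates, with sentinels. -/
def base (f : ℕ → ℕ) (n τ : ℕ) : Set ℕ :=
  {x | (n + 1 ≤ x ∧ Last f n τ (x - (n + 1))) ∨ ∃ k, 3 ≤ k ∧ x = k * (n + 1)}

/-- The text in shifted coordinates. -/
def shifted (f : ℕ → ℕ) (n : ℕ) (x : ℕ) : ℕ := f (x - (n + 1))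

theorem Last.lt {f : ℕ → ℕ} {n τ y : ℕ} (hτ : 1 ≤ τ) (h : Last f n τ y) : y < n := by
  obtain ⟨a, -, h, -⟩ := h
  have := h.1
  omega

theorem base_adm {f : ℕ → ℕ} {n τ : ℕ} (hτ : 1 ≤ τ) : Adm (n + 1) n (base f n τ) where
  le x hx := by
    rcases hx with hx | ⟨k, hk, rfl⟩
    · exact hx.1
    · nlinarith
  real x hx y hy hxy hyx := by
    rcases hy with hy | ⟨k, hk, rfl⟩
    · have := hy.2.lt hτ; omega
    · exfalso
      rcases hx with hx | ⟨k', hk', rfl⟩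
      · have := hx.2.lt hτ
        have := Nat.mul_le_mul_right (n + 1) hk
        omega
      · have : k' < k := by
          by_contra hn
          have := Nat.mul_le_mul_right (n + 1) (show k ≤ k' by omega)
          omega
        have := Nat.mul_le_mul_right (n + 1) (show k' + 1 ≤ k by omega)
        rw [add_mul] at this
        omega
  sent k hk := Or.inr ⟨k, hk, rfl⟩

/-- To decide an initial boundary one looks at an occurrence of length τ and at later ones shifted
by at most τ/2, hence at fewer than 2τ symbols to the right. -/
theorem base_loc {f : ℕ → ℕ} {n τ : ℕ} (hτ : 1 ≤ τ) :
    Loc (shifted f n) (n + 1) n (base f n τ) (2 * τ) := by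
  rintro x y hxy (⟨hx, a, ha, ho, hd⟩ | ⟨k, hk, rfl⟩)
  · have hyl := hxy.yl
    have hxr := hxy.xr
    have hyr := hxy.yr
    have pt : ∀ u, u < 2 * τ → f (x - (n + 1) + u) = f (y - (n + 1) + u) := fun u hu => by
      have := hxy.point (u := x + u) (by omega) (by omega)
      unfold shifted at this
      convert this using 2 <;> omega
    refine Or.inl ⟨by omega, a, ha, ⟨by omega, fun t ht => ?_⟩, fun d h1 h2 h3 => hd d h1 h2 ?_⟩
    · rw [ho.2 t ht, pt t (by omega)]
    · refine ⟨by omega, fun t ht => ?_⟩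
      rw [h3.2 t ht, add_assoc, add_assoc, pt _ (by omega)]
  · have := hxy.xr
    nlinarith

/-- An aligned block starts at a distance above 16τ and at most 17τ from `i`; it occurs at the same
offset from `j`. Without boundaries each occurrence is followed by another one at most τ/2 further.
The least shifts on the two sides must be equal, because different ones would produce a still
earlier occurrence. So the same chain of overlapping occurrences covers both texts, and each new
occurrence extends the agreement. -/
theorem base_det {f : ℕ → ℕ} {n τ : ℕ} (hτ : 1 ≤ τ) :
    Det (shifted f n) (n + 1) n τ (base f n τ) := by
  intro i j g hi hj hig hjg hA h1 h2
  by_cases hg : g ≤ 32 * τ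
  · exact fun t ht => hA t (by omega)
  obtain ⟨i, rfl⟩ := Nat.exists_eq_add_of_le' hi
  obtain ⟨j, rfl⟩ := Nat.exists_eq_add_of_le' hj
  have sh : ∀ u t, shifted f n (u + (n + 1) + t) = f (u + t) := fun u t => by
    unfold shifted; congr 1; omega
  simp only [sh] at hA ⊢
  have nl : ∀ i, (∀ x ∈ base f n τ, i + (n + 1) + 16 * τ ≤ x → i + (n + 1) + g ≤ x) →
      ∀ a < n / τ, ∀ s, 16 * τ ≤ s → s < g → Occ f n τ a (i + s) →
      ∃ d, (1 ≤ d ∧ d ≤ τ / 2) ∧ Occ f n τ a (i + s + d) := fun i h1 a ha s hs hsg hocc => by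
    by_contra hn
    push Not at hn
    have := h1 (i + s + (n + 1)) (Or.inl ⟨by omega, a, ha, by simpa using hocc, fun d hd1 hd2 => by
      simpa using hn d ⟨hd1, hd2⟩⟩) (by omega)
    omega
  -- an aligned block behind distance `16 τ`
  set a := (i + 17 * τ) / τ with hadef
  have ha1 : a * τ ≤ i + 17 * τ := Nat.div_mul_le_self _ _
  have ha2 : i + 17 * τ < a * τ + τ := by
    have := Nat.lt_div_mul_add (a := i + 17 * τ) (b := τ) (by omega)
    simpa [hadef] using this
  have ha : a < n / τ := by
    rw [Nat.lt_div_iff_mul_lt (by omega)]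
    have : (n - 1 - (τ - 1)) = n - τ := by omega
    omega
  obtain ⟨s, hs⟩ : ∃ s, a * τ = i + s := ⟨a * τ - i, by omega⟩
  have oi : Occ f n τ a (i + s) := ⟨by omega, fun t ht => by rw [hs]⟩
  have oj : Occ f n τ a (j + s) := ⟨by omega, fun t ht => by
    rw [hs, add_assoc, add_assoc, hA _ (by omega)]⟩
  have key : ∀ k s, g - s ≤ k → 16 * τ ≤ s → Occ f n τ a (i + s) → Occ f n τ a (j + s) →
      (∀ t < s + τ, f (i + t) = f (j + t)) → ∀ t < g, f (i + t) = f (j + t) := by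
    intro k
    induction k with
    | zero => intro s hk hs _ _ h t ht; exact h t (by omega)
    | succ k ih =>
      intro s hk hs oi oj h
      by_cases hsg : g ≤ s
      · exact fun t ht => h t (by omega)
      classical
      have ei := nl i h1 a ha s hs (by omega) oi
      have ej := nl j h2 a ha s hs (by omega) oj
      obtain ⟨⟨di1, di2⟩, di3⟩ := Nat.find_spec ei
      obtain ⟨⟨dj1, dj2⟩, dj3⟩ := Nat.find_spec ej
      have mi : ∀ d, 1 ≤ d → d < Nat.find ei → ¬ Occ f n τ a (i + s + d) := fun d hd1 hd2 hd3 =>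
        Nat.find_min ei hd2 ⟨⟨hd1, by omega⟩, hd3⟩
      have mj : ∀ d, 1 ≤ d → d < Nat.find ej → ¬ Occ f n τ a (j + s + d) := fun d hd1 hd2 hd3 =>
        Nat.find_min ej hd2 ⟨⟨hd1, by omega⟩, hd3⟩
      generalize Nat.find ei = di at *
      generalize Nat.find ej = dj at *
      -- a smaller shift on one side gives an earlier occurrence on the other side
      have cmp : ∀ p q d d', d < d' → 1 ≤ d → d' ≤ τ / 2 → Occ f n τ a p → Occ f n τ a (p + d) →
          Occ f n τ a q → Occ f n τ a (q + d') → Occ f n τ a (q + (d' - d)) := by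
        intro p q d d' hdd hd1 hd2 p1 p2 q1 q2
        -- The block has period `d` because of the occurrences at `p` and `p + d`, and period `d'`
        -- because of those at `q` and `q + d'`. Both shifts are at most τ/2, so the periods can be
        -- composed inside the block.
        have per : ∀ t, t + d < τ → f (a * τ + t) = f (a * τ + (t + d)) := fun t ht => by
          rw [p2.2 t (by omega), p1.2 (t + d) (by omega)]; congr 1; omega
        have per' : ∀ t, t + d' < τ → f (a * τ + t) = f (a * τ + (t + d')) := fun t ht => by
          rw [q2.2 t (by omega), q1.2 (t + d') (by omega)]; congr 1; omega
        refine ⟨by have := q2.1; omega, fun t ht => ?_⟩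
        by_cases htd : t < d
        · rw [per' t (by omega), show t + d' = t + (d' - d) + d by omega, ← per _ (by omega),
            q1.2 _ (by omega)]
          congr 1; omega
        · have := per (t - d) (by omega)
          rw [show t - d + d = t by omega] at this
          rw [← this, q2.2 _ (by omega)]
          congr 1; omega
      have hdd : di = dj := by
        rcases lt_trichotomy di dj with hlt | heq | hlt
        · exact absurd (cmp (i + s) (j + s) di dj hlt di1 dj2 oi di3 oj dj3)
            (mj _ (by omega) (by omega))
        · exact heq
        · exact absurd (cmp (j + s) (i + s) dj di hlt dj1 di2 oj dj3 oi di3)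
            (mi _ (by omega) (by omega))
      subst hdd
      rw [add_assoc] at di3 dj3
      refine ih (s + di) (by omega) (by omega) di3 dj3 fun t ht => ?_
      by_cases ht' : t < s + τ
      · exact h t ht'
      · have h1 := di3.2 (t - (s + di)) (by omega)
        have h2 := dj3.2 (t - (s + di)) (by omega)
        rw [h1] at h2
        convert h2 using 2 <;> omega
  exact key _ s le_rfl (by omega) oi oj fun t ht => hA t (by omega)

end LCE

/-! ### Locality radius and cardinality of the levels -/

namespace LCE

/-! ### The hierarchy of boundaries -/

/-- Threshold for the length of phrases at level `lam`. -/
def ell (τ J lam : ℕ) : ℕ := τ / 2 ^ (J - lam / 6)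

theorem ell_le (τ J lam : ℕ) : ell τ J lam ≤ τ := Nat.div_le_self _ _

/-- Boundaries at level `lam`, for the given seeds of the labels. -/
def lvl (f : ℕ → ℕ) (n τ J : ℕ) (ρ : ℕ → ℕ) : ℕ → Set ℕ
  | 0 => base f n τ
  | lam + 1 => thin (shifted f n) (n + 1) (ell τ J lam) lam (ρ lam) (lvl f n τ J ρ lam)

theorem lvl_congr {f : ℕ → ℕ} {n τ J : ℕ} {ρ ρ' : ℕ → ℕ} {lam : ℕ} (h : ∀ k < lam, ρ k = ρ' k) :
    lvl f n τ J ρ lam = lvl f n τ J ρ' lam := by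
  induction lam with
  | zero => rfl
  | succ lam ih =>
    simp only [lvl]
    rw [ih fun k hk => h k (by omega), h lam (by omega)]

section
variable {f : ℕ → ℕ} {n τ J : ℕ} {ρ : ℕ → ℕ}

theorem lvl_adm (hτ : 1 ≤ τ) (hn : τ ≤ n) (lam : ℕ) : Adm (n + 1) n (lvl f n τ J ρ lam) := by
  induction lam with
  | zero => exact base_adm hτ
  | succ lam ih => exact ih.thin (by omega) ((ell_le _ _ _).trans hn)

/-- Radius on which membership at level `lam` depends. -/
def radius (τ J : ℕ) : ℕ → ℕ
  | 0 => 2 * τ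
  | lam + 1 => radius τ J lam + 2 * ell τ J lam

theorem lvl_loc (hτ : 1 ≤ τ) (hn : τ ≤ n) (lam : ℕ) :
    Loc (shifted f n) (n + 1) n (lvl f n τ J ρ lam) (radius τ J lam) := by
  induction lam with
  | zero => exact base_loc hτ
  | succ lam ih => exact ih.thin (lvl_adm hτ hn lam) (by omega) ((ell_le _ _ _).trans hn)

/-- The six levels of phase p add 12 times the threshold of that phase, and the threshold at least
doubles with each phase, so the sum is dominated by its last term. The final summand stands on both
sides and is immaterial. -/
theorem radius_le_of_phase {p : ℕ} (hp : p ≤ J) :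
    radius τ J (6 * p) + 12 * τ / 2 ^ J ≤ 2 * τ + 12 * (τ / 2 ^ (J - p)) + 12 * τ / 2 ^ J := by
  induction p with
  | zero => simp [radius]
  | succ p ih =>
    have ih := ih (by omega)
    have e : ∀ k < 6, ell τ J (6 * p + k) = τ / 2 ^ (J - p) := fun k hk => by
      unfold ell
      rw [show (6 * p + k) / 6 = p by omega]
    have hr : radius τ J (6 * (p + 1)) = radius τ J (6 * p) + 12 * (τ / 2 ^ (J - p)) := by
      have e0 := e 0 (by omega)
      have e1 := e 1 (by omega)
      have e2 := e 2 (by omega)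
      have e3 := e 3 (by omega)
      have e4 := e 4 (by omega)
      have e5 := e 5 (by omega)
      rw [show 6 * (p + 1) = 6 * p + 5 + 1 by ring]
      simp only [radius, show 6 * p + 5 = 6 * p + 4 + 1 by ring,
        show 6 * p + 4 = 6 * p + 3 + 1 by ring, show 6 * p + 3 = 6 * p + 2 + 1 by ring,
        show 6 * p + 2 = 6 * p + 1 + 1 by ring] at *
      simp only [add_zero] at e0
      omega
    have hd : 2 * (τ / 2 ^ (J - p)) ≤ τ / 2 ^ (J - (p + 1)) := by
      rw [Nat.le_div_iff_mul_le (by positivity)]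
      have : 2 ^ (J - p) = 2 * 2 ^ (J - (p + 1)) := by
        rw [← pow_succ']; congr 1; omega
      have h := Nat.div_mul_le_self τ (2 ^ (J - p))
      rw [this] at h ⊢
      calc _ = _ := by ring
        _ ≤ τ := h
    omega

theorem radius_le : radius τ J (6 * J) ≤ 14 * τ := by
  have := radius_le_of_phase (τ := τ) (le_refl J)
  simp at this
  omega

theorem radius_mono : Monotone (radius τ J) :=
  monotone_nat_of_le_succ fun lam => by simp [radius]

theorem lvl_det (hτ : 1 ≤ τ) (hn : τ ≤ n) {lam : ℕ} (hlam : lam ≤ 6 * J) :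
    Det (shifted f n) (n + 1) n τ (lvl f n τ J ρ lam) := by
  induction lam with
  | zero => exact base_det hτ
  | succ lam ih =>
    have ha := lvl_adm (f := f) (J := J) (ρ := ρ) hτ hn lam
    have hl := ell_le τ J lam
    by_cases h : lam % 2 = 0
    · exact (ih (by omega)).thin_even (lvl_loc hτ hn lam)
        ((radius_mono (by omega)).trans radius_le) hτ ha (by omega) (by omega) hl h
    · exact (ih (by omega)).thin_odd ha (by omega) (by omega) hl h

/-! ### Counting boundaries -/

open Classical in
/-- Boundaries inside of the text. -/
noncomputable def reals (n : ℕ) (B : Set ℕ) : Finset ℕ :=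
  (Finset.Ico (n + 1) (n + 1 + n)).filter (· ∈ B)

theorem mem_reals {n : ℕ} {B : Set ℕ} {x : ℕ} :
    x ∈ reals n B ↔ (n + 1 ≤ x ∧ x < n + 1 + n) ∧ x ∈ B := by
  simp [reals]

/-- Boundaries both of whose adjacent phrases have length at most `l`. -/
def Active (l : ℕ) (B : Set ℕ) (x : ℕ) : Prop := x ≤ pre B x + l ∧ suc B x ≤ x + l

/-- Each interval of length `h + 1` contains at most one element of the set. -/
theorem card_le_of_separated {s : Finset ℕ} {a n h : ℕ} (hs : ∀ x ∈ s, a ≤ x ∧ x < a + n)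
    (hsep : ∀ x ∈ s, ∀ y ∈ s, x < y → x + h < y) : s.card ≤ n / (h + 1) + 1 := by
  have : s.card ≤ (Finset.range (n / (h + 1) + 1)).card := by
    refine Finset.card_le_card_of_injOn (fun x => (x - a) / (h + 1)) (fun x hx => ?_)
      fun x hx y hy hxy => ?_
    · have := hs x hx
      simp only [Finset.coe_range, Set.mem_Iio, Nat.lt_succ_iff]
      exact Nat.div_le_div_right (by omega)
    · by_contra hne
      have key : ∀ x ∈ s, ∀ y ∈ s, x < y → (x - a) / (h + 1) ≠ (y - a) / (h + 1) := by
        intro x hx y hy hlt heq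
        have h1 := hsep x hx y hy hlt
        have h2 := hs x hx
        have h3 : (x - a) / (h + 1) + 1 ≤ (y - a) / (h + 1) := by
          rw [← Nat.add_div_right _ (by omega)]
          exact Nat.div_le_div_right (by omega)
        omega
      rcases lt_or_gt_of_ne hne with hlt | hlt
      · exact key x hx y hy hlt hxy
      · exact key y hy x hx hlt hxy.symm
  simpa using this

open Classical in
-- Boundaries whose left phrase is longer than `l` are more than `l` apart from each other, and
-- likewise for right phrases; so there are few inactive boundaries of either kind.
theorem card_reals_le_active (l : ℕ) (B : Set ℕ) :
    (reals n B).card ≤ ((reals n B).filter (Active l B)).card + 2 * (n / (l + 1) + 1) := by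
  have h1 : ((reals n B).filter fun x => ¬ x ≤ pre B x + l).card ≤ n / (l + 1) + 1 := by
    refine card_le_of_separated (a := n + 1) (fun x hx => ?_) fun x hx y hy hxy => ?_
    · rw [Finset.mem_filter, mem_reals] at hx; exact hx.1.1
    · rw [Finset.mem_filter, mem_reals] at hx hy
      have := le_pre hx.1.2 hxy
      omega
  have h2 : ((reals n B).filter fun x => ¬ suc B x ≤ x + l).card ≤ n / (l + 1) + 1 := by
    refine card_le_of_separated (a := n + 1) (fun x hx => ?_) fun x hx y hy hxy => ?_
    · rw [Finset.mem_filter, mem_reals] at hx; exact hx.1.1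
    · rw [Finset.mem_filter, mem_reals] at hx hy
      have := suc_le hy.1.2 hxy
      omega
  have h3 : reals n B ⊆ (reals n B).filter (Active l B) ∪
      ((reals n B).filter fun x => ¬ x ≤ pre B x + l) ∪
      ((reals n B).filter fun x => ¬ suc B x ≤ x + l) := by
    intro x hx
    simp only [Finset.mem_union, Finset.mem_filter, hx, true_and, Active]
    tauto
  have := Finset.card_le_card h3
  have := Finset.card_union_le ((reals n B).filter (Active l B) ∪
      ((reals n B).filter fun x => ¬ x ≤ pre B x + l))
      ((reals n B).filter fun x => ¬ suc B x ≤ x + l)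
  have := Finset.card_union_le ((reals n B).filter (Active l B))
      ((reals n B).filter fun x => ¬ x ≤ pre B x + l)
  omega

/-- Label of the phrase that ends at `x`, and of the phrase that starts at `x`. -/
noncomputable def idL (F : ℕ → ℕ) (o l : ℕ) (B : Set ℕ) (x : ℕ) : ℕ :=
  pid F o l (pre B (pre B x)) (pre B x) x

noncomputable def idR (F : ℕ → ℕ) (o l : ℕ) (B : Set ℕ) (x : ℕ) : ℕ :=
  pid F o l (pre B x) x (suc B x)

open Classical in
/-- The seed `r` removes at least a quarter of the active boundaries. -/
def GoodSeed (F : ℕ → ℕ) (n l r : ℕ) (B : Set ℕ) : Prop :=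
  ((reals n B).filter (Active l B)).card ≤ 4 * ((reals n B).filter fun x => Active l B x ∧
    dot r (idL F (n + 1) l B x) % 2 < dot r (idR F (n + 1) l B x) % 2).card

open Classical in
-- Four times the removed boundaries are at least the active ones, and those are all but at most `2
-- * (n / (l + 1) + 1)` of the boundaries.
theorem card_thin_odd {F : ℕ → ℕ} {l lam r : ℕ} {B : Set ℕ} (hlam : lam % 2 ≠ 0)
    (hg : GoodSeed F n l r B) :
    4 * (reals n (thin F (n + 1) l lam r B)).card ≤ 3 * (reals n B).card + 2 * (n / (l + 1) + 1) := by
  have h1 := card_reals_le_active (n := n) l B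
  have h2 : reals n (thin F (n + 1) l lam r B) = (reals n B) \ ((reals n B).filter fun x =>
      Active l B x ∧ dot r (idL F (n + 1) l B x) % 2 < dot r (idR F (n + 1) l B x) % 2) := by
    ext x
    simp only [mem_reals, Finset.mem_sdiff, Finset.mem_filter]
    simp only [thin, rule, Set.mem_ofPred_eq, if_neg hlam, Active, idL, idR]
    tauto
  have h3 := Finset.card_sdiff_add_card_eq_card (s := (reals n B).filter fun x => Active l B x ∧
    dot r (idL F (n + 1) l B x) % 2 < dot r (idR F (n + 1) l B x) % 2) (t := reals n B)
    (Finset.filter_subset _ _)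
  rw [← h2] at h3
  unfold GoodSeed at hg
  omega

theorem card_thin_le {F : ℕ → ℕ} {l lam r : ℕ} {B : Set ℕ} :
    (reals n (thin F (n + 1) l lam r B)).card ≤ (reals n B).card :=
  Finset.card_le_card fun x hx => by
    rw [mem_reals] at hx ⊢; exact ⟨hx.1, hx.2.1⟩

/-- The boundaries that come from one fixed block are more than τ/2 apart, by definition of the last
occurrences. Summing over the n/τ blocks gives the bound. -/
theorem card_base (hn : τ ≤ n) :
    (reals n (base f n τ)).card * τ ≤ 3 * n * (n / τ) := by
  classical
  have h1 : reals n (base f n τ) ⊆ (Finset.range (n / τ)).biUnion fun a =>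
      (Finset.Ico (n + 1) (n + 1 + n)).filter fun x => Occ f n τ a (x - (n + 1)) ∧
        ∀ d, 1 ≤ d → d ≤ τ / 2 → ¬ Occ f n τ a (x - (n + 1) + d) := by
    intro x hx
    rw [mem_reals] at hx
    obtain ⟨hx, h | ⟨k, hk, rfl⟩⟩ := hx
    · obtain ⟨-, a, ha, h1, h2⟩ := h
      simp only [Finset.mem_biUnion, Finset.mem_range, Finset.mem_filter, Finset.mem_Ico]
      exact ⟨a, ha, hx, h1, h2⟩
    · nlinarith
  have h2 := (Finset.card_le_card h1).trans (Finset.card_biUnion_le_card_mul _ _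
    (n / (τ / 2 + 1) + 1) fun a _ => by
      refine card_le_of_separated (a := n + 1) (fun x hx => ?_) fun x hx y hy hxy => ?_
      · simpa using (Finset.mem_filter.mp hx).1
      · simp only [Finset.mem_filter, Finset.mem_Ico] at hx hy
        by_contra hle
        refine hx.2.2 (y - x) (by omega) (by omega) ?_
        rw [show x - (n + 1) + (y - x) = y - (n + 1) by omega]
        exact hy.2.1)
  rw [Finset.card_range] at h2
  have h3 : (n / (τ / 2 + 1) + 1) * τ ≤ 3 * n := by
    have := Nat.div_mul_le_self n (τ / 2 + 1)
    have h4 : n / (τ / 2 + 1) * τ ≤ n / (τ / 2 + 1) * (2 * (τ / 2 + 1)) :=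
      Nat.mul_le_mul_left _ (by omega)
    nlinarith
  calc _ ≤ n / τ * (n / (τ / 2 + 1) + 1) * τ := Nat.mul_le_mul_right _ h2
    _ = n / τ * ((n / (τ / 2 + 1) + 1) * τ) := by ring
    _ ≤ n / τ * (3 * n) := Nat.mul_le_mul_left _ h3
    _ = _ := by ring

/-- One phase must halve the bound. The inactive boundaries are few enough for this, because the
threshold of phase p is about τ / 2^(J - p). -/
theorem card_lvl_phase (hn : τ ≤ n) (hJ : n / τ ≤ 2 ^ J)
    (hρ : ∀ lam < 6 * J, lam % 2 = 1 →
      GoodSeed (shifted f n) n (ell τ J lam) (ρ lam) (lvl f n τ J ρ lam)) {p : ℕ} (hp : p ≤ J) :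
    (reals n (lvl f n τ J ρ (6 * p))).card * τ ≤ 64 * (n * 2 ^ (J - p)) := by
  induction p with
  | zero =>
    have h1 := card_base (f := f) hn
    have h2 := Nat.mul_le_mul_left (3 * n) hJ
    simp only [lvl, Nat.sub_zero]
    nlinarith
  | succ p ih =>
    have ih := ih (by omega)
    set X := n * 2 ^ (J - p) with hX
    have hX' : n * 2 ^ (J - (p + 1)) * 2 = X := by
      rw [hX, mul_assoc, ← pow_succ, show J - (p + 1) + 1 = J - p by omega]
    have e : ∀ k < 6, ell τ J (6 * p + k) = τ / 2 ^ (J - p) := fun k hk => by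
      unfold ell
      rw [show (6 * p + k) / 6 = p by omega]
    set l := τ / 2 ^ (J - p) with hl
    have hK : (n / (l + 1) + 1) * τ ≤ 2 * X := by
      have h1 : τ ≤ (l + 1) * 2 ^ (J - p) := by
        have := Nat.lt_div_mul_add (a := τ) (b := 2 ^ (J - p)) (by positivity)
        rw [← hl] at this
        rw [add_mul, one_mul]; omega
      have h2 := Nat.div_mul_le_self n (l + 1)
      have h3 : n / (l + 1) * τ ≤ X := by
        calc _ ≤ n / (l + 1) * ((l + 1) * 2 ^ (J - p)) := Nat.mul_le_mul_left _ h1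
          _ = n / (l + 1) * (l + 1) * 2 ^ (J - p) := by ring
          _ ≤ X := Nat.mul_le_mul_right _ h2
      have h4 : n * 1 ≤ X := Nat.mul_le_mul_left _ Nat.one_le_two_pow
      rw [add_mul]; omega
    have stepA : ∀ k < 6, (reals n (lvl f n τ J ρ (6 * p + k + 1))).card ≤
        (reals n (lvl f n τ J ρ (6 * p + k))).card := fun k hk => card_thin_le
    have stepB : ∀ k < 6, k % 2 = 1 → 4 * ((reals n (lvl f n τ J ρ (6 * p + k + 1))).card * τ) ≤
        3 * ((reals n (lvl f n τ J ρ (6 * p + k))).card * τ) + 4 * X := fun k hk hk2 => by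
      have h1 := card_thin_odd (lam := 6 * p + k) (by omega) (hρ (6 * p + k) (by omega) (by omega))
      rw [e k hk] at h1
      have h2 := Nat.mul_le_mul_right τ h1
      simp only [lvl, e k hk]
      nlinarith
    have a0 := Nat.mul_le_mul_right τ (stepA 0 (by omega))
    have a2 := Nat.mul_le_mul_right τ (stepA 2 (by omega))
    have a4 := Nat.mul_le_mul_right τ (stepA 4 (by omega))
    have b1 := stepB 1 (by omega) rfl
    have b3 := stepB 3 (by omega) rfl
    have b5 := stepB 5 (by omega) rfl
    simp only [add_assoc, Nat.reduceAdd, add_zero] at a0 a2 a4 b1 b3 b5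
    -- With X as unit, an odd level turns a bound x into (3 x + 4) / 4. Starting from 64 the three
    -- odd levels give 49, then 37.75, then less than 30, which is below the required 32. Even
    -- levels only help.
    rw [show 6 * (p + 1) = 6 * p + 6 by ring]
    omega

theorem card_lvl (hn : τ ≤ n) (hJ : n / τ ≤ 2 ^ J)
    (hρ : ∀ lam < 6 * J, lam % 2 = 1 →
      GoodSeed (shifted f n) n (ell τ J lam) (ρ lam) (lvl f n τ J ρ lam)) :
    (reals n (lvl f n τ J ρ (6 * J))).card * τ ≤ 64 * n := by
  simpa using card_lvl_phase hn hJ hρ le_rfl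

/-- At odd levels, the two phrases at an active boundary have different identifiers. -/
theorem idL_ne_idR (hτ : 1 ≤ τ) (hn : τ ≤ n) {lam : ℕ} (hlam : lam % 2 = 1) {x : ℕ}
    (hx : x ∈ lvl f n τ J ρ lam) (hact : Active (ell τ J lam) (lvl f n τ J ρ lam) x) :
    idL (shifted f n) (n + 1) (ell τ J lam) (lvl f n τ J ρ lam) x ≠
      idR (shifted f n) (n + 1) (ell τ J lam) (lvl f n τ J ρ lam) x := by
  have ha := lvl_adm (f := f) (J := J) (ρ := ρ) hτ hn lam
  have hl := ell_le τ J lam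
  have hxo := ha.le x hx
  refine pid_ne (pre_lt _ (by omega)) (suc_spec (ha.inf (by omega)) x).1 hact.1 (by omega) ?_
  obtain ⟨lam, rfl⟩ : ∃ k, lam = k + 1 := ⟨lam - 1, by omega⟩
  have he : ell τ J (lam + 1) = ell τ J lam := by
    unfold ell
    rw [show (lam + 1) / 6 = lam / 6 by omega]
  rw [he] at hact
  exact seg_ne_of_thin (lvl_adm hτ hn lam) (by omega) (by omega) (by omega) hx hact.1 hact.2

end

end LCE

/-! ### Evaluating all levels in one pass, and derandomising the seeds -/

namespace LCE

/-! ### Streaming over boundaries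

A level of the hierarchy sees its boundaries one after the other, and remembers the last three. -/

/-- A boundary together with its two left neighbours and its right neighbour:
`(x0, x1, x, z)`. -/
abbrev Win := ℕ × ℕ × ℕ × ℕ

def winState (l : List ℕ) : List Win × (ℕ × ℕ × ℕ) :=
  l.foldl (fun s z => (s.1 ++ [(s.2.1, s.2.2.1, s.2.2.2, z)], (s.2.2.1, s.2.2.2, z))) ([], (0, 0, 0))

/-- All windows of a list, which is padded by zeros on the left. -/
def wins (l : List ℕ) : List Win := (winState l).1

/-- The last three elements of a list, which is padded by zeros on the left. -/
def last3 (l : List ℕ) : ℕ × ℕ × ℕ := (winState l).2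

theorem wins_snoc (l : List ℕ) (z : ℕ) :
    wins (l ++ [z]) = wins l ++ [((last3 l).1, (last3 l).2.1, (last3 l).2.2, z)] := by
  simp [wins, last3, winState]

theorem last3_snoc (l : List ℕ) (z : ℕ) :
    last3 (l ++ [z]) = ((last3 l).2.1, (last3 l).2.2, z) := by
  simp [last3, winState]

open Classical in
/-- The boundaries below `M`, in increasing order. -/
noncomputable def els (B : Set ℕ) (M : ℕ) : List ℕ := (List.range M).filter (· ∈ B)

theorem els_zero (B : Set ℕ) : els B 0 = [] := rfl

theorem els_succ_mem {B : Set ℕ} {M : ℕ} (h : M ∈ B) : els B (M + 1) = els B M ++ [M] := by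
  simp [els, List.range_succ, h]

theorem els_succ_notMem {B : Set ℕ} {M : ℕ} (h : M ∉ B) : els B (M + 1) = els B M := by
  simp [els, List.range_succ, h]

theorem els_congr {B : Set ℕ} {a b : ℕ} (hab : a ≤ b) (h : ∀ x ∈ B, a ≤ x → b ≤ x) :
    els B b = els B a := by
  induction b, hab using Nat.le_induction with
  | base => rfl
  | succ b hb ih =>
    rw [els_succ_notMem fun hm => by have := h b hm hb; omega]
    exact ih fun x hx hax => by have := h x hx hax; omega

theorem mem_els {B : Set ℕ} {M x : ℕ} : x ∈ els B M ↔ x < M ∧ x ∈ B := by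
  simp [els]

theorem els_nodup (B : Set ℕ) (M : ℕ) : (els B M).Nodup := List.nodup_range.filter _

theorem els_length_le (B : Set ℕ) (M : ℕ) : (els B M).length ≤ M := by
  classical
  exact (List.length_filter_le _ _).trans (by simp)

theorem pre_zero (B : Set ℕ) : pre B 0 = 0 := by simp [pre]

theorem pre_succ_mem {B : Set ℕ} {M : ℕ} (h : M ∈ B) : pre B (M + 1) = M :=
  pre_eq h (by omega) (by omega)

theorem pre_succ_notMem {B : Set ℕ} {M : ℕ} (h : M ∉ B) : pre B (M + 1) = pre B M := by
  classical
  unfold pre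
  cases M with
  | zero => rfl
  | succ M => simp [h]

theorem last3_els (B : Set ℕ) (M : ℕ) :
    last3 (els B M) = (pre B (pre B (pre B M)), pre B (pre B M), pre B M) := by
  induction M with
  | zero => simp [els_zero, pre_zero, last3, winState]
  | succ M ih =>
    by_cases h : M ∈ B
    · rw [els_succ_mem h, last3_snoc, ih, pre_succ_mem h]
    · rw [els_succ_notMem h, ih, pre_succ_notMem h]

theorem els_eq_pre {B : Set ℕ} (h0 : 0 ∉ B) (M : ℕ) :
    els B M = els B (pre B M) ++ if pre B M = 0 then [] else [pre B M] := by
  by_cases h : pre B M = 0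
  · rw [if_pos h, List.append_nil]
    refine els_congr (by omega) fun x hx _ => ?_
    by_contra hlt
    have := le_pre hx (show x < M by omega)
    have : x = 0 := by omega
    exact h0 (this ▸ hx)
  · rw [if_neg h, ← els_succ_mem (pre_mem h)]
    have hM : 0 < M := by
      rcases Nat.eq_zero_or_pos M with rfl | h'
      · exact absurd (pre_zero B) h
      · exact h'
    refine els_congr (pre_lt B hM) fun x hx hpx => ?_
    by_contra hlt
    have := le_pre hx (show x < M by omega)
    omega

/-- The window of a boundary. -/
noncomputable def winOf (B : Set ℕ) (x : ℕ) : Win := (pre B (pre B x), pre B x, x, suc B x)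

/-- A zero in third place comes from the padding. The window of a boundary is complete only when the
next boundary has arrived, so after reading everything below `M` exactly the boundaries before the
last one have windows. -/
theorem wins_els {B : Set ℕ} (h0 : 0 ∉ B) (M : ℕ) :
    (wins (els B M)).filter (fun w => w.2.2.1 ≠ 0) = (els B (pre B M)).map (winOf B) := by
  induction M with
  | zero => simp [els_zero, pre_zero, wins, winState]
  | succ M ih =>
    by_cases h : M ∈ B
    · rw [els_succ_mem h, wins_snoc, last3_els, List.filter_append, ih, pre_succ_mem h,
        els_eq_pre h0 M, List.map_append]
      congr 1
      have hM : 0 < M := Nat.pos_of_ne_zero fun e => h0 (e ▸ h)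
      by_cases hp : pre B M = 0
      · simp [hp]
      · simp [hp, winOf, suc_pre h hM]
    · rw [els_succ_notMem h, ih, pre_succ_notMem h]

/-- A window with a zero as its third component has its last component in `B`. -/
theorem wins_last_mem {B : Set ℕ} (M : ℕ) : ∀ w ∈ wins (els B M), w.2.2.2 ∈ B := by
  induction M with
  | zero => simp [els_zero, wins, winState]
  | succ M ih =>
    by_cases h : M ∈ B
    · rw [els_succ_mem h, wins_snoc]
      intro w hw
      rcases List.mem_append.mp hw with hw | hw
      · exact ih w hw
      · rw [List.mem_singleton] at hw; subst hw; exact h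
    · rw [els_succ_notMem h]; exact ih

/-- The bound on `M` puts the sentinel `3 * (n + 1)` below `M`, so every boundary of the text has a
complete window. The two conditions on `p` exclude the padding and the sentinels from the count. -/
theorem countP_wins {B : Set ℕ} {n M : ℕ} (ha : Adm (n + 1) n B) (hM : 4 * (n + 1) ≤ M)
    (p : Win → Prop) [DecidablePred p] (hp0 : ∀ a b, ∀ z ∈ B, ¬ p (a, b, 0, z))
    (hp : ∀ x ∈ B, p (winOf B x) → x < n + 1 + n) :
    (wins (els B M)).countP p = ((reals n B).filter fun x => p (winOf B x)).card := by
  have h0 : 0 ∉ B := fun h => by have := ha.le 0 h; omega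
  have h1 : (wins (els B M)).countP p =
      ((wins (els B M)).filter (fun w => w.2.2.1 ≠ 0)).countP p := by
    rw [List.countP_filter]
    refine List.countP_congr fun w hw => ?_
    have hz := wins_last_mem M w hw
    obtain ⟨a, b, c, z⟩ := w
    simp only [ne_eq, decide_eq_true_eq, decide_not, Bool.and_eq_true, Bool.not_eq_true',
      decide_eq_false_iff_not, iff_self_and]
    rintro hpw rfl
    exact hp0 a b z hz hpw
  rw [h1, wins_els h0, List.countP_map, List.countP_eq_length_filter]
  classical
  have hnd : ((els B (pre B M)).filter ((fun w => decide (p w)) ∘ winOf B)).Nodup :=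
    (els_nodup _ _).filter _
  rw [← List.toFinset_card_of_nodup hnd]
  congr 1
  ext x
  simp only [List.mem_toFinset, List.mem_filter, mem_els, Function.comp, decide_eq_true_eq,
    Finset.mem_filter, mem_reals]
  have h3 : 3 * (n + 1) ≤ pre B M := le_pre (ha.sent 3 le_rfl) (by omega)
  constructor
  · rintro ⟨⟨-, hx⟩, hpx⟩
    exact ⟨⟨⟨ha.le x hx, hp x hx hpx⟩, hx⟩, hpx⟩
  · rintro ⟨⟨⟨-, hx1⟩, hx2⟩, hpx⟩
    exact ⟨⟨by omega, hx2⟩, hpx⟩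

section
variable (F : ℕ → ℕ) (o : ℕ)

open Classical in
/-- The boundaries that one level passes on to the next one. -/
noncomputable def emit (l lam r : ℕ) (L : List ℕ) : List ℕ :=
  ((wins L).filter fun w => w.2.2.1 ≠ 0 ∧ ¬ rule F o l lam r w.1 w.2.1 w.2.2.1 w.2.2.2).map
    fun w => w.2.2.1

open Classical in
theorem emit_snoc (l lam r : ℕ) (L : List ℕ) (z : ℕ) :
    emit F o l lam r (L ++ [z]) = emit F o l lam r L ++
      if (last3 L).2.2 ≠ 0 ∧ ¬ rule F o l lam r (last3 L).1 (last3 L).2.1 (last3 L).2.2 z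
      then [(last3 L).2.2] else [] := by
  unfold emit
  rw [wins_snoc, List.filter_append, List.map_append]
  congr 1
  split_ifs with h
  · rw [List.filter_cons_of_pos (by simpa using h)]; simp
  · rw [List.filter_cons_of_neg (by simpa using h)]; simp

/-- Streaming realises thinning with a lag of one boundary: of the boundaries below `M`, the last
one is still undecided, because its right neighbour is unknown. -/
theorem emit_els (l lam r : ℕ) {B : Set ℕ} (h0 : 0 ∉ B) (M : ℕ) :
    emit F o l lam r (els B M) = els (thin F o l lam r B) (pre B M) := by
  classical
  have h1 : (wins (els B M)).filter (fun w => decide (w.2.2.1 ≠ 0 ∧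
      ¬ rule F o l lam r w.1 w.2.1 w.2.2.1 w.2.2.2)) =
      ((wins (els B M)).filter (fun w => w.2.2.1 ≠ 0)).filter
        (fun w => ¬ rule F o l lam r w.1 w.2.1 w.2.2.1 w.2.2.2) := by
    rw [List.filter_filter]
    refine List.filter_congr fun w _ => ?_
    simp only [Bool.decide_and, Bool.and_comm]
  unfold emit
  rw [h1, wins_els h0, List.filter_map, List.map_map]
  have h2 : ((fun w : Win => w.2.2.1) ∘ winOf B) = id := rfl
  rw [h2, List.map_id]
  unfold els
  rw [List.filter_filter]
  refine List.filter_congr fun x _ => ?_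
  by_cases hx : x ∈ B <;> simp [thin, winOf, hx]
  congr 1

end

/-- The boundaries that arrive at level `q` when `L` arrives at the bottom. -/
noncomputable def stream (f : ℕ → ℕ) (n τ J : ℕ) (ρ : ℕ → ℕ) (L : List ℕ) : ℕ → List ℕ
  | 0 => L
  | q + 1 => emit (shifted f n) (n + 1) (ell τ J q) q (ρ q) (stream f n τ J ρ L q)

/-- Every level lags by one boundary, at worst by one sentinel. Supplying the sentinels below `(tgt
+ 4) * (n + 1)` pays for `tgt` levels and leaves a margin of `4 * (n + 1)` at the last one. -/
theorem stream_els {f : ℕ → ℕ} {n τ J : ℕ} {ρ : ℕ → ℕ} (hτ : 1 ≤ τ) (hn : τ ≤ n) {tgt q : ℕ}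
    (hq : q ≤ tgt) : ∃ M, (tgt + 4 - q) * (n + 1) ≤ M ∧
      stream f n τ J ρ (els (base f n τ) ((tgt + 4) * (n + 1))) q = els (lvl f n τ J ρ q) M := by
  induction q with
  | zero => exact ⟨_, le_rfl, rfl⟩
  | succ q ih =>
    obtain ⟨M, hM, hs⟩ := ih (by omega)
    have ha := lvl_adm (f := f) (J := J) (ρ := ρ) hτ hn q
    refine ⟨pre (lvl f n τ J ρ q) M, ?_, ?_⟩
    · refine le_pre (ha.sent _ (by omega)) (lt_of_lt_of_le ?_ hM)
      exact Nat.mul_lt_mul_of_pos_right (by omega) (by omega)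
    · simp only [stream]
      rw [hs, emit_els _ _ _ _ _ fun h => by have := ha.le 0 h; omega]
      rfl

/-! ### Greedy choice of a seed -/

section
variable (A : Finset ℕ) (u w : ℕ → ℕ)

/-- Pairs that differ only in bits below `k` and get equal labels from `r`. -/
def eqPairs (k r : ℕ) : Finset ℕ :=
  A.filter fun x => u x ≠ w x ∧ u x / 2 ^ k = w x / 2 ^ k ∧ dot r (u x) % 2 = dot r (w x) % 2

/-- Pairs that differ only in bits below `k` and get different labels from `r`. -/
def nePairs (k r : ℕ) : Finset ℕ :=
  A.filter fun x => u x / 2 ^ k = w x / 2 ^ k ∧ dot r (u x) % 2 ≠ dot r (w x) % 2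

/-- Pairs whose highest differing bit is `k` and which get equal labels from `r`. -/
def eqTop (k r : ℕ) : Finset ℕ :=
  A.filter fun x => u x / 2 ^ k ≠ w x / 2 ^ k ∧ u x / 2 ^ (k + 1) = w x / 2 ^ (k + 1) ∧
    dot r (u x) % 2 = dot r (w x) % 2

/-- Pairs whose highest differing bit is `k` and which get different labels from `r`. -/
def neTop (k r : ℕ) : Finset ℕ :=
  A.filter fun x => u x / 2 ^ k ≠ w x / 2 ^ k ∧ u x / 2 ^ (k + 1) = w x / 2 ^ (k + 1) ∧
    dot r (u x) % 2 ≠ dot r (w x) % 2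

/-- Invariant of the greedy choice. -/
def SeedInv (k r : ℕ) : Prop :=
  r < 2 ^ k ∧ r % 2 = 0 ∧ (eqPairs A u w k r).card ≤ (nePairs A u w k r).card

variable {A u w}

/-- All identifiers are odd, so no two of them differ only in bit 0 and the first decision concerns
bit 1. -/
theorem SeedInv.start (hu : ∀ x ∈ A, u x % 2 = 1) (hw : ∀ x ∈ A, w x % 2 = 1) :
    SeedInv A u w 1 0 := by
  refine ⟨by simp, rfl, ?_⟩
  have : eqPairs A u w 1 0 = ∅ := by
    refine Finset.filter_eq_empty_iff.mpr fun x hx h => h.1 ?_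
    have := hu x hx
    have := hw x hx
    have := h.2.1
    omega
  simp [this]

/-- Setting bit `k` of the seed swaps equal and different labels for the pairs whose highest
differing bit is `k`, and leaves this relation unchanged for the pairs that differ only below. So
one of the two choices separates at least half of the new pairs, and the comparison of the two
counts finds it. -/
theorem SeedInv.step {k r : ℕ} (h : SeedInv A u w k r) (hk : 1 ≤ k) :
    SeedInv A u w (k + 1)
      (if (neTop A u w k r).card < (eqTop A u w k r).card then r + 2 ^ k else r) := by
  obtain ⟨h1, h2, h3⟩ := h
  have hev : 2 ^ k % 2 = 0 := by
    obtain ⟨j, rfl⟩ := Nat.exists_eq_add_of_le hk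
    rw [pow_add]; omega
  have hdd : ∀ v : ℕ, v / 2 ^ (k + 1) = v / 2 ^ k / 2 := fun v => by
    rw [Nat.div_div_eq_div_mul, pow_succ]
  have split1 : (eqPairs A u w (k + 1) r).card ≤ (eqPairs A u w k r).card +
      (eqTop A u w k r).card := by
    refine (Finset.card_le_card fun x hx => ?_).trans (Finset.card_union_le _ _)
    simp only [eqPairs, eqTop, Finset.mem_union, Finset.mem_filter] at hx ⊢
    tauto
  have split2 : (nePairs A u w k r).card + (neTop A u w k r).card ≤
      (nePairs A u w (k + 1) r).card := by
    rw [← Finset.card_union_of_disjoint]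
    · refine Finset.card_le_card fun x hx => ?_
      simp only [nePairs, neTop, Finset.mem_union, Finset.mem_filter] at hx ⊢
      rcases hx with ⟨a, b, c⟩ | ⟨a, b, c, d⟩
      · exact ⟨a, by rw [hdd, hdd, b], c⟩
      · exact ⟨a, c, d⟩
    · rw [Finset.disjoint_left]
      intro x hx hx'
      simp only [nePairs, neTop, Finset.mem_filter] at hx hx'
      exact hx'.2.1 hx.2.1
  have flip : ∀ x, u x / 2 ^ k ≠ w x / 2 ^ k → u x / 2 ^ (k + 1) = w x / 2 ^ (k + 1) →
      (dot (r + 2 ^ k) (u x) % 2 = dot (r + 2 ^ k) (w x) % 2 ↔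
        dot r (u x) % 2 ≠ dot r (w x) % 2) := fun x a b => by
    rw [dot_add_two_pow k r _ h1, dot_add_two_pow k r _ h1]
    rw [hdd, hdd] at b
    omega
  have keep : ∀ x, u x / 2 ^ k = w x / 2 ^ k →
      (dot (r + 2 ^ k) (u x) % 2 = dot (r + 2 ^ k) (w x) % 2 ↔
        dot r (u x) % 2 = dot r (w x) % 2) := fun x a => by
    rw [dot_add_two_pow k r _ h1, dot_add_two_pow k r _ h1, a]
    omega
  split_ifs with hc
  · refine ⟨by rw [pow_succ]; omega, by omega, ?_⟩
    have s1 : (eqPairs A u w (k + 1) (r + 2 ^ k)).card ≤ (eqPairs A u w k r).card +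
        (neTop A u w k r).card := by
      refine (Finset.card_le_card fun x hx => ?_).trans (Finset.card_union_le _ _)
      simp only [eqPairs, neTop, Finset.mem_union, Finset.mem_filter] at hx ⊢
      obtain ⟨a, b, c, d⟩ := hx
      by_cases e : u x / 2 ^ k = w x / 2 ^ k
      · exact Or.inl ⟨a, b, e, (keep x e).mp d⟩
      · exact Or.inr ⟨a, e, c, (flip x e c).mp d⟩
    have s2 : (nePairs A u w k r).card + (eqTop A u w k r).card ≤
        (nePairs A u w (k + 1) (r + 2 ^ k)).card := by
      rw [← Finset.card_union_of_disjoint]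
      · refine Finset.card_le_card fun x hx => ?_
        simp only [nePairs, eqTop, Finset.mem_union, Finset.mem_filter] at hx ⊢
        rcases hx with ⟨a, b, c⟩ | ⟨a, b, c, d⟩
        · exact ⟨a, by rw [hdd, hdd, b], fun e => c ((keep x b).mp e)⟩
        · exact ⟨a, c, fun e => (flip x b c).mp e d⟩
      · rw [Finset.disjoint_left]
        intro x hx hx'
        simp only [nePairs, eqTop, Finset.mem_filter] at hx hx'
        exact hx'.2.1 hx.2.1
    omega
  · exact ⟨by rw [pow_succ]; omega, h2, by omega⟩

/-- The final correction of the seed by its lowest bit. -/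
theorem SeedInv.final {k r : ℕ} (h : SeedInv A u w k r) (hu : ∀ x ∈ A, u x % 2 = 1)
    (hw : ∀ x ∈ A, w x % 2 = 1) (huw : ∀ x ∈ A, u x ≠ w x)
    (hk : ∀ x ∈ A, u x / 2 ^ k = w x / 2 ^ k) {r' : ℕ}
    (hr : r' = if (A.filter fun x => dot r (u x) % 2 < dot r (w x) % 2).card <
      (A.filter fun x => dot r (w x) % 2 < dot r (u x) % 2).card then r + 1 else r) :
    A.card ≤ 4 * (A.filter fun x => dot r' (u x) % 2 < dot r' (w x) % 2).card := by
  obtain ⟨h1, h2, h3⟩ := h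
  have s1 : A.card ≤ (eqPairs A u w k r).card + (nePairs A u w k r).card := by
    refine (Finset.card_le_card fun x hx => ?_).trans (Finset.card_union_le _ _)
    simp only [eqPairs, nePairs, Finset.mem_union, Finset.mem_filter]
    have := huw x hx
    have := hk x hx
    tauto
  have s2 : (nePairs A u w k r).card ≤ (A.filter fun x => dot r (u x) % 2 < dot r (w x) % 2).card +
      (A.filter fun x => dot r (w x) % 2 < dot r (u x) % 2).card := by
    refine (Finset.card_le_card fun x hx => ?_).trans (Finset.card_union_le _ _)
    simp only [nePairs, Finset.mem_union, Finset.mem_filter] at hx ⊢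
    have := hx.2.2
    rcases lt_or_gt_of_ne this with h | h
    · exact Or.inl ⟨hx.1, h⟩
    · exact Or.inr ⟨hx.1, h⟩
  by_cases hc : (A.filter fun x => dot r (u x) % 2 < dot r (w x) % 2).card <
      (A.filter fun x => dot r (w x) % 2 < dot r (u x) % 2).card
  · rw [if_pos hc] at hr
    -- Identifiers are odd and the seed is even, so setting its bit 0 complements every label and
    -- exchanges the pattern 01 with 10. At least half of the pairs have different labels, and the
    -- more frequent pattern accounts for a quarter of all.
    have e : ∀ v, v % 2 = 1 → dot r' v = dot r v + 1 := fun v hv => by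
      rw [hr, dot_rec, dot_rec r]
      have e1 : (r + 1) % 2 = 1 := by omega
      have e2 : (r + 1) / 2 = r / 2 := by omega
      rw [e1, e2, hv, h2]; omega
    have : (A.filter fun x => dot r' (u x) % 2 < dot r' (w x) % 2) =
        A.filter fun x => dot r (w x) % 2 < dot r (u x) % 2 := by
      refine Finset.filter_congr fun x hx => ?_
      rw [e _ (hu x hx), e _ (hw x hx)]
      omega
    rw [this]; omega
  · rw [if_neg hc] at hr
    subst hr
    omega

end

theorem pid_odd (F : ℕ → ℕ) (o l x0 x1 x : ℕ) : pid F o l x0 x1 x % 2 = 1 := by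
  simp only [pid]; omega

end LCE

namespace LCE

/-! ### Deciding whether a boundary is removed -/

/-- Parameters of the construction: the text has length `n` and symbols at most `A`, words and arrays
are long enough, and identifiers of phrases have at most `K` bits. -/
structure Setup (E : Env) (n τ J A K : ℕ) : Prop where
  len : E.T.length = n
  pos : 1 ≤ τ
  le : τ ≤ n
  lt_J : n / τ < 2 ^ J
  J_le : 2 ^ J ≤ 2 * (n / τ)
  sym_le : ∀ x ∈ E.T, x ≤ A
  le_K : 2 * ((n + 1) * (A + 2)) ≤ 2 ^ K
  K_le : 2 ^ K ≤ 4 * ((n + 1) * (A + 2))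
  word : 2048 * ((n + 1) * ((n + 1) * (A + 2))) ≤ E.W
  -- At most 128 (n / τ) points are stored; the longest array is the table of logarithms, with room
  -- for 512 (n / τ) entries.
  space : 1024 * (n / τ) ≤ E.Z

/-- The global variables have their intended values. -/
structure Ctx (n₀ τ₀ J₀ : ℕ) (σ : St) : Prop where
  n : σ.v .n = n₀
  tau : σ.v .tau = τ₀
  m : σ.v .m = n₀ / τ₀
  h : σ.v .h = τ₀ / 2
  o : σ.v .o = n₀ + 1
  J : σ.v .J = J₀

theorem Ctx.congr {n τ J : ℕ} {σ σ' : St} (h : Ctx n τ J σ) {vs : List Var} {as : List Arr}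
    (hf : Frame vs as σ σ') (hd : ∀ x ∈ [Var.n, .tau, .m, .h, .o, .J], x ∉ vs) : Ctx n τ J σ' := by
  simp only [List.mem_cons, List.not_mem_nil, or_false, forall_eq_or_imp, forall_eq] at hd
  obtain ⟨h1, h2, h3, h4, h5, h6⟩ := hd
  exact ⟨(hf.v _ h1).trans h.n, (hf.v _ h2).trans h.tau, (hf.v _ h3).trans h.m,
    (hf.v _ h4).trans h.h, (hf.v _ h5).trans h.o, (hf.v _ h6).trans h.J⟩

section
variable {E : Env} {n τ J A K : ℕ}

theorem Setup.m_pos (S : Setup E n τ J A K) : 1 ≤ n / τ := Nat.div_pos S.le S.pos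

theorem Setup.m_le (_ : Setup E n τ J A K) : n / τ ≤ n := Nat.div_le_self _ _

theorem Setup.J_le_m (S : Setup E n τ J A K) : J ≤ n / τ := by
  have h1 := S.J_le
  have h2 := S.m_pos
  cases J with
  | zero => omega
  | succ J =>
    have := Nat.lt_two_pow_self (n := J)
    rw [pow_succ] at h1
    omega

theorem Setup.word_mul (S : Setup E n τ J A K) : 4096 * ((n + 1) * (n + 1)) ≤ E.W := by
  have h1 := S.word
  have h2 : (n + 1) * (n + 1) * 2 ≤ (n + 1) * ((n + 1) * (A + 2)) := by
    rw [← mul_assoc]; exact Nat.mul_le_mul_left _ (by omega)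
  omega

theorem Setup.word_lin (S : Setup E n τ J A K) : 2048 * (n + 1) + 2048 ≤ E.W := by
  have h1 := S.word_mul
  have h2 := S.pos
  have h3 := S.le
  nlinarith

theorem Setup.word_id (S : Setup E n τ J A K) : 64 * ((n + 1) * (A + 2)) ≤ E.W := by
  have h1 := S.word
  have h2 : (n + 1) * (A + 2) ≤ (n + 1) * ((n + 1) * (A + 2)) := Nat.le_mul_of_pos_left _ (by omega)
  omega

theorem Setup.f_le (S : Setup E n τ J A K) (x : ℕ) : E.f x ≤ A := by
  unfold Env.f
  rw [List.getD_eq_getElem?_getD]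
  cases h : E.T[x]? with
  | none => simp
  | some y => simpa using S.sym_le y (List.mem_of_getElem? h)

theorem mlen_shifted {f : ℕ → ℕ} {n a b : ℕ} (L : ℕ) (ha : n + 1 ≤ a) (hb : n + 1 ≤ b) :
    mlen (shifted f n) a b L = mlen f (a - (n + 1)) (b - (n + 1)) L := by
  induction L generalizing a b with
  | zero => rfl
  | succ L ih =>
    simp only [mlen, shifted]
    rw [ih (by omega) (by omega), Nat.sub_add_comm ha, Nat.sub_add_comm hb]
    congr 1

/-- Offset at most `n` and symbol at most `A + 1`. Together with `Setup.le_K` this bounds the bits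
of an identifier by `K`, and hence the number of rounds that determine a seed. -/
theorem pid_lt (S : Setup E n τ J A K) {l x0 x1 x : ℕ} (h1 : x ≤ x1 + n) :
    pid (shifted E.f n) (n + 1) l x0 x1 x < 2 * ((n + 1) * (A + 2)) := by
  simp only [pid]
  set d := if x1 ≤ x0 + l then mlen (shifted E.f n) x0 x1 (min (x1 - x0) (x - x1)) else 0 with hd
  have hdn : d ≤ n := by
    rw [hd]; split_ifs
    · have := mlen_le (shifted E.f n) x0 x1 (min (x1 - x0) (x - x1)); omega
    · omega
  have hs : sym (shifted E.f n) x1 x d ≤ A + 1 := by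
    unfold sym shifted
    split_ifs
    · omega
    · have := S.f_le (x1 + d - (n + 1)); omega
  have := Nat.mul_le_mul_left (n + 1) hs
  have e : (n + 1) * (A + 2) = (n + 1) * (A + 1) + (n + 1) := by ring
  omega

/-- The first part of `idCode`: offset of the first difference -/
def idDiffCode : Stmt :=
  .d ≔ 0 ;;
  .ite (.lt ♯.p1 (♯.p0 + ♯.ell + 1))
    (.pa ≔ ♯.p0 - ♯.o ;; .pb ≔ ♯.p1 - ♯.o ;;
      .ite (.lt (♯.p2 - ♯.p1) (♯.p1 - ♯.p0)) (.lim ≔ ♯.p2 - ♯.p1) (.lim ≔ ♯.p1 - ♯.p0) ;;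
      lcpCode)
    (.d ≔ 0)

/-- `pid := ` identifier of the phrase `[p1, p2)` with left neighbour `[p0, p1)` -/
def idCode : Stmt :=
  idDiffCode ;;
  .ite (.eq ♯.d (♯.p2 - ♯.p1)) (.s ≔ 0) (.s ≔ .inp (♯.p1 - ♯.o + ♯.d) + 1) ;;
  .pid ≔ 2 * (♯.d + ♯.o * ♯.s) + 1

theorem wp_idDiffCode (S : Setup E n τ J A K) {σ : St} {l x0 x1 x : ℕ} (h0 : σ.v .p0 = x0)
    (h1 : σ.v .p1 = x1) (h2 : σ.v .p2 = x) (hl : σ.v .ell = l) (ho : σ.v .o = n + 1)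
    (hln : l ≤ n) (h12 : x1 < x) (hx : x ≤ 2 * n + 1) (hox : n + 1 ≤ x1) (hx0 : x0 ≤ x1)
    (hact : x1 ≤ x0 + l → n + 1 ≤ x0) (hxl : x ≤ x1 + l)
    {Q : St → Prop} (hq : ∀ σ', Frame [.d, .lim, .pa, .pb] [] σ σ' →
      σ'.v .d = (if x1 ≤ x0 + l then mlen (shifted E.f n) x0 x1 (min (x1 - x0) (x - x1)) else 0) →
      σ'.clk ≤ σ.clk + l → Q σ') :
    wp E idDiffCode Q σ := by
  have hW := S.word_lin
  simp only [idDiffCode]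
  rw [wp_seq, wp_assign]
  simp [h0, h1, h2, hl, ho]
  and_intros <;> try omega
  · intro h
    have hox0 := hact (by omega)
    have hlim : ∀ k, k = min (x1 - x0) (x - x1) → wp E lcpCode Q
        (St.set (St.set (St.set (St.set σ .d 0) .pa (x0 - (n + 1))) .pb (x1 - (n + 1))) .lim k) := by
      intro k hk
      refine wp_lcpCode (a := x0 - (n + 1)) (b := x1 - (n + 1)) (L := k) (by simp) (by simp) (by simp)
        (by rw [S.len]; omega) (by rw [S.len]; omega) (by rw [S.len]; omega) fun σ' hf hd hc => ?_
      refine hq σ' ⟨fun y hy => ?_, fun y hy => ?_⟩ ?_ ?_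
      · simp at hy; simp [hy, hf.v]
      · simp [hf.a]
      · rw [hd, if_pos (by omega), mlen_shifted _ hox0 hox, hk]
      · simp at hc; omega
    and_intros <;> try omega
    · intro h'; exact ⟨by omega, hlim _ (by omega)⟩
    · intro h'; exact ⟨by omega, hlim _ (by omega)⟩
  · intro h
    refine ⟨by omega, hq _ ⟨fun y hy => by simp at hy; simp [hy], fun y hy => by simp⟩
      (by rw [if_neg (by omega)]; simp) (by simp)⟩

theorem wp_idCode (S : Setup E n τ J A K) {σ : St} {l x0 x1 x : ℕ} (h0 : σ.v .p0 = x0)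
    (h1 : σ.v .p1 = x1) (h2 : σ.v .p2 = x) (hl : σ.v .ell = l) (ho : σ.v .o = n + 1)
    (hln : l ≤ n) (h12 : x1 < x) (hx : x ≤ 2 * n + 1) (hox : n + 1 ≤ x1) (hx0 : x0 ≤ x1)
    (hact : x1 ≤ x0 + l → n + 1 ≤ x0) (hxl : x ≤ x1 + l)
    {Q : St → Prop} (hq : ∀ σ', Frame [.d, .lim, .pa, .pb, .s, .pid] [] σ σ' →
      σ'.v .pid = pid (shifted E.f n) (n + 1) l x0 x1 x → σ'.clk ≤ σ.clk + l → Q σ') :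
    wp E idCode Q σ := by
  have hW := S.word_lin
  have hW2 := S.word_id
  have hpl := pid_lt S (l := l) (x0 := x0) (x1 := x1) (x := x) (by omega)
  have main : ∀ σ₁ : St, Frame [.d, .lim, .pa, .pb] [] σ σ₁ →
      σ₁.v .d = (if x1 ≤ x0 + l then mlen (shifted E.f n) x0 x1 (min (x1 - x0) (x - x1)) else 0) →
      σ₁.clk ≤ σ.clk + l → wp E (.ite (.eq ♯.d (♯.p2 - ♯.p1)) (.s ≔ 0) (.s ≔ .inp (♯.p1 - ♯.o + ♯.d) + 1) ;;
        .pid ≔ 2 * (♯.d + ♯.o * ♯.s) + 1) Q σ₁ := by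
    intro σ₁ hf hd hc
    have e1 : σ₁.v .p1 = x1 := by simp [hf.v, h1]
    have e2 : σ₁.v .p2 = x := by simp [hf.v, h2]
    have e3 : σ₁.v .o = n + 1 := by simp [hf.v, ho]
    have hdle : σ₁.v .d ≤ x - x1 := by
      rw [hd]; split_ifs
      · have := mlen_le (shifted E.f n) x0 x1 (min (x1 - x0) (x - x1)); omega
      · omega
    have hfin : ∀ k, k = sym (shifted E.f n) x1 x (σ₁.v .d) →
        pid (shifted E.f n) (n + 1) l x0 x1 x = 2 * (σ₁.v .d + (n + 1) * k) + 1 := by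
      rintro k rfl
      simp only [pid]; rw [hd]
    have hfr : ∀ k k', Frame [.d, .lim, .pa, .pb, .s, .pid] [] σ ((σ₁.set .s k).set .pid k') :=
      fun k k' => ⟨fun y hy => by simp at hy; simp [hy, hf.v], fun y hy => by simp [hf.a]⟩
    simp only [wp_seq, wp_ite, wp_assign]
    simp [e1, e2, e3]
    and_intros <;> [omega; intro h; intro h]
    · have hk := hfin 0 (by simp [sym, h])
      simp at hk
      and_intros <;> try omega
      exact hq _ (hfr _ _) (by simp [hk]) (by simpa using hc)
    · have hfl := S.f_le (x1 - (n + 1) + σ₁.v .d)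
      have hA : A + 2 ≤ (n + 1) * (A + 2) := Nat.le_mul_of_pos_left _ (by omega)
      have hk := hfin (E.f (x1 - (n + 1) + σ₁.v .d) + 1) (by
        simp only [sym, h, if_false, shifted]
        congr 2; omega)
      have hlen := S.len
      and_intros <;> try omega
      exact hq _ (hfr _ _) (by simp [hk]) (by simpa using hc)
  simp only [idCode]
  rw [wp_seq]
  exact wp_idDiffCode S h0 h1 h2 hl ho hln h12 hx hox hx0 hact hxl main

theorem dot_le (r u : ℕ) : dot r u ≤ r := by
  induction r using Nat.strong_induction_on generalizing u with
  | _ r ih =>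
    rcases Nat.eq_zero_or_pos r with rfl | h
    · simp [dot_zero]
    · rw [dot_rec]
      have := ih (r / 2) (by omega) (u / 2)
      have : r % 2 * (u % 2) ≤ r % 2 * 1 := Nat.mul_le_mul_left _ (by omega)
      omega

/-- `dot := dot dotr dotu` -/
def dotCode : Stmt :=
  .dot ≔ 0 ;;
  .while (.lt 0 ♯.dotr)
    (.dot ≔ ♯.dot + ♯.dotr % 2 * (♯.dotu % 2) ;; .dotr ≔ ♯.dotr / 2 ;; .dotu ≔ ♯.dotu / 2)

theorem wp_dotCode {σ : St} {r u k : ℕ} (hr : σ.v .dotr = r) (hu : σ.v .dotu = u) (hk : r < 2 ^ k)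
    (hrW : r < E.W) (huW : u < E.W) (hW : 2 < E.W) {Q : St → Prop}
    (hq : ∀ σ', Frame [.dot, .dotr, .dotu] [] σ σ' → σ'.v .dot = dot r u → σ'.clk ≤ σ.clk + k →
      Q σ') : wp E dotCode Q σ := by
  simp only [dotCode, wp_seq]
  rw [wp_assign]
  refine ⟨by simp; omega, by simp; omega, ?_⟩
  refine wp_while (fun σ' => σ'.v .dot + dot (σ'.v .dotr) (σ'.v .dotu) = dot r u ∧
      σ'.v .dotr ≤ r ∧ σ'.v .dotu ≤ u)
    (fun σ' => Nat.size (σ'.v .dotr)) 1 ?_ ?_ ?_ ?_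
  · simp [hr, hu]
  · intro _ _ _; simp; omega
  · rintro σ' hf ⟨h1, h2, h3⟩ hc
    simp at hc
    have hle := dot_le r u
    have hrec := dot_rec (σ'.v .dotr) (σ'.v .dotu)
    have hm : σ'.v .dotr % 2 * (σ'.v .dotu % 2) ≤ 1 * 1 := Nat.mul_le_mul (by omega) (by omega)
    simp
    and_intros <;> try omega
    have := Nat.lt_size_self (σ'.v .dotr)
    have hs : 1 ≤ (σ'.v .dotr).size := Nat.size_pos.mpr hc
    obtain ⟨s, hs⟩ := Nat.exists_eq_add_of_le hs
    rw [hs, add_comm, Nat.lt_succ_iff, Nat.size_le]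
    rw [hs, pow_add] at this
    omega
  · rintro σ' hf ⟨h1, h2, h3⟩ hc hclk
    simp at hc hclk
    refine hq σ' ⟨fun x hx => ?_, fun x hx => ?_⟩ ?_ ?_
    · simp at hx
      rw [hf.v x (by simp [hx])]; simp [hx]
    · rw [hf.a x (by simp)]; simp
    · rw [hc, dot_zero] at h1; omega
    · have : r.size ≤ k := Nat.size_le.mpr hk
      rw [hr] at hclk; omega

/-- `keep := 0` if the phrases `[x1, x)` and `[x, z)` commute -/
def commCode : Stmt :=
  .pa ≔ ♯.x1 - ♯.o ;; .pb ≔ ♯.x - ♯.o ;; .lim ≔ ♯.z - ♯.x ;; lcpCode ;;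
  .ite (.eq ♯.d (♯.z - ♯.x))
    (.pb ≔ ♯.x1 - ♯.o + (♯.z - ♯.x) ;; .lim ≔ ♯.x - ♯.x1 ;; lcpCode ;;
      .ite (.eq ♯.d (♯.x - ♯.x1)) (.keep ≔ 0) (.keep ≔ 1))
    (.keep ≔ 1)

/-- Since uv lies in the text, uv = vu says that uv begins with v and continues with u. These are
two comparisons of substrings of the text, so commutation can be tested without copying words. -/
theorem seg_comm_iff {F : ℕ → ℕ} {a b c : ℕ} (hab : a ≤ b) (hbc : b ≤ c) :
    seg F a b ++ seg F b c = seg F b c ++ seg F a b ↔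
      (∀ t < c - b, F (a + t) = F (b + t)) ∧ ∀ t < b - a, F (a + t) = F (a + (c - b) + t) := by
  rw [seg_append F hab hbc]
  constructor
  · intro h
    have key : ∀ t, t < c - a → F (a + t) = (seg F b c ++ seg F a b).getD t 0 := by
      intro t ht
      rw [← h, List.getD_eq_getElem _ _ (by rw [seg_length]; exact ht), seg_getElem]
    constructor
    · intro t ht
      rw [key t (by omega), List.getD_append _ _ _ _ (by rw [seg_length]; exact ht),
        List.getD_eq_getElem _ _ (by rw [seg_length]; exact ht), seg_getElem]
    · intro t ht
      have := key (c - b + t) (by omega)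
      rw [List.getD_append_right _ _ _ _ (by rw [seg_length]; omega), seg_length,
        Nat.add_sub_cancel_left, List.getD_eq_getElem _ _ (by rw [seg_length]; exact ht),
        seg_getElem] at this
      rw [← this, add_assoc]
  · rintro ⟨h1, h2⟩
    apply List.ext_getElem
    · simp only [List.length_append, seg_length]; omega
    · intro t ht ht'
      rw [seg_length] at ht
      rw [seg_getElem, List.getElem_append]
      split_ifs with h
      · rw [seg_length] at h
        rw [seg_getElem]; exact h1 t h
      · rw [seg_length] at h
        rw [seg_getElem, seg_length, h2 (t - (c - b)) (by omega)]
        congr 1; omega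

theorem wp_commCode (S : Setup E n τ J A K) {σ : St} {x1 x z l : ℕ} (h1 : σ.v .x1 = x1)
    (h2 : σ.v .x = x) (h3 : σ.v .z = z) (ho : σ.v .o = n + 1)
    (h12 : x1 < x) (h23 : x < z) (hz : z ≤ 2 * n + 1) (hox : n + 1 ≤ x1) (hl1 : x ≤ x1 + l)
    (hl2 : z ≤ x + l)
    {Q : St → Prop} (hq : ∀ σ', Frame [.d, .lim, .pa, .pb, .keep] [] σ σ' →
      (σ'.v .keep = 0 ↔ seg (shifted E.f n) x1 x ++ seg (shifted E.f n) x z =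
        seg (shifted E.f n) x z ++ seg (shifted E.f n) x1 x) → σ'.clk ≤ σ.clk + 2 * l → Q σ') :
    wp E commCode Q σ := by
  have hW := S.word_lin
  have hsh : ∀ y, n + 1 ≤ y → shifted E.f n y = E.f (y - (n + 1)) := fun y _ => rfl
  have hseg : (seg (shifted E.f n) x1 x ++ seg (shifted E.f n) x z =
        seg (shifted E.f n) x z ++ seg (shifted E.f n) x1 x) ↔
      mlen E.f (x1 - (n + 1)) (x - (n + 1)) (z - x) = z - x ∧
      mlen E.f (x1 - (n + 1)) (x1 - (n + 1) + (z - x)) (x - x1) = x - x1 := by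
    rw [seg_comm_iff h12.le h23.le, mlen_eq_iff, mlen_eq_iff]
    simp only [shifted]
    refine and_congr (forall₂_congr fun t ht => ?_) (forall₂_congr fun t ht => ?_)
    · rw [Nat.sub_add_comm hox, Nat.sub_add_comm (show n + 1 ≤ x by omega)]
    · rw [Nat.sub_add_comm hox, show x1 + (z - x) + t - (n + 1) = x1 - (n + 1) + (z - x) + t by omega]
  simp only [commCode, wp_seq, wp_assign]
  simp [h1, h2, h3, ho]
  and_intros <;> try omega
  refine wp_lcpCode (a := x1 - (n + 1)) (b := x - (n + 1)) (L := z - x) (by simp) (by simp) (by simp)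
        (by rw [S.len]; omega) (by rw [S.len]; omega) (by rw [S.len]; omega) fun σ₁ hf hd hc => ?_
  have e1 : σ₁.v .x1 = x1 := by simp [hf.v, h1]
  have e2 : σ₁.v .x = x := by simp [hf.v, h2]
  have e3 : σ₁.v .o = n + 1 := by simp [hf.v, ho]
  have e4 : σ₁.v .z = z := by simp [hf.v, h3]
  have e5 : σ₁.v .pa = x1 - (n + 1) := by simp [hf.v]
  simp at hc
  simp [e1, e2, e3, e4, hd]
  refine ⟨by omega, fun h => ?_, fun h => ?_⟩
  · and_intros <;> try omega
    refine wp_lcpCode (a := x1 - (n + 1)) (b := x1 - (n + 1) + (z - x)) (L := x - x1) (by simp [e5])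
        (by simp) (by simp)
        (by rw [S.len]; omega) (by rw [S.len]; omega) (by rw [S.len]; omega) fun σ₂ hf2 hd2 hc2 => ?_
    have e1 : σ₂.v .x1 = x1 := by simp [hf2.v, e1]
    have e2 : σ₂.v .x = x := by simp [hf2.v, e2]
    simp at hc2
    simp [e1, e2, hd2]
    refine ⟨by omega, fun h' => ?_, fun h' => ?_⟩
    · refine ⟨by omega, hq _ ⟨fun y hy => ?_, fun y hy => ?_⟩ ?_ ?_⟩
      · simp at hy; simp [hy, hf2.v, hf.v]
      · simp [hf2.a, hf.a]
      · simp [hseg, h, h']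
      · simp; omega
    · refine ⟨by omega, hq _ ⟨fun y hy => ?_, fun y hy => ?_⟩ ?_ ?_⟩
      · simp at hy; simp [hy, hf2.v, hf.v]
      · simp [hf2.a, hf.a]
      · simp [hseg, h, h']
      · simp; omega
  · refine ⟨by omega, hq _ ⟨fun y hy => ?_, fun y hy => ?_⟩ ?_ ?_⟩
    · simp at hy; simp [hy, hf.v]
    · simp [hf.a]
    · simp [hseg, h]
    · simp; omega

/-- `ell := ` threshold at level `q` -/
def ellCode : Stmt := .ell ≔ .op .shr ♯.tau (♯.J - ♯.q / 6)

/-- Identifiers and labels for the seed in `r` of the two phrases at `x`: `idu`, `idw`, `la`, `lb` -/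
def labelCode : Stmt :=
  .p0 ≔ ♯.x0 ;; .p1 ≔ ♯.x1 ;; .p2 ≔ ♯.x ;; idCode ;; .idu ≔ ♯.pid ;;
  .p0 ≔ ♯.x1 ;; .p1 ≔ ♯.x ;; .p2 ≔ ♯.z ;; idCode ;; .idw ≔ ♯.pid ;;
  .dotr ≔ ♯.r ;; .dotu ≔ ♯.idu ;; dotCode ;; .la ≔ ♯.dot % 2 ;;
  .dotr ≔ ♯.r ;; .dotu ≔ ♯.idw ;; dotCode ;; .lb ≔ ♯.dot % 2

def labelVars : List Var := [.p0, .p1, .p2, .d, .lim, .pa, .pb, .s, .pid, .idu, .idw, .dotr, .dotu,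
  .dot, .la, .lb]

theorem wp_labelCode (S : Setup E n τ J A K) {σ : St} {l x0 x1 x z r : ℕ} (h0 : σ.v .x0 = x0)
    (h1 : σ.v .x1 = x1) (h2 : σ.v .x = x) (h3 : σ.v .z = z) (hl : σ.v .ell = l) (ho : σ.v .o = n + 1)
    (hr : σ.v .r = r) (hrK : r < 2 ^ (K + 1))
    (hln : l ≤ n) (h01 : x0 ≤ x1) (h12 : x1 < x) (h23 : x < z) (hz : z ≤ 2 * n + 1)
    (hox : n + 1 ≤ x1) (hl1 : x ≤ x1 + l) (hl2 : z ≤ x + l) (hact : x1 ≤ x0 + l → n + 1 ≤ x0)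
    {Q : St → Prop} (hq : ∀ σ', Frame labelVars [] σ σ' →
      σ'.v .idu = pid (shifted E.f n) (n + 1) l x0 x1 x →
      σ'.v .idw = pid (shifted E.f n) (n + 1) l x1 x z →
      σ'.v .la = dot r (pid (shifted E.f n) (n + 1) l x0 x1 x) % 2 →
      σ'.v .lb = dot r (pid (shifted E.f n) (n + 1) l x1 x z) % 2 →
      σ'.clk ≤ σ.clk + (2 * l + 2 * (K + 1)) → Q σ') :
    wp E labelCode Q σ := by
  have hW := S.word_lin
  have hW2 := S.word_id
  have hK := S.K_le
  have hp1 := pid_lt S (l := l) (x0 := x0) (x1 := x1) (x := x) (by omega)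
  have hp2 := pid_lt S (l := l) (x0 := x1) (x1 := x) (x := z) (by omega)
  set u := pid (shifted E.f n) (n + 1) l x0 x1 x
  set w := pid (shifted E.f n) (n + 1) l x1 x z
  have hrW : r < E.W := by rw [pow_succ] at hrK; omega
  simp only [labelCode, wp_seq, wp_assign]
  simp [h0, h1, h2]
  and_intros <;> try omega
  refine wp_idCode S (x0 := x0) (x1 := x1) (x := x) (l := l) (by simp) (by simp) (by simp) (by simp [hl])
    (by simp [ho]) hln h12 (by omega) hox h01 hact hl1 fun σ₁ f1 v1 c1 => ?_
  have a1 : σ₁.v .x1 = x1 := by simp [f1.v, h1]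
  have a2 : σ₁.v .x = x := by simp [f1.v, h2]
  have a3 : σ₁.v .z = z := by simp [f1.v, h3]
  simp at c1
  simp [v1, a1, a2, a3]
  and_intros <;> try omega
  refine wp_idCode S (x0 := x1) (x1 := x) (x := z) (l := l) (by simp) (by simp) (by simp)
    (by simp [f1.v, hl]) (by simp [f1.v, ho]) hln h23 (by omega) (by omega) (by omega)
    (fun _ => hox) hl2 fun σ₂ f2 v2 c2 => ?_
  have b1 : σ₂.v .r = r := by simp [f2.v, f1.v, hr]
  have b2 : σ₂.v .idu = u := by simp [f2.v, u]
  simp at c2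
  simp [v2, b1, b2]
  and_intros <;> try omega
  refine wp_dotCode (r := r) (u := u) (k := K + 1) (by simp) (by simp) hrK hrW (by omega) (by omega)
    fun σ₃ f3 v3 c3 => ?_
  have d1 : σ₃.v .r = r := by simp [f3.v, b1]
  have d2 : σ₃.v .idw = w := by simp [f3.v, w]
  simp at c3
  simp [v3, d1, d2]
  and_intros <;> try omega
  refine wp_dotCode (r := r) (u := w) (k := K + 1) (by simp) (by simp) hrK hrW (by omega) (by omega)
    fun σ₄ f4 v4 c4 => ?_
  simp at c4
  simp [v4]
  and_intros <;> try omega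
  refine hq _ ⟨fun y hy => ?_, fun y hy => ?_⟩ ?_ ?_ ?_ ?_ ?_
  · simp [labelVars] at hy; simp [hy, f4.v, f3.v, f2.v, f1.v]
  · simp [f4.a, f3.a, f2.a, f1.a]
  · simp [f4.v, f3.v, b2, u]
  · simp [f4.v, d2, w]
  · simp [f4.v, u]
  · simp [w]
  · simp; omega

end

end LCE

namespace LCE

/-! ### Windows of consecutive boundaries and their passage through the levels -/

section
variable {E : Env} {n τ J A K : ℕ}

/-- Properties of four consecutive boundaries. -/
structure WinOK (n x0 x1 x z : ℕ) : Prop where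
  le0 : x0 ≤ x1
  le1 : x1 ≤ x
  lt : x < z
  act : x ≤ x1 + n → z ≤ x + n → n + 1 ≤ x1 ∧ x1 < x ∧ z ≤ 2 * n + 1
  left : n + 1 ≤ x1 → x1 ≤ x0 + n → n + 1 ≤ x0

theorem pre_le (B : Set ℕ) (x : ℕ) : pre B x ≤ x := by
  rcases Nat.eq_zero_or_pos x with rfl | h
  · rw [pre_zero]
  · exact (pre_lt B h).le

/-- The zero padding is harmless: a short phrase forces its ends to be genuine boundaries inside the
text, so the program reads the text only at valid positions. -/
theorem winOK_of_mem {B : Set ℕ} (ha : Adm (n + 1) n B) {z : ℕ} (hz : z ∈ B) :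
    WinOK n (pre B (pre B (pre B z))) (pre B (pre B z)) (pre B z) z := by
  have hz' := ha.le z hz
  have hge : ∀ y, pre B y ≠ 0 → n + 1 ≤ pre B y := fun y hy => ha.le _ (pre_mem hy)
  refine ⟨pre_le _ _, pre_le _ _, pre_lt _ (by omega), fun h1 h2 => ?_, fun h1 h2 => ?_⟩
  · have hx : pre B z ≠ 0 := by omega
    have := hge _ hx
    have hx1 : pre B (pre B z) ≠ 0 := by omega
    have := ha.real _ (pre_mem hx) z hz (pre_lt _ (by omega)) h2
    exact ⟨hge _ hx1, pre_lt _ (by omega), by omega⟩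
  · exact hge _ (by omega)

/-- `keep := 0` if the boundary `x` with neighbours `x0`, `x1`, `z` is removed at level `q` -/
def decideCode : Stmt :=
  ellCode ;;
  .ite (.lt ♯.x (♯.x1 + ♯.ell + 1))
    (.ite (.lt ♯.z (♯.x + ♯.ell + 1))
      (.ite (.eq (♯.q % 2) 0) commCode
        (.r ≔ .arr .seed ♯.q ;; labelCode ;; .ite (.lt ♯.la ♯.lb) (.keep ≔ 0) (.keep ≔ 1)))
      (.keep ≔ 1))
    (.keep ≔ 1)

def decideVars : List Var := [.p0, .p1, .p2, .d, .lim, .pa, .pb, .s, .pid, .idu, .idw, .dotr, .dotu,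
  .dot, .la, .lb, .keep, .ell, .r]

theorem wp_decideCode (S : Setup E n τ J A K) {σ : St} (hC : Ctx n τ J σ) {x0 x1 x z q r : ℕ}
    (h0 : σ.v .x0 = x0) (h1 : σ.v .x1 = x1) (h2 : σ.v .x = x) (h3 : σ.v .z = z) (hq : σ.v .q = q)
    (hr : σ.a .seed q = r) (hrK : r < 2 ^ (K + 1)) (hqZ : q < E.Z) (hqW : q < E.W)
    (hw : WinOK n x0 x1 x z) (hzW : z + n + 2 ≤ E.W)
    {Q : St → Prop} (hQ : ∀ σ', Frame decideVars [] σ σ' →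
      (σ'.v .keep = 0 ↔ rule (shifted E.f n) (n + 1) (ell τ J q) q r x0 x1 x z) →
      σ'.clk ≤ σ.clk + (2 * τ + 2 * (K + 1)) → Q σ') : wp E decideCode Q σ := by
  have hW := S.word_lin
  have hW2 := S.word_id
  have hK := S.K_le
  have hle := S.le
  have hJm := S.J_le_m
  have hmn := S.m_le
  have hell := ell_le τ J q
  obtain ⟨g1, g2, g3, g4, g5⟩ := hw
  simp only [decideCode, ellCode]
  rw [wp_seq, wp_assign]
  have hev : (Expr.op .shr ♯.tau (♯.J - ♯.q / 6)).eval E σ = ell τ J q := by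
    simp [hC.tau, hC.J, hq, ell]
  refine ⟨?_, by rw [hev]; omega, ?_⟩
  · have := Nat.div_le_self q 6
    simp [hC.tau, hC.J, hq]
    have h' : τ / 2 ^ (J - q / 6) ≤ τ := hell
    omega
  rw [hev]
  set l := ell τ J q with hl
  have hrule : rule (shifted E.f n) (n + 1) l q r x0 x1 x z ↔ x ≤ x1 + l ∧ z ≤ x + l ∧
      if q % 2 = 0 then seg (shifted E.f n) x1 x ++ seg (shifted E.f n) x z =
        seg (shifted E.f n) x z ++ seg (shifted E.f n) x1 x
      else dot r (pid (shifted E.f n) (n + 1) l x0 x1 x) % 2 <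
        dot r (pid (shifted E.f n) (n + 1) l x1 x z) % 2 := Iff.rfl
  rw [hrule] at hQ
  have hfr : Frame decideVars [] σ (σ.set .ell l) := Frame.set _ _ _ (by decide)
  have keep1 : ¬ (x ≤ x1 + l ∧ z ≤ x + l) → Q ((σ.set .ell l).set .keep 1) := fun h =>
    hQ _ (hfr.trans (Frame.set _ _ _ (by decide)))
      (by simp only [St.set_v, if_true]; tauto) (by simp)
  rw [wp_ite]
  refine ⟨by simp [h1]; omega, fun c1 => ?_, fun c1 => ?_⟩
  · simp [h2, h1] at c1
    rw [wp_ite]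
    refine ⟨by simp [h2]; omega, fun c2 => ?_, fun c2 => ?_⟩
    · simp [h2, h3] at c2
      obtain ⟨a1, a2, a3⟩ := g4 (by omega) (by omega)
      rw [wp_ite]
      refine ⟨by simp [hq]; omega, fun c3 => ?_, fun c3 => ?_⟩
      · simp [hq] at c3
        refine wp_commCode S (x1 := x1) (x := x) (z := z) (l := l) (by simp [h1]) (by simp [h2])
          (by simp [h3]) (by simp [hC.o]) a2 g3 a3 a1 (by omega) (by omega) fun σ' hf hk hc => ?_
        refine hQ σ' (hfr.trans (hf.mono (by decide) (by simp))) ?_ ?_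
        · rw [hk, if_pos c3]
          exact ⟨fun h => ⟨by omega, by omega, h⟩, fun h => h.2.2⟩
        · simp at hc; omega
      · simp [hq] at c3
        have hrW : r < E.W := by rw [pow_succ] at hrK; omega
        rw [wp_seq, wp_assign, wp_seq]
        simp only [Expr.eval_arr, Expr.eval_var, St.set_v, Expr.ok_arr, Expr.ok_var, St.set_a]
        simp only [reduceCtorEq, if_false, hq, hr]
        refine ⟨⟨trivial, hqZ⟩, hrW, ?_⟩
        refine wp_labelCode S (x0 := x0) (x1 := x1) (x := x) (z := z) (l := l) (r := r) (by simp [h0])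
          (by simp [h1]) (by simp [h2]) (by simp [h3]) (by simp) (by simp [hC.o]) (by simp) hrK
          (by omega) g1 a2 g3 a3 a1 (by omega) (by omega) (fun h => g5 a1 (by omega))
          fun σ' hf _ _ hla hlb hc => ?_
        have hfr' : ∀ k, Frame decideVars [] σ (σ'.set .keep k) := fun k =>
          ((hfr.trans (Frame.set _ _ _ (by decide))).trans (hf.mono (by decide) (by simp))).trans
            (Frame.set _ _ _ (by decide))
        simp at hc
        simp only [wp_ite, wp_assign]
        simp [hla, hlb]
        refine ⟨fun h => ⟨by omega, hQ _ (hfr' _) ?_ (by simp; omega)⟩,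
          fun h => ⟨by omega, hQ _ (hfr' _) ?_ (by simp; omega)⟩⟩
        · simp [c3, h]; omega
        · simp [c3]; omega
    · simp [h2, h3] at c2
      simp only [wp_assign]
      exact ⟨by simp; omega, by simp; omega, keep1 (by omega)⟩
  · simp [h2, h1] at c1
    simp only [wp_assign]
    exact ⟨by simp; omega, by simp; omega, keep1 (by omega)⟩

/-! ### Pushing one boundary through the levels -/

/-- The newest boundary determines all that the level has seen before, so the windows can be read as
left neighbours with `pre`. -/
theorem els_eq_snoc {B : Set ℕ} {M z : ℕ} {l : List ℕ} (h : els B M = l ++ [z]) :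
    z ∈ B ∧ l = els B z ∧ z < M := by
  induction M with
  | zero => simp [els_zero] at h
  | succ M ih =>
    by_cases hM : M ∈ B
    · rw [els_succ_mem hM] at h
      obtain ⟨h1, h2⟩ := List.append_inj' h rfl
      simp at h2
      subst h2
      exact ⟨hM, h1.symm, by omega⟩
    · rw [els_succ_notMem hM] at h
      obtain ⟨h1, h2, h3⟩ := ih h
      exact ⟨h1, h2, by omega⟩

theorem stream_els_le {f : ℕ → ℕ} {ρ : ℕ → ℕ} (hτ : 1 ≤ τ) (hn : τ ≤ n) (M q : ℕ) :
    ∃ M' ≤ M, stream f n τ J ρ (els (base f n τ) M) q = els (lvl f n τ J ρ q) M' := by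
  induction q with
  | zero => exact ⟨_, le_rfl, rfl⟩
  | succ q ih =>
    obtain ⟨M', hM, hs⟩ := ih
    have ha := lvl_adm (f := f) (J := J) (ρ := ρ) hτ hn q
    refine ⟨pre (lvl f n τ J ρ q) M', (pre_le _ _).trans hM, ?_⟩
    simp only [stream]
    rw [hs, emit_els _ _ _ _ _ fun h => by have := ha.le 0 h; omega]
    rfl

/-- Pushes the boundary `z` through the levels below `tgt`; the action `act` is applied to a boundary
that arrives at level `tgt`. -/
def pushCode (act : Stmt) : Stmt :=
  .q ≔ 0 ;;
  .while (.lt ♯.q ♯.tgt)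
    (.x0 ≔ .arr .W0 ♯.q ;; .x1 ≔ .arr .W1 ♯.q ;; .x ≔ .arr .W2 ♯.q ;;
      .store .W0 ♯.q ♯.x1 ;; .store .W1 ♯.q ♯.x ;; .store .W2 ♯.q ♯.z ;; decideCode ;;
      .ite (.eq ♯.keep 0) (.q ≔ ♯.tgt + 1)
        (.ite (.eq ♯.x 0) (.q ≔ ♯.tgt + 1) (.z ≔ ♯.x ;; .q ≔ ♯.q + 1))) ;;
  .ite (.eq ♯.q ♯.tgt) act (.flag ≔ 0)

/-- Variables that the pipeline changes. -/
def pipeVars : List Var := [.y, .a, .flag, .z, .q, .x0, .x1, .x, .p0, .p1, .p2, .d, .lim, .pa, .pb, .s,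
  .pid, .idu, .idw, .dotr, .dotu, .dot, .la, .lb, .keep, .ell, .r]

/-- Arrays that the pipeline changes. -/
def pipeArrs : List Arr := [.last, .W0, .W1, .W2]

/-- The windows hold the last three boundaries of each level. -/
def Windows (f : ℕ → ℕ) (n τ J : ℕ) (ρ : ℕ → ℕ) (L : List ℕ) (tgt : ℕ) (σ : St) : Prop :=
  ∀ q < tgt, (σ.a .W0 q, σ.a .W1 q, σ.a .W2 q) = last3 (stream f n τ J ρ L q)

/-- `act` processes boundaries at level `tgt`, with the invariant `Inv` for the list of the boundaries
processed so far, at cost `cA` for each of them. -/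
structure Action (E : Env) (n τ J : ℕ) (ρ : ℕ → ℕ) (tgt : ℕ) (act : Stmt)
    (Inv : List ℕ → St → Prop) (cA : ℕ) : Prop where
  vars : ∀ x ∈ [Var.n, .tau, .m, .h, .o, .J, .tgt, .y], x ∉ act.vars
  arrs : ∀ b ∈ [Arr.last, .W0, .W1, .W2, .seed], b ∉ act.arrs
  frame : ∀ σ σ' L, Frame pipeVars pipeArrs σ σ' → Inv L σ → Inv L σ'
  step : ∀ σ z, Ctx n τ J σ → σ.v .tgt = tgt → (∀ q < tgt, σ.a .seed q = ρ q) →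
    z ∈ lvl E.f n τ J ρ tgt → σ.v .z = z →
    z + n + 2 ≤ E.W → Inv (els (lvl E.f n τ J ρ tgt) z) σ →
    wp E act (fun σ' => Inv (els (lvl E.f n τ J ρ tgt) z ++ [z]) σ' ∧ σ'.clk ≤ σ.clk + cA) σ

/-- Cost of pushing one boundary. -/
def pushCost (τ K tgt cA : ℕ) : ℕ := tgt * (2 * τ + 2 * (K + 1) + 1) + cA

theorem wp_pushCode (S : Setup E n τ J A K) {ρ : ℕ → ℕ} {tgt : ℕ} {act : Stmt}
    {Inv : List ℕ → St → Prop} {cA : ℕ} (hA : Action E n τ J ρ tgt act Inv cA) {σ : St}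
    (hC : Ctx n τ J σ) (htgt : σ.v .tgt = tgt) (hZ : tgt ≤ 6 * J)
    (hρ : ∀ q < tgt, σ.a .seed q = ρ q) (hρK : ∀ q < tgt, ρ q < 2 ^ (K + 1)) {z : ℕ}
    (hz : z ∈ base E.f n τ) (hσz : σ.v .z = z) (hzW : z + n + 2 ≤ E.W)
    (hwin : Windows E.f n τ J ρ (els (base E.f n τ) z) tgt σ)
    (hI : Inv (stream E.f n τ J ρ (els (base E.f n τ) z) tgt) σ) {Q : St → Prop}
    (hQ : ∀ σ', Frame (pipeVars ++ act.vars) (pipeArrs ++ act.arrs) σ σ' →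
      σ'.v .y = σ.v .y → σ'.a .last = σ.a .last →
      Windows E.f n τ J ρ (els (base E.f n τ) (z + 1)) tgt σ' →
      Inv (stream E.f n τ J ρ (els (base E.f n τ) (z + 1)) tgt) σ' →
      σ'.clk ≤ σ.clk + pushCost τ K tgt cA → Q σ') : wp E (pushCode act) Q σ := by
  classical
  have hW := S.word_lin
  have hsp := S.space
  have hle := S.le
  have hJm := S.J_le_m
  have hmn := S.m_le
  set L := els (base E.f n τ) z with hL
  set L' := els (base E.f n τ) (z + 1) with hL'
  have hLL : L' = L ++ [z] := els_succ_mem hz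
  have hgen : ∀ q zq, stream E.f n τ J ρ L' q = stream E.f n τ J ρ L q ++ [zq] →
      zq ∈ lvl E.f n τ J ρ q ∧ stream E.f n τ J ρ L q = els (lvl E.f n τ J ρ q) zq ∧ zq ≤ z := by
    intro q zq h
    obtain ⟨M', hM', hs⟩ := stream_els_le (f := E.f) (J := J) (ρ := ρ) S.pos S.le (z + 1) q
    rw [hs] at h
    obtain ⟨h1, h2, h3⟩ := els_eq_snoc h
    exact ⟨h1, h2, by omega⟩
  simp only [pushCode]
  rw [wp_seq, wp_assign, wp_seq]
  refine ⟨by simp; omega, by simp; omega, ?_⟩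
  -- Levels below `q` have already shifted their windows, the others have not. While `q ≤ tgt`, the
  -- variable `z` is the boundary that newly arrives at level `q`; the value `tgt + 1` records that
  -- some level passed nothing on, so that the streams above it are unchanged.
  refine wp_while (fun σ' => σ'.v .q ≤ tgt + 1 ∧
      (∀ k < tgt, k < σ'.v .q → (σ'.a .W0 k, σ'.a .W1 k, σ'.a .W2 k) =
        last3 (stream E.f n τ J ρ L' k)) ∧
      (∀ k < tgt, σ'.v .q ≤ k → (σ'.a .W0 k, σ'.a .W1 k, σ'.a .W2 k) =
        last3 (stream E.f n τ J ρ L k)) ∧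
      (σ'.v .q ≤ tgt → stream E.f n τ J ρ L' (σ'.v .q) =
        stream E.f n τ J ρ L (σ'.v .q) ++ [σ'.v .z]) ∧
      (σ'.v .q = tgt + 1 → stream E.f n τ J ρ L' tgt = stream E.f n τ J ρ L tgt))
    (fun σ' => tgt - σ'.v .q) (2 * τ + 2 * (K + 1) + 1) ?_ ?_ ?_ ?_
  · refine ⟨by simp, by simp, ?_, ?_, by simp⟩
    · intro k hk _; simpa using hwin k hk
    · simp [stream, hLL, hσz]
  · intro _ _ _; simp
  · rintro σ' hf ⟨h1, h2, h3, h4, h5⟩ hc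
    have et : σ'.v .tgt = tgt := by rw [hf.v _ (by decide)]; simp [htgt]
    have eC : Ctx n τ J σ' := ⟨by rw [hf.v _ (by decide)]; simp [hC.n],
      by rw [hf.v _ (by decide)]; simp [hC.tau], by rw [hf.v _ (by decide)]; simp [hC.m],
      by rw [hf.v _ (by decide)]; simp [hC.h], by rw [hf.v _ (by decide)]; simp [hC.o],
      by rw [hf.v _ (by decide)]; simp [hC.J]⟩
    have es : ∀ q < tgt, σ'.a .seed q = ρ q := by
      intro q hq; rw [hf.a _ (by decide)]; simpa using hρ q hq
    simp only [Cond.eval_lt, Expr.eval_var, et] at hc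
    set q := σ'.v .q with hqdef
    obtain ⟨m1, m2, m3⟩ := hgen q _ (h4 (by omega))
    set zq := σ'.v .z with hzq
    have hw := h3 q hc le_rfl
    rw [m2, last3_els] at hw
    simp only [Prod.mk.injEq] at hw
    obtain ⟨w0, w1, w2⟩ := hw
    have hok := winOK_of_mem (lvl_adm (f := E.f) (J := J) (ρ := ρ) S.pos S.le q) m1
    have hsucc : stream E.f n τ J ρ L' (q + 1) = stream E.f n τ J ρ L (q + 1) ++
        if (last3 (stream E.f n τ J ρ L q)).2.2 ≠ 0 ∧ ¬ rule (shifted E.f n) (n + 1) (ell τ J q) q (ρ q)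
          (last3 (stream E.f n τ J ρ L q)).1 (last3 (stream E.f n τ J ρ L q)).2.1
          (last3 (stream E.f n τ J ρ L q)).2.2 zq
        then [(last3 (stream E.f n τ J ρ L q)).2.2] else [] := by
      simp only [stream]; rw [h4 (by omega)]; exact emit_snoc _ _ _ _ _ _ _
    have hl3 : last3 (stream E.f n τ J ρ L' q) = (σ'.a .W1 q, σ'.a .W2 q, zq) := by
      rw [h4 (by omega), last3_snoc, m2, last3_els, ← w0, ← w1, ← w2]
    rw [m2, last3_els, ← w0, ← w1, ← w2] at hsucc
    rw [← w0, ← w1, ← w2] at hok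
    have o1 := hok.le0
    have o2 := hok.le1
    have o3 := hok.lt
    set x0 := σ'.a .W0 q with hx0
    set x1 := σ'.a .W1 q with hx1
    set x := σ'.a .W2 q with hx
    have stays : ∀ k, tgt ≤ q + k → stream E.f n τ J ρ L' (q + 1) = stream E.f n τ J ρ L (q + 1) →
        ∀ k' , q + 1 ≤ k' → stream E.f n τ J ρ L' k' = stream E.f n τ J ρ L k' := by
      intro _ _ h k' hk'
      induction k', hk' using Nat.le_induction with
      | base => exact h
      | succ k' _ ih => simp only [stream]; rw [ih]
    simp only [wp_seq]
    simp only [wp_assign, wp_store]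
    simp [← hqdef, ← hx0, ← hx1, ← hx, ← hzq]
    and_intros <;> try omega
    refine wp_decideCode S (x0 := x0) (x1 := x1) (x := x) (z := zq) (q := q) (r := ρ q)
      ⟨by simp [eC.n], by simp [eC.tau], by simp [eC.m], by simp [eC.h], by simp [eC.o],
        by simp [eC.J]⟩ (by simp)
      (by simp) (by simp) (by simp [hzq]) (by simp [hqdef]) (by simp [es q hc]) (hρK q hc) (by omega)
      (by omega) hok (by omega) fun σ₁ hf1 hk hcl => ?_
    have et1 : σ₁.v .tgt = tgt := by rw [hf1.v _ (by decide)]; simp [et]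
    have ex1 : σ₁.v .x = x := by rw [hf1.v _ (by decide)]; simp
    have eq1 : σ₁.v .q = q := by rw [hf1.v _ (by decide)]; simp [hqdef]
    have ew0 : ∀ k, σ₁.a .W0 k = if k = q then x1 else σ'.a .W0 k := by
      intro k; rw [hf1.a _ (by simp)]; simp
    have ew1 : ∀ k, σ₁.a .W1 k = if k = q then x else σ'.a .W1 k := by
      intro k; rw [hf1.a _ (by simp)]; simp
    have ew2 : ∀ k, σ₁.a .W2 k = if k = q then zq else σ'.a .W2 k := by
      intro k; rw [hf1.a _ (by simp)]; simp
    have hnew : ∀ k < tgt, k ≤ q → (σ₁.a .W0 k, σ₁.a .W1 k, σ₁.a .W2 k) =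
        last3 (stream E.f n τ J ρ L' k) := by
      intro k hk hkq
      rw [ew0, ew1, ew2]
      by_cases e : k = q
      · subst e; simp [hl3]
      · simp only [e, if_false]; exact h2 k hk (by omega)
    have hold : ∀ k < tgt, q + 1 ≤ k → (σ₁.a .W0 k, σ₁.a .W1 k, σ₁.a .W2 k) =
        last3 (stream E.f n τ J ρ L k) := by
      intro k hk hkq
      rw [ew0, ew1, ew2]
      simp only [show k ≠ q by omega, if_false]
      exact h3 k hk (by omega)
    have hstays : stream E.f n τ J ρ L' (q + 1) = stream E.f n τ J ρ L (q + 1) →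
        ∀ k < tgt, (σ₁.a .W0 k, σ₁.a .W1 k, σ₁.a .W2 k) = last3 (stream E.f n τ J ρ L' k) := by
      intro h k hk
      rcases Nat.lt_or_ge q k with h' | h'
      · rw [hold k hk h', stays tgt (by omega) h k h']
      · exact hnew k hk h'
    simp at hcl
    simp [et1, ex1, eq1]
    refine ⟨by omega, fun h => ?_, fun h => ⟨by omega, fun h' => ?_, fun h' => ?_⟩⟩
    · rw [if_neg (fun hh => hh.2 (hk.mp h)), List.append_nil] at hsucc
      refine ⟨by omega, by omega, ⟨fun k hk' _ => hstays hsucc k hk', fun k hk' _ => by omega,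
        stays tgt (by omega) hsucc tgt (by omega)⟩, by omega, by omega⟩
    · rw [if_neg (fun hh => hh.1 h'), List.append_nil] at hsucc
      refine ⟨by omega, by omega, ⟨fun k hk' _ => hstays hsucc k hk', fun k hk' _ => by omega,
        stays tgt (by omega) hsucc tgt (by omega)⟩, by omega, by omega⟩
    · rw [if_pos ⟨h', fun hh => h (hk.mpr hh)⟩] at hsucc
      refine ⟨by omega, by omega, by omega, ⟨by omega, fun k hk' hkq => hnew k hk' (by omega),
        fun k hk' hkq => hold k hk' (by omega), fun _ => hsucc, fun _ => by omega⟩, by omega, by omega⟩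
  · rintro σ' hf ⟨h1, h2, h3, h4, h5⟩ hc hcl
    have et : σ'.v .tgt = tgt := by rw [hf.v _ (by decide)]; simp [htgt]
    have hf' : Frame pipeVars pipeArrs σ σ' :=
      (Frame.set _ _ _ (by decide)).trans (hf.mono (by decide) (by decide))
    have hy : σ'.v .y = σ.v .y := by rw [hf.v _ (by decide)]; simp
    have hlast : σ'.a .last = σ.a .last := by rw [hf.a _ (by decide)]; simp
    have eC : Ctx n τ J σ' := hC.congr hf' (by decide)
    simp only [Cond.eval_lt, Expr.eval_var, et] at hc
    simp only [St.set_v, if_true, Expr.eval_ofNat, Nat.sub_zero, St.set_clk] at hcl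
    have hI' := hA.frame _ _ _ hf' hI
    have hwin' : Windows E.f n τ J ρ L' tgt σ' := fun k hk => h2 k hk (by omega)
    rw [wp_ite]
    refine ⟨by simp, fun h => ?_, fun h => ?_⟩
    · simp only [Cond.eval_eq, Expr.eval_var, et] at h
      have h6 := h4 (by omega)
      rw [h] at h6
      obtain ⟨m1, m2, m3⟩ := hgen tgt _ h6
      rw [m2] at hI'
      have es : ∀ q < tgt, σ'.a .seed q = ρ q := by
        intro q hq; rw [hf.a _ (by decide)]; simpa using hρ q hq
      refine (hA.step σ' _ eC et es m1 rfl (by omega) hI').frame.mono ?_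
      rintro σ₂ ⟨⟨hi, hcl2⟩, hf2⟩
      rw [← m2, ← h6] at hi
      have ar := hA.arrs
      simp only [List.mem_cons, List.not_mem_nil, or_false, forall_eq_or_imp, forall_eq] at ar
      obtain ⟨r0, r1, r2, r3, r4⟩ := ar
      refine hQ σ₂ ((hf'.mono (List.subset_append_left _ _) (List.subset_append_left _ _)).trans
        (hf2.mono (List.subset_append_right _ _) (List.subset_append_right _ _))) ?_ ?_ ?_ hi ?_
      · rw [hf2.v _ (hA.vars _ (by decide)), hy]
      · rw [hf2.a _ r0, hlast]
      · intro k hk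
        rw [hf2.a _ r1, hf2.a _ r2, hf2.a _ r3]; exact hwin' k hk
      · unfold pushCost; omega
    · simp only [Cond.eval_eq, Expr.eval_var, et] at h
      rw [wp_assign]
      refine ⟨by simp; omega, by simp; omega, hQ _
        ((hf'.trans (Frame.set _ _ _ (by decide))).mono (List.subset_append_left _ _)
          (List.subset_append_left _ _)) ?_ ?_ ?_ ?_ ?_⟩
      · simp [hy]
      · simp [hlast]
      · simpa [Windows] using hwin'
      · rw [h5 (by omega)]
        exact hA.frame σ' _ _ (Frame.set _ _ _ (by decide)) hI'
      · simp only [St.set_clk]; unfold pushCost; omega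

end

end LCE

namespace LCE

section
variable {E : Env} {n τ J A K : ℕ}

/-! ### One pass over the text -/

/-- `v` encodes the last occurrence of the block `a` before position `y`. -/
def LastOcc (f : ℕ → ℕ) (n τ a y v : ℕ) : Prop :=
  (v = 0 ∧ ∀ p < y, ¬ Occ f n τ a p) ∨
    ∃ p < y, v = p + (n + 1) ∧ Occ f n τ a p ∧ ∀ p', p < p' → p' < y → ¬ Occ f n τ a p'

theorem LastOcc.succ_mem {f : ℕ → ℕ} {a y : ℕ} (h : Occ f n τ a y) :
    LastOcc f n τ a (y + 1) (y + (n + 1)) :=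
  Or.inr ⟨y, by omega, rfl, h, by omega⟩

theorem LastOcc.succ_notMem {f : ℕ → ℕ} {a y v : ℕ} (h : LastOcc f n τ a y v)
    (h' : ¬ Occ f n τ a y) : LastOcc f n τ a (y + 1) v := by
  rcases h with ⟨h1, h2⟩ | ⟨p, h1, h2, h3, h4⟩
  · refine Or.inl ⟨h1, fun p hp => ?_⟩
    rcases Nat.lt_succ_iff_lt_or_eq.mp hp with h | rfl
    · exact h2 p h
    · exact h'
  · refine Or.inr ⟨p, by omega, h2, h3, fun p' hp hp' => ?_⟩
    rcases Nat.lt_succ_iff_lt_or_eq.mp hp' with h | rfl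
    · exact h4 p' hp h
    · exact h'

/-- An occurrence counts as last when no further one starts within distance τ/2, which is known once
the scan has passed it by τ/2 positions. Occurrences are stored with offset `n + 1`, so that the
value 0 for none can never satisfy the equation. -/
theorem LastOcc.iff {f : ℕ → ℕ} {a y v : ℕ} (h : LastOcc f n τ a (y + 1) v) (hτ : τ ≤ n) :
    v + τ / 2 = y + (n + 1) ↔ τ / 2 ≤ y ∧ Occ f n τ a (y - τ / 2) ∧
      ∀ d, 1 ≤ d → d ≤ τ / 2 → ¬ Occ f n τ a (y - τ / 2 + d) := by
  rcases h with ⟨h1, h2⟩ | ⟨p, h1, h2, h3, h4⟩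
  · refine ⟨fun h => by omega, fun h => absurd h.2.1 (h2 _ (by omega))⟩
  · constructor
    · intro h
      have e : y - τ / 2 = p := by omega
      rw [e]
      exact ⟨by omega, h3, fun d hd hd' => h4 _ (by omega) (by omega)⟩
    · rintro ⟨g1, g2, g3⟩
      have e : y - τ / 2 = p := by
        rcases lt_trichotomy (y - τ / 2) p with h | h | h
        · have := g3 (p - (y - τ / 2)) (by omega) (by omega)
          rw [show y - τ / 2 + (p - (y - τ / 2)) = p by omega] at this
          exact absurd h3 this
        · exact h
        · exact absurd g2 (h4 _ h (by omega))
      omega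

/-- `flag := 1` if the last occurrence of some block before `y + 1` starts at `y - h` -/
def scanCode : Stmt :=
  .flag ≔ 0 ;; .a ≔ 0 ;;
  .while (.lt ♯.a ♯.m)
    (.d ≔ 0 ;;
      .ite (.lt (♯.y + ♯.tau) (♯.n + 1)) (.pa ≔ ♯.a * ♯.tau ;; .pb ≔ ♯.y ;; .lim ≔ ♯.tau ;; lcpCode)
        (.d ≔ 0) ;;
      .ite (.eq ♯.d ♯.tau) (.store .last ♯.a (♯.y + ♯.o)) (.d ≔ 0) ;;
      .ite (.eq (.arr .last ♯.a + ♯.h) (♯.y + ♯.o)) (.flag ≔ 1) (.d ≔ 0) ;;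
      .a ≔ ♯.a + 1)

theorem wp_scanCode (S : Setup E n τ J A K) {σ : St} (hC : Ctx n τ J σ) {y : ℕ} (hy : σ.v .y = y)
    (hyn : y < n + τ / 2) (hlast : ∀ a < n / τ, LastOcc E.f n τ a y (σ.a .last a)) {Q : St → Prop}
    (hQ : ∀ σ', Frame [.flag, .a, .d, .lim, .pa, .pb] [.last] σ σ' →
      (∀ a < n / τ, LastOcc E.f n τ a (y + 1) (σ'.a .last a)) →
      (σ'.v .flag = 1 ↔ τ / 2 ≤ y ∧ Last E.f n τ (y - τ / 2)) →
      σ'.clk ≤ σ.clk + n / τ * (τ + 1) → Q σ') : wp E scanCode Q σ := by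
  have hW := S.word_lin
  have hsp := S.space
  have hle := S.le
  have hpos := S.pos
  have hmn := S.m_le
  have hlen := S.len
  simp only [scanCode]
  rw [wp_seq, wp_assign, wp_seq, wp_assign]
  refine ⟨by simp; omega, by simp; omega, by simp; omega, by simp; omega, ?_⟩
  refine wp_while (fun σ' => σ'.v .a ≤ n / τ ∧
      (∀ a < n / τ, a < σ'.v .a → LastOcc E.f n τ a (y + 1) (σ'.a .last a)) ∧
      (∀ a < n / τ, σ'.v .a ≤ a → LastOcc E.f n τ a y (σ'.a .last a)) ∧
      (σ'.v .flag = 1 ↔ ∃ a < σ'.v .a, σ'.a .last a + τ / 2 = y + (n + 1)))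
    (fun σ' => n / τ - σ'.v .a) (τ + 1) ?_ ?_ ?_ ?_
  · simpa using hlast
  · intro _ _ _; simp
  · rintro σ' hf ⟨h1, h2, h3, h4⟩ hc
    have em : σ'.v .m = n / τ := by rw [hf.v _ (by decide)]; simp [hC.m]
    have et : σ'.v .tau = τ := by rw [hf.v _ (by decide)]; simp [hC.tau]
    have en : σ'.v .n = n := by rw [hf.v _ (by decide)]; simp [hC.n]
    have eo : σ'.v .o = n + 1 := by rw [hf.v _ (by decide)]; simp [hC.o]
    have eh : σ'.v .h = τ / 2 := by rw [hf.v _ (by decide)]; simp [hC.h]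
    have ey : σ'.v .y = y := by rw [hf.v _ (by decide)]; simp [hy]
    simp only [Cond.eval_lt, Expr.eval_var, em] at hc
    have hup : (σ'.v .a + 1) * τ ≤ n := (Nat.mul_le_mul_right τ hc).trans (Nat.div_mul_le_self n τ)
    rw [add_mul, one_mul] at hup
    have main : ∀ σ₁, Frame [.d, .lim, .pa, .pb] [] σ'.tick σ₁ → σ₁.clk ≤ σ'.clk + 1 + τ →
        (σ₁.v .d = τ ↔ Occ E.f n τ (σ'.v .a) y) →
        wp E (.ite (.eq ♯.d ♯.tau) (.store .last ♯.a (♯.y + ♯.o)) (.d ≔ 0) ;;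
          .ite (.eq (.arr .last ♯.a + ♯.h) (♯.y + ♯.o)) (.flag ≔ 1) (.d ≔ 0) ;;
          .a ≔ ♯.a + 1) (fun σ'' => (σ''.v .a ≤ n / τ ∧
      (∀ a < n / τ, a < σ''.v .a → LastOcc E.f n τ a (y + 1) (σ''.a .last a)) ∧
      (∀ a < n / τ, σ''.v .a ≤ a → LastOcc E.f n τ a y (σ''.a .last a)) ∧
      (σ''.v .flag = 1 ↔ ∃ a < σ''.v .a, σ''.a .last a + τ / 2 = y + (n + 1))) ∧
        n / τ - σ''.v .a < n / τ - σ'.v .a ∧ σ''.clk ≤ σ'.clk + (τ + 1)) σ₁ := by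
      intro σ₁ f1 c1 d1
      have em : σ₁.v .tau = τ := by simp [f1.v, et]
      have ea : σ₁.v .a = σ'.v .a := by simp [f1.v]
      have eo : σ₁.v .o = n + 1 := by simp [f1.v, eo]
      have eh : σ₁.v .h = τ / 2 := by simp [f1.v, eh]
      have ey : σ₁.v .y = y := by simp [f1.v, ey]
      have efl : σ₁.v .flag = σ'.v .flag := by simp [f1.v]
      have el : σ₁.a .last = σ'.a .last := by simp [f1.a]
      have tail : ∀ σ₂ v, (∀ x ∈ [Var.tau, .a, .o, .h, .y, .flag], σ₂.v x = σ₁.v x) →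
          (∀ a, σ₂.a .last a = if a = σ'.v .a then v else σ'.a .last a) → σ₂.clk = σ₁.clk →
          LastOcc E.f n τ (σ'.v .a) (y + 1) v →
          wp E (.ite (.eq (.arr .last ♯.a + ♯.h) (♯.y + ♯.o)) (.flag ≔ 1) (.d ≔ 0) ;;
          .a ≔ ♯.a + 1) (fun σ'' => (σ''.v .a ≤ n / τ ∧
      (∀ a < n / τ, a < σ''.v .a → LastOcc E.f n τ a (y + 1) (σ''.a .last a)) ∧
      (∀ a < n / τ, σ''.v .a ≤ a → LastOcc E.f n τ a y (σ''.a .last a)) ∧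
      (σ''.v .flag = 1 ↔ ∃ a < σ''.v .a, σ''.a .last a + τ / 2 = y + (n + 1))) ∧
        n / τ - σ''.v .a < n / τ - σ'.v .a ∧ σ''.clk ≤ σ'.clk + (τ + 1)) σ₂ := by
        intro σ₂ v hv hl hcl hocc
        simp only [List.mem_cons, List.not_mem_nil, or_false, forall_eq_or_imp, forall_eq] at hv
        obtain ⟨v1, v2, v3, v4, v5, v6⟩ := hv
        rw [em] at v1
        rw [ea] at v2
        rw [eo] at v3
        rw [eh] at v4
        rw [ey] at v5
        rw [efl] at v6
        have hvn : v ≤ y + (n + 1) := by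
          rcases hocc with ⟨rfl, _⟩ | ⟨p, g1, g2, _⟩ <;> omega
        have q1 : ∀ a < n / τ, a ≤ σ'.v .a → LastOcc E.f n τ a (y + 1) (σ₂.a .last a) := by
          intro a ha hle
          rw [hl]
          split_ifs with e
          · subst e; exact hocc
          · exact h2 a ha (by omega)
        have q2 : ∀ a < n / τ, σ'.v .a + 1 ≤ a → LastOcc E.f n τ a y (σ₂.a .last a) := by
          intro a ha hle
          rw [hl, if_neg (by omega)]
          exact h3 a ha (by omega)
        have q3 : (∃ a ≤ σ'.v .a, σ₂.a .last a + τ / 2 = y + (n + 1)) ↔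
            (σ'.v .flag = 1 ∨ v + τ / 2 = y + (n + 1)) := by
          rw [h4]
          constructor
          · rintro ⟨a, ha, h⟩
            rw [hl] at h
            split_ifs at h with e
            · exact Or.inr h
            · exact Or.inl ⟨a, by omega, h⟩
          · rintro (⟨a, ha, h⟩ | h)
            · exact ⟨a, by omega, by rw [hl, if_neg (by omega)]; exact h⟩
            · exact ⟨σ'.v .a, by omega, by rw [hl, if_pos rfl]; exact h⟩
        have hla : σ₂.a .last (σ'.v .a) = v := by rw [hl, if_pos rfl]
        rw [wp_seq, wp_ite]
        simp only [wp_assign]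
        simp [v2, v3, v4, v5, v6, hla]
        refine ⟨by omega, fun h => ?_, fun h => ?_⟩
        · and_intros <;> first
            | omega
            | exact q1
            | exact q2
            | exact q3.mpr (Or.inr h)
        · and_intros <;> first
            | omega
            | exact q1
            | exact q2
            | (rw [q3]; simp [h])
      rw [wp_seq, wp_ite]
      simp only [wp_store, wp_assign]
      simp only [Cond.ok_eq, Expr.ok_var, Cond.eval_eq, Expr.eval_var, em, ea, Expr.ok_add,
        Expr.eval_add, ey, eo, Expr.eval_ofNat, Expr.ok_ofNat]
      refine ⟨⟨trivial, trivial⟩, fun h => ?_, fun h => ?_⟩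
      · refine ⟨trivial, ⟨trivial, trivial, by omega⟩, by omega, by omega, ?_⟩
        refine tail _ (y + (n + 1)) (by simp) (fun a => by simp [el]) (by simp)
          (LastOcc.succ_mem (d1.mp h))
      · refine ⟨by omega, by omega, ?_⟩
        refine tail _ (σ'.a .last (σ'.v .a)) (by simp) (fun a => ?_) (by simp)
          ((h3 _ hc le_rfl).succ_notMem fun ho => h (d1.mpr ho))
        simp [el]; intro e; rw [e]
    rw [wp_seq, wp_assign]
    refine ⟨by simp; omega, by simp; omega, ?_⟩
    rw [wp_seq, wp_ite]
    simp only [Cond.ok_lt, Expr.ok_add, Expr.ok_var, Expr.eval_var, Expr.eval_add, St.set_v, St.tick_v,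
      reduceCtorEq, if_false, Expr.eval_ofNat, Expr.ok_ofNat, Cond.eval_lt, ey, et, en]
    refine ⟨⟨⟨trivial, trivial, by omega⟩, trivial, by omega, by omega⟩, fun h => ?_, fun h => ?_⟩
    · rw [wp_seq, wp_assign, wp_seq, wp_assign, wp_seq, wp_assign]
      refine ⟨by simp [et]; omega, by simp [et]; omega, by simp, by simp [ey]; omega, by simp,
        by simp [et]; omega, ?_⟩
      refine wp_lcpCode (a := σ'.v .a * τ) (b := y) (L := τ) (by simp [et]) (by simp [ey])
        (by simp [et])
        (by omega) (by omega) (by omega) fun σ₁ f1 d1 c1 => ?_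
      refine main σ₁ ?_ (by simpa [add_assoc] using c1) ?_
      · refine ((((Frame.set _ _ _ (by decide)).trans (Frame.set _ _ _ (by decide))).trans
          (Frame.set _ _ _ (by decide))).trans (Frame.set _ _ _ (by decide))).trans
          (f1.mono (by decide) (by decide))
      · rw [d1, mlen_eq_iff, Occ]
        exact ⟨fun hh => ⟨by omega, hh⟩, fun hh => hh.2⟩
    · rw [wp_assign]
      refine ⟨by simp; omega, by simp; omega, ?_⟩
      refine main _ ?_ (by simp) ?_
      · exact (Frame.set _ _ _ (by decide)).trans (Frame.set _ _ _ (by decide))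
      · simp only [St.set_v, if_true, Occ, Expr.eval_ofNat]
        exact ⟨fun hh => by omega, fun hh => by omega⟩
  · rintro σ' hf ⟨h1, h2, h3, h4⟩ hc hcl
    have em : σ'.v .m = n / τ := by rw [hf.v _ (by decide)]; simp [hC.m]
    simp only [Cond.eval_lt, Expr.eval_var, em] at hc
    have ea : σ'.v .a = n / τ := by omega
    rw [ea] at h2 h4
    refine hQ σ' ?_ (fun a ha => h2 a ha ha) ?_ ?_
    · exact ((Frame.set _ _ _ (by decide)).trans (Frame.set _ _ _ (by decide))).trans
        (hf.mono (by decide) (by decide))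
    · rw [h4, Last]
      constructor
      · rintro ⟨a, ha, h⟩
        obtain ⟨g1, g2, g3⟩ := ((h2 a ha ha).iff hle).mp h
        exact ⟨g1, a, ha, g2, g3⟩
      · rintro ⟨g1, a, ha, g2, g3⟩
        exact ⟨a, ha, ((h2 a ha ha).iff hle).mpr ⟨g1, g2, g3⟩⟩
    · simpa using hcl

/-- Clears the windows and the last occurrences. -/
def resetCode : Stmt :=
  .y ≔ 0 ;;
  .while (.lt ♯.y ♯.tgt)
    (.store .W0 ♯.y 0 ;; .store .W1 ♯.y 0 ;; .store .W2 ♯.y 0 ;; .y ≔ ♯.y + 1) ;;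
  .y ≔ 0 ;;
  .while (.lt ♯.y ♯.m) (.store .last ♯.y 0 ;; .y ≔ ♯.y + 1)

theorem wp_resetCode (S : Setup E n τ J A K) {σ : St} (hC : Ctx n τ J σ) {tgt : ℕ}
    (htgt : σ.v .tgt = tgt) (hZ : tgt ≤ 6 * J) {Q : St → Prop}
    (hQ : ∀ σ', Frame [.y] [.last, .W0, .W1, .W2] σ σ' →
      (∀ k < tgt, σ'.a .W0 k = 0 ∧ σ'.a .W1 k = 0 ∧ σ'.a .W2 k = 0) →
      (∀ k < n / τ, σ'.a .last k = 0) → σ'.clk ≤ σ.clk + (tgt + n / τ) → Q σ') :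
    wp E resetCode Q σ := by
  have hW := S.word_lin
  have hsp := S.space
  have hle := S.le
  have hJm := S.J_le_m
  have hmn := S.m_le
  simp only [resetCode]
  rw [wp_seq, wp_assign, wp_seq]
  refine ⟨by simp; omega, by simp; omega, ?_⟩
  refine wp_while (fun σ' => σ'.v .y ≤ tgt ∧
      ∀ k < σ'.v .y, σ'.a .W0 k = 0 ∧ σ'.a .W1 k = 0 ∧ σ'.a .W2 k = 0)
    (fun σ' => tgt - σ'.v .y) 1 (by simp) (by intro _ _ _; simp) ?_ ?_
  · rintro σ' hf ⟨h1, h2⟩ hc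
    have et : σ'.v .tgt = tgt := by rw [hf.v _ (by decide)]; simp [htgt]
    simp only [Cond.eval_lt, Expr.eval_var, et] at hc
    simp
    and_intros <;> try omega
    intro k hk
    by_cases e : k = σ'.v .y
    · simp [e]
    · simpa [e] using h2 k (by omega)
  · rintro σ' hf ⟨h1, h2⟩ hc hcl
    have et : σ'.v .tgt = tgt := by rw [hf.v _ (by decide)]; simp [htgt]
    simp only [Cond.eval_lt, Expr.eval_var, et] at hc
    have e1 : σ'.v .y = tgt := by omega
    rw [wp_seq, wp_assign]
    refine ⟨by simp; omega, by simp; omega, ?_⟩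
    refine wp_while (fun σ' => σ'.v .y ≤ n / τ ∧ ∀ k < σ'.v .y, σ'.a .last k = 0)
      (fun σ' => n / τ - σ'.v .y) 1 (by simp) (by intro _ _ _; simp) ?_ ?_
    · rintro σ₁ hf1 ⟨h3, h4⟩ hc1
      have em : σ₁.v .m = n / τ := by
        rw [hf1.v _ (by decide), St.set_v, if_neg (by decide), hf.v _ (by decide)]; simp [hC.m]
      simp only [Cond.eval_lt, Expr.eval_var, em] at hc1
      simp
      and_intros <;> try omega
      intro k hk
      by_cases e : k = σ₁.v .y
      · simp [e]
      · simpa [e] using h4 k (by omega)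
    · rintro σ₁ hf1 ⟨h3, h4⟩ hc1 hcl1
      have em : σ₁.v .m = n / τ := by
        rw [hf1.v _ (by decide), St.set_v, if_neg (by decide), hf.v _ (by decide)]; simp [hC.m]
      simp only [Cond.eval_lt, Expr.eval_var, em] at hc1
      refine hQ σ₁ ?_ ?_ (fun k hk => h4 k (by omega)) ?_
      · exact (((Frame.set _ _ _ (by decide)).trans (hf.mono (by decide) (by decide))).trans
          (Frame.set _ _ _ (by decide))).trans (hf1.mono (by decide) (by decide))
      · intro k hk
        rw [hf1.a _ (by decide), hf1.a _ (by decide), hf1.a _ (by decide)]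
        exact h2 k (by omega)
      · simp at hcl hcl1; omega

/-- Applies `act` to all boundaries at level `tgt`, from left to right. -/
def passCode (act : Stmt) : Stmt :=
  resetCode ;;
  .y ≔ 0 ;;
  .while (.lt ♯.y (♯.n + ♯.h))
    (scanCode ;;
      .ite (.eq ♯.flag 1) (.z ≔ ♯.y + ♯.o - ♯.h ;; pushCode act) (.flag ≔ 0) ;;
      .y ≔ ♯.y + 1) ;;
  .y ≔ 0 ;;
  .while (.lt ♯.y (♯.tgt + 1)) (.z ≔ (♯.y + 3) * ♯.o ;; pushCode act ;; .y ≔ ♯.y + 1)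

def passCost (n τ K tgt cA : ℕ) : ℕ :=
  tgt + n / τ + (n + τ / 2) * (n / τ * (τ + 1) + pushCost τ K tgt cA + 1) +
    (tgt + 1) * (pushCost τ K tgt cA + 1)

theorem mem_base_iff {f : ℕ → ℕ} {x : ℕ} (hx : x < n + 1 + n) :
    x ∈ base f n τ ↔ n + 1 ≤ x ∧ Last f n τ (x - (n + 1)) := by
  constructor
  · rintro (h | ⟨k, hk, rfl⟩)
    · exact h
    · nlinarith
  · exact Or.inl

/-- There is no boundary between the end of the text and the sentinel `3 * (n + 1)`, nor strictly
between adjacent sentinels. The case `k = 2` stands for the first of these gaps. -/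
theorem els_base_sent {f : ℕ → ℕ} (hτ : 1 ≤ τ) {a k : ℕ} (ha : n + 1 + n ≤ a)
    (hka : k = 2 ∨ k * (n + 1) < a) (hak : a ≤ (k + 1) * (n + 1)) :
    els (base f n τ) ((k + 1) * (n + 1)) = els (base f n τ) a := by
  refine els_congr hak fun x hx hax => ?_
  rcases hx with ⟨h1, h2⟩ | ⟨k', h1, rfl⟩
  · have := h2.lt hτ; omega
  · refine Nat.mul_le_mul_right _ ?_
    by_contra hlt
    have : k' * (n + 1) ≤ k * (n + 1) := Nat.mul_le_mul_right _ (by omega)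
    rcases hka with rfl | hka <;> omega

theorem stream_nil {f ρ : ℕ → ℕ} (k : ℕ) : stream f n τ J ρ [] k = [] := by
  induction k with
  | zero => rfl
  | succ k ih => simp only [stream]; rw [ih]; simp [emit, wins, winState]

theorem windows_nil {f ρ : ℕ → ℕ} {tgt : ℕ} {σ : St}
    (h : ∀ k < tgt, σ.a .W0 k = 0 ∧ σ.a .W1 k = 0 ∧ σ.a .W2 k = 0) :
    Windows f n τ J ρ [] tgt σ := by
  intro k hk
  obtain ⟨h1, h2, h3⟩ := h k hk
  rw [stream_nil, h1, h2, h3]; simp [last3, winState]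

theorem wp_passCode (S : Setup E n τ J A K) {ρ : ℕ → ℕ} {tgt : ℕ} {act : Stmt}
    {Inv : List ℕ → St → Prop} {cA : ℕ} (hA : Action E n τ J ρ tgt act Inv cA) {σ : St}
    (hC : Ctx n τ J σ) (htgt : σ.v .tgt = tgt) (hZ : tgt ≤ 6 * J)
    (hρ : ∀ q < tgt, σ.a .seed q = ρ q) (hρK : ∀ q < tgt, ρ q < 2 ^ (K + 1)) (hI : Inv [] σ)
    {Q : St → Prop}
    (hQ : ∀ σ' M, Frame (pipeVars ++ act.vars) (pipeArrs ++ act.arrs) σ σ' → 4 * (n + 1) ≤ M →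
      Inv (els (lvl E.f n τ J ρ tgt) M) σ' →
      σ'.clk ≤ σ.clk + passCost n τ K tgt cA → Q σ') : wp E (passCode act) Q σ := by
  have hW := S.word_lin
  have hWm := S.word_mul
  have hsp := S.space
  have hle := S.le
  have hpos := S.pos
  have hJm := S.J_le_m
  have hmn := S.m_le
  have hsent : (tgt + 4) * (n + 1) + n + 2 ≤ E.W := by
    have : (tgt + 4) * (n + 1) ≤ 10 * ((n + 1) * (n + 1)) := by
      rw [← mul_assoc]; exact Nat.mul_le_mul_right _ (by omega)
    have : n + 1 ≤ (n + 1) * (n + 1) := Nat.le_mul_of_pos_left _ (by omega)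
    omega
  set cP := pushCost τ K tgt cA with hcP
  have vr := hA.vars
  simp only [List.mem_cons, List.not_mem_nil, or_false, forall_eq_or_imp, forall_eq] at vr
  obtain ⟨vn, vtau, vm, vh, vo, vJ, vtgt, vy⟩ := vr
  have ar := hA.arrs
  simp only [List.mem_cons, List.not_mem_nil, or_false, forall_eq_or_imp, forall_eq] at ar
  obtain ⟨r0, r1, r2, r3, r4⟩ := ar
  have hfr : ∀ {σ₁ σ₂ : St}, Frame (pipeVars ++ act.vars) (pipeArrs ++ act.arrs) σ₁ σ₂ →
      Ctx n τ J σ₁ ∧ σ₁.v .tgt = tgt ∧ (∀ q < tgt, σ₁.a .seed q = ρ q) →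
      Ctx n τ J σ₂ ∧ σ₂.v .tgt = tgt ∧ (∀ q < tgt, σ₂.a .seed q = ρ q) := by
    intro σ₁ σ₂ hf h
    refine ⟨h.1.congr hf ?_, ?_, ?_⟩
    · have : ∀ x ∈ [Var.n, .tau, .m, .h, .o, .J], x ∉ pipeVars := by decide
      intro x hx
      simp only [List.mem_append, not_or]
      exact ⟨this x hx, hA.vars x (by simp at hx ⊢; tauto)⟩
    · rw [hf.v _ (by simp only [List.mem_append, not_or]; exact ⟨by decide, vtgt⟩), h.2.1]
    · rw [hf.a _ (by simp only [List.mem_append, not_or]; exact ⟨by decide, r4⟩)]; exact h.2.2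
  have F1 : ∀ {σ₁ σ₂ : St}, Frame pipeVars pipeArrs σ₁ σ₂ →
      Frame (pipeVars ++ act.vars) (pipeArrs ++ act.arrs) σ₁ σ₂ := fun h =>
    h.mono (List.subset_append_left _ _) (List.subset_append_left _ _)
  simp only [passCode]
  rw [wp_seq]
  refine wp_resetCode S hC htgt hZ fun σ₁ f1 w1 l1 c1 => ?_
  have f1' : Frame pipeVars pipeArrs σ σ₁ := f1.mono (by decide) (by decide)
  have hI1 := hA.frame _ _ _ f1' hI
  rw [wp_seq, wp_assign, wp_seq]
  refine ⟨by simp; omega, by simp; omega, ?_⟩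
  have C1 := hfr (F1 f1') ⟨hC, htgt, hρ⟩
  -- Step `y` of the scan decides the shifted position `n + 1 + y - τ / 2`; for `y < τ / 2` this
  -- lies before the text, where there are no boundaries. Because of this delay the loop runs up to
  -- `n + τ / 2`.
  refine wp_while (fun σ' => Frame (pipeVars ++ act.vars) (pipeArrs ++ act.arrs) σ σ' ∧
      σ'.v .y ≤ n + τ / 2 ∧ (∀ a < n / τ, LastOcc E.f n τ a (σ'.v .y) (σ'.a .last a)) ∧
      Windows E.f n τ J ρ (els (base E.f n τ) (n + 1 + σ'.v .y - τ / 2)) tgt σ' ∧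
      Inv (stream E.f n τ J ρ (els (base E.f n τ) (n + 1 + σ'.v .y - τ / 2)) tgt) σ')
    (fun σ' => n + τ / 2 - σ'.v .y) (n / τ * (τ + 1) + cP + 1) ?_ ?_ ?_ ?_
  · have e0 : els (base E.f n τ) (n + 1 - τ / 2) = [] := by
      rw [← els_zero (base E.f n τ)]
      refine els_congr (by omega) fun x hx _ => ?_
      have := (base_adm (f := E.f) (n := n) hpos).le x hx
      omega
    refine ⟨F1 (f1'.trans (Frame.set _ _ _ (by decide))), by simp, ?_, ?_, ?_⟩
    · intro a ha
      simp only [St.set_a, l1 a ha]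
      exact Or.inl ⟨rfl, by simp⟩
    · simp only [St.set_v, if_true, Expr.eval_ofNat, add_zero]
      rw [e0]; exact windows_nil (by simpa using w1)
    · simp only [St.set_v, if_true, Expr.eval_ofNat, add_zero]
      rw [e0, stream_nil]
      exact hA.frame _ _ _ (Frame.set _ _ _ (by decide)) hI1
  · rintro σ' - ⟨hf, h1, -⟩
    obtain ⟨hC', -, -⟩ := hfr hf ⟨hC, htgt, hρ⟩
    simp [hC'.n, hC'.h]; omega
  · rintro σ' - ⟨hf, h1, h2, h3, h4⟩ hc
    obtain ⟨hC', ht', hs'⟩ := hfr hf ⟨hC, htgt, hρ⟩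
    simp only [Cond.eval_lt, Expr.eval_var, Expr.eval_add, hC'.n, hC'.h] at hc
    rw [wp_seq]
    set y := σ'.v .y with hy
    refine wp_scanCode S (σ := σ'.tick) (y := y) ⟨hC'.n, hC'.tau, hC'.m, hC'.h, hC'.o, hC'.J⟩ rfl hc h2
      fun σ₂ f2 l2 g2 c2 => ?_
    have f2' : Frame pipeVars pipeArrs σ' σ₂ :=
      (Frame.tick _ _ _).trans (f2.mono (by decide) (by decide))
    obtain ⟨hC2, ht2, hs2⟩ := hfr (F1 f2') ⟨hC', ht', hs'⟩
    have hI2 := hA.frame _ _ _ f2' h4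
    have ey2 : σ₂.v .y = y := by rw [f2.v _ (by decide)]; rfl
    have w2 : Windows E.f n τ J ρ (els (base E.f n τ) (n + 1 + y - τ / 2)) tgt σ₂ := by
      intro k hk
      rw [f2.a _ (by decide), f2.a _ (by decide), f2.a _ (by decide)]; exact h3 k hk
    have hmem : n + 1 + y - τ / 2 ∈ base E.f n τ ↔ σ₂.v .flag = 1 := by
      rw [mem_base_iff (by omega), g2]
      rw [show n + 1 + y - τ / 2 - (n + 1) = y - τ / 2 by omega]
      refine and_congr (by omega) Iff.rfl
    have enext : n + 1 + (y + 1) - τ / 2 = n + 1 + y - τ / 2 + 1 := by omega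
    simp only [St.tick_clk] at c2
    have fin : ∀ σ₃, Frame (pipeVars ++ act.vars) (pipeArrs ++ act.arrs) σ₂ σ₃ → σ₃.v .y = y →
        σ₃.a .last = σ₂.a .last →
        Windows E.f n τ J ρ (els (base E.f n τ) (n + 1 + y - τ / 2 + 1)) tgt σ₃ →
        Inv (stream E.f n τ J ρ (els (base E.f n τ) (n + 1 + y - τ / 2 + 1)) tgt) σ₃ →
        σ₃.clk ≤ σ₂.clk + cP → wp E (.y ≔ ♯.y + 1) (fun σ'' =>
          (Frame (pipeVars ++ act.vars) (pipeArrs ++ act.arrs) σ σ'' ∧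
      σ''.v .y ≤ n + τ / 2 ∧ (∀ a < n / τ, LastOcc E.f n τ a (σ''.v .y) (σ''.a .last a)) ∧
      Windows E.f n τ J ρ (els (base E.f n τ) (n + 1 + σ''.v .y - τ / 2)) tgt σ'' ∧
      Inv (stream E.f n τ J ρ (els (base E.f n τ) (n + 1 + σ''.v .y - τ / 2)) tgt) σ'') ∧
      n + τ / 2 - σ''.v .y < n + τ / 2 - y ∧
        σ''.clk ≤ σ'.clk + (n / τ * (τ + 1) + cP + 1)) σ₃ := by
      intro σ₃ f3 y3 l3 w3 i3 c3
      rw [wp_assign]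
      simp only [Expr.eval_add, Expr.eval_var, Expr.eval_ofNat, y3, St.set_v, if_true, St.set_a,
        St.set_clk, Expr.ok_add, Expr.ok_var, Expr.ok_ofNat, enext]
      refine ⟨⟨trivial, by omega, by omega⟩, by omega, ⟨?_, by omega, ?_, ?_, ?_⟩, by omega, by omega⟩
      · exact ((hf.trans (F1 f2')).trans f3).trans (Frame.set _ _ _ (List.mem_append_left _ (by decide)))
      · rw [l3]; exact l2
      · simpa [Windows] using w3
      · exact hA.frame _ _ _ (Frame.set _ _ _ (by decide)) i3
    rw [wp_seq, wp_ite]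
    refine ⟨by simp; omega, fun h => ?_, fun h => ?_⟩
    · simp only [Cond.eval_eq, Expr.eval_var, Expr.eval_ofNat] at h
      rw [wp_seq, wp_assign]
      simp only [Expr.eval_add, Expr.eval_sub, Expr.eval_var, ey2, hC2.o, hC2.h, Expr.ok_sub,
        Expr.ok_add, Expr.ok_var]
      refine ⟨⟨⟨trivial, trivial, by omega⟩, trivial, by omega⟩, by omega, ?_⟩
      have ez : y + (n + 1) - τ / 2 = n + 1 + y - τ / 2 := by omega
      rw [ez]
      have f3 : Frame pipeVars pipeArrs σ₂ (σ₂.set .z (n + 1 + y - τ / 2)) :=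
        Frame.set _ _ _ (by decide)
      obtain ⟨hC3, ht3, hs3⟩ := hfr (F1 f3) ⟨hC2, ht2, hs2⟩
      refine wp_pushCode S hA hC3 ht3 hZ hs3 hρK (hmem.mpr h) (by simp) (by omega)
        (by simpa [Windows] using w2) (hA.frame _ _ _ f3 hI2) fun σ₄ f4 y4 l4 w4 i4 c4 => ?_
      exact fin σ₄ ((F1 f3).trans f4) (by simpa [ey2] using y4) (by simpa using l4) w4 i4
        (by simpa using c4)
    · simp only [Cond.eval_eq, Expr.eval_var, Expr.eval_ofNat] at h
      rw [wp_assign]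
      refine ⟨by simp; omega, by simp; omega, ?_⟩
      rw [← els_succ_notMem (mt hmem.mp h)] at w2 hI2
      exact fin _ (F1 (Frame.set _ _ _ (by decide))) (by simp [ey2]) (by simp)
        (by simpa [Windows] using w2) (hA.frame _ _ _ (Frame.set _ _ _ (by decide)) hI2) (by simp)
  · rintro σ' - ⟨hf, h1, h2, h3, h4⟩ hc hcl
    obtain ⟨hC', ht', hs'⟩ := hfr hf ⟨hC, htgt, hρ⟩
    simp only [Cond.eval_lt, Expr.eval_var, Expr.eval_add, hC'.n, hC'.h] at hc
    simp only [St.set_v, if_true, Expr.eval_ofNat, Nat.sub_zero, St.set_clk] at hcl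
    have ey : n + 1 + σ'.v .y - τ / 2 = n + 1 + n := by omega
    have e3 : els (base E.f n τ) (3 * (n + 1)) = els (base E.f n τ) (n + 1 + n) :=
      els_base_sent (k := 2) hpos le_rfl (Or.inl rfl) (by omega)
    rw [ey, ← e3] at h3 h4
    rw [wp_seq, wp_assign]
    refine ⟨by simp; omega, by simp; omega, ?_⟩
    -- The sentinels from `3 * (n + 1)` to `(tgt + 3) * (n + 1)` flush the pipeline, which holds
    -- back one boundary per level.
    refine wp_while (fun σ' => Frame (pipeVars ++ act.vars) (pipeArrs ++ act.arrs) σ σ' ∧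
        σ'.v .y ≤ tgt + 1 ∧
        Windows E.f n τ J ρ (els (base E.f n τ) ((σ'.v .y + 3) * (n + 1))) tgt σ' ∧
        Inv (stream E.f n τ J ρ (els (base E.f n τ) ((σ'.v .y + 3) * (n + 1))) tgt) σ')
      (fun σ' => tgt + 1 - σ'.v .y) (cP + 1) ?_ ?_ ?_ ?_
    · refine ⟨hf.trans (F1 (Frame.set _ _ _ (by decide))), by simp, ?_, ?_⟩
      · simpa [Windows] using h3
      · simp only [St.set_v, if_true, Expr.eval_ofNat, zero_add]
        exact hA.frame _ _ _ (Frame.set _ _ _ (by decide)) h4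
    · rintro σ' - ⟨hf, h1, -⟩
      obtain ⟨hC', ht', -⟩ := hfr hf ⟨hC, htgt, hρ⟩
      simp [ht']; omega
    · rintro σ₂ - ⟨f2, g1, g2, g3⟩ hc2
      obtain ⟨hC2, ht2, hs2⟩ := hfr f2 ⟨hC, htgt, hρ⟩
      simp only [Cond.eval_lt, Expr.eval_var, Expr.eval_add, Expr.eval_ofNat, ht2] at hc2
      set y := σ₂.v .y with hy
      have hyz : (y + 3) * (n + 1) + (n + 1) ≤ (tgt + 4) * (n + 1) := by
        rw [← Nat.succ_mul]; exact Nat.mul_le_mul_right _ (by omega)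
      rw [wp_seq, wp_assign]
      simp only [Expr.eval_add, Expr.eval_mul, Expr.eval_var, Expr.eval_ofNat, St.tick_v, hC2.o,
        Expr.ok_mul, Expr.ok_add, Expr.ok_var, Expr.ok_ofNat, ← hy]
      refine ⟨⟨⟨trivial, by omega, by omega⟩, trivial, by omega⟩, by omega, ?_⟩
      rw [wp_seq]
      have f3 : Frame pipeVars pipeArrs σ₂ (σ₂.tick.set .z ((y + 3) * (n + 1))) :=
        (Frame.tick _ _ _).trans (Frame.set _ _ _ (by decide))
      obtain ⟨hC3, ht3, hs3⟩ := hfr (F1 f3) ⟨hC2, ht2, hs2⟩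
      refine wp_pushCode S hA hC3 ht3 hZ hs3 hρK (z := (y + 3) * (n + 1))
        (Or.inr ⟨_, by omega, rfl⟩) (by simp) (by omega)
        (by simpa [Windows] using g2) (hA.frame _ _ _ f3 g3) fun σ₄ f4 y4 l4 w4 i4 c4 => ?_
      have e4 : els (base E.f n τ) ((y + 3) * (n + 1) + 1) =
          els (base E.f n τ) ((y + 1 + 3) * (n + 1)) := by
        have g1 := Nat.mul_le_mul_right (n + 1) (show 3 ≤ y + 3 by omega)
        have g2 := Nat.add_mul (y + 3) 1 (n + 1)
        rw [show y + 1 + 3 = y + 3 + 1 by omega]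
        exact (els_base_sent hpos (by omega) (Or.inr (by omega)) (by omega)).symm
      rw [e4] at w4 i4
      simp only [St.set_v, reduceCtorEq, if_false, St.tick_v, ← hy, St.set_clk, St.tick_clk] at y4 c4
      rw [← hcP] at c4
      rw [wp_assign]
      simp only [Expr.eval_add, Expr.eval_var, Expr.eval_ofNat, y4, St.set_v, if_true,
        St.set_clk, Expr.ok_add, Expr.ok_var, Expr.ok_ofNat]
      refine ⟨⟨trivial, by omega, by omega⟩, by omega, ⟨?_, by omega, ?_, ?_⟩, by omega, by omega⟩
      · exact ((f2.trans (F1 f3)).trans f4).trans (Frame.set _ _ _ (List.mem_append_left _ (by decide)))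
      · simpa [Windows] using w4
      · exact hA.frame _ _ _ (Frame.set _ _ _ (by decide)) i4
    · rintro σ₂ - ⟨f2, g1, g2, g3⟩ hc2 hcl2
      obtain ⟨hC2, ht2, hs2⟩ := hfr f2 ⟨hC, htgt, hρ⟩
      simp only [Cond.eval_lt, Expr.eval_var, Expr.eval_add, Expr.eval_ofNat, ht2] at hc2
      simp only [St.set_v, if_true, Expr.eval_ofNat, Nat.sub_zero, St.set_clk] at hcl2
      have ey : σ₂.v .y + 3 = tgt + 4 := by omega
      rw [ey] at g3
      obtain ⟨M, hM, hs⟩ := stream_els (f := E.f) (J := J) (ρ := ρ) S.pos S.le (tgt := tgt) le_rfl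
      rw [hs] at g3
      refine hQ σ₂ M f2 (by simpa using hM) g3 ?_
      unfold passCost
      rw [← hcP]
      omega

end

end LCE

namespace LCE

section
variable {E : Env} {n τ J A K : ℕ}

/-! ### Computing the seeds -/

theorem wins_length (l : List ℕ) : (wins l).length = l.length := by
  induction l using List.reverseRecOn with
  | nil => rfl
  | append_singleton l z ih => rw [wins_snoc]; simp [ih]

/-- Identifiers of the two phrases of a window. -/
def winL (F : ℕ → ℕ) (o l : ℕ) (w : Win) : ℕ := pid F o l w.1 w.2.1 w.2.2.1

def winR (F : ℕ → ℕ) (o l : ℕ) (w : Win) : ℕ := pid F o l w.2.1 w.2.2.1 w.2.2.2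

/-- Windows whose two phrases have length at most `l`. -/
def winActive (l : ℕ) (w : Win) : Prop := w.2.2.1 ≤ w.2.1 + l ∧ w.2.2.2 ≤ w.2.2.1 + l

instance (l : ℕ) (w : Win) : Decidable (winActive l w) :=
  inferInstanceAs (Decidable (_ ∧ _))

/-- Number of active windows whose two identifiers satisfy `p`. -/
def winCount (F : ℕ → ℕ) (o l : ℕ) (p : ℕ → ℕ → Prop) [∀ a b, Decidable (p a b)] (L : List ℕ) : ℕ :=
  (wins L).countP fun w => winActive l w ∧ p (winL F o l w) (winR F o l w)

theorem winCount_snoc (F : ℕ → ℕ) (o l : ℕ) (p : ℕ → ℕ → Prop) [∀ a b, Decidable (p a b)]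
    (L : List ℕ) (z : ℕ) : winCount F o l p (L ++ [z]) = winCount F o l p L +
      if ((last3 L).2.2 ≤ (last3 L).2.1 + l ∧ z ≤ (last3 L).2.2 + l) ∧
        p (pid F o l (last3 L).1 (last3 L).2.1 (last3 L).2.2) (pid F o l (last3 L).2.1 (last3 L).2.2 z)
      then 1 else 0 := by
  unfold winCount
  rw [wins_snoc, List.countP_append, List.countP_singleton]
  congr 1
  by_cases h : ((last3 L).2.2 ≤ (last3 L).2.1 + l ∧ z ≤ (last3 L).2.2 + l) ∧
      p (pid F o l (last3 L).1 (last3 L).2.1 (last3 L).2.2) (pid F o l (last3 L).2.1 (last3 L).2.2 z)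
  · rw [if_pos h]; exact if_pos (decide_eq_true h)
  · rw [if_neg h]; exact if_neg fun hh => h (of_decide_eq_true hh)

theorem winCount_le (F : ℕ → ℕ) (o l : ℕ) (p : ℕ → ℕ → Prop) [∀ a b, Decidable (p a b)]
    (L : List ℕ) : winCount F o l p L ≤ L.length :=
  List.countP_le_length.trans (wins_length L).le

open Classical in
-- Counters that see only a stream of windows thus hold cardinalities of sets of active boundaries,
-- as the greedy argument needs them.
theorem winCount_els {B : Set ℕ} {M l : ℕ} {F : ℕ → ℕ} (ha : Adm (n + 1) n B)
    (hM : 4 * (n + 1) ≤ M) (hl : l ≤ n) (p : ℕ → ℕ → Prop) [∀ a b, Decidable (p a b)] :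
    winCount F (n + 1) l p (els B M) = (((reals n B).filter (Active l B)).filter fun x =>
      p (idL F (n + 1) l B x) (idR F (n + 1) l B x)).card := by
  unfold winCount
  rw [countP_wins ha hM, Finset.filter_filter]
  · congr 1
    ext x
    simp only [Finset.mem_filter]
    rfl
  · rintro a b z hz ⟨⟨-, h⟩, -⟩
    have := ha.le z hz
    simp at h; omega
  · rintro x hx ⟨⟨-, h⟩, -⟩
    obtain ⟨h1, h2⟩ := suc_spec (ha.inf (by omega)) x
    simp only [winOf] at h
    have := ha.real x hx _ h2 h1 (by omega)
    omega

/-- Updates the statistics about the seed `cur` by the boundary `z`. -/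
def statCode : Stmt :=
  .x0 ≔ ♯.s0 ;; .x1 ≔ ♯.s1 ;; .x ≔ ♯.s2 ;; .s0 ≔ ♯.x1 ;; .s1 ≔ ♯.x ;; .s2 ≔ ♯.z ;; .q ≔ ♯.tgt ;;
  ellCode ;;
  .ite (.lt ♯.x (♯.x1 + ♯.ell + 1))
    (.ite (.lt ♯.z (♯.x + ♯.ell + 1))
      (.r ≔ ♯.cur ;; labelCode ;;
        .ite (.eq (♯.idu / ♯.bit) (♯.idw / ♯.bit)) (.d ≔ 0)
          (.more ≔ 1 ;;
            .ite (.eq (♯.idu / (2 * ♯.bit)) (♯.idw / (2 * ♯.bit)))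
              (.ite (.eq ♯.la ♯.lb) (.c0 ≔ ♯.c0 + 1) (.c1 ≔ ♯.c1 + 1)) (.d ≔ 0)) ;;
        .ite (.lt ♯.la ♯.lb) (.c01 ≔ ♯.c01 + 1)
          (.ite (.lt ♯.lb ♯.la) (.c10 ≔ ♯.c10 + 1) (.d ≔ 0)))
      (.d ≔ 0))
    (.d ≔ 0)

/-- The statistics are correct for the list `L`. -/
structure Stat (F : ℕ → ℕ) (o l k r : ℕ) (L : List ℕ) (σ : St) : Prop where
  cur : σ.v .cur = r
  bit : σ.v .bit = 2 ^ k
  win : (σ.v .s0, σ.v .s1, σ.v .s2) = last3 L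
  c0 : σ.v .c0 = winCount F o l (fun u w => u / 2 ^ k ≠ w / 2 ^ k ∧ u / 2 ^ (k + 1) = w / 2 ^ (k + 1) ∧
    dot r u % 2 = dot r w % 2) L
  c1 : σ.v .c1 = winCount F o l (fun u w => u / 2 ^ k ≠ w / 2 ^ k ∧ u / 2 ^ (k + 1) = w / 2 ^ (k + 1) ∧
    dot r u % 2 ≠ dot r w % 2) L
  c01 : σ.v .c01 = winCount F o l (fun u w => dot r u % 2 < dot r w % 2) L
  c10 : σ.v .c10 = winCount F o l (fun u w => dot r w % 2 < dot r u % 2) L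
  more_le : σ.v .more ≤ 1
  more : σ.v .more = 0 ↔ winCount F o l (fun u w => u / 2 ^ k ≠ w / 2 ^ k) L = 0

theorem Stat.congr {F : ℕ → ℕ} {o l k r : ℕ} {L : List ℕ} {σ σ' : St} (h : Stat F o l k r L σ)
    {vs : List Var} {as : List Arr} (hf : Frame vs as σ σ')
    (hd : ∀ x ∈ [Var.cur, .bit, .s0, .s1, .s2, .c0, .c1, .c01, .c10, .more], x ∉ vs) :
    Stat F o l k r L σ' := by
  simp only [List.mem_cons, List.not_mem_nil, or_false, forall_eq_or_imp, forall_eq] at hd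
  obtain ⟨h1, h2, h3, h4, h5, h6, h7, h8, h9, h10⟩ := hd
  obtain ⟨g1, g2, g3, g4, g5, g6, g7, g8, g9⟩ := h
  constructor <;> simp only [hf.v _ h1, hf.v _ h2, hf.v _ h3, hf.v _ h4, hf.v _ h5, hf.v _ h6,
    hf.v _ h7, hf.v _ h8, hf.v _ h9, hf.v _ h10] <;> assumption

theorem stat_action (S : Setup E n τ J A K) {ρ : ℕ → ℕ} {lam k r : ℕ} (hk : k ≤ K + 1)
    (hr : r < 2 ^ (K + 1)) (hlam : lam < 6 * J) :
    Action E n τ J ρ lam statCode (Stat (shifted E.f n) (n + 1) (ell τ J lam) k r)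
      (2 * τ + 2 * (K + 1)) where
  vars := by decide
  arrs := by decide
  frame σ σ' L hf h := h.congr hf (by decide)
  step σ z hC htgt hseed hz hσz hzW hI := by
    have hW := S.word_lin
    have hW2 := S.word_id
    have hK := S.K_le
    have hle := S.le
    have hJm := S.J_le_m
    have hmn := S.m_le
    have hell := ell_le τ J lam
    have hbit : 2 * 2 ^ k ≤ 16 * ((n + 1) * (A + 2)) := by
      have := Nat.pow_le_pow_right (show 0 < 2 by norm_num) hk
      rw [pow_succ] at this; omega
    have hok := winOK_of_mem (lvl_adm (f := E.f) (J := J) (ρ := ρ) S.pos S.le lam) hz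
    have hsn0 := winCount_snoc (shifted E.f n) (n + 1) (ell τ J lam)
    have hwl := fun (p : ℕ → ℕ → Prop) [∀ a b, Decidable (p a b)] =>
      (winCount_le (shifted E.f n) (n + 1) (ell τ J lam) p (els (lvl E.f n τ J ρ lam) z)).trans
        (els_length_le _ _)
    obtain ⟨g1, g2, g3, g4, g5, g6, g7, g8, g9⟩ := hI
    have b4 := hwl (fun u w => u / 2 ^ k ≠ w / 2 ^ k ∧ u / 2 ^ (k + 1) = w / 2 ^ (k + 1) ∧
      dot r u % 2 = dot r w % 2)
    have b5 := hwl (fun u w => u / 2 ^ k ≠ w / 2 ^ k ∧ u / 2 ^ (k + 1) = w / 2 ^ (k + 1) ∧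
      dot r u % 2 ≠ dot r w % 2)
    have b6 := hwl (fun u w => dot r u % 2 < dot r w % 2)
    have b7 := hwl (fun u w => dot r w % 2 < dot r u % 2)
    have hl3 := last3_els (lvl E.f n τ J ρ lam) z
    rw [← g3] at hl3
    simp only [Prod.mk.injEq] at hl3
    rw [← hl3.1, ← hl3.2.1, ← hl3.2.2] at hok
    rw [← g4] at b4
    rw [← g5] at b5
    rw [← g6] at b6
    rw [← g7] at b7
    obtain ⟨o1, o2, o3, o4, o5⟩ := hok
    set L := els (lvl E.f n τ J ρ lam) z with hL
    set x0 := σ.v .s0 with hx0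
    set x1 := σ.v .s1 with hx1
    set x := σ.v .s2 with hx
    set l := ell τ J lam with hl
    set σ₁ : St := (((((((σ.set .x0 x0).set .x1 x1).set .x x).set .s0 x1).set .s1 x).set .s2 z).set .q
      lam).set .ell l with hσ₁
    have hfin : ∀ σ', Frame (decideVars ++ [.more, .c0, .c1, .c01, .c10]) [] σ₁ σ' →
        (σ'.v .c0 = σ.v .c0 + if (x ≤ x1 + l ∧ z ≤ x + l) ∧
          pid (shifted E.f n) (n + 1) l x0 x1 x / 2 ^ k ≠ pid (shifted E.f n) (n + 1) l x1 x z / 2 ^ k ∧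
          pid (shifted E.f n) (n + 1) l x0 x1 x / 2 ^ (k + 1) =
            pid (shifted E.f n) (n + 1) l x1 x z / 2 ^ (k + 1) ∧
          dot r (pid (shifted E.f n) (n + 1) l x0 x1 x) % 2 =
            dot r (pid (shifted E.f n) (n + 1) l x1 x z) % 2 then 1 else 0) →
        (σ'.v .c1 = σ.v .c1 + if (x ≤ x1 + l ∧ z ≤ x + l) ∧
          pid (shifted E.f n) (n + 1) l x0 x1 x / 2 ^ k ≠ pid (shifted E.f n) (n + 1) l x1 x z / 2 ^ k ∧
          pid (shifted E.f n) (n + 1) l x0 x1 x / 2 ^ (k + 1) =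
            pid (shifted E.f n) (n + 1) l x1 x z / 2 ^ (k + 1) ∧
          dot r (pid (shifted E.f n) (n + 1) l x0 x1 x) % 2 ≠
            dot r (pid (shifted E.f n) (n + 1) l x1 x z) % 2 then 1 else 0) →
        (σ'.v .c01 = σ.v .c01 + if (x ≤ x1 + l ∧ z ≤ x + l) ∧
          dot r (pid (shifted E.f n) (n + 1) l x0 x1 x) % 2 <
            dot r (pid (shifted E.f n) (n + 1) l x1 x z) % 2 then 1 else 0) →
        (σ'.v .c10 = σ.v .c10 + if (x ≤ x1 + l ∧ z ≤ x + l) ∧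
          dot r (pid (shifted E.f n) (n + 1) l x1 x z) % 2 <
            dot r (pid (shifted E.f n) (n + 1) l x0 x1 x) % 2 then 1 else 0) →
        (σ'.v .more = if (x ≤ x1 + l ∧ z ≤ x + l) ∧
          pid (shifted E.f n) (n + 1) l x0 x1 x / 2 ^ k ≠ pid (shifted E.f n) (n + 1) l x1 x z / 2 ^ k
          then 1 else σ.v .more) →
        Stat (shifted E.f n) (n + 1) l k r (L ++ [z]) σ' := by
      intro σ' hf h1 h2 h3 h4 h5
      have hv : ∀ y, y ∉ decideVars ++ [Var.more, .c0, .c1, .c01, .c10] → σ'.v y = σ₁.v y := hf.v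
      constructor
      · rw [hv _ (by decide)]; simp [hσ₁, g1]
      · rw [hv _ (by decide)]; simp [hσ₁, g2]
      · rw [hv _ (by decide), hv _ (by decide), hv _ (by decide), last3_snoc, ← g3]
        simp [hσ₁]
      · rw [hsn0, ← g3, h1, g4]
      · rw [hsn0, ← g3, h2, g5]
      · rw [hsn0, ← g3, h3, g6]
      · rw [hsn0, ← g3, h4, g7]
      · rw [h5]; split_ifs <;> omega
      · rw [hsn0, ← g3, h5]
        split_ifs
        · simp
        · rw [g9]; simp
    have hinact : ¬ (x ≤ x1 + l ∧ z ≤ x + l) →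
        Stat (shifted E.f n) (n + 1) l k r (L ++ [z]) (σ₁.set .d 0) := by
      intro h
      refine hfin _ (Frame.set _ _ _ (by decide)) ?_ ?_ ?_ ?_ ?_ <;>
        rw [if_neg (fun hh => h hh.1)] <;> simp [hσ₁]
    have hev : (Expr.op .shr ♯.tau (♯.J - ♯.q / 6)).eval E
        (((((((σ.set .x0 x0).set .x1 x1).set .x x).set .s0 x1).set .s1 x).set .s2 z).set .q lam) = l := by
      simp [hC.tau, hC.J, hl, ell]
    simp only [statCode, ellCode]
    iterate 7 rw [wp_seq, wp_assign]
    rw [wp_seq, wp_assign]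
    simp only [Expr.eval_var, St.set_v, reduceCtorEq, if_false, if_true, ← hx0, ← hx1, ← hx, hσz, htgt,
      Expr.ok_var, true_and]
    rw [hev, ← hσ₁]
    refine ⟨by omega, by omega, by omega, by omega, by omega, by omega, by omega, ?_, by omega, ?_⟩
    · have := Nat.div_le_self lam 6
      have h' : τ / 2 ^ (J - lam / 6) ≤ τ := hell
      simp [hC.tau, hC.J]
      omega
    have v1 : σ₁.v .x1 = x1 := by simp [hσ₁]
    have v2 : σ₁.v .x = x := by simp [hσ₁]
    have v3 : σ₁.v .z = z := by simp [hσ₁, hσz]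
    have v4 : σ₁.v .ell = l := by simp [hσ₁]
    have v5 : σ₁.clk = σ.clk := by simp [hσ₁]
    rw [wp_ite]
    refine ⟨by simp [v1, v4]; omega, fun c1 => ?_, fun c1 => ?_⟩
    · simp [v1, v2, v4] at c1
      rw [wp_ite]
      refine ⟨by simp [v2, v4]; omega, fun c2 => ?_, fun c2 => ?_⟩
      · simp [v2, v3, v4] at c2
        have hact : x ≤ x1 + l ∧ z ≤ x + l := by omega
        obtain ⟨a1, a2, a3⟩ := o4 (by omega) (by omega)
        simp only [hact, true_and] at hfin
        rw [wp_seq, wp_assign, wp_seq]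
        refine ⟨by simp, by simp [hσ₁, g1]; rw [pow_succ] at hr; omega, ?_⟩
        refine wp_labelCode S (x0 := x0) (x1 := x1) (x := x) (z := z) (l := l) (r := r)
          (by simp [hσ₁]) (by simp [v1]) (by simp [v2]) (by simp [v3]) (by simp [v4])
          (by simp [hσ₁, hC.o]) (by simp [hσ₁, g1]) hr
          (by omega) o1 a2 o3 a3 a1 (by omega) (by omega) (fun h => o5 a1 (by omega))
          fun σ₂ hf hu hw hla hlb hc => ?_
        set u := pid (shifted E.f n) (n + 1) l x0 x1 x with hu'
        set w := pid (shifted E.f n) (n + 1) l x1 x z with hw'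
        have hp1 := pid_lt S (l := l) (x0 := x0) (x1 := x1) (x := x) (by omega)
        have hp2 := pid_lt S (l := l) (x0 := x1) (x1 := x) (x := z) (by omega)
        rw [← hu'] at hp1
        rw [← hw'] at hp2
        have hd1 : u / 2 ^ k ≤ u := Nat.div_le_self _ _
        have hd2 : w / 2 ^ k ≤ w := Nat.div_le_self _ _
        have hd3 : u / 2 ^ (k + 1) ≤ u := Nat.div_le_self _ _
        have hd4 : w / 2 ^ (k + 1) ≤ w := Nat.div_le_self _ _
        have hf' : Frame decideVars [] σ₁ σ₂ :=
          (Frame.set _ _ _ (by decide)).trans (hf.mono (by decide) (by simp))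
        have w1 : σ₂.v .bit = 2 ^ k := by rw [hf'.v _ (by decide)]; simp [hσ₁, g2]
        have w2 : σ₂.v .c0 = σ.v .c0 := by rw [hf'.v _ (by decide)]; simp [hσ₁]
        have w3 : σ₂.v .c1 = σ.v .c1 := by rw [hf'.v _ (by decide)]; simp [hσ₁]
        have w4 : σ₂.v .c01 = σ.v .c01 := by rw [hf'.v _ (by decide)]; simp [hσ₁]
        have w5 : σ₂.v .c10 = σ.v .c10 := by rw [hf'.v _ (by decide)]; simp [hσ₁]
        have w6 : σ₂.v .more = σ.v .more := by rw [hf'.v _ (by decide)]; simp [hσ₁]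
        simp only [St.set_clk] at hc
        have hc : σ₂.clk ≤ σ.clk + (2 * τ + 2 * (K + 1)) := by omega
        have hbound : dot r u % 2 < 2 ∧ dot r w % 2 < 2 := by omega
        generalize dot r u % 2 = du at *
        generalize dot r w % 2 = dw at *
        have hpow : 2 * 2 ^ k = 2 ^ (k + 1) := by rw [pow_succ]; omega
        rw [hpow] at hbit
        have hpk : 2 ^ k < E.W := by rw [pow_succ] at hbit; omega
        have F1 : Frame (decideVars ++ [.more, .c0, .c1, .c01, .c10]) [] σ₁ σ₂ :=
          hf'.mono (List.subset_append_left _ _) (by simp)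
        have tail : ∀ σ₃, Frame (decideVars ++ [.more, .c0, .c1, .c01, .c10]) [] σ₁ σ₃ →
            (σ₃.v .c0 = σ.v .c0 + if u / 2 ^ k ≠ w / 2 ^ k ∧ u / 2 ^ (k + 1) = w / 2 ^ (k + 1) ∧
              du = dw then 1 else 0) →
            (σ₃.v .c1 = σ.v .c1 + if u / 2 ^ k ≠ w / 2 ^ k ∧ u / 2 ^ (k + 1) = w / 2 ^ (k + 1) ∧
              du ≠ dw then 1 else 0) →
            (σ₃.v .more = if u / 2 ^ k ≠ w / 2 ^ k then 1 else σ.v .more) →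
            σ₃.v .la = du → σ₃.v .lb = dw → σ₃.v .c01 = σ.v .c01 → σ₃.v .c10 = σ.v .c10 →
            σ₃.clk ≤ σ.clk + (2 * τ + 2 * (K + 1)) →
            wp E (.ite (.lt ♯.la ♯.lb) (.c01 ≔ ♯.c01 + 1)
              (.ite (.lt ♯.lb ♯.la) (.c10 ≔ ♯.c10 + 1) (.d ≔ 0)))
              (fun σ' => Stat (shifted E.f n) (n + 1) l k r (L ++ [z]) σ' ∧
                σ'.clk ≤ σ.clk + (2 * τ + 2 * (K + 1))) σ₃ := by
          intro σ₃ f3 t1 t2 t3 t4 t5 t6 t7 t8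
          simp only [wp_ite, wp_assign]
          simp [t4, t5, t6, t7]
          refine ⟨fun h => ?_, fun h => ⟨fun h' => ?_, fun h' => ?_⟩⟩
          · refine ⟨by omega, by omega, hfin _ (f3.trans (Frame.set _ _ _ (by decide))) ?_ ?_ ?_ ?_ ?_,
              t8⟩
            · simpa using t1
            · simpa using t2
            · simp [h]
            · simp [t7]; omega
            · simpa using t3
          · refine ⟨by omega, by omega, hfin _ (f3.trans (Frame.set _ _ _ (by decide))) ?_ ?_ ?_ ?_ ?_,
              t8⟩
            · simpa using t1
            · simpa using t2
            · simp [t6]; omega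
            · simp [h']
            · simpa using t3
          · refine ⟨by omega, hfin _ (f3.trans (Frame.set _ _ _ (by decide))) ?_ ?_ ?_ ?_ ?_, t8⟩
            · simpa using t1
            · simpa using t2
            · simp [t6]; omega
            · simp [t7]; omega
            · simpa using t3
        rw [wp_seq]
        simp only [wp_ite (p := .d ≔ 0), wp_seq (p := .more ≔ 1), wp_assign (x := .more)]
        simp only [Cond.ok_eq, Cond.eval_eq, Expr.ok_div, Expr.eval_div, Expr.eval_var, Expr.ok_var, hu,
          hw, w1, Expr.ok_ofNat, Expr.eval_ofNat]
        refine ⟨by simp; omega, fun h => ?_, fun h => ?_⟩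
        · rw [wp_assign]
          refine ⟨by simp; omega, by simp; omega, ?_⟩
          refine tail _ (F1.trans (Frame.set _ _ _ (by decide))) ?_ ?_ ?_ ?_ ?_ ?_ ?_ ?_ <;>
            simp [h, w2, w3, w4, w5, w6, hla, hlb, hc]
        · refine ⟨by omega, by omega, ?_⟩
          rw [wp_ite]
          simp only [Cond.ok_eq, Cond.eval_eq, Expr.ok_div, Expr.ok_mul, Expr.eval_mul, Expr.eval_div,
            Expr.eval_var, Expr.ok_var, St.set_v, reduceCtorEq, if_false, hu, hw, w1, Expr.ok_ofNat,
            Expr.eval_ofNat, hpow]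
          refine ⟨by simp; omega, fun h' => ?_, fun h' => ?_⟩
          · rw [wp_ite]
            refine ⟨by simp, fun h'' => ?_, fun h'' => ?_⟩
            · simp [hla, hlb] at h''
              rw [wp_assign]
              refine ⟨by simp [w2]; omega, by simp [w2]; omega, ?_⟩
              refine tail _ ((F1.trans (Frame.set _ _ _ (by decide))).trans
                (Frame.set _ _ _ (by decide))) ?_ ?_ ?_ ?_ ?_ ?_ ?_ ?_ <;>
                simp [h, h', h'', w2, w3, w4, w5, hla, hlb, hc]
            · simp [hla, hlb] at h''
              rw [wp_assign]
              refine ⟨by simp [w3]; omega, by simp [w3]; omega, ?_⟩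
              refine tail _ ((F1.trans (Frame.set _ _ _ (by decide))).trans
                (Frame.set _ _ _ (by decide))) ?_ ?_ ?_ ?_ ?_ ?_ ?_ ?_ <;>
                simp [h, h', h'', w2, w3, w4, w5, hla, hlb, hc]
          · rw [wp_assign]
            refine ⟨by simp; omega, by simp; omega, ?_⟩
            refine tail _ ((F1.trans (Frame.set _ _ _ (by decide))).trans
              (Frame.set _ _ _ (by decide))) ?_ ?_ ?_ ?_ ?_ ?_ ?_ ?_ <;>
              simp [h, h', w2, w3, w4, w5, hla, hlb, hc]
      · simp [v2, v3, v4] at c2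
        rw [wp_assign]
        exact ⟨by simp; omega, by simp; omega, hinact (by omega), by simp; omega⟩
    · simp [v1, v2, v4] at c1
      rw [wp_assign]
      exact ⟨by simp; omega, by simp; omega, hinact (by omega), by simp; omega⟩

end

end LCE

namespace LCE

/-! ### Seeds by majority decisions, and the list of final boundaries -/

section
variable {E : Env} {n τ J A K : ℕ}

/-- One round of the greedy choice: fixes the bit `bit` of the seed `cur`. -/
def roundCode : Stmt :=
  .c0 ≔ 0 ;; .c1 ≔ 0 ;; .c01 ≔ 0 ;; .c10 ≔ 0 ;; .s0 ≔ 0 ;; .s1 ≔ 0 ;; .s2 ≔ 0 ;; .more ≔ 0 ;;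
  passCode statCode ;;
  .ite (.lt ♯.c1 ♯.c0) (.cur ≔ ♯.cur + ♯.bit) (.d ≔ 0) ;;
  .bit ≔ 2 * ♯.bit

/-- Computes the seed of level `lam`. -/
def seedCode : Stmt :=
  .tgt ≔ ♯.lam ;; .cur ≔ 0 ;; .bit ≔ 2 ;; .more ≔ 1 ;;
  .while (.eq ♯.more 1) roundCode ;;
  .ite (.lt ♯.c01 ♯.c10) (.cur ≔ ♯.cur + 1) (.d ≔ 0) ;;
  .store .seed ♯.lam ♯.cur

/-- Variables that the computation of seeds changes. -/
def seedVars : List Var := pipeVars ++ [.cur, .bit, .s0, .s1, .s2, .c0, .c1, .c01, .c10, .more, .tgt]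

def statCost (n τ K lam : ℕ) : ℕ := passCost n τ K lam (2 * τ + 2 * (K + 1))

open Classical in
-- One full pass over the text evaluates the current seed. The counters `c0` and `c1` belong to the
-- pairs decided by bit `k`, `c01` and `c10` to the orientation of the labels, and `more` tells
-- whether some active pair still differs in bit `k` or above.
theorem wp_roundCode (S : Setup E n τ J A K) {ρ : ℕ → ℕ} {σ : St} (hC : Ctx n τ J σ) {lam k r : ℕ}
    (htgt : σ.v .tgt = lam) (hlam : lam < 6 * J) (hρ : ∀ q < lam, σ.a .seed q = ρ q)
    (hρK : ∀ q < lam, ρ q < 2 ^ (K + 1)) (hk : k ≤ K + 1) (hr : r < 2 ^ k)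
    (hcur : σ.v .cur = r) (hbit : σ.v .bit = 2 ^ k) {Q : St → Prop}
    (hQ : ∀ A' u w, A' = (reals n (lvl E.f n τ J ρ lam)).filter
          (Active (ell τ J lam) (lvl E.f n τ J ρ lam)) →
      u = idL (shifted E.f n) (n + 1) (ell τ J lam) (lvl E.f n τ J ρ lam) →
      w = idR (shifted E.f n) (n + 1) (ell τ J lam) (lvl E.f n τ J ρ lam) →
      ∀ σ', Frame seedVars pipeArrs σ σ' → σ'.v .tgt = lam → σ'.v .bit = 2 ^ (k + 1) →
      (σ'.v .cur = if (neTop A' u w k r).card < (eqTop A' u w k r).card then r + 2 ^ k else r) →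
      σ'.v .more ≤ 1 → (σ'.v .more = 0 ↔ ∀ x ∈ A', u x / 2 ^ k = w x / 2 ^ k) →
      σ'.v .c01 = (A'.filter fun x => dot r (u x) % 2 < dot r (w x) % 2).card →
      σ'.v .c10 = (A'.filter fun x => dot r (w x) % 2 < dot r (u x) % 2).card →
      σ'.clk ≤ σ.clk + statCost n τ K lam → Q σ') :
    wp E roundCode Q σ := by
  have hW := S.word_lin
  have hW2 := S.word_id
  have hK := S.K_le
  have hbound : 2 * 2 ^ k ≤ 16 * ((n + 1) * (A + 2)) := by
    have := Nat.pow_le_pow_right (show 0 < 2 by norm_num) hk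
    rw [pow_succ] at this; omega
  simp only [roundCode]
  iterate 8 rw [wp_seq, wp_assign]
  simp only [Expr.ok_ofNat, Expr.eval_ofNat]
  refine ⟨by omega, by omega, by omega, by omega, by omega, by omega, by omega, by omega, by omega,
    by omega, by omega, by omega, by omega, by omega, by omega, by omega, ?_⟩
  set σ₁ : St := (((((((σ.set .c0 0).set .c1 0).set .c01 0).set .c10 0).set .s0 0).set .s1 0).set .s2
    0).set .more 0 with hσ₁
  have f1 : Frame [.c0, .c1, .c01, .c10, .s0, .s1, .s2, .more] [] σ σ₁ :=
    ⟨fun y hy => by simp at hy; simp [hσ₁, hy], fun y hy => by simp [hσ₁]⟩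
  have hstat : Stat (shifted E.f n) (n + 1) (ell τ J lam) k r [] σ₁ := by
    constructor <;> simp [hσ₁, hcur, hbit, winCount, wins, last3, winState]
  have hrK : r < 2 ^ (K + 1) := hr.trans_le (Nat.pow_le_pow_right (by norm_num) hk)
  rw [wp_seq]
  refine wp_passCode S (stat_action S (ρ := ρ) hk hrK hlam) (hC.congr f1 (by decide))
    (by simp [hσ₁, htgt]) hlam.le (by simpa [hσ₁] using hρ) hρK hstat fun σ₂ M f2 hM hs c2 => ?_
  have f2' : Frame (pipeVars ++ [.cur, .bit, .s0, .s1, .s2, .c0, .c1, .c01, .c10, .more]) pipeArrs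
      σ₁ σ₂ := f2.mono (by decide) (by decide)
  have htgt2 : σ₂.v .tgt = lam := by rw [f2.v _ (by decide)]; simp [hσ₁, htgt]
  have ha := lvl_adm (f := E.f) (J := J) (ρ := ρ) S.pos S.le lam
  have hln : ell τ J lam ≤ n := (ell_le _ _ _).trans S.le
  obtain ⟨g1, g2, g3, g4, g5, g6, g7, g8, g9⟩ := hs
  rw [winCount_els ha hM hln] at g4 g5 g6 g7 g9
  have hQ := hQ _ _ _ rfl rfl rfl
  set A' := (reals n (lvl E.f n τ J ρ lam)).filter
          (Active (ell τ J lam) (lvl E.f n τ J ρ lam))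
  set u := idL (shifted E.f n) (n + 1) (ell τ J lam) (lvl E.f n τ J ρ lam)
  set w := idR (shifted E.f n) (n + 1) (ell τ J lam) (lvl E.f n τ J ρ lam)
  have e4 : σ₂.v .c0 = (eqTop A' u w k r).card := g4
  have e5 : σ₂.v .c1 = (neTop A' u w k r).card := g5
  have e9 : σ₂.v .more = 0 ↔ ∀ x ∈ A', u x / 2 ^ k = w x / 2 ^ k := by
    rw [g9, Finset.card_eq_zero, Finset.filter_eq_empty_iff]
    simp
  have hclk : σ₂.clk ≤ σ.clk + statCost n τ K lam := by
    simpa [hσ₁, statCost] using c2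
  have hpow : 2 * 2 ^ k = 2 ^ (k + 1) := by rw [pow_succ]; omega
  have F0 : Frame seedVars pipeArrs σ σ₂ :=
    (f1.mono (by decide) (by decide)).trans (f2'.mono (by decide) (by decide))
  simp only [wp_seq, wp_ite, wp_assign]
  simp [e4, e5, g1, g2]
  refine ⟨fun h => ?_, fun h => ?_⟩
  · and_intros <;> try omega
    refine hQ _ ?_ ?_ ?_ ?_ ?_ ?_ ?_ ?_ ?_
    · exact (F0.trans (Frame.set _ _ _ (by decide))).trans (Frame.set _ _ _ (by decide))
    · simp [htgt2]
    · simp [hpow]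
    · simp [h]
    · simpa using g8
    · simpa using e9
    · simpa using g6
    · simpa using g7
    · simpa using hclk
  · and_intros <;> try omega
    refine hQ _ ?_ ?_ ?_ ?_ ?_ ?_ ?_ ?_ ?_
    · exact (F0.trans (Frame.set _ _ _ (by decide))).trans (Frame.set _ _ _ (by decide))
    · simp [htgt2]
    · simp [hpow]
    · simp [g1]; omega
    · simpa using g8
    · simpa using e9
    · simpa using g6
    · simpa using g7
    · simpa using hclk

open Classical in
theorem wp_seedCode (S : Setup E n τ J A K) {ρ : ℕ → ℕ} {σ : St} (hC : Ctx n τ J σ) {lam : ℕ}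
    (hl : σ.v .lam = lam) (hlam : lam < 6 * J) (hρ : ∀ q < lam, σ.a .seed q = ρ q)
    (hρK : ∀ q < lam, ρ q < 2 ^ (K + 1)) {Q : St → Prop}
    (hQ : ∀ σ', Frame seedVars (.seed :: pipeArrs) σ σ' →
      (∀ q, q ≠ lam → σ'.a .seed q = σ.a .seed q) → σ'.a .seed lam < 2 ^ (K + 1) →
      (lam % 2 = 1 → GoodSeed (shifted E.f n) n (ell τ J lam) (σ'.a .seed lam) (lvl E.f n τ J ρ lam)) →
      σ'.clk ≤ σ.clk + (K + 1) * (statCost n τ K lam + 1) → Q σ') :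
    wp E seedCode Q σ := by
  have hW := S.word_lin
  have hW2 := S.word_id
  have hK := S.K_le
  have hsp := S.space
  have hJm := S.J_le_m
  have hmn := S.m_le
  have hKW : 4 * 2 ^ (K + 1) ≤ E.W := by rw [pow_succ]; omega
  obtain ⟨A', hA'⟩ : ∃ A', A' = (reals n (lvl E.f n τ J ρ lam)).filter
          (Active (ell τ J lam) (lvl E.f n τ J ρ lam)) := ⟨_, rfl⟩
  obtain ⟨u, hu⟩ : ∃ u, u = idL (shifted E.f n) (n + 1) (ell τ J lam) (lvl E.f n τ J ρ lam) := ⟨_, rfl⟩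
  obtain ⟨w, hw⟩ : ∃ w, w = idR (shifted E.f n) (n + 1) (ell τ J lam) (lvl E.f n τ J ρ lam) := ⟨_, rfl⟩
  have hodd1 : ∀ x ∈ A', u x % 2 = 1 := fun x _ => by rw [hu]; exact pid_odd _ _ _ _ _ _
  have hodd2 : ∀ x ∈ A', w x % 2 = 1 := fun x _ => by rw [hw]; exact pid_odd _ _ _ _ _ _
  have hln : ell τ J lam ≤ n := (ell_le _ _ _).trans S.le
  have hltK : ∀ x ∈ A', u x < 2 ^ K ∧ w x < 2 ^ K := by
    intro x hx
    rw [hA', Finset.mem_filter] at hx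
    obtain ⟨h1, h2⟩ := hx.2
    have := S.le_K
    rw [hu, hw]
    exact ⟨(pid_lt S (by omega)).trans_le this, (pid_lt S (by omega)).trans_le this⟩
  have htop : ∀ k, K ≤ k → ∀ x ∈ A', u x / 2 ^ k = w x / 2 ^ k := by
    intro k hk x hx
    have hp := Nat.pow_le_pow_right (show 0 < 2 by norm_num) hk
    obtain ⟨h1, h2⟩ := hltK x hx
    rw [Nat.div_eq_of_lt (by omega), Nat.div_eq_of_lt (by omega)]
  simp only [seedCode]
  iterate 4 rw [wp_seq, wp_assign]
  simp only [Expr.ok_ofNat, Expr.eval_ofNat, Expr.ok_var, Expr.eval_var, hl]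
  refine ⟨trivial, by omega, by omega, by omega, by omega, by omega, by omega, by omega, ?_⟩
  set σ₁ : St := (((σ.set .tgt lam).set .cur 0).set .bit 2).set .more 1 with hσ₁
  have f1 : Frame seedVars pipeArrs σ σ₁ := (((Frame.set _ _ _ (by decide)).trans
    (Frame.set _ _ _ (by decide))).trans (Frame.set _ _ _ (by decide))).trans
    (Frame.set _ _ _ (by decide))
  rw [wp_seq]
  refine wp_while (fun σ' => Frame seedVars pipeArrs σ σ' ∧ σ'.v .tgt = lam ∧
      ∃ k, 1 ≤ k ∧ k ≤ K + 1 ∧ SeedInv A' u w k (σ'.v .cur) ∧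
      ((σ'.v .more = 1 ∧ σ'.v .bit = 2 ^ k) ∨ (σ'.v .more = 0 ∧ σ'.v .bit = 2 ^ (k + 1) ∧
        (∀ x ∈ A', u x / 2 ^ k = w x / 2 ^ k) ∧
        σ'.v .c01 = (A'.filter fun x => dot (σ'.v .cur) (u x) % 2 < dot (σ'.v .cur) (w x) % 2).card ∧
        σ'.v .c10 =
          (A'.filter fun x => dot (σ'.v .cur) (w x) % 2 < dot (σ'.v .cur) (u x) % 2).card)))
    -- The variable `bit` starts at 2 and doubles in every round, so this measure starts at `K + 1`.
    (fun σ' => if σ'.v .more = 1 then K + 2 - Nat.log 2 (σ'.v .bit) else 0) (statCost n τ K lam + 1)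
    ?_ ?_ ?_ ?_
  · refine ⟨f1, by simp [hσ₁], 1, le_rfl, by omega, ?_, Or.inl ⟨by simp [hσ₁], by simp [hσ₁]⟩⟩
    simpa [hσ₁] using SeedInv.start hodd1 hodd2
  · intro _ _ _; simp; omega
  · rintro σ' - ⟨hf, ht, k, hk1, hk2, hinv, hor⟩ hc
    simp only [Cond.eval_eq, Expr.eval_var, Expr.eval_ofNat] at hc
    rcases hor with ⟨-, hb⟩ | ⟨h0, -⟩
    swap
    · omega
    have hC' : Ctx n τ J σ' := hC.congr hf (by decide)
    refine wp_roundCode S (σ := σ'.tick) (ρ := ρ) (k := k) (r := σ'.v .cur)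
      ⟨hC'.n, hC'.tau, hC'.m, hC'.h, hC'.o, hC'.J⟩ ht hlam ?_ hρK hk2 hinv.1 rfl hb ?_
    · intro q hq; simp only [St.tick_a]; rw [hf.a _ (by decide)]; exact hρ q hq
    intro A'' u' w' hA'' hu' hw' σ'' hf2 ht2 hb2 hcur hm1 hm2 h01 h10 hcl
    rw [← hA'] at hA''
    rw [← hu] at hu'
    rw [← hw] at hw'
    subst hA'' hu' hw'
    have hstep := hinv.step hk1
    rw [← hcur] at hstep
    have hclk : σ''.clk ≤ σ'.clk + (statCost n τ K lam + 1) := by simp at hcl; omega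
    have hlog : Nat.log 2 (2 ^ k) = k := Nat.log_pow (by norm_num) k
    have hlog' : Nat.log 2 (2 ^ (k + 1)) = k + 1 := Nat.log_pow (by norm_num) (k + 1)
    have hF := hf.trans ((Frame.tick _ _ _).trans hf2)
    by_cases hmore : σ''.v .more = 0
    · have hall := hm2.mp hmore
      -- In the last round no pair has `k` as its highest differing bit, so the seed is not changed
      -- after the pass, and the counters `c01` and `c10` describe the seed that is kept.
      have he : (eqTop A'' u' w' k (σ'.v .cur)).card = 0 := by
        rw [Finset.card_eq_zero]
        exact Finset.filter_eq_empty_iff.mpr fun x hx h => h.1 (hall x hx)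
      rw [he, if_neg (by omega)] at hcur
      refine ⟨⟨hF, ht2, k, hk1, hk2, by rw [hcur]; exact hinv,
        Or.inr ⟨hmore, hb2, hall, by rw [hcur]; exact h01, by rw [hcur]; exact h10⟩⟩, ?_, hclk⟩
      simp only [hmore, hc, hb, hlog]
      simp; omega
    · have hkK : k < K := by
        by_contra hh
        exact hmore (hm2.mpr (htop k (by omega)))
      refine ⟨⟨hF, ht2, k + 1, by omega, by omega, hstep, Or.inl ⟨by omega, hb2⟩⟩, ?_, hclk⟩
      simp only [show σ''.v .more = 1 by omega, hc, hb, hb2, hlog, hlog']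
      simp; omega
  · rintro σ' - ⟨hf, ht, k, hk1, hk2, hinv, hor⟩ hc hcl
    simp only [Cond.eval_eq, Expr.eval_var, Expr.eval_ofNat] at hc
    rcases hor with ⟨h1, -⟩ | ⟨h0, hb, hall, h01, h10⟩
    · omega
    have hlam' : σ'.v .lam = lam := by rw [hf.v _ (by decide), hl]
    have hclk : σ'.clk ≤ σ.clk + (K + 1) * (statCost n τ K lam + 1) := by
      have hlog : Nat.log 2 2 = 1 := by decide
      simpa [hσ₁, hlog] using hcl
    have hpk := Nat.pow_le_pow_right (show 0 < 2 by norm_num) hk2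
    have hcur1 : σ'.v .cur + 1 < 2 ^ k := by
      have h1 := hinv.1
      have h2 := hinv.2.1
      have : 2 ^ k % 2 = 0 := by
        obtain ⟨j, rfl⟩ := Nat.exists_eq_add_of_le hk1
        rw [pow_add]; omega
      omega
    have good : ∀ r', (r' = if (A'.filter fun x => dot (σ'.v .cur) (u x) % 2 < dot (σ'.v .cur) (w x) % 2).card
        < (A'.filter fun x => dot (σ'.v .cur) (w x) % 2 < dot (σ'.v .cur) (u x) % 2).card
        then σ'.v .cur + 1 else σ'.v .cur) → lam % 2 = 1 →
        GoodSeed (shifted E.f n) n (ell τ J lam) r' (lvl E.f n τ J ρ lam) := by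
      intro r' hr' hodd
      have hne : ∀ x ∈ A', u x ≠ w x := by
        intro x hx
        rw [hA', Finset.mem_filter, mem_reals] at hx
        rw [hu, hw]
        exact idL_ne_idR S.pos S.le hodd hx.1.2 hx.2
      have := hinv.final hodd1 hodd2 hne hall hr'
      unfold GoodSeed
      rw [hA', hu, hw, Finset.filter_filter] at this
      exact this
    rw [wp_seq, wp_ite]
    simp only [wp_assign, wp_store]
    simp only [Cond.ok_lt, Cond.eval_lt, Expr.ok_var, Expr.eval_var, Expr.ok_add, Expr.eval_add,
      Expr.ok_ofNat, Expr.eval_ofNat, St.set_v, reduceCtorEq, if_false, if_true, hlam', h01, h10]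
    refine ⟨⟨trivial, trivial⟩, fun h => ?_, fun h => ?_⟩
    · refine ⟨⟨trivial, by omega, by omega⟩, by omega, trivial, trivial, by omega, by omega,
        hQ _ ?_ ?_ ?_ ?_ ?_⟩
      · exact ((hf.trans (Frame.set _ _ _ (by decide))).mono (by simp) (by simp)).trans
          (Frame.setA _ _ _ _ (by decide))
      · intro q hq; simp [hq]; rw [hf.a _ (by decide)]
      · simp; omega
      · simp only [St.setA_a, if_true]
        exact good _ (by rw [if_pos h])
      · simpa using hclk
    · refine ⟨by omega, by omega, trivial, trivial, by omega, by omega,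
        hQ _ ?_ ?_ ?_ ?_ ?_⟩
      · exact ((hf.trans (Frame.set _ _ _ (by decide))).mono (by simp) (by simp)).trans
          (Frame.setA _ _ _ _ (by decide))
      · intro q hq; simp [hq]; rw [hf.a _ (by decide)]
      · simp; omega
      · simp only [St.setA_a, if_true]
        exact good _ (by rw [if_neg h])
      · simpa using hclk

/-- Computes the seeds of all levels. -/
def seedsCode : Stmt := .lam ≔ 0 ;; .while (.lt ♯.lam ♯.nlam) (seedCode ;; .lam ≔ ♯.lam + 1)

theorem statCost_mono (n τ K : ℕ) {a b : ℕ} (h : a ≤ b) : statCost n τ K a ≤ statCost n τ K b := by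
  unfold statCost passCost pushCost
  gcongr

theorem wp_seedsCode (S : Setup E n τ J A K) {σ : St} (hC : Ctx n τ J σ) (hnl : σ.v .nlam = 6 * J)
    {Q : St → Prop}
    (hQ : ∀ σ', Frame (.lam :: seedVars) (.seed :: pipeArrs) σ σ' →
      (∀ q < 6 * J, σ'.a .seed q < 2 ^ (K + 1)) →
      (∀ q < 6 * J, q % 2 = 1 → GoodSeed (shifted E.f n) n (ell τ J q) (σ'.a .seed q)
        (lvl E.f n τ J (σ'.a .seed) q)) →
      σ'.clk ≤ σ.clk + 6 * J * ((K + 1) * (statCost n τ K (6 * J) + 1) + 1) → Q σ') :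
    wp E seedsCode Q σ := by
  have hW := S.word_lin
  have hJm := S.J_le_m
  have hmn := S.m_le
  simp only [seedsCode]
  rw [wp_seq, wp_assign]
  refine ⟨by simp; omega, by simp; omega, ?_⟩
  refine wp_while (fun σ' => Frame (.lam :: seedVars) (.seed :: pipeArrs) σ σ' ∧ σ'.v .lam ≤ 6 * J ∧
      (∀ q < σ'.v .lam, σ'.a .seed q < 2 ^ (K + 1)) ∧
      (∀ q < σ'.v .lam, q % 2 = 1 → GoodSeed (shifted E.f n) n (ell τ J q) (σ'.a .seed q)
        (lvl E.f n τ J (σ'.a .seed) q)))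
    (fun σ' => 6 * J - σ'.v .lam) ((K + 1) * (statCost n τ K (6 * J) + 1) + 1) ?_ ?_ ?_ ?_
  · exact ⟨Frame.set _ _ _ (by decide), by simp, by simp, by simp⟩
  · intro _ _ _; simp
  · rintro σ' - ⟨hf, h1, h2, h3⟩ hc
    have en : σ'.v .nlam = 6 * J := by rw [hf.v _ (by decide), hnl]
    simp only [Cond.eval_lt, Expr.eval_var, en] at hc
    have hC' : Ctx n τ J σ' := hC.congr hf (by decide)
    rw [wp_seq]
    refine wp_seedCode S (σ := σ'.tick) (ρ := σ'.a .seed) (lam := σ'.v .lam)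
      ⟨hC'.n, hC'.tau, hC'.m, hC'.h, hC'.o, hC'.J⟩ rfl hc (fun _ _ => rfl) h2
      fun σ₂ f2 s2 b2 g2 c2 => ?_
    have el : σ₂.v .lam = σ'.v .lam := by rw [f2.v _ (by decide)]; rfl
    have hmono : (K + 1) * (statCost n τ K (σ'.v .lam) + 1) ≤
        (K + 1) * (statCost n τ K (6 * J) + 1) := by
      have := statCost_mono n τ K h1
      gcongr
    simp only [St.tick_clk, St.tick_a] at c2 s2
    rw [wp_assign]
    simp only [Expr.eval_add, Expr.eval_var, Expr.eval_ofNat, Expr.ok_add, Expr.ok_var, Expr.ok_ofNat,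
      el, St.set_v, if_true, St.set_a, St.set_clk]
    refine ⟨⟨trivial, by omega, by omega⟩, by omega, ⟨?_, by omega, ?_, ?_⟩, by omega, by omega⟩
    · exact ((hf.trans (Frame.tick _ _ _)).trans (f2.mono (by simp) (by simp))).trans
        (Frame.set _ _ _ (by decide))
    · intro q hq
      by_cases e : q = σ'.v .lam
      · rw [e]; exact b2
      · rw [s2 q e]; exact h2 q (by omega)
    · intro q hq hodd
      -- The levels up to the current one do not use the seed that has just been written.
      have hl : lvl E.f n τ J (σ₂.a .seed) q = lvl E.f n τ J (σ'.a .seed) q :=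
        lvl_congr fun k hk => s2 k (by omega)
      rw [hl]
      by_cases e : q = σ'.v .lam
      · rw [e] at hodd ⊢; exact g2 hodd
      · rw [s2 q e]; exact h3 q (by omega) hodd
  · rintro σ' - ⟨hf, h1, h2, h3⟩ hc hcl
    have en : σ'.v .nlam = 6 * J := by rw [hf.v _ (by decide), hnl]
    simp only [Cond.eval_lt, Expr.eval_var, en] at hc
    have e : σ'.v .lam = 6 * J := by omega
    rw [e] at h2 h3
    exact hQ σ' hf h2 h3 (by simpa using hcl)

/-! ### The points -/

theorem lvl_subset_base {f : ℕ → ℕ} {ρ : ℕ → ℕ} (lam : ℕ) : lvl f n τ J ρ lam ⊆ base f n τ := by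
  induction lam with
  | zero => exact fun _ h => h
  | succ lam ih => exact fun x hx => ih hx.1

/-- Stores the boundary `z`, unless it is a sentinel. -/
def storeCode : Stmt :=
  .ite (.lt ♯.z (2 * ♯.o)) (.store .P ♯.N (♯.z - ♯.o) ;; .N ≔ ♯.N + 1) (.d ≔ 0)

theorem length_filter_els_le {f : ℕ → ℕ} {ρ : ℕ → ℕ} (hτ : 1 ≤ τ) (lam M : ℕ) :
    ((els (lvl f n τ J ρ lam) M).filter (· < 2 * (n + 1))).length ≤
      (reals n (lvl f n τ J ρ lam)).card := by
  rw [← List.toFinset_card_of_nodup ((els_nodup _ _).filter _)]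
  refine Finset.card_le_card fun x hx => ?_
  simp only [List.mem_toFinset, List.mem_filter, mem_els, decide_eq_true_eq] at hx
  rw [mem_reals]
  have hb := lvl_subset_base lam hx.1.2
  refine ⟨⟨(base_adm hτ).le x hb, ?_⟩, hx.1.2⟩
  rcases hb with ⟨-, h⟩ | ⟨k, hk, rfl⟩
  · have := h.lt hτ; omega
  · nlinarith

theorem store_action (S : Setup E n τ J A K) {ρ : ℕ → ℕ}
    (hcard : (reals n (lvl E.f n τ J ρ (6 * J))).card < E.Z) :
    Action E n τ J ρ (6 * J) storeCode (fun L σ => (List.range (σ.v .N)).map (σ.a .P) =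
      (L.filter (· < 2 * (n + 1))).map (· - (n + 1))) 0 where
  vars := by decide
  arrs := by decide
  frame σ σ' L hf h := by rw [hf.v _ (by decide), hf.a _ (by decide)]; exact h
  step σ z hC htgt hseed hz hσz hzW hI := by
    have hW := S.word_lin
    have hlen := congrArg List.length hI
    simp only [List.length_map, List.length_range] at hlen
    have hle := length_filter_els_le (f := E.f) (n := n) (J := J) (ρ := ρ) S.pos (6 * J) z
    have hle2 : σ.v .N ≤ z := by
      rw [hlen]; exact (List.length_filter_le _ _).trans (els_length_le _ _)
    rw [← hlen] at hle
    simp only [storeCode, wp_ite, wp_seq]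
    simp only [wp_store, wp_assign]
    simp [hσz, hC.o]
    refine ⟨by omega, fun h => ?_, fun h => ?_⟩
    · refine ⟨by omega, by omega, by omega, by omega, by omega, ?_⟩
      rw [List.range_succ, List.map_append,
        List.filter_cons_of_pos (by simpa using h), ← hI]
      congr 1
      · refine List.map_congr_left fun t ht => ?_
        rw [List.mem_range] at ht
        simp only [St.setA_a, if_true]
        rw [if_neg (by omega)]
      · simp
    · refine ⟨by omega, ?_⟩
      rw [List.filter_cons_of_neg (by simpa using h)]
      simpa using hI

/-- The array `P` lists the boundaries at the last level. -/
structure Points (B : Set ℕ) (n N : ℕ) (P : ℕ → ℕ) : Prop where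
  lt : ∀ s t, s < t → t < N → P s < P t
  mem : ∀ x, (∃ t < N, P t = x) ↔ x < n ∧ x + (n + 1) ∈ B

theorem els_pairwise (B : Set ℕ) (M : ℕ) : (els B M).Pairwise (· < ·) :=
  List.pairwise_lt_range.filter _

theorem points_of_list {f : ℕ → ℕ} {ρ : ℕ → ℕ} (hτ : 1 ≤ τ) {lam M N : ℕ} {P : ℕ → ℕ}
    (hM : 4 * (n + 1) ≤ M) (h : (List.range N).map P =
      ((els (lvl f n τ J ρ lam) M).filter (· < 2 * (n + 1))).map (· - (n + 1))) :
    Points (lvl f n τ J ρ lam) n N P := by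
  have hge : ∀ x ∈ lvl f n τ J ρ lam, n + 1 ≤ x := fun x hx =>
    (base_adm hτ).le x (lvl_subset_base lam hx)
  constructor
  · have hp : ((List.range N).map P).Pairwise (· < ·) := by
      rw [h, List.pairwise_map]
      refine ((els_pairwise _ _).filter _).imp_of_mem fun {a b} ha hb hab => ?_
      have h1 := hge a (mem_els.mp (List.mem_filter.mp ha).1).2
      omega
    intro s t hst ht
    rw [List.pairwise_iff_getElem] at hp
    have := hp s t (by simp; omega) (by simpa using ht) hst
    rw [List.getElem_map, List.getElem_map, List.getElem_range, List.getElem_range] at this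
    exact this
  · intro x
    have h1 : (∃ t < N, P t = x) ↔ x ∈ (List.range N).map P := by simp
    rw [h1, h]
    simp only [List.mem_map, List.mem_filter, mem_els, decide_eq_true_eq]
    constructor
    · rintro ⟨y, ⟨⟨-, hy⟩, hy2⟩, rfl⟩
      have := hge y hy
      rw [Nat.sub_add_cancel this]
      refine ⟨?_, hy⟩
      rcases lvl_subset_base lam hy with ⟨-, h⟩ | ⟨k, hk, rfl⟩
      · exact h.lt hτ
      · nlinarith
    · rintro ⟨hx, hxB⟩
      exact ⟨x + (n + 1), ⟨⟨by omega, hxB⟩, by omega⟩, by omega⟩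

/-- Lists the boundaries at the last level, with the sentinel `n` behind them. -/
def pointsCode : Stmt :=
  .tgt ≔ ♯.nlam ;; .N ≔ 0 ;; passCode storeCode ;; .store .P ♯.N ♯.n

theorem wp_pointsCode (S : Setup E n τ J A K) {σ : St} (hC : Ctx n τ J σ) (hnl : σ.v .nlam = 6 * J)
    (hρK : ∀ q < 6 * J, σ.a .seed q < 2 ^ (K + 1))
    (hg : ∀ q < 6 * J, q % 2 = 1 → GoodSeed (shifted E.f n) n (ell τ J q) (σ.a .seed q)
        (lvl E.f n τ J (σ.a .seed) q)) {Q : St → Prop}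
    (hQ : ∀ σ', Frame (pipeVars ++ [.tgt, .N]) (pipeArrs ++ [.P]) σ σ' →
      σ'.v .N ≤ 128 * (n / τ) → σ'.a .P (σ'.v .N) = n →
      Points (lvl E.f n τ J (σ.a .seed) (6 * J)) n (σ'.v .N) (σ'.a .P) →
      σ'.clk ≤ σ.clk + passCost n τ K (6 * J) 0 → Q σ') :
    wp E pointsCode Q σ := by
  have hW := S.word_lin
  have hsp := S.space
  have hJm := S.J_le_m
  have hmn := S.m_le
  have hmp := S.m_pos
  have hcard : (reals n (lvl E.f n τ J (σ.a .seed) (6 * J))).card ≤ 128 * (n / τ) := by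
    have h1 := card_lvl S.le S.lt_J.le hg
    -- Since n/τ is at least 1, rounding down loses at most a factor of 2, which turns the bound 64
    -- n/τ into 128 times the rounded quotient.
    have h2 : n ≤ 2 * (n / τ) * τ := by
      have := Nat.lt_div_mul_add (a := n) S.pos
      have h3 : 1 * τ ≤ n / τ * τ := Nat.mul_le_mul_right τ hmp
      rw [mul_assoc]; omega
    refine Nat.le_of_mul_le_mul_right (c := τ) ?_ S.pos
    calc _ ≤ 64 * n := h1
      _ ≤ 64 * (2 * (n / τ) * τ) := by omega
      _ = _ := by ring
  simp only [pointsCode]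
  rw [wp_seq, wp_assign, wp_seq, wp_assign, wp_seq]
  refine ⟨by simp, by simp [hnl]; omega, by simp; omega, by simp; omega, ?_⟩
  simp only [Expr.eval_var, hnl, Expr.eval_ofNat]
  have f1 : Frame [.tgt, .N] [] σ ((σ.set .tgt (6 * J)).set .N 0) :=
    (Frame.set _ _ _ (by decide)).trans (Frame.set _ _ _ (by decide))
  refine wp_passCode S (store_action S (ρ := σ.a .seed) (by omega)) (hC.congr f1 (by decide))
    (by simp) le_rfl (by simp) hρK (by simp) fun σ₂ M f2 hM hI c2 => ?_
  have hN : σ₂.v .N ≤ 128 * (n / τ) := by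
    have hlen := congrArg List.length hI
    simp only [List.length_map, List.length_range] at hlen
    rw [hlen]; exact (length_filter_els_le S.pos _ _).trans hcard
  have en : σ₂.v .n = n := by rw [f2.v _ (by decide)]; simp [hC.n]
  have hpt := points_of_list S.pos hM hI
  rw [wp_store]
  simp only [Expr.ok_var, Expr.eval_var, en]
  refine ⟨trivial, trivial, by omega, by omega, hQ _ ?_ (by simpa using hN) (by simp) ?_
    (by simpa using c2)⟩
  · exact ((f1.mono (by decide) (by decide)).trans (f2.mono (by decide) (by decide))).trans
      (Frame.setA _ _ _ _ (by decide))
  · have hP : ∀ t < σ₂.v .N, (σ₂.setA .P (σ₂.v .N) n).a .P t = σ₂.a .P t := by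
      intro t ht; simp; omega
    refine ⟨fun s t hst ht => ?_, fun x => ?_⟩
    · simp only [St.setA_v] at ht
      rw [hP s (by omega), hP t ht]; exact hpt.lt s t hst ht
    · rw [← hpt.mem]
      simp only [St.setA_v]
      refine exists_congr fun t => and_congr_right fun ht => ?_
      rw [hP t ht]

end

end LCE

namespace LCE

/-! ### The order of suffixes -/

/-- The text with an end marker. -/
def mark (f : ℕ → ℕ) (n x : ℕ) : ℕ := if x < n then f x + 1 else 0

/-- The suffix at `p` is smaller than the suffix at `q`, and `d` is the first difference. -/
def Dif (g : ℕ → ℕ) (p q d : ℕ) : Prop := (∀ t < d, g (p + t) = g (q + t)) ∧ g (p + d) < g (q + d)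

/-- Sorted suffixes behave like an ultrametric: the first difference of the outer two is the earlier
one of the two inner differences. -/
theorem Dif.trans {g : ℕ → ℕ} {a b c d d' : ℕ} (h : Dif g a b d) (h' : Dif g b c d') :
    Dif g a c (min d d') := by
  refine ⟨fun t ht => (h.1 t (by omega)).trans (h'.1 t (by omega)), ?_⟩
  rcases lt_trichotomy d d' with e | e | e
  · rw [min_eq_left e.le, ← h'.1 d e]; exact h.2
  · subst e; rw [min_self]; exact h.2.trans h'.2
  · rw [min_eq_right e.le, h.1 d' e]; exact h'.2

theorem Dif.ne {g : ℕ → ℕ} {a b d : ℕ} (h : Dif g a b d) : a ≠ b := by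
  rintro rfl; exact lt_irrefl _ h.2

section
variable {f : ℕ → ℕ} {n : ℕ}

/-- The end marker is smaller than every symbol and makes the suffixes pairwise different. The first
difference occurs at the latest where the shorter suffix ends, so it is the common prefix length. -/
theorem Dif.mlen_eq {p q d : ℕ} (h : Dif (mark f n) p q d) (hp : p < n) (hq : q < n) :
    mlen f p q (n - max p q) = d := by
  have hd : d ≤ n - max p q := by
    by_contra hlt
    have h1 := h.1 (n - max p q) (by omega)
    have := h.ne
    rcases le_total p q with hpq | hpq
    · rw [max_eq_right hpq] at h1
      simp only [mark] at h1
      rw [if_pos (by omega), if_neg (by omega)] at h1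
      omega
    · rw [max_eq_left hpq] at h1
      simp only [mark] at h1
      rw [if_neg (by omega), if_pos (by omega)] at h1
      omega
  refine mlen_unique hd (fun t ht => ?_) fun hlt he => ?_
  · have h1 := h.1 t ht
    simp only [mark] at h1
    rw [if_pos (by omega), if_pos (by omega)] at h1
    omega
  · have h2 := h.2
    simp only [mark] at h2
    rw [if_pos (by omega), if_pos (by omega)] at h2
    omega

/-- Comparison of two suffixes by their first difference. -/
theorem dif_of_mlen {p q : ℕ} (hp : p < n) (hq : q < n) (hpq : p ≠ q) {d : ℕ}
    (hd : d = mlen f p q (n - max p q)) :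
    (p + d = n ∨ (q + d ≠ n ∧ f (p + d) < f (q + d)) → Dif (mark f n) p q d) ∧
    (¬ (p + d = n ∨ (q + d ≠ n ∧ f (p + d) < f (q + d))) → Dif (mark f n) q p d) := by
  have hle := mlen_le f p q (n - max p q)
  have heq : ∀ t < d, mark f n (p + t) = mark f n (q + t) := fun t ht => by
    have := mlen_eq f p q (n - max p q) (t := t) (by omega)
    simp only [mark]
    rw [if_pos (by omega), if_pos (by omega), this]
  have hne : d < n - max p q → f (p + d) ≠ f (q + d) := fun h => by
    rw [hd] at h ⊢; exact mlen_ne f p q _ h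
  constructor
  · intro h
    refine ⟨heq, ?_⟩
    simp only [mark]
    rcases h with h | ⟨h1, h2⟩
    · rw [if_neg (by omega), if_pos (by omega)]; omega
    · by_cases h3 : p + d = n
      · rw [if_neg (by omega), if_pos (by omega)]; omega
      · rw [if_pos (by omega), if_pos (by omega)]; omega
  · intro h
    refine ⟨fun t ht => (heq t ht).symm, ?_⟩
    simp only [mark]
    by_cases h3 : q + d = n
    · rw [if_neg (by omega), if_pos (by omega)]; omega
    · have := hne (by omega)
      rw [if_pos (by omega), if_pos (by omega)]; omega

theorem mlen_comm (f : ℕ → ℕ) (a b L : ℕ) : mlen f a b L = mlen f b a L := by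
  refine mlen_unique (mlen_le _ _ _ _) (fun t ht => (mlen_eq f b a L ht).symm) fun h => ?_
  exact (mlen_ne f b a L h).symm

theorem mlen_extend {a b L L' : ℕ} (h : mlen f a b L < L) (hL : L ≤ L') :
    mlen f a b L' = mlen f a b L :=
  mlen_unique (h.le.trans hL) (fun _ ht => mlen_eq f a b L ht) fun _ => mlen_ne f a b L h

theorem mlen_add {a b e L : ℕ} (h : ∀ t < e, f (a + t) = f (b + t)) :
    mlen f a b (e + L) = e + mlen f (a + e) (b + e) L := by
  have hle := mlen_le f (a + e) (b + e) L
  refine mlen_unique (by omega) (fun t ht => ?_) fun hlt => ?_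
  · by_cases hte : t < e
    · exact h t hte
    · have := mlen_eq f (a + e) (b + e) L (t := t - e) (by omega)
      rwa [show a + e + (t - e) = a + t by omega, show b + e + (t - e) = b + t by omega] at this
  · have := mlen_ne f (a + e) (b + e) L (by omega)
    rwa [add_assoc, add_assoc] at this

end

/-- With this length the comparison stops at the end of the shorter suffix, and the default value of
the text is never read. -/
theorem lcp_drop (T : List ℕ) (L i j : ℕ) (hL : L = T.length - max i j) (hi : i ≤ T.length)
    (hj : j ≤ T.length) : lcp (T.drop i) (T.drop j) = mlen (fun x => T.getD x 0) i j L := by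
  induction L generalizing i j with
  | zero =>
    rcases Nat.lt_or_ge i T.length with h | h
    · rw [List.drop_of_length_le (i := j) (by omega), List.drop_eq_getElem_cons h]; rfl
    · rw [List.drop_of_length_le h]; rfl
  | succ L ih =>
    have h1 : i < T.length := by omega
    have h2 : j < T.length := by omega
    rw [List.drop_eq_getElem_cons h1, List.drop_eq_getElem_cons h2]
    simp only [lcp, mlen]
    rw [ih (i + 1) (j + 1) (by omega) (by omega) (by omega)]
    simp only [List.getD_eq_getElem _ _ h1, List.getD_eq_getElem _ _ h2]

theorem lce_eq (E : Env) {i j : ℕ} (hi : i ≤ E.T.length) (hj : j ≤ E.T.length) :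
    lce E.T i j = mlen E.f i j (E.T.length - max i j) :=
  lcp_drop E.T _ i j rfl hi hj

/-! ### Range minima -/

/-- `v` is the minimum of `L` on `[l, r]`. -/
def IsMin (L : ℕ → ℕ) (l r v : ℕ) : Prop :=
  (∀ u, l ≤ u → u ≤ r → v ≤ L u) ∧ ∃ u, l ≤ u ∧ u ≤ r ∧ L u = v

theorem IsMin.unique {L : ℕ → ℕ} {l r v v' : ℕ} (h : IsMin L l r v) (h' : IsMin L l r v') :
    v = v' := by
  obtain ⟨u, h1, h2, h3⟩ := h.2
  obtain ⟨u', h1', h2', h3'⟩ := h'.2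
  have := h.1 u' h1' h2'
  have := h'.1 u h1 h2
  omega

/-- The minimum on the union of two overlapping or adjacent ranges. -/
theorem IsMin.union {L : ℕ → ℕ} {l r l' r' v v' : ℕ} (h : IsMin L l r v) (h' : IsMin L l' r' v')
    (h1 : l ≤ l') (h2 : l' ≤ r + 1) (h3 : r ≤ r') : IsMin L l r' (min v v') := by
  constructor
  · intro u hu hu'
    by_cases hr : u ≤ r
    · exact (min_le_left _ _).trans (h.1 u hu hr)
    · exact (min_le_right _ _).trans (h'.1 u (by omega) hu')
  · obtain ⟨u, a1, a2, a3⟩ := h.2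
    obtain ⟨u', b1, b2, b3⟩ := h'.2
    rcases le_total v v' with hv | hv
    · exact ⟨u, a1, by omega, by rw [min_eq_left hv, a3]⟩
    · exact ⟨u', by omega, b2, by rw [min_eq_right hv, b3]⟩

theorem IsMin.single (L : ℕ → ℕ) (l : ℕ) : IsMin L l l (L l) :=
  ⟨fun u h1 h2 => by rw [show u = l by omega], l, le_rfl, le_rfl, rfl⟩

theorem IsMin.exists (L : ℕ → ℕ) {l r : ℕ} (h : l ≤ r) : ∃ v, IsMin L l r v := by
  induction r, h using Nat.le_induction with
  | base => exact ⟨_, IsMin.single L l⟩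
  | succ r hr ih =>
    obtain ⟨v, hv⟩ := ih
    exact ⟨_, hv.union (IsMin.single L (r + 1)) (by omega) (by omega) (by omega)⟩

/-- In a sorted sequence of suffixes, first differences are range minima. -/
theorem dif_of_isMin {g q L : ℕ → ℕ} {s t v : ℕ}
    (h : ∀ u, s ≤ u → u ≤ t → Dif g (q u) (q (u + 1)) (L u)) (hst : s ≤ t) (hv : IsMin L s t v) :
    Dif g (q s) (q (t + 1)) v := by
  induction t, hst using Nat.le_induction generalizing v with
  | base => rw [hv.unique (IsMin.single L s)]; exact h s le_rfl le_rfl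
  | succ t hs ih =>
    obtain ⟨v', hv'⟩ := IsMin.exists L hs
    have h1 := ih (fun u a b => h u a (by omega)) hv'
    have h2 := h (t + 1) (by omega) le_rfl
    rw [hv.unique (hv'.union (IsMin.single L (t + 1)) (by omega) (by omega) (by omega))]
    exact h1.trans h2

/-- The bits of `M` below `b` mark the positions `r - t` where `L` is smaller than everywhere between
them and `r`. -/
def Records (L : ℕ → ℕ) (b r M : ℕ) : Prop :=
  ∀ t < b, t ≤ r → (M / 2 ^ t % 2 = 1 ↔ ∀ u < t, L (r - t) < L (r - u))

/-- The highest bit of `M` below `k + 1` gives the minimum on `[r - k, r]`. -/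
theorem Records.isMin {L : ℕ → ℕ} {b r M k : ℕ} (h : Records L b r M) (hk : k < b) (hkr : k ≤ r) :
    IsMin L (r - k) r (L (r - Nat.log 2 (M % 2 ^ (k + 1)))) := by
  have h0 : M % 2 = 1 := by
    have := (h 0 (by omega) (by omega)).mpr (by omega)
    simpa using this
  have hmod : ∀ t ≤ k, M % 2 ^ (k + 1) / 2 ^ t % 2 = M / 2 ^ t % 2 := by
    intro t ht
    obtain ⟨c, rfl⟩ := Nat.exists_eq_add_of_le ht
    rw [show t + c + 1 = t + (c + 1) by omega, pow_add, Nat.mod_mul_right_div_self, pow_succ,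
      mul_comm (2 ^ c) 2, Nat.mod_mul_right_mod]
  set x := M % 2 ^ (k + 1) with hx
  have hx0 : x ≠ 0 := by
    intro e
    have := hmod 0 (by omega)
    rw [e] at this
    simp at this
    omega
  have hxlt : x < 2 ^ (k + 1) := Nat.mod_lt _ (by positivity)
  set s := Nat.log 2 x with hs
  have hsk : s ≤ k := by
    have := Nat.log_lt_of_lt_pow hx0 hxlt
    omega
  have hs1 : 2 ^ s ≤ x := Nat.pow_log_le_self 2 hx0
  have hs2 : x < 2 ^ (s + 1) := Nat.lt_pow_succ_log_self (by norm_num) x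
  have hbit : x / 2 ^ s = 1 := by
    refine Nat.div_eq_of_lt_le (by omega) ?_
    rw [pow_succ] at hs2
    omega
  have hrec := (h s (by omega) (by omega)).mp (by rw [← hmod s hsk, hbit])
  -- A position farther to the left than the top record is no record, so some nearer position has a
  -- value at most as large; by induction the value at the top record is at most as large too.
  have hhigh : ∀ t, s < t → t ≤ k → L (r - s) ≤ L (r - t) := by
    intro t
    induction t using Nat.strong_induction_on with
    | _ t ih =>
      intro hst htk
      have hz : x / 2 ^ t = 0 :=
        Nat.div_eq_of_lt (hs2.trans_le (Nat.pow_le_pow_right (by norm_num) hst))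
      have hnb : ¬ ∀ u < t, L (r - t) < L (r - u) := by
        rw [← h t (by omega) (by omega), ← hmod t htk, hz]; simp
      push Not at hnb
      obtain ⟨u, hu, hLu⟩ := hnb
      rcases lt_trichotomy u s with e | e | e
      · exact (hrec u e).le.trans hLu
      · rw [e] at hLu; exact hLu
      · exact (ih u hu e (by omega)).trans hLu
  refine ⟨fun u hu hur => ?_, r - s, by omega, by omega, rfl⟩
  obtain ⟨t, rfl⟩ : ∃ t, u = r - t := ⟨r - u, by omega⟩
  have htk : min t r ≤ k := by omega
  have e : r - t = r - min t r := by omega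
  rw [e]
  rcases lt_trichotomy (min t r) s with e | e | e
  · exact (hrec _ e).le
  · rw [e]
  · exact hhigh _ e htk

end LCE

/-! ### Sparse suffix array of the boundaries -/

namespace LCE

section
variable {E : Env} {n τ J A K : ℕ}

/-- `P` is increasing on `[0, N]`, with the sentinel `n` at the end. -/
def Increasing (n N : ℕ) (P : ℕ → ℕ) : Prop := P N = n ∧ ∀ s t, s < t → t ≤ N → P s < P t

theorem Increasing.le {N : ℕ} {P : ℕ → ℕ} (h : Increasing n N P) {t : ℕ} (ht : t ≤ N) : P t ≤ n := by
  rcases Nat.lt_or_ge t N with h' | h'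
  · have := h.2 t N h' le_rfl
    rw [h.1] at this; omega
  · rw [show t = N by omega, h.1]

theorem Increasing.lt {N : ℕ} {P : ℕ → ℕ} (h : Increasing n N P) {t : ℕ} (ht : t < N) : P t < n := by
  have := h.2 t N ht le_rfl
  rwa [h.1] at this

theorem Increasing.ne {N : ℕ} {P : ℕ → ℕ} (h : Increasing n N P) {s t : ℕ} (hs : s ≤ N) (ht : t ≤ N)
    (hst : s ≠ t) : P s ≠ P t := by
  rcases lt_or_gt_of_ne hst with h' | h'
  · exact (h.2 s t h' ht).ne
  · exact (h.2 t s h' hs).ne'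

/-! ### Successors -/

/-- Moves `t` to the first point at or behind `x`. -/
def advanceCode : Stmt := .while (.lt (.arr .P ♯.t) ♯.x) (.t ≔ ♯.t + 1)

/-- The points are strictly increasing integers, so the walk takes at most as many steps as the
distance to `x`. -/
theorem wp_advanceCode (S : Setup E n τ J A K) {σ : St} {N t x : ℕ} (hN : N ≤ 128 * (n / τ))
    (hP : Increasing n N (σ.a .P)) (hx : σ.v .x = x) (hxn : x ≤ n) (ht : σ.v .t = t) (htN : t ≤ N)
    (hlo : ∀ s < t, σ.a .P s < x) {Q : St → Prop}
    (hQ : ∀ σ', Frame [.t] [] σ σ' → σ'.v .t ≤ N → (∀ s < σ'.v .t, σ.a .P s < x) →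
      x ≤ σ.a .P (σ'.v .t) → σ'.clk ≤ σ.clk + (x - σ.a .P t) → Q σ') : wp E advanceCode Q σ := by
  have hW := S.word_lin
  have hsp := S.space
  have hmn := S.m_le
  have hmp := S.m_pos
  refine wp_while (fun σ' => σ'.v .t ≤ N ∧ ∀ s < σ'.v .t, σ.a .P s < x)
    (fun σ' => x - σ.a .P (σ'.v .t)) 1 ⟨by rw [ht]; exact htN, by rwa [ht]⟩ ?_ ?_ ?_
  · rintro σ' hf ⟨h1, h2⟩; simp; omega
  · rintro σ' hf ⟨h1, h2⟩ hc
    have eP : σ'.a .P = σ.a .P := by rw [hf.a _ (by decide)]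
    have ex : σ'.v .x = x := by rw [hf.v _ (by decide), hx]
    simp only [Cond.eval_lt, Expr.eval_arr, Expr.eval_var, eP, ex] at hc
    have htN : σ'.v .t < N := by
      rcases Nat.lt_or_ge (σ'.v .t) N with h | h
      · exact h
      · rw [show σ'.v .t = N by omega, hP.1] at hc; omega
    have hlt := hP.2 (σ'.v .t) (σ'.v .t + 1) (by omega) htN
    rw [wp_assign]
    simp
    and_intros <;> try omega
    intro s hs
    rcases Nat.lt_or_ge s (σ'.v .t) with h | h
    · exact h2 s h
    · rw [show s = σ'.v .t by omega]; exact hc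
  · rintro σ' hf ⟨h1, h2⟩ hc hcl
    have eP : σ'.a .P = σ.a .P := by rw [hf.a _ (by decide)]
    have ex : σ'.v .x = x := by rw [hf.v _ (by decide), hx]
    simp only [Cond.eval_lt, Expr.eval_arr, Expr.eval_var, eP, ex] at hc
    exact hQ σ' (hf.mono (by decide) (by decide)) h1 h2 (by omega) (by rw [ht] at hcl; simpa using hcl)

/-- For each block of length `τ` of the text, the first point at or behind its start -/
def blkCode : Stmt :=
  .t ≔ 0 ;; .q ≔ 0 ;;
  .while (.lt ♯.q (♯.m + 1))
    (.x ≔ ♯.q * ♯.tau ;; advanceCode ;; .store .BLK ♯.q ♯.t ;; .q ≔ ♯.q + 1)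

def BlkSpec (τ m N : ℕ) (P B : ℕ → ℕ) : Prop :=
  ∀ q ≤ m, B q ≤ N ∧ (∀ s < B q, P s < q * τ) ∧ q * τ ≤ P (B q)

theorem wp_blkCode (S : Setup E n τ J A K) {σ : St} (hC : Ctx n τ J σ) {N : ℕ}
    (hN : N ≤ 128 * (n / τ)) (hP : Increasing n N (σ.a .P)) {Q : St → Prop}
    (hQ : ∀ σ', Frame [.t, .q, .x] [.BLK] σ σ' → BlkSpec τ (n / τ) N (σ.a .P) (σ'.a .BLK) →
      σ'.clk ≤ σ.clk + (n / τ + 1) * (n + 1) → Q σ') : wp E blkCode Q σ := by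
  have hW := S.word_lin
  have hsp := S.space
  have hmn := S.m_le
  have hmp := S.m_pos
  simp only [blkCode]
  rw [wp_seq, wp_assign, wp_seq, wp_assign]
  refine ⟨by simp; omega, by simp; omega, by simp; omega, by simp; omega, ?_⟩
  refine wp_while (fun σ' => σ'.v .q ≤ n / τ + 1 ∧ σ'.v .t ≤ N ∧
      (∀ s < σ'.v .t, σ.a .P s < σ'.v .q * τ) ∧ ∀ q < σ'.v .q, σ'.a .BLK q ≤ N ∧
        (∀ s < σ'.a .BLK q, σ.a .P s < q * τ) ∧ q * τ ≤ σ.a .P (σ'.a .BLK q))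
    (fun σ' => n / τ + 1 - σ'.v .q) (n + 1) (by simp) ?_ ?_ ?_
  · rintro σ' hf -
    have em : σ'.v .m = n / τ := by rw [hf.v _ (by decide)]; simp [hC.m]
    simp [em]; omega
  · rintro σ' hf ⟨h1, h2, h3, h4⟩ hc
    have em : σ'.v .m = n / τ := by rw [hf.v _ (by decide)]; simp [hC.m]
    have et : σ'.v .tau = τ := by rw [hf.v _ (by decide)]; simp [hC.tau]
    have eP : σ'.a .P = σ.a .P := by rw [hf.a _ (by decide)]; simp
    simp only [Cond.eval_lt, Expr.eval_var, Expr.eval_add, Expr.eval_ofNat, em] at hc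
    have hqn : σ'.v .q * τ ≤ n := (Nat.mul_le_mul_right τ (show σ'.v .q ≤ n / τ by omega)).trans
      (Nat.div_mul_le_self n τ)
    rw [wp_seq, wp_assign]
    simp only [Expr.eval_mul, Expr.eval_var, St.tick_v, et, Expr.ok_mul, Expr.ok_var]
    refine ⟨⟨trivial, trivial, by omega⟩, by omega, ?_⟩
    rw [wp_seq]
    refine wp_advanceCode S (N := N) (t := σ'.v .t) (x := σ'.v .q * τ) hN (by simpa [eP] using hP)
      (by simp) hqn (by simp) h2 (by simpa [eP] using h3) fun σ₂ f2 t2 l2 g2 c2 => ?_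
    have eq2 : σ₂.v .q = σ'.v .q := by rw [f2.v _ (by decide)]; simp
    have eB : σ₂.a .BLK = σ'.a .BLK := by rw [f2.a _ (by decide)]; simp
    simp only [St.set_a, St.tick_a, eP, St.set_clk, St.tick_clk] at l2 g2 c2
    simp [eq2, eB]
    and_intros <;> try omega
    · intro s hs
      have := l2 s hs
      rw [add_mul]; omega
    · intro q hq
      by_cases e : q = σ'.v .q
      · simp only [e, if_true]; exact ⟨t2, l2, g2⟩
      · simp only [e, if_false]; exact h4 q (by omega)
  · rintro σ' hf ⟨h1, h2, h3, h4⟩ hc hcl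
    have em : σ'.v .m = n / τ := by rw [hf.v _ (by decide)]; simp [hC.m]
    simp only [Cond.eval_lt, Expr.eval_var, Expr.eval_add, Expr.eval_ofNat, em] at hc
    refine hQ σ' ?_ (fun q hq => h4 q (by omega)) (by simpa using hcl)
    exact ((Frame.set _ _ _ (by decide)).trans (Frame.set _ _ _ (by decide))).trans
      (hf.mono (by decide) (by decide))

/-! ### Sorting the points by their suffixes -/

/-- `lim := n - max pa pb`, `d := ` length of the longest common prefix of the suffixes -/
def fullLcpCode : Stmt :=
  .ite (.lt ♯.pa ♯.pb) (.lim ≔ ♯.n - ♯.pb) (.lim ≔ ♯.n - ♯.pa) ;; lcpCode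

theorem wp_fullLcpCode (S : Setup E n τ J A K) {σ : St} {p q : ℕ} (hn : σ.v .n = n)
    (hp : σ.v .pa = p) (hq : σ.v .pb = q) (hpn : p ≤ n) (hqn : q ≤ n) {Q : St → Prop}
    (hQ : ∀ σ', Frame [.d, .lim] [] σ σ' → σ'.v .d = mlen E.f p q (n - max p q) →
      σ'.clk ≤ σ.clk + n → Q σ') : wp E fullLcpCode Q σ := by
  have hW := S.word_lin
  have hlen := S.len
  have key : wp E lcpCode Q (σ.set .lim (n - max p q)) := by
    refine wp_lcpCode (a := p) (b := q) (L := n - max p q) (by simp [hp]) (by simp [hq]) (by simp)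
      (by omega) (by omega) (by omega) fun σ' hf hd hc => hQ σ' ?_ hd ?_
    · exact (Frame.set _ _ _ (by decide)).trans hf
    · simp at hc; omega
  simp only [fullLcpCode]
  rw [wp_seq, wp_ite]
  simp only [wp_assign]
  simp only [Cond.ok_lt, Cond.eval_lt, Expr.ok_var, Expr.eval_var, hp, hq, hn, Expr.ok_sub,
    Expr.eval_sub]
  refine ⟨⟨trivial, trivial⟩, fun h => ?_, fun h => ?_⟩
  · rw [max_eq_right h.le] at key
    exact ⟨⟨trivial, trivial, by omega⟩, by omega, key⟩
  · rw [max_eq_left (by omega)] at key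
    exact ⟨⟨trivial, trivial, by omega⟩, by omega, key⟩

/-- `flag := 1` if the suffix at `pa` is smaller than the suffix at `pb` -/
def cmpCode : Stmt :=
  fullLcpCode ;;
  .ite (.eq (♯.pa + ♯.d) ♯.n) (.flag ≔ 1)
    (.ite (.eq (♯.pb + ♯.d) ♯.n) (.flag ≔ 0)
      (.ite (.lt (.inp (♯.pa + ♯.d)) (.inp (♯.pb + ♯.d))) (.flag ≔ 1) (.flag ≔ 0)))

theorem wp_cmpCode (S : Setup E n τ J A K) {σ : St} {p q : ℕ} (hn : σ.v .n = n)
    (hp : σ.v .pa = p) (hq : σ.v .pb = q) (hpn : p < n) (hqn : q < n) (hpq : p ≠ q) {Q : St → Prop}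
    (hQ : ∀ σ', Frame [.d, .lim, .flag] [] σ σ' →
      (σ'.v .flag = 1 → ∃ d, Dif (mark E.f n) p q d) →
      (σ'.v .flag ≠ 1 → ∃ d, Dif (mark E.f n) q p d) → σ'.clk ≤ σ.clk + n → Q σ') :
    wp E cmpCode Q σ := by
  have hW := S.word_lin
  have hlen := S.len
  simp only [cmpCode]
  rw [wp_seq]
  refine wp_fullLcpCode S hn hp hq hpn.le hqn.le fun σ₁ f1 d1 c1 => ?_
  obtain ⟨k1, k2⟩ := dif_of_mlen hpn hqn hpq d1
  have hle := mlen_le E.f p q (n - max p q)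
  rw [← d1] at hle
  have e1 : σ₁.v .pa = p := by simp [f1.v, hp]
  have e2 : σ₁.v .pb = q := by simp [f1.v, hq]
  have e3 : σ₁.v .n = n := by simp [f1.v, hn]
  have fr : ∀ k, Frame [.d, .lim, .flag] [] σ (σ₁.set .flag k) := fun k =>
    (f1.mono (by decide) (by decide)).trans (Frame.set _ _ _ (by decide))
  simp only [wp_ite, wp_assign]
  simp [e1, e2, e3]
  refine ⟨by omega, fun h => ?_, fun h => ⟨by omega, fun h' => ?_, fun h' => ⟨by omega, fun h'' => ?_,
    fun h'' => ?_⟩⟩⟩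
  · exact ⟨by omega, hQ _ (fr _) (fun _ => ⟨_, k1 (Or.inl h)⟩) (by simp) (by simpa using c1)⟩
  · exact ⟨by omega, hQ _ (fr _) (by simp) (fun _ => ⟨_, k2 (by omega)⟩) (by simpa using c1)⟩
  · exact ⟨by omega, hQ _ (fr _) (fun _ => ⟨_, k1 (Or.inr ⟨h', h''⟩)⟩) (by simp) (by simpa using c1)⟩
  · exact ⟨by omega, hQ _ (fr _) (by simp) (fun _ => ⟨_, k2 (by omega)⟩) (by simpa using c1)⟩

/-- The suffix at `p` is smaller than the suffix at `q`. -/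
def SufLt (f : ℕ → ℕ) (n p q : ℕ) : Prop := ∃ d, Dif (mark f n) p q d

theorem SufLt.trans {f : ℕ → ℕ} {p q r : ℕ} (h : SufLt f n p q) (h' : SufLt f n q r) :
    SufLt f n p r := by
  obtain ⟨_, h⟩ := h
  obtain ⟨_, h'⟩ := h'
  exact ⟨_, h.trans h'⟩

/-- `SA` sorts the first `k` points. -/
def SortedTo (f : ℕ → ℕ) (n k : ℕ) (P SA : ℕ → ℕ) : Prop :=
  (∀ t < k, SA t < k) ∧ ∀ s t, s < t → t < k → SufLt f n (P (SA s)) (P (SA t))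

/-- `lo := ` number of the first `k` points that are smaller than the point `k` -/
def searchCode : Stmt :=
  .lo ≔ 0 ;; .hi ≔ ♯.k ;; .pa ≔ .arr .P ♯.k ;;
  .while (.lt ♯.lo ♯.hi)
    (.mid ≔ (♯.lo + ♯.hi) / 2 ;; .pb ≔ .arr .P (.arr .SA ♯.mid) ;; cmpCode ;;
      .ite (.eq ♯.flag 1) (.hi ≔ ♯.mid) (.lo ≔ ♯.mid + 1))

theorem size_half_lt {a b : ℕ} (ha : 0 < a) (hb : b ≤ a / 2) : Nat.size b < Nat.size a := by
  have := Nat.lt_size_self a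
  have hs : 1 ≤ a.size := Nat.size_pos.mpr ha
  obtain ⟨s, hs⟩ := Nat.exists_eq_add_of_le hs
  rw [hs, add_comm, Nat.lt_succ_iff, Nat.size_le]
  rw [hs, pow_add] at this
  omega

theorem wp_searchCode (S : Setup E n τ J A K) {σ : St} (hn : σ.v .n = n) {N k : ℕ}
    (hN : N ≤ 128 * (n / τ)) (hP : Increasing n N (σ.a .P)) (hk : σ.v .k = k) (hkN : k < N)
    (hs : SortedTo E.f n k (σ.a .P) (σ.a .SA)) {Q : St → Prop}
    (hQ : ∀ σ', Frame [.lo, .hi, .mid, .pa, .pb, .d, .lim, .flag] [] σ σ' → σ'.v .lo ≤ k →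
      (∀ t < σ'.v .lo, SufLt E.f n (σ.a .P (σ.a .SA t)) (σ.a .P k)) →
      (∀ t, σ'.v .lo ≤ t → t < k → SufLt E.f n (σ.a .P k) (σ.a .P (σ.a .SA t))) →
      σ'.clk ≤ σ.clk + N.size * (n + 1) → Q σ') : wp E searchCode Q σ := by
  have hW := S.word_lin
  have hsp := S.space
  have hmn := S.m_le
  have hpk := hP.lt hkN
  simp only [searchCode]
  rw [wp_seq, wp_assign, wp_seq, wp_assign, wp_seq, wp_assign]
  simp only [Expr.ok_ofNat, Expr.eval_ofNat, Expr.ok_var, Expr.eval_var, Expr.ok_arr, Expr.eval_arr,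
    St.set_v, reduceCtorEq, if_false, hk, St.set_a]
  refine ⟨by omega, by omega, trivial, by omega, ⟨trivial, by omega⟩, by omega, ?_⟩
  refine wp_while (fun σ' => σ'.v .lo ≤ σ'.v .hi ∧ σ'.v .hi ≤ k ∧
      (∀ t < σ'.v .lo, SufLt E.f n (σ.a .P (σ.a .SA t)) (σ.a .P k)) ∧
      (∀ t, σ'.v .hi ≤ t → t < k → SufLt E.f n (σ.a .P k) (σ.a .P (σ.a .SA t))))
    (fun σ' => Nat.size (σ'.v .hi - σ'.v .lo)) (n + 1) ?_ (by intro _ _ _; simp) ?_ ?_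
  · refine ⟨by simp, by simp, by simp, ?_⟩
    intro t h1 h2; simp at h1; omega
  · rintro σ' hf ⟨h1, h2, h3, h4⟩ hc
    have eP : σ'.a .P = σ.a .P := by rw [hf.a _ (by decide)]; simp
    have eS : σ'.a .SA = σ.a .SA := by rw [hf.a _ (by decide)]; simp
    have en : σ'.v .n = n := by rw [hf.v _ (by decide)]; simp [hn]
    have epa : σ'.v .pa = σ.a .P k := by rw [hf.v _ (by decide)]; simp
    simp only [Cond.eval_lt, Expr.eval_var] at hc
    obtain ⟨mid, hmid⟩ : ∃ mid, mid = (σ'.v .lo + σ'.v .hi) / 2 := ⟨_, rfl⟩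
    have hSA := hs.1 mid (by omega)
    have hpm := hP.lt (show σ.a .SA mid < N by omega)
    rw [wp_seq, wp_assign, wp_seq, wp_assign, wp_seq]
    simp only [Expr.ok_add, Expr.ok_div, Expr.eval_div, Expr.eval_add, Expr.ok_ofNat, Expr.eval_ofNat,
      Expr.ok_var, Expr.eval_var, Expr.ok_arr, Expr.eval_arr, St.set_v, St.tick_v,
      if_true, St.set_a, St.tick_a, eP, eS, ← hmid]
    refine ⟨⟨⟨trivial, trivial, by omega⟩, by omega, by omega⟩, by omega,
      ⟨⟨trivial, by omega⟩, by omega⟩, by omega, ?_⟩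
    refine wp_cmpCode S (p := σ.a .P k) (q := σ.a .P (σ.a .SA mid)) (by simp [en]) (by simp [epa])
      (by simp) hpk hpm (hP.ne (by omega) (by omega) (by omega)) fun σ₂ f2 k1 k2 c2 => ?_
    have elo : σ₂.v .lo = σ'.v .lo := by simp [f2.v]
    have ehi : σ₂.v .hi = σ'.v .hi := by simp [f2.v]
    have emid : σ₂.v .mid = mid := by simp [f2.v]
    simp only [St.set_clk, St.tick_clk] at c2
    rw [wp_ite]
    refine ⟨by simp; omega, fun h => ?_, fun h => ?_⟩
    · have hlt := k1 (by simpa using h)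
      simp only [wp_assign]
      simp [emid, elo]
      refine ⟨by omega, ⟨by omega, by omega, h3, fun t h5 h6 => ?_⟩,
        size_half_lt (by omega) (by omega), by omega⟩
      rcases Nat.eq_or_lt_of_le h5 with e | e
      · rw [← e]; exact hlt
      · exact SufLt.trans hlt (hs.2 mid t e h6)
    · have hlt := k2 (by simpa using h)
      simp only [wp_assign]
      simp [emid, ehi]
      refine ⟨by omega, by omega, ⟨by omega, by omega, fun t h5 => ?_, h4⟩,
        size_half_lt (by omega) (by omega), by omega⟩
      rcases Nat.eq_or_lt_of_le h5 with e | e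
      · rw [show t = mid by omega]; exact hlt
      · exact SufLt.trans (hs.2 t mid (by omega) (by omega)) hlt
  · rintro σ' hf ⟨h1, h2, h3, h4⟩ hc hcl
    simp only [Cond.eval_lt, Expr.eval_var] at hc
    refine hQ σ' ?_ (by omega) h3 (fun t h5 h6 => h4 t (by omega) h6) ?_
    · exact (((Frame.set _ _ _ (by decide)).trans (Frame.set _ _ _ (by decide))).trans
        (Frame.set _ _ _ (by decide))).trans (hf.mono (by decide) (by decide))
    · have : Nat.size k * (n + 1) ≤ N.size * (n + 1) :=
        Nat.mul_le_mul_right _ (Nat.size_le_size hkN.le)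
      simp at hcl
      omega

/-- Inserts `k` at position `lo` into `SA`. -/
def insertCode : Stmt :=
  .t ≔ ♯.k ;;
  .while (.lt ♯.lo ♯.t) (.store .SA ♯.t (.arr .SA (♯.t - 1)) ;; .t ≔ ♯.t - 1) ;;
  .store .SA ♯.lo ♯.k

theorem wp_insertCode (S : Setup E n τ J A K) {σ : St} {k lo : ℕ} (hk : σ.v .k = k)
    (hkN : k < 128 * (n / τ)) (hlo : σ.v .lo = lo) (hlk : lo ≤ k) (hSA : ∀ t < k, σ.a .SA t < k)
    {Q : St → Prop} (hQ : ∀ σ', Frame [.t] [.SA] σ σ' →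
      (∀ t < lo, σ'.a .SA t = σ.a .SA t) → σ'.a .SA lo = k →
      (∀ t, lo < t → t ≤ k → σ'.a .SA t = σ.a .SA (t - 1)) → σ'.clk ≤ σ.clk + k → Q σ') :
    wp E insertCode Q σ := by
  have hW := S.word_lin
  have hsp := S.space
  have hmn := S.m_le
  simp only [insertCode]
  rw [wp_seq, wp_assign, wp_seq]
  simp only [Expr.ok_var, Expr.eval_var, hk]
  refine ⟨trivial, by omega, ?_⟩
  refine wp_while (fun σ' => lo ≤ σ'.v .t ∧ σ'.v .t ≤ k ∧ (∀ s ≤ σ'.v .t, σ'.a .SA s = σ.a .SA s) ∧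
      ∀ s, σ'.v .t < s → s ≤ k → σ'.a .SA s = σ.a .SA (s - 1))
    (fun σ' => σ'.v .t - lo) 1 ?_ (by intro _ _ _; simp) ?_ ?_
  · exact ⟨by simp [hlk], by simp, by simp, fun s h1 h2 => by simp at h1; omega⟩
  · rintro σ' hf ⟨h1, h2, h3, h4⟩ hc
    have elo : σ'.v .lo = lo := by rw [hf.v _ (by decide)]; simp [hlo]
    simp only [Cond.eval_lt, Expr.eval_var, elo] at hc
    have hv := hSA (σ'.v .t - 1) (by omega)
    have e3 := h3 (σ'.v .t - 1) (by omega)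
    rw [wp_seq, wp_store]
    simp only [wp_assign]
    simp [e3]
    and_intros <;> try omega
    · intro s hs
      rw [if_neg (by omega)]; exact h3 s (by omega)
    · intro s h5 h6
      split_ifs with e
      · rw [e]
      · exact h4 s (by omega) h6
  · rintro σ' hf ⟨h1, h2, h3, h4⟩ hc hcl
    have elo : σ'.v .lo = lo := by rw [hf.v _ (by decide)]; simp [hlo]
    have ek : σ'.v .k = k := by rw [hf.v _ (by decide)]; simp [hk]
    simp only [Cond.eval_lt, Expr.eval_var, elo] at hc
    rw [wp_store]
    simp only [Expr.ok_var, Expr.eval_var, elo, ek]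
    refine ⟨trivial, trivial, by omega, by omega, hQ _ ?_ ?_ (by simp) ?_ ?_⟩
    · exact ((Frame.set _ _ _ (by decide)).trans (hf.mono (by decide) (by decide))).trans
        (Frame.setA _ _ _ _ (by decide))
    · intro t ht
      simp only [St.setA_a, if_true]
      rw [if_neg (by omega)]; exact h3 t (by omega)
    · intro t h5 h6
      simp only [St.setA_a, if_true]
      rw [if_neg (by omega)]; exact h4 t (by omega) h6
    · simp at hcl ⊢; omega

/-- Sorts the points by their suffixes. -/
def sortCode : Stmt :=
  .k ≔ 0 ;; .while (.lt ♯.k ♯.N) (searchCode ;; insertCode ;; .k ≔ ♯.k + 1)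

def sortVars : List Var := [.k, .t, .lo, .hi, .mid, .pa, .pb, .d, .lim, .flag]

theorem wp_sortCode (S : Setup E n τ J A K) {σ : St} (hn : σ.v .n = n) {N : ℕ}
    (hN : N ≤ 128 * (n / τ)) (hP : Increasing n N (σ.a .P)) (hσN : σ.v .N = N) {Q : St → Prop}
    (hQ : ∀ σ', Frame sortVars [.SA] σ σ' → SortedTo E.f n N (σ.a .P) (σ'.a .SA) →
      σ'.clk ≤ σ.clk + N * (N.size * (n + 1) + N + 1) → Q σ') : wp E sortCode Q σ := by
  have hW := S.word_lin
  have hsp := S.space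
  have hmn := S.m_le
  simp only [sortCode]
  rw [wp_seq, wp_assign]
  refine ⟨by simp; omega, by simp; omega, ?_⟩
  refine wp_while (fun σ' => σ'.v .k ≤ N ∧ SortedTo E.f n (σ'.v .k) (σ.a .P) (σ'.a .SA))
    (fun σ' => N - σ'.v .k) (N.size * (n + 1) + N + 1) ?_ (by intro _ _ _; simp) ?_ ?_
  · exact ⟨by simp, by simp, fun s t _ ht => by simp at ht⟩
  · rintro σ' hf ⟨h1, h2⟩ hc
    have eN : σ'.v .N = N := by rw [hf.v _ (by decide)]; simp [hσN]
    have en : σ'.v .n = n := by rw [hf.v _ (by decide)]; simp [hn]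
    have eP : σ'.a .P = σ.a .P := by rw [hf.a _ (by decide)]; simp
    simp only [Cond.eval_lt, Expr.eval_var, eN] at hc
    rw [← eP] at hP h2
    rw [wp_seq]
    refine wp_searchCode S (σ := σ'.tick) (N := N) (k := σ'.v .k) en hN hP rfl hc h2
      fun σ₂ f2 l2 a2 b2 c2 => ?_
    have eS2 : σ₂.a .SA = σ'.a .SA := by simp [f2.a]
    have ek2 : σ₂.v .k = σ'.v .k := by simp [f2.v]
    rw [wp_seq]
    refine wp_insertCode S (σ := σ₂) (k := σ'.v .k) (lo := σ₂.v .lo) ek2 (by omega) rfl l2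
      (by rw [eS2]; exact h2.1) fun σ₃ f3 a3 b3 c3 d3 => ?_
    have ek3 : σ₃.v .k = σ'.v .k := by simp [f3.v, ek2]
    rw [eS2] at a3 c3
    simp only [St.tick_a, St.tick_clk] at a2 b2 c2
    rw [wp_assign]
    simp only [Expr.eval_add, Expr.eval_var, Expr.eval_ofNat, Expr.ok_add, Expr.ok_var, Expr.ok_ofNat,
      ek3, St.set_v, if_true, St.set_a, St.set_clk]
    refine ⟨⟨trivial, by omega, by omega⟩, by omega, ⟨by omega, ?_, ?_⟩, by omega, by omega⟩
    · intro t ht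
      rcases lt_trichotomy t (σ₂.v .lo) with e | e | e
      · rw [a3 t e]; have := h2.1 t (by omega); omega
      · rw [e, b3]; omega
      · rw [c3 t e (by omega)]; have := h2.1 (t - 1) (by omega); omega
    · intro s t hst ht
      rw [← eP]
      rcases lt_trichotomy t (σ₂.v .lo) with e | e | e
      · rw [a3 t e, a3 s (by omega)]; exact h2.2 s t hst (by omega)
      · rw [e, b3, a3 s (by omega)]; exact a2 s (by omega)
      · rw [c3 t e (by omega)]
        rcases lt_trichotomy s (σ₂.v .lo) with e' | e' | e'
        · rw [a3 s e']; exact h2.2 s (t - 1) (by omega) (by omega)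
        · rw [e', b3]; exact b2 (t - 1) (by omega) (by omega)
        · rw [c3 s e' (by omega)]; exact h2.2 (s - 1) (t - 1) (by omega) (by omega)
  · rintro σ' hf ⟨h1, h2⟩ hc hcl
    have eN : σ'.v .N = N := by rw [hf.v _ (by decide)]; simp [hσN]
    simp only [Cond.eval_lt, Expr.eval_var, eN] at hc
    rw [show σ'.v .k = N by omega] at h2
    exact hQ σ' ((Frame.set _ _ _ (by decide)).trans (hf.mono (by decide) (by decide))) h2
      (by simpa using hcl)

/-- Inverts `SA`. -/
def rankCode : Stmt :=
  .t ≔ 0 ;; .while (.lt ♯.t ♯.N) (.store .RK (.arr .SA ♯.t) ♯.t ;; .t ≔ ♯.t + 1)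

theorem SortedTo.inj {f : ℕ → ℕ} {N : ℕ} {P SA : ℕ → ℕ} (h : SortedTo f n N P SA) {s t : ℕ}
    (hs : s < N) (ht : t < N) (he : SA s = SA t) : s = t := by
  rcases lt_trichotomy s t with e | e | e
  · obtain ⟨d, hd⟩ := h.2 s t e ht
    exact absurd (by rw [he]) hd.ne
  · exact e
  · obtain ⟨d, hd⟩ := h.2 t s e hs
    exact absurd (by rw [he]) hd.ne

/-- Different ranks hold different points, since no suffix is smaller than itself; an injective map
of a finite set to itself is onto. -/
theorem SortedTo.surj {f : ℕ → ℕ} {N : ℕ} {P SA : ℕ → ℕ} (h : SortedTo f n N P SA) {i : ℕ}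
    (hi : i < N) : ∃ t < N, SA t = i := by
  have hinj : Function.Injective (fun t : Fin N => (⟨SA t, h.1 t t.2⟩ : Fin N)) := by
    intro s t he
    simp only [Fin.mk.injEq] at he
    exact Fin.ext (h.inj s.2 t.2 he)
  obtain ⟨t, ht⟩ := (Finite.injective_iff_surjective.mp hinj) ⟨i, hi⟩
  exact ⟨t, t.2, by simpa using congrArg Fin.val ht⟩

theorem wp_rankCode (S : Setup E n τ J A K) {σ : St} {N : ℕ} {P : ℕ → ℕ}
    (hN : N ≤ 128 * (n / τ)) (hσN : σ.v .N = N) (hs : SortedTo E.f n N P (σ.a .SA)) {Q : St → Prop}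
    (hQ : ∀ σ', Frame [.t] [.RK] σ σ' → (∀ i < N, σ'.a .RK i < N ∧ σ.a .SA (σ'.a .RK i) = i) →
      σ'.clk ≤ σ.clk + N → Q σ') : wp E rankCode Q σ := by
  have hW := S.word_lin
  have hsp := S.space
  have hmn := S.m_le
  simp only [rankCode]
  rw [wp_seq, wp_assign]
  refine ⟨by simp; omega, by simp; omega, ?_⟩
  refine wp_while (fun σ' => σ'.v .t ≤ N ∧ ∀ s < σ'.v .t, σ'.a .RK (σ.a .SA s) = s)
    (fun σ' => N - σ'.v .t) 1 (by simp) (by intro _ _ _; simp) ?_ ?_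
  · rintro σ' hf ⟨h1, h2⟩ hc
    have eN : σ'.v .N = N := by rw [hf.v _ (by decide)]; simp [hσN]
    have eS : σ'.a .SA = σ.a .SA := by rw [hf.a _ (by decide)]; simp
    simp only [Cond.eval_lt, Expr.eval_var, eN] at hc
    have := hs.1 _ hc
    rw [wp_seq, wp_store]
    simp only [wp_assign]
    simp [eS]
    and_intros <;> try omega
    intro s hs'
    split_ifs with e
    · exact (hs.inj (by omega) hc e).symm
    · refine h2 s ?_
      rcases Nat.eq_or_lt_of_le hs' with e' | e'
      · exact absurd (by rw [show s = σ'.v .t by omega]) e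
      · omega
  · rintro σ' hf ⟨h1, h2⟩ hc hcl
    have eN : σ'.v .N = N := by rw [hf.v _ (by decide)]; simp [hσN]
    simp only [Cond.eval_lt, Expr.eval_var, eN] at hc
    refine hQ σ' ((Frame.set _ _ _ (by decide)).trans (hf.mono (by decide) (by decide))) ?_
      (by simpa using hcl)
    intro i hi
    obtain ⟨t, ht, rfl⟩ := hs.surj hi
    rw [h2 t (by omega)]; exact ⟨ht, rfl⟩

/-- `L[t] := ` longest common prefix of the `t`-th and the `t + 1`-st suffix -/
def lcpArrCode : Stmt :=
  .t ≔ 0 ;;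
  .while (.lt (♯.t + 1) ♯.N)
    (.pa ≔ .arr .P (.arr .SA ♯.t) ;; .pb ≔ .arr .P (.arr .SA (♯.t + 1)) ;; fullLcpCode ;;
      .store .L ♯.t ♯.d ;; .t ≔ ♯.t + 1)

theorem wp_lcpArrCode (S : Setup E n τ J A K) {σ : St} (hn : σ.v .n = n) {N : ℕ}
    (hN : N ≤ 128 * (n / τ)) (hσN : σ.v .N = N) (hP : Increasing n N (σ.a .P))
    (hs : SortedTo E.f n N (σ.a .P) (σ.a .SA)) {Q : St → Prop}
    (hQ : ∀ σ', Frame [.t, .pa, .pb, .d, .lim] [.L] σ σ' →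
      (∀ t, t + 1 < N → σ'.a .L t ≤ n ∧
        Dif (mark E.f n) (σ.a .P (σ.a .SA t)) (σ.a .P (σ.a .SA (t + 1))) (σ'.a .L t)) →
      σ'.clk ≤ σ.clk + N * (n + 1) → Q σ') : wp E lcpArrCode Q σ := by
  have hW := S.word_lin
  have hsp := S.space
  have hmn := S.m_le
  simp only [lcpArrCode]
  rw [wp_seq, wp_assign]
  refine ⟨by simp; omega, by simp; omega, ?_⟩
  refine wp_while (fun σ' => σ'.v .t ≤ N ∧ ∀ t < σ'.v .t, σ'.a .L t ≤ n ∧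
        Dif (mark E.f n) (σ.a .P (σ.a .SA t)) (σ.a .P (σ.a .SA (t + 1))) (σ'.a .L t))
    (fun σ' => N - σ'.v .t) (n + 1) (by simp) ?_ ?_ ?_
  · rintro σ' - ⟨h1, -⟩; simp; omega
  · rintro σ' hf ⟨h1, h2⟩ hc
    have eN : σ'.v .N = N := by rw [hf.v _ (by decide)]; simp [hσN]
    have en : σ'.v .n = n := by rw [hf.v _ (by decide)]; simp [hn]
    have eS : σ'.a .SA = σ.a .SA := by rw [hf.a _ (by decide)]; simp
    have eP : σ'.a .P = σ.a .P := by rw [hf.a _ (by decide)]; simp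
    simp only [Cond.eval_lt, Expr.eval_var, Expr.eval_add, Expr.eval_ofNat, eN] at hc
    have s1 := hs.1 (σ'.v .t) (by omega)
    have s2 := hs.1 _ hc
    have p1 := hP.lt s1
    have p2 := hP.lt s2
    obtain ⟨d, hd⟩ := hs.2 (σ'.v .t) (σ'.v .t + 1) (by omega) hc
    rw [wp_seq, wp_assign, wp_seq, wp_assign, wp_seq]
    simp only [Expr.eval_add, Expr.eval_var, Expr.eval_ofNat, Expr.ok_add, Expr.ok_var, Expr.ok_ofNat,
      Expr.ok_arr, Expr.eval_arr, St.set_v, reduceCtorEq, if_false, St.set_a, St.tick_v, St.tick_a, eS, eP]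
    refine ⟨⟨⟨trivial, by omega⟩, by omega⟩, by omega, ⟨⟨⟨trivial, by omega, by omega⟩, by omega⟩,
      by omega⟩, by omega, ?_⟩
    refine wp_fullLcpCode S (p := σ.a .P (σ.a .SA (σ'.v .t))) (q := σ.a .P (σ.a .SA (σ'.v .t + 1)))
      (by simp [en]) (by simp) (by simp) p1.le p2.le fun σ₂ f2 d2 c2 => ?_
    rw [hd.mlen_eq p1 p2] at d2
    have hdn : d ≤ n := by
      have := mlen_le E.f (σ.a .P (σ.a .SA (σ'.v .t))) (σ.a .P (σ.a .SA (σ'.v .t + 1)))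
        (n - max (σ.a .P (σ.a .SA (σ'.v .t))) (σ.a .P (σ.a .SA (σ'.v .t + 1))))
      rw [hd.mlen_eq p1 p2] at this
      omega
    have et : σ₂.v .t = σ'.v .t := by simp [f2.v]
    have eL : σ₂.a .L = σ'.a .L := by simp [f2.a]
    simp only [St.set_clk, St.tick_clk] at c2
    rw [wp_seq, wp_store]
    simp only [wp_assign]
    simp [et, d2, eL]
    and_intros <;> try omega
    intro t ht
    by_cases e : t = σ'.v .t
    · simp only [e, if_true]; exact ⟨hdn, hd⟩
    · simp only [e, if_false]; exact h2 t (by omega)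
  · rintro σ' hf ⟨h1, h2⟩ hc hcl
    have eN : σ'.v .N = N := by rw [hf.v _ (by decide)]; simp [hσN]
    simp only [Cond.eval_lt, Expr.eval_var, Expr.eval_add, Expr.eval_ofNat, eN] at hc
    exact hQ σ' ((Frame.set _ _ _ (by decide)).trans (hf.mono (by decide) (by decide)))
      (fun t ht => h2 t (by omega)) (by simpa using hcl)

end

end LCE

namespace LCE

/-! ### Range minimum queries -/

section
variable {E : Env} {n τ J A K : ℕ}

/-- `len := N - 1`, and `e = 2 ^ b` is larger than `len`. -/
def widthCode : Stmt :=
  .len ≔ ♯.N - 1 ;; .b ≔ 1 ;; .e ≔ 2 ;;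
  .while (.lt ♯.e (♯.len + 1)) (.e ≔ ♯.e + ♯.e ;; .b ≔ ♯.b + 1)

theorem wp_widthCode (S : Setup E n τ J A K) {σ : St} {N : ℕ} (hN : N ≤ 128 * (n / τ))
    (hσN : σ.v .N = N) {Q : St → Prop}
    (hQ : ∀ σ' b, Frame [.len, .b, .e] [] σ σ' → σ'.v .len = N - 1 → σ'.v .b = b →
      σ'.v .e = 2 ^ b → 1 ≤ b → N - 1 < 2 ^ b → 2 ^ b ≤ 2 * (N - 1) + 2 → σ'.clk ≤ σ.clk + N → Q σ') :
    wp E widthCode Q σ := by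
  have hW := S.word_lin
  have hmn := S.m_le
  simp only [widthCode]
  rw [wp_seq, wp_assign, wp_seq, wp_assign, wp_seq, wp_assign]
  simp only [Expr.ok_ofNat, Expr.eval_ofNat, Expr.ok_var, Expr.eval_var, Expr.ok_sub, Expr.eval_sub, hσN]
  refine ⟨⟨trivial, by omega, by omega⟩, by omega, by omega, by omega, by omega, by omega, ?_⟩
  refine wp_while (fun σ' => σ'.v .e = 2 ^ σ'.v .b ∧ 1 ≤ σ'.v .b ∧ 2 ^ σ'.v .b ≤ 2 * (N - 1) + 2)
    (fun σ' => N - σ'.v .e) 1 (by simp) ?_ ?_ ?_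
  · rintro σ' hf ⟨h1, h2, h3⟩
    have el : σ'.v .len = N - 1 := by rw [hf.v _ (by decide)]; simp
    simp [el]; omega
  · rintro σ' hf ⟨h1, h2, h3⟩ hc
    have el : σ'.v .len = N - 1 := by rw [hf.v _ (by decide)]; simp
    simp only [Cond.eval_lt, Expr.eval_var, Expr.eval_add, Expr.eval_ofNat, el] at hc
    have hb : σ'.v .b < 2 ^ σ'.v .b := Nat.lt_two_pow_self
    rw [wp_seq, wp_assign]
    simp only [wp_assign]
    simp [pow_succ]
    and_intros <;> try omega
  · rintro σ' hf ⟨h1, h2, h3⟩ hc hcl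
    have el : σ'.v .len = N - 1 := by rw [hf.v _ (by decide)]; simp
    simp only [Cond.eval_lt, Expr.eval_var, Expr.eval_add, Expr.eval_ofNat, el] at hc
    refine hQ σ' _ ?_ el rfl h1 h2 (by omega) h3 (by simp at hcl; omega)
    exact (((Frame.set _ _ _ (by decide)).trans (Frame.set _ _ _ (by decide))).trans
      (Frame.set _ _ _ (by decide))).trans (hf.mono (by decide) (by decide))

/-- Table of logarithms below `e` -/
def logCode : Stmt :=
  .store .LG 0 0 ;; .store .LG 1 0 ;; .t ≔ 2 ;;
  .while (.lt ♯.t ♯.e) (.store .LG ♯.t (.arr .LG (♯.t / 2) + 1) ;; .t ≔ ♯.t + 1)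

theorem wp_logCode (S : Setup E n τ J A K) {σ : St} {B : ℕ} (hB : B ≤ 512 * (n / τ))
    (he : σ.v .e = B) {Q : St → Prop}
    (hQ : ∀ σ', Frame [.t] [.LG] σ σ' → (∀ t < B, σ'.a .LG t = Nat.log 2 t) →
      σ'.clk ≤ σ.clk + B → Q σ') : wp E logCode Q σ := by
  have hW := S.word_lin
  have hsp := S.space
  have hmn := S.m_le
  have hmp := S.m_pos
  simp only [logCode]
  rw [wp_seq, wp_store, wp_seq, wp_store, wp_seq, wp_assign]
  simp only [Expr.ok_ofNat, Expr.eval_ofNat]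
  refine ⟨by omega, by omega, by omega, by omega, by omega, by omega, by omega, by omega, by omega,
    by omega, ?_⟩
  refine wp_while (fun σ' => 2 ≤ σ'.v .t ∧ (σ'.v .t ≤ B ∨ σ'.v .t = 2) ∧
      ∀ t < σ'.v .t, σ'.a .LG t = Nat.log 2 t)
    (fun σ' => B - σ'.v .t) 1 ?_ (by intro _ _ _; simp) ?_ ?_
  · refine ⟨by simp, by simp, fun t ht => ?_⟩
    simp only [St.set_v, if_true] at ht
    interval_cases t <;> simp
  · rintro σ' hf ⟨h1, h2, h3⟩ hc
    have ee : σ'.v .e = B := by rw [hf.v _ (by decide)]; simp [he]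
    simp only [Cond.eval_lt, Expr.eval_var, ee] at hc
    have hlog := h3 (σ'.v .t / 2) (by omega)
    have hlt : Nat.log 2 (σ'.v .t / 2) ≤ σ'.v .t / 2 := Nat.log_le_self _ _
    have hl : Nat.log 2 (σ'.v .t) = Nat.log 2 (σ'.v .t / 2) + 1 :=
      Nat.log_of_one_lt_of_le (by norm_num) h1
    rw [wp_seq, wp_store]
    simp only [wp_assign]
    simp [hlog]
    and_intros <;> try omega
    intro t ht
    split_ifs with e
    · rw [e]; omega
    · exact h3 t (by omega)
  · rintro σ' hf ⟨h1, h2, h3⟩ hc hcl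
    have ee : σ'.v .e = B := by rw [hf.v _ (by decide)]; simp [he]
    simp only [Cond.eval_lt, Expr.eval_var, ee] at hc
    refine hQ σ' ?_ (fun t ht => h3 t (by omega)) (by simp at hcl; omega)
    exact (((Frame.setA _ _ _ _ (by decide)).trans (Frame.setA _ _ _ _ (by decide))).trans
      (Frame.set _ _ _ (by decide))).trans (hf.mono (by decide) (by decide))

/-- `res := ` mask of the records to the left of `k` -/
def recordsCode : Stmt :=
  .acc ≔ .arr .L ♯.k ;; .res ≔ 1 ;; .t ≔ 1 ;;
  .while (.lt ♯.t ♯.b)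
    (.ite (.lt ♯.k ♯.t) (.res ≔ ♯.res)
      (.ite (.lt (.arr .L (♯.k - ♯.t)) ♯.acc)
        (.res ≔ ♯.res + .op .shl 1 ♯.t ;; .acc ≔ .arr .L (♯.k - ♯.t)) (.res ≔ ♯.res)) ;;
     .t ≔ ♯.t + 1)

theorem bit_add_pow {x s t : ℕ} (hst : s < t) : (x + 2 ^ t) / 2 ^ s % 2 = x / 2 ^ s % 2 := by
  obtain ⟨c, rfl⟩ := Nat.exists_eq_add_of_lt hst
  rw [show 2 ^ (s + c + 1) = 2 ^ s * (2 * 2 ^ c) by ring, Nat.add_mul_div_left _ _ (by positivity),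
    Nat.add_mul_mod_self_left]

theorem wp_recordsCode (S : Setup E n τ J A K) {σ : St} {ℓ b k : ℕ} (hℓ : ℓ ≤ 128 * (n / τ))
    (hb : σ.v .b = b) (hb1 : 1 ≤ b) (hbB : 2 ^ b ≤ 512 * (n / τ)) (hk : σ.v .k = k) (hkℓ : k < ℓ)
    (hL : ∀ t < ℓ, σ.a .L t ≤ n) {Q : St → Prop}
    (hQ : ∀ σ', Frame [.acc, .res, .t] [] σ σ' → Records (σ.a .L) b k (σ'.v .res) →
      σ'.v .res < 2 ^ b → σ'.clk ≤ σ.clk + b → Q σ') : wp E recordsCode Q σ := by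
  have hW := S.word_lin
  have hsp := S.space
  have hmn := S.m_le
  have hLk := hL k hkℓ
  have hbb : b < 2 ^ b := Nat.lt_two_pow_self
  simp only [recordsCode]
  rw [wp_seq, wp_assign, wp_seq, wp_assign, wp_seq, wp_assign]
  simp only [Expr.ok_ofNat, Expr.eval_ofNat, Expr.ok_var, Expr.eval_var, Expr.ok_arr, Expr.eval_arr, hk]
  refine ⟨⟨trivial, by omega⟩, by omega, by omega, by omega, by omega, by omega, ?_⟩
  -- The variable `acc` is the minimum over the positions seen so far, so one comparison with it
  -- decides whether the next position to the left is a record.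
  refine wp_while (fun σ' => 1 ≤ σ'.v .t ∧ σ'.v .t ≤ b ∧ σ'.v .res < 2 ^ σ'.v .t ∧
      (∀ u < σ'.v .t, u ≤ k → σ'.v .acc ≤ σ.a .L (k - u)) ∧
      (∃ u < σ'.v .t, u ≤ k ∧ σ.a .L (k - u) = σ'.v .acc) ∧
      Records (σ.a .L) (σ'.v .t) k (σ'.v .res))
    (fun σ' => b - σ'.v .t) 1 ?_ (by intro _ _ _; simp) ?_ ?_
  · simp only [St.set_v, reduceCtorEq, if_true, if_false, Records]
    refine ⟨le_rfl, hb1, by norm_num, fun u hu _ => ?_, ⟨0, by omega, by omega, rfl⟩, fun u hu _ => ?_⟩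
    · rw [show u = 0 by omega]; exact le_rfl
    · rw [show u = 0 by omega]; simp
  · rintro σ' hf ⟨h1, h2, h3, h4, h5, h6⟩ hc
    have eb : σ'.v .b = b := by rw [hf.v _ (by decide)]; simp [hb]
    have ek : σ'.v .k = k := by rw [hf.v _ (by decide)]; simp [hk]
    have eL : σ'.a .L = σ.a .L := by rw [hf.a _ (by decide)]; simp
    simp only [Cond.eval_lt, Expr.eval_var, eb] at hc
    obtain ⟨t, ht⟩ : ∃ t, σ'.v .t = t := ⟨_, rfl⟩
    obtain ⟨res, hres⟩ : ∃ res, σ'.v .res = res := ⟨_, rfl⟩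
    rw [ht] at h1 h2 h3 h4 h5 h6 hc
    rw [hres] at h3 h6
    have hpow : 2 ^ (t + 1) ≤ 2 ^ b := Nat.pow_le_pow_right (by norm_num) hc
    rw [pow_succ] at hpow
    have hLt := hL (k - t) (by omega)
    have hz : res / 2 ^ t = 0 := Nat.div_eq_of_lt h3
    rw [wp_seq, wp_ite]
    refine ⟨by simp, fun hkt => ?_, fun hkt => ?_⟩
    · simp only [Cond.eval_lt, Expr.eval_var, St.tick_v, ek, ht] at hkt
      simp only [wp_assign]
      simp only [Expr.ok_ofNat, Expr.eval_ofNat, Expr.ok_var, Expr.eval_var, Expr.ok_add, Expr.eval_add,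
        St.set_v, St.tick_v, reduceCtorEq, if_true, if_false, hres, ht, St.set_clk, St.tick_clk]
      refine ⟨trivial, by omega, ⟨trivial, by omega, by omega⟩, by omega, ⟨by omega, by omega, ?_,
        fun u hu hu' => h4 u (by omega) hu', ?_, fun u hu hu' => h6 u (by omega) hu'⟩, by omega, by omega⟩
      · rw [pow_succ]; omega
      · obtain ⟨u, q1, q2, q3⟩ := h5; exact ⟨u, by omega, q2, q3⟩
    · simp only [Cond.eval_lt, Expr.eval_var, St.tick_v, ek, ht] at hkt
      have hiff : σ.a .L (k - t) < σ'.v .acc ↔ ∀ u < t, σ.a .L (k - t) < σ.a .L (k - u) := by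
        constructor
        · intro h u hu; exact h.trans_le (h4 u hu (by omega))
        · intro h
          obtain ⟨u, q1, q2, q3⟩ := h5
          rw [← q3]; exact h u q1
      rw [wp_ite]
      refine ⟨by simp [ek, ht]; omega, fun hcmp => ?_, fun hcmp => ?_⟩
      · simp only [Cond.eval_lt, Expr.eval_var, Expr.eval_arr, Expr.eval_sub, St.tick_v, St.tick_a, ek,
          ht, eL] at hcmp
        simp only [wp_assign, wp_seq]
        simp only [Expr.ok_ofNat, Expr.eval_ofNat, Expr.ok_var, Expr.eval_var, Expr.ok_add, Expr.eval_add,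
          Expr.ok_shl, Expr.eval_shl, Expr.ok_arr, Expr.eval_arr, Expr.ok_sub, Expr.eval_sub, St.set_a,
          St.tick_a, eL, ek, one_mul,
          St.set_v, St.tick_v, reduceCtorEq, if_true, if_false, hres, ht, St.set_clk, St.tick_clk]
        refine ⟨⟨trivial, ⟨by omega, trivial, by omega⟩, by omega⟩, by omega,
          ⟨⟨trivial, trivial, by omega⟩, by omega⟩, by omega,
          ⟨trivial, by omega, by omega⟩, by omega, ⟨by omega, by omega, ?_, fun u hu hu' => ?_,
          ⟨t, by omega, by omega, rfl⟩, fun u hu hu' => ?_⟩, by omega, by omega⟩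
        · rw [pow_succ]; omega
        · rcases Nat.lt_succ_iff_lt_or_eq.mp hu with h | h
          · exact hcmp.le.trans (h4 u h hu')
          · rw [h]
        · rcases Nat.lt_succ_iff_lt_or_eq.mp hu with h | h
          · rw [bit_add_pow h]; exact h6 u h hu'
          · rw [h, Nat.add_div_right _ (by positivity), hz, ← hiff]
            simp [hcmp]
      · simp only [Cond.eval_lt, Expr.eval_var, Expr.eval_arr, Expr.eval_sub, St.tick_v, St.tick_a, ek,
          ht, eL] at hcmp
        simp only [wp_assign]
        simp only [Expr.ok_ofNat, Expr.eval_ofNat, Expr.ok_var, Expr.eval_var, Expr.ok_add, Expr.eval_add,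
          St.set_v, St.tick_v, reduceCtorEq, if_true, if_false, hres, ht, St.set_clk, St.tick_clk]
        refine ⟨trivial, by omega, ⟨trivial, by omega, by omega⟩, by omega, ⟨by omega, by omega, ?_,
          fun u hu hu' => ?_, ?_, fun u hu hu' => ?_⟩, by omega, by omega⟩
        · rw [pow_succ]; omega
        · rcases Nat.lt_succ_iff_lt_or_eq.mp hu with h | h
          · exact h4 u h hu'
          · rw [h]; omega
        · obtain ⟨u, q1, q2, q3⟩ := h5; exact ⟨u, by omega, q2, q3⟩
        · rcases Nat.lt_succ_iff_lt_or_eq.mp hu with h | h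
          · exact h6 u h hu'
          · rw [h, hz, ← hiff]
            simp [hcmp]
  · rintro σ' hf ⟨h1, h2, h3, h4, h5, h6⟩ hc hcl
    have eb : σ'.v .b = b := by rw [hf.v _ (by decide)]; simp [hb]
    simp only [Cond.eval_lt, Expr.eval_var, eb] at hc
    have et : σ'.v .t = b := by omega
    rw [et] at h3 h6
    refine hQ σ' ?_ h6 h3 (by simp at hcl; omega)
    exact (((Frame.set _ _ _ (by decide)).trans (Frame.set _ _ _ (by decide))).trans
      (Frame.set _ _ _ (by decide))).trans (hf.mono (by decide) (by decide))

/-- Masks of records for all positions -/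
def masksCode : Stmt :=
  .k ≔ 0 ;; .while (.lt ♯.k ♯.len) (recordsCode ;; .store .MK ♯.k ♯.res ;; .k ≔ ♯.k + 1)

theorem wp_masksCode (S : Setup E n τ J A K) {σ : St} {ℓ b : ℕ} (hℓ : ℓ ≤ 128 * (n / τ))
    (hlen : σ.v .len = ℓ) (hb : σ.v .b = b) (hb1 : 1 ≤ b) (hbB : 2 ^ b ≤ 512 * (n / τ))
    (hL : ∀ t < ℓ, σ.a .L t ≤ n) {Q : St → Prop}
    (hQ : ∀ σ', Frame [.k, .acc, .res, .t] [.MK] σ σ' →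
      (∀ r < ℓ, Records (σ.a .L) b r (σ'.a .MK r) ∧ σ'.a .MK r < 2 ^ b) →
      σ'.clk ≤ σ.clk + ℓ * (b + 1) → Q σ') : wp E masksCode Q σ := by
  have hW := S.word_lin
  have hsp := S.space
  have hmn := S.m_le
  simp only [masksCode]
  rw [wp_seq, wp_assign]
  refine ⟨by simp; omega, by simp; omega, ?_⟩
  refine wp_while (fun σ' => σ'.v .k ≤ ℓ ∧
      ∀ r < σ'.v .k, Records (σ.a .L) b r (σ'.a .MK r) ∧ σ'.a .MK r < 2 ^ b)
    (fun σ' => ℓ - σ'.v .k) (b + 1) (by simp) (by intro _ _ _; simp) ?_ ?_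
  · rintro σ' hf ⟨h1, h2⟩ hc
    have el : σ'.v .len = ℓ := by rw [hf.v _ (by decide)]; simp [hlen]
    have eb : σ'.v .b = b := by rw [hf.v _ (by decide)]; simp [hb]
    have eL : σ'.a .L = σ.a .L := by rw [hf.a _ (by decide)]; simp
    simp only [Cond.eval_lt, Expr.eval_var, el] at hc
    rw [wp_seq]
    refine wp_recordsCode S (σ := σ'.tick) (k := σ'.v .k) hℓ eb hb1 hbB rfl hc
      (by simpa [eL] using hL) fun σ₂ f2 r2 m2 c2 => ?_
    have ek : σ₂.v .k = σ'.v .k := by simp [f2.v]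
    have eM : σ₂.a .MK = σ'.a .MK := by simp [f2.a]
    simp only [St.tick_a, St.tick_clk, eL] at r2 c2
    rw [wp_seq, wp_store]
    simp only [wp_assign]
    simp [ek, eM]
    and_intros <;> try omega
    intro r hr
    by_cases e : r = σ'.v .k
    · simp only [e, if_true]; exact ⟨r2, m2⟩
    · simp only [e, if_false]; exact h2 r (by omega)
  · rintro σ' hf ⟨h1, h2⟩ hc hcl
    have el : σ'.v .len = ℓ := by rw [hf.v _ (by decide)]; simp [hlen]
    simp only [Cond.eval_lt, Expr.eval_var, el] at hc
    exact hQ σ' ((Frame.set _ _ _ (by decide)).trans (hf.mono (by decide) (by decide)))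
      (fun r hr => h2 r (by omega)) (by simpa using hcl)

end

end LCE

namespace LCE

/-! ### Range minima in constant time: block table combined with bit masks -/

section
variable {E : Env} {n τ J A K : ℕ}

/-- Minima of the blocks of length `b` -/
def blockMinCode : Stmt :=
  .nb ≔ ♯.len / ♯.b ;; .q ≔ 0 ;;
  .while (.lt ♯.q ♯.nb)
    (.acc ≔ .arr .L (♯.q * ♯.b) ;; .t ≔ 1 ;;
     .while (.lt ♯.t ♯.b)
      (.ite (.lt (.arr .L (♯.q * ♯.b + ♯.t)) ♯.acc) (.acc ≔ .arr .L (♯.q * ♯.b + ♯.t)) (.acc ≔ ♯.acc) ;;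
       .t ≔ ♯.t + 1) ;;
     .store .ST ♯.q ♯.acc ;; .q ≔ ♯.q + 1)

theorem wp_blockMinCode (S : Setup E n τ J A K) {σ : St} {ℓ b : ℕ} (hℓ : ℓ ≤ 128 * (n / τ))
    (hlen : σ.v .len = ℓ) (hb : σ.v .b = b) (hb1 : 1 ≤ b) (hbB : b ≤ 512 * (n / τ))
    (hL : ∀ t < ℓ, σ.a .L t ≤ n) {Q : St → Prop}
    (hQ : ∀ σ', Frame [.nb, .q, .acc, .t] [.ST] σ σ' → σ'.v .nb = ℓ / b →
      (∀ q < ℓ / b, IsMin (σ.a .L) (q * b) ((q + 1) * b - 1) (σ'.a .ST q) ∧ σ'.a .ST q ≤ n) →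
      σ'.clk ≤ σ.clk + ℓ * (b + 1) → Q σ') : wp E blockMinCode Q σ := by
  have hW := S.word_lin
  have hsp := S.space
  have hmn := S.m_le
  have hnb : ℓ / b ≤ ℓ := Nat.div_le_self _ _
  have hnb' : ℓ / b * b ≤ ℓ := Nat.div_mul_le_self _ _
  simp only [blockMinCode]
  rw [wp_seq, wp_assign, wp_seq, wp_assign]
  simp only [Expr.ok_ofNat, Expr.eval_ofNat, Expr.ok_var, Expr.eval_var, Expr.ok_div, Expr.eval_div,
    hlen, hb]
  refine ⟨⟨trivial, trivial, by omega⟩, by omega, by omega, by omega, ?_⟩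
  refine wp_while (fun σ' => σ'.v .q ≤ ℓ / b ∧ ∀ q < σ'.v .q,
      IsMin (σ.a .L) (q * b) ((q + 1) * b - 1) (σ'.a .ST q) ∧ σ'.a .ST q ≤ n)
    (fun σ' => ℓ / b - σ'.v .q) (b + 1) (by simp) (by intro _ _ _; simp) ?_ ?_
  · rintro σ' hf ⟨h1, h2⟩ hc
    have en : σ'.v .nb = ℓ / b := by rw [hf.v _ (by decide)]; simp
    have eb : σ'.v .b = b := by rw [hf.v _ (by decide)]; simp [hb]
    have eL : σ'.a .L = σ.a .L := by rw [hf.a _ (by decide)]; simp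
    simp only [Cond.eval_lt, Expr.eval_var, en] at hc
    obtain ⟨q, hq⟩ : ∃ q, σ'.v .q = q := ⟨_, rfl⟩
    rw [hq] at hc h2
    have hqb : q * b + b ≤ ℓ := by
      have : (q + 1) * b ≤ ℓ / b * b := Nat.mul_le_mul_right _ hc
      rw [add_mul] at this; omega
    have hLq := hL (q * b) (by omega)
    rw [wp_seq, wp_assign, wp_seq, wp_assign, wp_seq]
    simp only [Expr.ok_ofNat, Expr.eval_ofNat, Expr.ok_var, Expr.eval_var, Expr.ok_mul, Expr.eval_mul,
      Expr.ok_arr, Expr.eval_arr, St.tick_v, St.tick_a, hq, eb, eL]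
    refine ⟨⟨⟨trivial, trivial, by omega⟩, by omega⟩, by omega, by omega, by omega, ?_⟩
    refine wp_while (fun σ₂ => 1 ≤ σ₂.v .t ∧ σ₂.v .t ≤ b ∧ σ₂.v .acc ≤ n ∧
        IsMin (σ.a .L) (q * b) (q * b + σ₂.v .t - 1) (σ₂.v .acc))
      (fun σ₂ => b - σ₂.v .t) 1 ?_ (by intro _ _ _; simp) ?_ ?_
    · refine ⟨by simp, by simp [hb1], by simpa using hLq, ?_⟩
      simpa using IsMin.single (σ.a .L) (q * b)
    · rintro σ₂ f2 ⟨g1, g2, g3, g4⟩ hc2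
      have eq2 : σ₂.v .q = q := by rw [f2.v _ (by decide)]; simp [hq]
      have eb2 : σ₂.v .b = b := by rw [f2.v _ (by decide)]; simp [eb]
      have eL2 : σ₂.a .L = σ.a .L := by rw [f2.a _ (by decide)]; simp [eL]
      simp only [Cond.eval_lt, Expr.eval_var, eb2] at hc2
      have hLt := hL (q * b + σ₂.v .t) (by omega)
      have hun := g4.union (IsMin.single (σ.a .L) (q * b + σ₂.v .t)) (by omega) (by omega) (by omega)
      rw [wp_seq, wp_ite]
      simp only [wp_assign]
      simp [eq2, eb2, eL2]
      refine ⟨by omega, fun hlt => ?_, fun hlt => ?_⟩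
      · rw [min_eq_right (by simpa using hlt.le)] at hun
        and_intros <;> first | omega | exact hun.1 | exact hun.2
      · rw [min_eq_left (by simpa using hlt)] at hun
        and_intros <;> first | omega | exact hun.1 | exact hun.2
    · rintro σ₂ f2 ⟨g1, g2, g3, g4⟩ hc2 hcl2
      have eq2 : σ₂.v .q = q := by rw [f2.v _ (by decide)]; simp [hq]
      have eb2 : σ₂.v .b = b := by rw [f2.v _ (by decide)]; simp [eb]
      have eS2 : σ₂.a .ST = σ'.a .ST := by rw [f2.a _ (by decide)]; simp
      simp only [Cond.eval_lt, Expr.eval_var, eb2] at hc2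
      rw [show σ₂.v .t = b by omega, show q * b + b = (q + 1) * b by ring] at g4
      simp only [St.set_clk, St.tick_clk, St.set_v, if_true] at hcl2
      rw [wp_seq, wp_store]
      simp only [wp_assign]
      simp [eq2, eS2]
      and_intros <;> try omega
      intro q' hq'
      by_cases e : q' = q
      · simp only [e, if_true]; exact ⟨g4, g3⟩
      · simp only [e, if_false]; exact h2 q' (by omega)
  · rintro σ' hf ⟨h1, h2⟩ hc hcl
    have en : σ'.v .nb = ℓ / b := by rw [hf.v _ (by decide)]; simp
    simp only [Cond.eval_lt, Expr.eval_var, en] at hc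
    have : ℓ / b * (b + 1) ≤ ℓ * (b + 1) := Nat.mul_le_mul_right _ hnb
    refine hQ σ' ?_ en (fun q hq => h2 q (by omega)) (by simp at hcl; omega)
    exact ((Frame.set _ _ _ (by decide)).trans (Frame.set _ _ _ (by decide))).trans
      (hf.mono (by decide) (by decide))

/-- Minima of `2 ^ (k + 1)` consecutive blocks from those of `2 ^ k` consecutive blocks -/
def levelCode : Stmt :=
  .q ≔ 0 ;;
  .while (.lt (♯.q + (♯.e + ♯.e)) (♯.nb + 1))
    (.u1 ≔ .arr .ST (♯.k * ♯.nb + ♯.q) ;; .u2 ≔ .arr .ST (♯.k * ♯.nb + ♯.q + ♯.e) ;;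
     .ite (.lt ♯.u2 ♯.u1) (.u1 ≔ ♯.u2) (.u1 ≔ ♯.u1) ;;
     .store .ST ((♯.k + 1) * ♯.nb + ♯.q) ♯.u1 ;; .q ≔ ♯.q + 1)

/-- The rows of the table below `k` hold minima of ranges of blocks. -/
def TableTo (L : ℕ → ℕ) (n b nb k : ℕ) (ST : ℕ → ℕ) : Prop :=
  ∀ k' < k, ∀ q, q + 2 ^ k' ≤ nb →
    IsMin L (q * b) ((q + 2 ^ k') * b - 1) (ST (k' * nb + q)) ∧ ST (k' * nb + q) ≤ n

theorem wp_levelCode (S : Setup E n τ J A K) {σ : St} {L : ℕ → ℕ} {b nb k : ℕ} (hb1 : 1 ≤ b)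
    (hnb : σ.v .nb = nb) (he : σ.v .e = 2 ^ k) (hk : σ.v .k = k) (h2k : 2 ^ (k + 1) ≤ nb)
    (hsz : (k + 2) * nb ≤ 128 * (n / τ)) (hT : TableTo L n b nb (k + 1) (σ.a .ST)) {Q : St → Prop}
    (hQ : ∀ σ', Frame [.q, .u1, .u2] [.ST] σ σ' → TableTo L n b nb (k + 2) (σ'.a .ST) →
      σ'.clk ≤ σ.clk + nb → Q σ') : wp E levelCode Q σ := by
  have hW := S.word_lin
  have hsp := S.space
  have hmn := S.m_le
  have e1 : (k + 1) * nb = k * nb + nb := by ring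
  have e2 : (k + 2) * nb = k * nb + nb + nb := by ring
  have hk1 : k < 2 ^ k := Nat.lt_two_pow_self
  rw [pow_succ] at h2k
  rw [e2] at hsz
  simp only [levelCode]
  rw [wp_seq, wp_assign]
  refine ⟨by simp; omega, by simp; omega, ?_⟩
  refine wp_while (fun σ' => σ'.v .q ≤ nb ∧ TableTo L n b nb (k + 1) (σ'.a .ST) ∧
      ∀ q < σ'.v .q, IsMin L (q * b) ((q + 2 ^ (k + 1)) * b - 1) (σ'.a .ST ((k + 1) * nb + q)) ∧
        σ'.a .ST ((k + 1) * nb + q) ≤ n)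
    (fun σ' => nb - σ'.v .q) 1 (by simpa using hT) ?_ ?_ ?_
  · rintro σ' hf ⟨h1, -⟩
    have en : σ'.v .nb = nb := by rw [hf.v _ (by decide)]; simp [hnb]
    have ee : σ'.v .e = 2 ^ k := by rw [hf.v _ (by decide)]; simp [he]
    simp [en, ee]; omega
  · rintro σ' hf ⟨h1, h2, h3⟩ hc
    have en : σ'.v .nb = nb := by rw [hf.v _ (by decide)]; simp [hnb]
    have ee : σ'.v .e = 2 ^ k := by rw [hf.v _ (by decide)]; simp [he]
    have ek : σ'.v .k = k := by rw [hf.v _ (by decide)]; simp [hk]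
    simp only [Cond.eval_lt, Expr.eval_var, Expr.eval_add, Expr.eval_ofNat, en, ee] at hc
    obtain ⟨q, hq⟩ : ∃ q, σ'.v .q = q := ⟨_, rfl⟩
    rw [hq] at hc h3
    obtain ⟨a1, a2⟩ := h2 k (by omega) q (by omega)
    obtain ⟨b1, b2⟩ := h2 k (by omega) (q + 2 ^ k) (by omega)
    rw [← add_assoc] at b1 b2
    have hpos : 0 < 2 ^ k * b := by positivity
    have hun := a1.union b1 (by rw [add_mul]; omega) (by rw [add_mul]; omega)
      (by rw [add_mul, add_mul, add_mul]; omega)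
    rw [show q + 2 ^ k + 2 ^ k = q + 2 ^ (k + 1) by ring] at hun
    have hfin : ∀ v, v = min (σ'.a .ST (k * nb + q)) (σ'.a .ST (k * nb + q + 2 ^ k)) →
        TableTo L n b nb (k + 1) ((σ'.setA .ST ((k + 1) * nb + q) v).a .ST) ∧
        ∀ q' < q + 1, IsMin L (q' * b) ((q' + 2 ^ (k + 1)) * b - 1)
          ((σ'.setA .ST ((k + 1) * nb + q) v).a .ST ((k + 1) * nb + q')) ∧
          (σ'.setA .ST ((k + 1) * nb + q) v).a .ST ((k + 1) * nb + q') ≤ n := by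
      intro v hv
      refine ⟨fun k' hk' q' hq' => ?_, fun q' hq' => ?_⟩
      · have hp := Nat.two_pow_pos k'
        have : (k' + 1) * nb ≤ (k + 1) * nb := Nat.mul_le_mul_right _ hk'
        rw [add_mul, one_mul] at this
        simp only [St.setA_a, if_true]
        rw [if_neg (by omega)]
        exact h2 k' hk' q' hq'
      · simp only [St.setA_a, if_true]
        by_cases e : q' = q
        · rw [e, if_pos rfl, hv]; exact ⟨hun, by omega⟩
        · rw [if_neg (by omega)]; exact h3 q' (by omega)
    simp only [St.setA_a, if_true] at hfin
    rw [e1] at hfin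
    rw [wp_seq, wp_assign, wp_seq, wp_assign, wp_seq, wp_ite]
    simp only [wp_assign, wp_store, wp_seq]
    simp [en, ee, ek, hq, e1]
    refine ⟨by omega, by omega, by omega, by omega, fun hlt => ?_, fun hlt => ?_⟩
    · obtain ⟨r1, r2⟩ := hfin _ (min_eq_right (by simpa using hlt.le)).symm
      and_intros <;> first | omega | exact r1 | simpa [Nat.lt_succ_iff] using r2
    · obtain ⟨r1, r2⟩ := hfin _ (min_eq_left (by simpa using hlt)).symm
      and_intros <;> first | omega | exact r1 | simpa [Nat.lt_succ_iff] using r2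
  · rintro σ' hf ⟨h1, h2, h3⟩ hc hcl
    have en : σ'.v .nb = nb := by rw [hf.v _ (by decide)]; simp [hnb]
    have ee : σ'.v .e = 2 ^ k := by rw [hf.v _ (by decide)]; simp [he]
    simp only [Cond.eval_lt, Expr.eval_var, Expr.eval_add, Expr.eval_ofNat, en, ee] at hc
    refine hQ σ' ((Frame.set _ _ _ (by decide)).trans (hf.mono (by decide) (by decide))) ?_
      (by simp at hcl; omega)
    intro k' hk' q hq
    rcases Nat.lt_succ_iff_lt_or_eq.mp hk' with h | h
    · exact h2 k' h q hq
    · subst h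
      rw [pow_succ] at hq
      exact h3 q (by omega)

/-- Minima of all ranges of `2 ^ k` blocks -/
def tableCode : Stmt :=
  .k ≔ 0 ;; .e ≔ 1 ;;
  .while (.lt (♯.e + ♯.e) (♯.nb + 1)) (levelCode ;; .k ≔ ♯.k + 1 ;; .e ≔ ♯.e + ♯.e)

theorem wp_tableCode (S : Setup E n τ J A K) {σ : St} {L : ℕ → ℕ} {ℓ b : ℕ} (hb1 : 1 ≤ b)
    (hℓ : ℓ ≤ 128 * (n / τ)) (hℓb : ℓ < 2 ^ b) (hnb : σ.v .nb = ℓ / b)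
    (hT : ∀ q < ℓ / b, IsMin L (q * b) ((q + 1) * b - 1) (σ.a .ST q) ∧ σ.a .ST q ≤ n)
    {Q : St → Prop}
    (hQ : ∀ σ', Frame [.k, .e, .q, .u1, .u2] [.ST] σ σ' →
      (∀ k, TableTo L n b (ℓ / b) k (σ'.a .ST)) → σ'.clk ≤ σ.clk + ℓ * (ℓ + 1) → Q σ') :
    wp E tableCode Q σ := by
  have hW := S.word_lin
  have hsp := S.space
  have hmn := S.m_le
  have hnb1 : ℓ / b ≤ ℓ := Nat.div_le_self _ _
  have hnb2 : b * (ℓ / b) ≤ ℓ := Nat.mul_div_le ℓ b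
  simp only [tableCode]
  rw [wp_seq, wp_assign, wp_seq, wp_assign]
  simp only [Expr.ok_ofNat, Expr.eval_ofNat]
  refine ⟨by omega, by omega, by omega, by omega, ?_⟩
  refine wp_while (fun σ' => σ'.v .e = 2 ^ σ'.v .k ∧ (σ'.v .e ≤ ℓ / b ∨ σ'.v .e = 1) ∧
      TableTo L n b (ℓ / b) (σ'.v .k + 1) (σ'.a .ST))
    (fun σ' => ℓ / b - σ'.v .e) (ℓ + 1) ?_ ?_ ?_ ?_
  · refine ⟨by simp, by simp, fun k' hk' q hq => ?_⟩
    simp only [St.set_v, reduceCtorEq, if_true, if_false] at hk'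
    have e : k' = 0 := by omega
    subst e
    simpa using hT q (by simpa using hq)
  · rintro σ' hf ⟨-, h1, -⟩
    have en : σ'.v .nb = ℓ / b := by rw [hf.v _ (by decide)]; simp [hnb]
    simp [en]; omega
  · rintro σ' hf ⟨h1, h2, h3⟩ hc
    have en : σ'.v .nb = ℓ / b := by rw [hf.v _ (by decide)]; simp [hnb]
    simp only [Cond.eval_lt, Expr.eval_var, Expr.eval_add, Expr.eval_ofNat, en] at hc
    obtain ⟨k, hk⟩ : ∃ k, σ'.v .k = k := ⟨_, rfl⟩
    rw [hk] at h1 h3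
    have h2k : 2 ^ (k + 1) ≤ ℓ / b := by rw [pow_succ]; omega
    -- This keeps the table linear: 2^(k+1) is at most ℓ and ℓ is below 2^b, so there are at most
    -- `b` rows, each with ℓ / b entries.
    have hkb : k + 2 ≤ b := by
      have : 2 ^ (k + 1) < 2 ^ b := by omega
      exact (Nat.pow_lt_pow_iff_right (by norm_num)).mp this
    have hk1 : k < 2 ^ k := Nat.lt_two_pow_self
    have hsz : (k + 2) * (ℓ / b) ≤ 128 * (n / τ) :=
      ((Nat.mul_le_mul_right _ hkb).trans hnb2).trans hℓ
    rw [wp_seq]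
    refine wp_levelCode S (σ := σ'.tick) (k := k) hb1 en h1 hk h2k hsz h3 fun σ₂ f2 t2 c2 => ?_
    have ek2 : σ₂.v .k = k := by simp [f2.v, hk]
    have ee2 : σ₂.v .e = 2 ^ k := by simp [f2.v, h1]
    simp only [St.tick_clk] at c2
    rw [wp_seq, wp_assign, wp_assign]
    simp only [Expr.eval_add, Expr.eval_var, Expr.eval_ofNat, Expr.ok_add, Expr.ok_var, Expr.ok_ofNat,
      ek2, ee2, h1, St.set_v, if_true, reduceCtorEq, if_false, St.set_a, St.set_clk]
    rw [h1] at hc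
    refine ⟨⟨trivial, by omega, by omega⟩, by omega, ⟨trivial, trivial, by omega⟩, by omega,
      ⟨by rw [pow_succ]; omega, by omega, t2⟩, by omega, by omega⟩
  · rintro σ' hf ⟨h1, h2, h3⟩ hc hcl
    have en : σ'.v .nb = ℓ / b := by rw [hf.v _ (by decide)]; simp [hnb]
    simp only [Cond.eval_lt, Expr.eval_var, Expr.eval_add, Expr.eval_ofNat, en] at hc
    have : (ℓ / b - 1) * (ℓ + 1) ≤ ℓ * (ℓ + 1) := Nat.mul_le_mul_right _ (by omega)
    refine hQ σ' ?_ (fun k k' hk' q hq => ?_) (by simp at hcl; omega)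
    · exact ((Frame.set _ _ _ (by decide)).trans (Frame.set _ _ _ (by decide))).trans
        (hf.mono (by decide) (by decide))
    · refine h3 k' ?_ q hq
      by_contra hlt
      have : 2 ^ (σ'.v .k + 1) ≤ 2 ^ k' := Nat.pow_le_pow_right (by norm_num) (by omega)
      rw [pow_succ] at this
      omega

/-- A data structure for range minima of `L` on `[0, ℓ)` -/
structure RmqOK (n ℓ b nb : ℕ) (L MK LG ST : ℕ → ℕ) : Prop where
  pos : 1 ≤ b
  lt : ℓ < 2 ^ b
  le : 2 ^ b ≤ 2 * ℓ + 2
  nb_eq : nb = ℓ / b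
  val : ∀ t < ℓ, L t ≤ n
  mask : ∀ r < ℓ, Records L b r (MK r) ∧ MK r < 2 ^ b
  log : ∀ t < 2 ^ b, LG t = Nat.log 2 t
  table : ∀ k, TableTo L n b nb k ST

def rmqBuildCode : Stmt := widthCode ;; logCode ;; masksCode ;; blockMinCode ;; tableCode

theorem wp_rmqBuildCode (S : Setup E n τ J A K) {σ : St} {N : ℕ} (hN : N ≤ 128 * (n / τ))
    (hσN : σ.v .N = N) (hL : ∀ t, t + 1 < N → σ.a .L t ≤ n) {Q : St → Prop}
    (hQ : ∀ σ', Frame [.len, .b, .e, .t, .k, .acc, .res, .nb, .q, .u1, .u2] [.LG, .MK, .ST] σ σ' →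
      RmqOK n (N - 1) (σ'.v .b) (σ'.v .nb) (σ.a .L) (σ'.a .MK) (σ'.a .LG) (σ'.a .ST) →
      σ'.clk ≤ σ.clk + (4 * N + 4) * (4 * N + 4) → Q σ') : wp E rmqBuildCode Q σ := by
  have hmp := S.m_pos
  have hL' : ∀ t < N - 1, σ.a .L t ≤ n := fun t ht => hL t (by omega)
  simp only [rmqBuildCode]
  rw [wp_seq]
  refine wp_widthCode S hN hσN fun σ₁ b f1 l1 b1 e1 q1 q2 q3 c1 => ?_
  have hbb : b < 2 ^ b := Nat.lt_two_pow_self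
  rw [wp_seq]
  refine wp_logCode S (B := 2 ^ b) (by omega) e1 fun σ₂ f2 g2 c2 => ?_
  rw [wp_seq]
  refine wp_masksCode S (ℓ := N - 1) (b := b) (by omega) (by simp [f2.v, l1]) (by simp [f2.v, b1]) q1
    (by omega) (by simpa [f2.a, f1.a] using hL') fun σ₃ f3 g3 c3 => ?_
  rw [wp_seq]
  refine wp_blockMinCode S (ℓ := N - 1) (b := b) (by omega) (by simp [f3.v, f2.v, l1])
    (by simp [f3.v, f2.v, b1]) q1 (by omega) (by simpa [f3.a, f2.a, f1.a] using hL')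
    fun σ₄ f4 n4 g4 c4 => ?_
  have eL2 : σ₂.a .L = σ.a .L := by simp [f2.a, f1.a]
  have eL3 : σ₃.a .L = σ.a .L := by simp [f3.a, eL2]
  rw [eL2] at g3
  rw [eL3] at g4
  refine wp_tableCode S (L := σ.a .L) (ℓ := N - 1) (b := b) q1 (by omega) q2 n4 g4
    fun σ₅ f5 g5 c5 => ?_
  refine hQ σ₅ ?_ ?_ ?_
  · exact ((((f1.mono (by decide) (by decide)).trans (f2.mono (by decide) (by decide))).trans
      (f3.mono (by decide) (by decide))).trans (f4.mono (by decide) (by decide))).trans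
      (f5.mono (by decide) (by decide))
  · have eb : σ₅.v .b = b := by simp [f5.v, f4.v, f3.v, f2.v, b1]
    have en : σ₅.v .nb = (N - 1) / b := by simp [f5.v, n4]
    have eM : σ₅.a .MK = σ₃.a .MK := by simp [f5.a, f4.a]
    have eG : σ₅.a .LG = σ₂.a .LG := by simp [f5.a, f4.a, f3.a]
    rw [eb, en, eM, eG]
    exact ⟨q1, q2, q3, rfl, hL', g3, g2, g5⟩
  · have hb2 : b ≤ 2 * N + 1 := by omega
    have t1 : (N - 1) * (b + 1) ≤ N * (2 * N + 2) := Nat.mul_le_mul (by omega) (by omega)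
    have t2 : (N - 1) * (N - 1 + 1) ≤ N * (N + 1) := Nat.mul_le_mul (by omega) (by omega)
    have t3 : N + (2 * N + 2) + N * (2 * N + 2) + N * (2 * N + 2) + N * (N + 1) ≤
      (4 * N + 4) * (4 * N + 4) := by nlinarith
    omega

/-- The minimum on a range of length at most `b`, read off from a mask of records -/
def smallExpr (l r : Expr) : Expr :=
  .arr .L (r - .arr .LG (.arr .MK r % .op .shl 1 (r - l + 1)))

/-- Reducing the mask of `r` modulo `2 ^ (r - l + 1)` keeps the records inside the range; the
highest of them is the minimum, and the table of logarithms locates it. -/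
theorem eval_smallExpr {σ : St} {ℓ b nb : ℕ}
    (h : RmqOK n ℓ b nb (σ.a .L) (σ.a .MK) (σ.a .LG) (σ.a .ST)) {el er : Expr} {l r : ℕ}
    (hl : el.eval E σ = l) (hr : er.eval E σ = r) (hlr : l ≤ r) (hrb : r < l + b) (hrℓ : r < ℓ) :
    IsMin (σ.a .L) l r ((smallExpr el er).eval E σ) := by
  obtain ⟨m1, m2⟩ := h.mask r hrℓ
  have h1 := m1.isMin (k := r - l) (by omega) (by omega)
  rw [show r - (r - l) = l by omega] at h1
  simp only [smallExpr, Expr.eval_arr, Expr.eval_sub, Expr.eval_mod, Expr.eval_shl, Expr.eval_add,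
    Expr.eval_ofNat, hl, hr, one_mul]
  rwa [h.log _ ((Nat.mod_le _ _).trans_lt m2)]

theorem ok_smallExpr (S : Setup E n τ J A K) {σ : St} {ℓ b nb : ℕ} (hℓ : ℓ ≤ 128 * (n / τ))
    (h : RmqOK n ℓ b nb (σ.a .L) (σ.a .MK) (σ.a .LG) (σ.a .ST)) {el er : Expr} {l r : ℕ}
    (hl : el.eval E σ = l) (hr : er.eval E σ = r) (hol : el.ok E σ) (hor : er.ok E σ)
    (hlr : l ≤ r) (hrb : r < l + b) (hrℓ : r < ℓ) : (smallExpr el er).ok E σ := by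
  have hW := S.word_lin
  have hsp := S.space
  have hmn := S.m_le
  have hmp := S.m_pos
  have h1 := h.le
  have hm := (h.mask r hrℓ).2
  have hp : 2 ^ (r - l + 1) ≤ 2 ^ b := Nat.pow_le_pow_right (by norm_num) (by omega)
  have hmod := Nat.mod_le (σ.a .MK r) (2 ^ (r - l + 1))
  have hbb : b < 2 ^ b := Nat.lt_two_pow_self
  simp only [smallExpr, Expr.eval_arr, Expr.eval_sub, Expr.eval_mod, Expr.eval_shl, Expr.eval_add,
    Expr.eval_ofNat, hl, hr, one_mul, Expr.ok_arr, Expr.ok_sub, Expr.ok_mod, Expr.ok_shl, Expr.ok_add,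
    Expr.ok_ofNat]
  refine ⟨⟨hor, ⟨⟨⟨hor, by omega⟩, ⟨by omega, ⟨⟨hor, hol, by omega⟩, by omega, by omega⟩, by omega⟩,
    by omega⟩, by omega⟩, by omega⟩, by omega⟩

/-- `acc := min acc e` -/
def minCode : Stmt := .ite (.lt ♯.e ♯.acc) (.acc ≔ ♯.e) (.acc ≔ ♯.acc)

theorem wp_minCode {σ : St} {x y : ℕ} (hx : σ.v .acc = x) (hy : σ.v .e = y) (hxW : x < E.W)
    (hyW : y < E.W) {Q : St → Prop} (hQ : Q (σ.set .acc (min x y))) : wp E minCode Q σ := by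
  simp only [minCode]
  rw [wp_ite]
  refine ⟨by simp, fun h => ?_, fun h => ?_⟩ <;>
    simp only [Cond.eval_lt, Expr.eval_var, hx, hy] at h <;>
    simp only [wp_assign, Expr.ok_var, Expr.eval_var, hx, hy, true_and]
  · rw [min_eq_right h.le] at hQ; exact ⟨hyW, hQ⟩
  · rw [min_eq_left (by omega)] at hQ; exact ⟨hxW, hQ⟩

/-- `acc := ` minimum on the range from `lo` to `hi` -/
def rmqCode : Stmt :=
  .ite (.lt ♯.hi (♯.lo + ♯.b)) (.acc ≔ smallExpr ♯.lo ♯.hi)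
    (.acc ≔ smallExpr ♯.lo (♯.lo + ♯.b - 1) ;; .e ≔ smallExpr (♯.hi + 1 - ♯.b) ♯.hi ;; minCode ;;
     .x0 ≔ ♯.lo / ♯.b + 1 ;; .x1 ≔ ♯.hi / ♯.b ;;
     .ite (.lt ♯.x0 ♯.x1)
      (.k ≔ .arr .LG (♯.x1 - ♯.x0) ;; .e ≔ .arr .ST (♯.k * ♯.nb + ♯.x0) ;; minCode ;;
       .e ≔ .arr .ST (♯.k * ♯.nb + (♯.x1 - .op .shl 1 ♯.k)) ;; minCode)
      (.acc ≔ ♯.acc))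

/-- A prefix and a suffix of the range together with a middle part that touches both of them cover
the range. If the prefix already reaches the end of the middle part, it also touches the suffix. -/
theorem IsMin.min {L : ℕ → ℕ} {l r a b l' r' v v' : ℕ} (h1 : IsMin L l a v) (h2 : IsMin L b r v')
    (ha : a ≤ r) (hb : l ≤ b) {w : ℕ} (h : IsMin L l' r' w) (hl : l ≤ l') (hr : r' ≤ r)
    (hla : l' ≤ a + 1) (hrb : b ≤ r' + 1) : IsMin L l r (Min.min (Min.min v v') w) := by
  rw [min_right_comm]
  rcases Nat.lt_or_ge a r' with h' | h'
  · exact (h1.union h hl hla h'.le).union h2 hb hrb hr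
  · refine ⟨fun u hu hur => ?_, ?_⟩
    · rcases Nat.lt_or_ge a u with h'' | h''
      · exact (min_le_right _ _).trans (h2.1 u (by omega) hur)
      · exact (min_le_left _ _).trans ((min_le_left _ _).trans (h1.1 u hu h''))
    · obtain ⟨u1, a1, a2, a3⟩ := h1.2
      obtain ⟨u2, b1, b2, b3⟩ := h2.2
      obtain ⟨u3, c1, c2, c3⟩ := h.2
      rcases min_choice (Min.min v w) v' with e | e <;> rw [e]
      · rcases min_choice v w with e' | e' <;> rw [e']
        · exact ⟨u1, a1, by omega, a3⟩
        · exact ⟨u3, by omega, by omega, c3⟩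
      · exact ⟨u2, by omega, b2, b3⟩

/-- A range longer than `b` is covered by its first `b` and its last `b` positions, answered from
masks, and by the whole blocks `x0` to `x1 - 1` in between, answered by two overlapping entries of
the table. -/
theorem wp_rmqCode (S : Setup E n τ J A K) {σ : St} {ℓ b nb l r : ℕ} (hℓ : ℓ ≤ 128 * (n / τ))
    (h : RmqOK n ℓ b nb (σ.a .L) (σ.a .MK) (σ.a .LG) (σ.a .ST)) (hb : σ.v .b = b)
    (hnb : σ.v .nb = nb) (hl : σ.v .lo = l) (hr : σ.v .hi = r) (hlr : l ≤ r) (hrℓ : r < ℓ)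
    {Q : St → Prop} (hQ : ∀ σ', Frame [.acc, .e, .x0, .x1, .k] [] σ σ' →
      IsMin (σ.a .L) l r (σ'.v .acc) → σ'.clk = σ.clk → Q σ') : wp E rmqCode Q σ := by
  have hW := S.word_lin
  have hsp := S.space
  have hmn := S.m_le
  have hb1 := h.pos
  have hle := h.le
  have hbb : b < 2 ^ b := Nat.lt_two_pow_self
  have hbound : ∀ {l r v}, r < ℓ → IsMin (σ.a .L) l r v → v ≤ n := by
    intro l r v hr hv
    obtain ⟨u, -, h2, h3⟩ := hv.2
    rw [← h3]; exact h.val u (by omega)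
  simp only [rmqCode]
  rw [wp_ite]
  refine ⟨by simp [hl, hb]; omega, fun hc => ?_, fun hc => ?_⟩ <;>
    simp only [Cond.eval_lt, Expr.eval_var, Expr.eval_add, hl, hr, hb] at hc
  · have hm := eval_smallExpr (E := E) h (el := ♯.lo) (er := ♯.hi) hl hr hlr hc hrℓ
    rw [wp_assign]
    refine ⟨ok_smallExpr S hℓ h hl hr trivial trivial hlr hc hrℓ, ?_, hQ _ (Frame.set _ _ _ (by decide))
      (by simpa using hm) rfl⟩
    have := hbound hrℓ hm; omega
  · have hm1 := eval_smallExpr (E := E) h (el := ♯.lo) (er := ♯.lo + ♯.b - 1) (r := l + b - 1) hl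
      (by simp [hl, hb]) (by omega) (by omega) (by omega)
    have ok1 := ok_smallExpr S hℓ h (el := ♯.lo) (er := ♯.lo + ♯.b - 1) (r := l + b - 1) hl
      (by simp [hl, hb]) trivial (by simp [hl, hb]; omega) (by omega) (by omega) (by omega)
    have v1 := hbound (by omega) hm1
    obtain ⟨y1, hy1⟩ : ∃ y, (smallExpr ♯.lo (♯.lo + ♯.b - 1)).eval E σ = y := ⟨_, rfl⟩
    rw [hy1] at hm1 v1
    have hm2 := eval_smallExpr (E := E) (σ := σ.set .acc y1) h (el := ♯.hi + 1 - ♯.b) (er := ♯.hi)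
      (l := r + 1 - b) (by simp [hr, hb]) (by simpa using hr) (by omega) (by omega) hrℓ
    have ok2 := ok_smallExpr S (σ := σ.set .acc y1) hℓ h (el := ♯.hi + 1 - ♯.b) (er := ♯.hi)
      (l := r + 1 - b) (by simp [hr, hb]) (by simpa using hr) (by simp [hr, hb]; omega) trivial
      (by omega) (by omega) hrℓ
    have v2 := hbound (by omega) hm2
    obtain ⟨y2, hy2⟩ : ∃ y, (smallExpr (♯.hi + 1 - ♯.b) ♯.hi).eval E (σ.set .acc y1) = y := ⟨_, rfl⟩
    rw [hy2] at hm2 v2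
    rw [wp_seq, wp_assign, wp_seq, wp_assign, hy1, hy2]
    refine ⟨ok1, by omega, ok2, by omega, ?_⟩
    rw [wp_seq]
    refine wp_minCode (x := y1) (y := y2) (by simp) (by simp) (by omega) (by omega) ?_
    have hx0 : l / b ≤ l := Nat.div_le_self _ _
    have hx1 : r / b ≤ r := Nat.div_le_self _ _
    rw [wp_seq, wp_assign, wp_seq, wp_assign]
    have el1 := Nat.div_add_mod l b
    have el2 := Nat.mod_lt l hb1
    have er1 := Nat.div_add_mod r b
    have er2 := Nat.mod_lt r hb1
    obtain ⟨x0, hx0d⟩ : ∃ x0, x0 = l / b + 1 := ⟨_, rfl⟩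
    obtain ⟨x1, hx1d⟩ : ∃ x1, x1 = r / b := ⟨_, rfl⟩
    simp only [Expr.ok_div, Expr.ok_add, Expr.ok_var, Expr.ok_ofNat, Expr.eval_add, Expr.eval_div,
      Expr.eval_var, Expr.eval_ofNat, St.set_v, reduceCtorEq, if_false, hl, hr, hb, ← hx0d, ← hx1d]
    refine ⟨⟨⟨trivial, trivial, by omega⟩, by omega, by omega⟩, by omega, ⟨trivial, trivial, by omega⟩,
      by omega, ?_⟩
    rw [← hx1d] at hx1 er1
    have fr : ∀ v w x y, Frame [.acc, .e, .x0, .x1, .k] [] σ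
        (((((σ.set .acc v).set .e w).set .acc x).set .x0 y).set .x1 x1) := fun v w x y =>
      ((((Frame.set _ _ _ (by decide)).trans (Frame.set _ _ _ (by decide))).trans
        (Frame.set _ _ _ (by decide))).trans (Frame.set _ _ _ (by decide))).trans
        (Frame.set _ _ _ (by decide))
    rw [wp_ite]
    refine ⟨by simp, fun hc2 => ?_, fun hc2 => ?_⟩ <;>
      simp only [Cond.eval_lt, Expr.eval_var, St.set_v, reduceCtorEq, if_false, if_true] at hc2
    · have hnbl : x1 ≤ nb := by rw [h.nb_eq, hx1d]; exact Nat.div_le_div_right (by omega)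
      have hnbb : nb * b ≤ ℓ := by rw [h.nb_eq]; exact Nat.div_mul_le_self _ _
      have hnb' : nb ≤ ℓ := by rw [h.nb_eq]; exact Nat.div_le_self _ _
      have hlog := h.log (x1 - x0) (by have := h.lt; omega)
      have hk1 : 2 ^ Nat.log 2 (x1 - x0) ≤ x1 - x0 := Nat.pow_log_le_self 2 (by omega)
      have hk2 : x1 - x0 < 2 ^ (Nat.log 2 (x1 - x0) + 1) := Nat.lt_pow_succ_log_self (by norm_num) _
      generalize Nat.log 2 (x1 - x0) = k at hlog hk1 hk2
      rw [pow_succ] at hk2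
      have hkk : k < 2 ^ k := Nat.lt_two_pow_self
      obtain ⟨s1, s2⟩ := h.table (k + 1) k (by omega) x0 (by omega)
      obtain ⟨t1, t2⟩ := h.table (k + 1) k (by omega) (x1 - 2 ^ k) (by omega)
      rw [show x1 - 2 ^ k + 2 ^ k = x1 by omega] at t1
      have hkb : k < b := by
        have : 2 ^ k < 2 ^ b := by have := h.lt; omega
        exact (Nat.pow_lt_pow_iff_right (by norm_num)).mp this
      have hknb : k * nb + nb ≤ ℓ := by
        have : (k + 1) * nb ≤ b * nb := Nat.mul_le_mul_right _ hkb
        rw [add_mul, one_mul] at this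
        rw [mul_comm] at hnbb
        omega
      rw [wp_seq, wp_assign, wp_seq, wp_assign]
      simp only [Expr.ok_arr, Expr.eval_arr, Expr.ok_sub, Expr.ok_var, Expr.eval_sub, Expr.ok_add,
        Expr.eval_add, Expr.ok_mul, Expr.eval_mul, Expr.eval_var, St.set_v, reduceCtorEq, if_false,
        if_true, St.set_a, hlog, hnb]
      refine ⟨⟨⟨trivial, trivial, by omega⟩, by omega⟩, by omega,
        ⟨⟨⟨trivial, trivial, by omega⟩, trivial, by omega⟩, by omega⟩, by omega, ?_⟩
      rw [wp_seq]
      refine wp_minCode (x := min y1 y2) (y := σ.a .ST (k * nb + x0)) (by simp) (by simp) (by omega)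
        (by omega) ?_
      rw [wp_seq, wp_assign]
      simp only [Expr.ok_arr, Expr.eval_arr, Expr.ok_sub, Expr.ok_var, Expr.eval_sub, Expr.ok_add,
        Expr.eval_add, Expr.ok_mul, Expr.eval_mul, Expr.eval_var, St.set_v, reduceCtorEq, if_false,
        if_true, St.set_a, hnb, Expr.ok_shl, Expr.eval_shl, Expr.ok_ofNat, Expr.eval_ofNat, one_mul]
      refine ⟨⟨⟨⟨trivial, trivial, by omega⟩, ⟨trivial, ⟨by omega, trivial, by omega⟩, by omega⟩,
        by omega⟩, by omega⟩, by omega, ?_⟩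
      refine wp_minCode (x := min (min y1 y2) (σ.a .ST (k * nb + x0)))
        (y := σ.a .ST (k * nb + (x1 - 2 ^ k))) (by simp) (by simp) (by omega) (by omega) ?_
      refine hQ _ ?_ ?_ (by simp)
      · exact (((((fr _ _ _ _).trans (Frame.set _ _ _ (by decide))).trans
          (Frame.set _ _ _ (by decide))).trans (Frame.set _ _ _ (by decide))).trans
          (Frame.set _ _ _ (by decide))).trans (Frame.set _ _ _ (by decide))
      · simp only [St.set_v, if_true]
        have hx0b : x0 * b = b * (l / b) + b := by rw [hx0d]; ring
        have hx1b : x1 * b = b * x1 := mul_comm _ _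
        have m1 : x0 * b ≤ (x1 - 2 ^ k) * b := Nat.mul_le_mul_right _ (by omega)
        have m2 : (x1 - 2 ^ k) * b ≤ (x0 + 2 ^ k) * b := Nat.mul_le_mul_right _ (by omega)
        have m3 : (x0 + 2 ^ k) * b ≤ x1 * b := Nat.mul_le_mul_right _ (by omega)
        have m4 : (x0 + 1) * b ≤ x1 * b := Nat.mul_le_mul_right _ (by omega)
        rw [add_mul] at m4
        have hu := s1.union t1 m1 (by omega) (by omega)
        have := hm1.min hm2 (by omega) (by omega) hu (by omega) (by omega) (by omega) (by omega)
        rwa [← min_assoc] at this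
    · have hlt : r < l + 2 * b := by
        have : b * x1 ≤ b * (l / b + 1) := Nat.mul_le_mul_left _ (by omega)
        rw [mul_add] at this
        omega
      simp only [wp_assign, Expr.ok_var, Expr.eval_var, St.set_v, reduceCtorEq, if_false, if_true,
        true_and]
      refine ⟨by omega, hQ _ ((fr _ _ _ _).trans (Frame.set _ _ _ (by decide))) ?_ (by simp)⟩
      simp only [St.set_v, if_true]
      exact hm1.union hm2 (by omega) (by omega) (by omega)

end

end LCE

namespace LCE

/-! ### Queries -/

/-- `t` is the index of the first point at or behind `x`. -/
def IsSucc (N : ℕ) (P : ℕ → ℕ) (x t : ℕ) : Prop := t ≤ N ∧ (∀ s < t, P s < x) ∧ x ≤ P t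

section
variable {n τ N c : ℕ} {f P : ℕ → ℕ} {B : Set ℕ}

theorem IsSucc.le (hP : Increasing n N P) (hB : Points B n N P) {x t y : ℕ} (h : IsSucc N P x t)
    (hy : y + (n + 1) ∈ B) (hyn : y < n) (hxy : x ≤ y) : P t ≤ y := by
  obtain ⟨s, hs, rfl⟩ := (hB.mem y).mpr ⟨hyn, hy⟩
  by_contra hlt
  rcases Nat.lt_or_ge s t with h' | h'
  · exact absurd (h.2.1 s h') (by omega)
  · rcases Nat.eq_or_lt_of_le h' with e | e
    · rw [e] at hlt; exact hlt le_rfl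
    · exact hlt (hP.2 t s e (by omega)).le

/-- Up to offset `e` neither text meets a boundary from distance 16τ on, by choice of the
successors; determinacy applies. A successor equal to the sentinel `n` means that no boundary
follows in the text. -/
theorem agree_of_succ (hdet : Det (shifted f n) (n + 1) n τ B) (hP : Increasing n N P)
    (hB : Points B n N P) {i j s t e : ℕ} (hA : ∀ u < 32 * τ, f (i + u) = f (j + u))
    (hs : IsSucc N P (i + 16 * τ) s) (ht : IsSucc N P (j + 16 * τ) t) (hes : i + e ≤ P s)
    (het : j + e ≤ P t) : ∀ u < e, f (i + u) = f (j + u) := by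
  have h1 := hP.le hs.1
  have h2 := hP.le ht.1
  have key : ∀ {i s}, IsSucc N P (i + 16 * τ) s → i + e ≤ P s → ∀ x ∈ B,
      i + (n + 1) + 16 * τ ≤ x → i + (n + 1) + e ≤ x := by
    intro i s hs hes x hx hix
    have h3 := hP.le hs.1
    by_cases hxn : x < n + 1 + n
    · have := hs.le hP hB (y := x - (n + 1)) (by rwa [Nat.sub_add_cancel (by omega)]) (by omega)
        (by omega)
      omega
    · omega
  have hsh : ∀ y u, shifted f n (y + (n + 1) + u) = f (y + u) := fun y u => by
    simp only [shifted]; congr 1; omega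
  have := hdet (i + (n + 1)) (j + (n + 1)) e (by omega) (by omega) (by omega) (by omega)
    (fun u hu => by rw [hsh, hsh]; exact hA u hu) (key hs hes) (key ht het)
  intro u hu
  have := this u hu
  rwa [hsh, hsh] at this

/-- A boundary behind one of two equal texts is one behind the other, or the texts differ soon. -/
theorem mlen_lt_of_succ (hloc : Loc (shifted f n) (n + 1) n B c) (hc : c ≤ 14 * τ)
    (hP : Increasing n N P) (hB : Points B n N P) {i j s t e : ℕ}
    (hA : ∀ u < e, f (i + u) = f (j + u)) (hs : IsSucc N P (i + 16 * τ) s)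
    (ht : IsSucc N P (j + 16 * τ) t) (hes : i + e = P s) (het : j + e < P t)
    (hi : i + e + 14 * τ < n) (hj : j + e + 14 * τ < n) : mlen f (i + e) (j + e) (14 * τ) < 14 * τ := by
  refine lt_of_le_of_ne (mlen_le _ _ _ _) fun hm => ?_
  rw [mlen_eq_iff] at hm
  -- The left half of the neighbourhood, of length at most 14τ, therefore lies in the part that
  -- agrees already; the right half is the assumed further agreement.
  have he : 16 * τ ≤ e := by have := hs.2.2; omega
  have hsN : s < N := by
    rcases Nat.lt_or_ge s N with h | h
    · exact h
    · rw [show s = N by have := hs.1; omega, hP.1] at hes; omega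
  have hmem : i + e + (n + 1) ∈ B := ((hB.mem (i + e)).mp ⟨s, hsN, hes.symm⟩).2
  have hmem2 : j + e + (n + 1) ∈ B := by
    refine hloc _ _ ⟨by omega, by omega, by omega, by omega, fun u hu => ?_⟩ hmem
    simp only [shifted]
    rw [show i + e + (n + 1) - c + u - (n + 1) = i + (e - c + u) by omega,
      show j + e + (n + 1) - c + u - (n + 1) = j + (e - c + u) by omega]
    by_cases hu' : e - c + u < e
    · exact hA _ hu'
    · have := hm (u - c) (by omega)
      rwa [show i + e + (u - c) = i + (e - c + u) by omega,
        show j + e + (u - c) = j + (e - c + u) by omega] at this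
  have := ht.le hP hB hmem2 (by omega) (by omega)
  omega

end

section
variable {E : Env} {n τ J A K c : ℕ} {B : Set ℕ}

/-- The state holds the data structure. -/
structure Ready (E : Env) (n₀ τ₀ c : ℕ) (B : Set ℕ) (σ : St) : Prop where
  n : σ.v .n = n₀
  tau : σ.v .tau = τ₀
  det : Det (shifted E.f n₀) (n₀ + 1) n₀ τ₀ B
  loc : Loc (shifted E.f n₀) (n₀ + 1) n₀ B c
  c_le : c ≤ 14 * τ₀
  N_le : σ.v .N ≤ 128 * (n₀ / τ₀)
  inc : Increasing n₀ (σ.v .N) (σ.a .P)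
  pts : Points B n₀ (σ.v .N) (σ.a .P)
  blk : BlkSpec τ₀ (n₀ / τ₀) (σ.v .N) (σ.a .P) (σ.a .BLK)
  rank : ∀ t < σ.v .N, σ.a .RK t < σ.v .N ∧ σ.a .SA (σ.a .RK t) = t
  dif : ∀ t, t + 1 < σ.v .N →
    Dif (mark E.f n₀) (σ.a .P (σ.a .SA t)) (σ.a .P (σ.a .SA (t + 1))) (σ.a .L t)
  rmq : RmqOK n₀ (σ.v .N - 1) (σ.v .b) (σ.v .nb) (σ.a .L) (σ.a .MK) (σ.a .LG) (σ.a .ST)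

theorem Ready.congr {σ σ' : St} (h : Ready E n τ c B σ)
    (hv : ∀ x ∈ [Var.n, .tau, .N, .b, .nb], σ'.v x = σ.v x) (ha : σ'.a = σ.a) :
    Ready E n τ c B σ' := by
  simp only [List.mem_cons, List.not_mem_nil, or_false, forall_eq_or_imp, forall_eq] at hv
  obtain ⟨h1, h2, h3, h4, h5⟩ := hv
  obtain ⟨q1, q2, q3, q4, q5, q6, q7, q8, q9, q10, q11, q12⟩ := h
  constructor <;> (try rw [h1]) <;> (try rw [h2]) <;> (try rw [h3]) <;> (try rw [h4]) <;>
    (try rw [h5]) <;> (try rw [ha]) <;> assumption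

theorem Frame.ready {vs : List Var} {σ σ' : St} (hf : Frame vs [] σ σ') (h : Ready E n τ c B σ)
    (hd : ∀ x ∈ [Var.n, .tau, .N, .b, .nb], x ∉ vs) : Ready E n τ c B σ' :=
  h.congr (fun x hx => hf.v x (hd x hx)) (funext fun b => hf.a b (by simp))

/-- `t := ` index of the first point at or behind `y + 16 τ` -/
def succCode (y : Var) : Stmt :=
  .x ≔ ♯y + 16 * ♯.tau ;; .t ≔ .arr .BLK (♯.x / ♯.tau) ;; advanceCode

/-- The entry for the aligned block of `x` is the first point from the start of that block on, which
lies less than τ before `x`; so the walk to `x` has at most τ steps. -/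
theorem wp_succCode (S : Setup E n τ J A K) {σ : St} (h : Ready E n τ c B σ) {y : Var} {i : ℕ}
    (hy : σ.v y = i) (hi : i + 16 * τ ≤ n) {Q : St → Prop}
    (hQ : ∀ σ', Frame [.x, .t] [] σ σ' → IsSucc (σ.v .N) (σ.a .P) (i + 16 * τ) (σ'.v .t) →
      σ'.clk ≤ σ.clk + τ → Q σ') : wp E (succCode y) Q σ := by
  have hW := S.word_lin
  have hsp := S.space
  have hmn := S.m_le
  have hmp := S.m_pos
  have hN := h.N_le
  obtain ⟨x, hx⟩ : ∃ x, x = i + 16 * τ := ⟨_, rfl⟩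
  have hxm : x / τ ≤ n / τ := Nat.div_le_div_right (by omega)
  obtain ⟨b1, b2, b3⟩ := h.blk _ hxm
  have hx1 : x / τ * τ ≤ x := Nat.div_mul_le_self _ _
  have hx2 : x < x / τ * τ + τ := Nat.lt_div_mul_add S.pos
  simp only [succCode]
  rw [wp_seq, wp_assign, wp_seq, wp_assign]
  simp only [Expr.ok_add, Expr.ok_mul, Expr.ok_var, Expr.ok_ofNat, Expr.eval_add, Expr.eval_mul,
    Expr.eval_var, Expr.eval_ofNat, Expr.ok_arr, Expr.eval_arr, Expr.ok_div, Expr.eval_div, St.set_v,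
    reduceCtorEq, if_true, if_false, St.set_a, hy, h.tau, ← hx]
  refine ⟨⟨trivial, ⟨by omega, trivial, by omega⟩, by omega⟩, by omega,
    ⟨⟨trivial, trivial, by omega⟩, by omega⟩, by omega, ?_⟩
  refine wp_advanceCode S (σ := (σ.set .x x).set .t (σ.a .BLK (x / τ))) (N := σ.v .N)
    (t := σ.a .BLK (x / τ)) (x := x) hN h.inc (by simp) (by omega) (by simp) b1 (fun s hs => (b2 s hs).trans_le hx1) fun σ' hf q1 q2 q3 q4 => ?_
  refine hQ σ' ?_ (by rw [← hx]; exact ⟨q1, q2, q3⟩) ?_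
  · exact ((Frame.set _ _ _ (by decide)).trans (Frame.set _ _ _ (by decide))).trans
      (hf.mono (by decide) (by decide))
  · simp only [St.set_clk, St.set_a] at q4; omega

/-- The case that the texts differ soon behind the next boundary -/
def nearCode : Stmt :=
  .ite (.lt ♯.lb ♯.la) (.la ≔ ♯.lb) (.la ≔ ♯.la) ;;
  .pa ≔ ♯.i + ♯.la ;; .pb ≔ ♯.j + ♯.la ;; .lim ≔ ♯.z - ♯.la ;;
  .ite (.lt ♯.lim (14 * ♯.tau)) (.lim ≔ ♯.lim) (.lim ≔ 14 * ♯.tau) ;;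
  lcpCode ;; .i ≔ ♯.la + ♯.d

theorem wp_nearCode (S : Setup E n τ J A K) {σ : St} (ht : σ.v .tau = τ) {i j a b : ℕ}
    (hi : σ.v .i = i) (hj : σ.v .j = j) (ha : σ.v .la = a) (hb : σ.v .lb = b) (han : i + a ≤ n)
    (hbn : j + b ≤ n) (hz : σ.v .z = n - max i j) {Q : St → Prop}
    (hQ : ∀ σ', Frame [.la, .pa, .pb, .lim, .d, .i] [] σ σ' →
      σ'.v .i = min a b + mlen E.f (i + min a b) (j + min a b) (min (n - max i j - min a b) (14 * τ)) →
      σ'.clk ≤ σ.clk + 14 * τ → Q σ') : wp E nearCode Q σ := by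
  have hW := S.word_lin
  have hτ := S.le
  have hlen := S.len
  simp only [nearCode]
  have h1 : wp E (.ite (.lt ♯.lb ♯.la) (.la ≔ ♯.lb) (.la ≔ ♯.la)) (· = σ.set .la (min a b)) σ := by
    simp only [wp_ite, wp_assign]
    simp only [Cond.ok_lt, Cond.eval_lt, Expr.ok_var, Expr.eval_var, ha, hb]
    refine ⟨⟨trivial, trivial⟩, fun h => ⟨trivial, by omega, ?_⟩, fun h => ⟨trivial, by omega, ?_⟩⟩
    · rw [min_eq_right h.le]
    · rw [min_eq_left (by omega)]
  rw [wp_seq]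
  refine h1.mono fun σ' e => ?_
  subst e
  obtain ⟨e, he⟩ : ∃ e, min a b = e := ⟨_, rfl⟩
  have hea : e ≤ a := by omega
  have heb : e ≤ b := by omega
  rw [he] at hQ ⊢
  rw [wp_seq, wp_assign, wp_seq, wp_assign, wp_seq, wp_assign, wp_seq]
  simp only [Expr.ok_add, Expr.ok_sub, Expr.ok_var, Expr.eval_add, Expr.eval_sub,
    Expr.eval_var, St.set_v, reduceCtorEq, if_true, if_false, hi, hj, hz]
  refine ⟨⟨trivial, trivial, by omega⟩, by omega, ⟨trivial, trivial, by omega⟩, by omega,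
    ⟨trivial, trivial, by omega⟩, by omega, ?_⟩
  set σ₂ := (((σ.set .la e).set .pa (i + e)).set .pb (j + e)).set .lim (n - max i j - e) with hσ₂
  have f2 : Frame [.la, .pa, .pb, .lim, .d, .i] [] σ σ₂ :=
    (((Frame.set _ _ _ (by decide)).trans (Frame.set _ _ _ (by decide))).trans
      (Frame.set _ _ _ (by decide))).trans (Frame.set _ _ _ (by decide))
  have h2 : wp E (.ite (.lt ♯.lim (14 * ♯.tau)) (.lim ≔ ♯.lim) (.lim ≔ 14 * ♯.tau))
      (· = σ₂.set .lim (min (n - max i j - e) (14 * τ))) σ₂ := by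
    have el : σ₂.v .lim = n - max i j - e := by simp [hσ₂]
    have et : σ₂.v .tau = τ := by simp [hσ₂, ht]
    simp only [wp_ite, wp_assign]
    simp only [Cond.ok_lt, Cond.eval_lt, Expr.ok_var, Expr.eval_var, Expr.ok_mul, Expr.eval_mul,
      Expr.ok_ofNat, Expr.eval_ofNat, el, et]
    refine ⟨⟨trivial, by omega, trivial, by omega⟩, fun h => ⟨trivial, by omega, ?_⟩,
      fun h => ⟨⟨by omega, trivial, by omega⟩, by omega, ?_⟩⟩
    · rw [min_eq_left h.le]
    · rw [min_eq_right (by omega)]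
  refine h2.mono fun σ' e' => ?_
  subst e'
  rw [wp_seq]
  refine wp_lcpCode (a := i + e) (b := j + e) (L := min (n - max i j - e) (14 * τ)) (by simp [hσ₂])
    (by simp [hσ₂]) (by simp) (by omega) (by omega) (by omega) fun σ₃ f3 d3 c3 => ?_
  have hle := mlen_le E.f (i + e) (j + e) (min (n - max i j - e) (14 * τ))
  have ea : σ₃.v .la = e := by rw [f3.v _ (by decide)]; simp [hσ₂]
  rw [wp_assign]
  simp only [Expr.ok_add, Expr.ok_var, Expr.eval_add, Expr.eval_var, d3, ea]
  refine ⟨⟨trivial, trivial, by omega⟩, by omega, hQ _ ?_ (by simp) ?_⟩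
  · exact ((f2.trans (Frame.set _ _ _ (by decide))).trans (f3.mono (by decide) (by decide))).trans
      (Frame.set _ _ _ (by decide))
  · simp [hσ₂] at c3 ⊢; omega

/-- The case that the next boundaries match -/
def farCode : Stmt :=
  .lo ≔ .arr .RK ♯.u1 ;; .hi ≔ .arr .RK ♯.u2 ;;
  .ite (.lt ♯.lo ♯.hi) (.hi ≔ ♯.hi - 1) (.x ≔ ♯.lo - 1 ;; .lo ≔ ♯.hi ;; .hi ≔ ♯.x) ;;
  rmqCode ;; .i ≔ ♯.la + ♯.acc

theorem wp_farCode (S : Setup E n τ J A K) {σ : St} (h : Ready E n τ c B σ) {s t a : ℕ}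
    (hs : σ.v .u1 = s) (ht : σ.v .u2 = t) (hsN : s < σ.v .N) (htN : t < σ.v .N) (hst : s ≠ t)
    (ha : σ.v .la = a) (han : a ≤ n) {Q : St → Prop}
    (hQ : ∀ σ', Frame [.lo, .hi, .x, .acc, .e, .x0, .x1, .k, .i] [] σ σ' →
      σ'.v .i = a + mlen E.f (σ.a .P s) (σ.a .P t) (n - max (σ.a .P s) (σ.a .P t)) →
      σ'.clk = σ.clk → Q σ') : wp E farCode Q σ := by
  have hW := S.word_lin
  have hsp := S.space
  have hmn := S.m_le
  have hN := h.N_le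
  obtain ⟨r1, r2⟩ := h.rank s hsN
  obtain ⟨r3, r4⟩ := h.rank t htN
  have hne : σ.a .RK s ≠ σ.a .RK t := fun e => hst (by rw [← r2, ← r4, e])
  obtain ⟨l, hl⟩ : ∃ l, l = min (σ.a .RK s) (σ.a .RK t) := ⟨_, rfl⟩
  obtain ⟨r, hr⟩ : ∃ r, r = max (σ.a .RK s) (σ.a .RK t) - 1 := ⟨_, rfl⟩
  have hmin : ∀ v, IsMin (σ.a .L) l r v →
      mlen E.f (σ.a .P s) (σ.a .P t) (n - max (σ.a .P s) (σ.a .P t)) = v := by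
    intro v hv
    have hd := dif_of_isMin (g := mark E.f n) (q := fun u => σ.a .P (σ.a .SA u))
      (fun u _ hu => h.dif u (by omega)) (by omega) hv
    have p1 := h.inc.lt hsN
    have p2 := h.inc.lt htN
    rcases lt_or_gt_of_ne hne with hlt | hlt
    · rw [show l = σ.a .RK s by omega, show r + 1 = σ.a .RK t by omega, r2, r4] at hd
      exact hd.mlen_eq p1 p2
    · rw [show l = σ.a .RK t by omega, show r + 1 = σ.a .RK s by omega, r2, r4] at hd
      rw [mlen_comm, max_comm]
      exact hd.mlen_eq p2 p1
  have h1 : ∀ σ₂, Frame [.lo, .hi, .x] [] σ σ₂ → σ₂.clk = σ.clk → σ₂.v .lo = l → σ₂.v .hi = r →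
      wp E (rmqCode ;; .i ≔ ♯.la + ♯.acc) Q σ₂ := by
    intro σ₂ f2 c2 l2 r2
    have hR := f2.ready h (by decide)
    have eN : σ₂.v .N = σ.v .N := f2.v _ (by decide)
    have eL : σ₂.a .L = σ.a .L := f2.a _ (by decide)
    rw [wp_seq]
    refine wp_rmqCode S (σ := σ₂) (ℓ := σ₂.v .N - 1) (by omega) hR.rmq rfl rfl l2 r2 (by omega)
      (by omega) fun σ₃ f3 m3 c3 => ?_
    rw [eL] at m3
    have hm := hmin _ m3
    have hle := mlen_le E.f (σ.a .P s) (σ.a .P t) (n - max (σ.a .P s) (σ.a .P t))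
    have ea : σ₃.v .la = a := by rw [f3.v _ (by decide), f2.v _ (by decide), ha]
    rw [wp_assign]
    simp only [Expr.ok_add, Expr.ok_var, Expr.eval_add, Expr.eval_var, ea]
    refine ⟨⟨trivial, trivial, by omega⟩, by omega, hQ _ ?_ (by simp [hm]) (by simp; omega)⟩
    exact ((f2.mono (by decide) (by decide)).trans (f3.mono (by decide) (by decide))).trans
      (Frame.set _ _ _ (by decide))
  simp only [farCode]
  rw [wp_seq, wp_assign, wp_seq, wp_assign, wp_seq, wp_ite]
  simp only [Expr.ok_arr, Expr.eval_arr, Expr.ok_var, Expr.eval_var, St.set_v, St.set_a, reduceCtorEq,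
    if_false, hs, ht]
  refine ⟨⟨trivial, by omega⟩, by omega, ⟨trivial, by omega⟩, by omega, by simp, fun hc => ?_,
    fun hc => ?_⟩ <;>
    simp only [Cond.eval_lt, Expr.eval_var, St.set_v, reduceCtorEq, if_false, if_true] at hc
  · rw [wp_assign]
    simp only [Expr.ok_sub, Expr.eval_sub, Expr.ok_var, Expr.eval_var, Expr.ok_ofNat, Expr.eval_ofNat,
      St.set_v, if_true]
    refine ⟨⟨trivial, by omega, by omega⟩, by omega, h1 _ ?_ (by simp) (by simp; omega) (by simp; omega)⟩
    exact ((Frame.set _ _ _ (by decide)).trans (Frame.set _ _ _ (by decide))).trans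
      (Frame.set _ _ _ (by decide))
  · rw [wp_seq, wp_assign, wp_seq, wp_assign, wp_assign]
    simp only [Expr.ok_sub, Expr.eval_sub, Expr.ok_var, Expr.eval_var, Expr.ok_ofNat, Expr.eval_ofNat,
      St.set_v, reduceCtorEq, if_true, if_false]
    refine ⟨⟨trivial, by omega, by omega⟩, by omega, trivial, by omega, trivial, by omega,
      h1 _ ?_ (by simp) (by simp; omega) (by simp; omega)⟩
    exact ((((Frame.set _ _ _ (by decide)).trans (Frame.set _ _ _ (by decide))).trans
      (Frame.set _ _ _ (by decide))).trans (Frame.set _ _ _ (by decide))).trans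
      (Frame.set _ _ _ (by decide))

/-- The case that the texts agree on `32 τ` symbols -/
def longCode : Stmt :=
  succCode .i ;; .u1 ≔ ♯.t ;; succCode .j ;; .u2 ≔ ♯.t ;;
  .la ≔ .arr .P ♯.u1 - ♯.i ;; .lb ≔ .arr .P ♯.u2 - ♯.j ;;
  .ite (.eq ♯.la ♯.lb) (.ite (.lt ♯.u1 ♯.N) (.ite (.lt ♯.u2 ♯.N) farCode nearCode) nearCode) nearCode

/-- Variables that queries change -/
def queryVars : List Var := [.i, .pa, .pb, .z, .lim, .d, .x, .t, .u1, .u2, .la, .lb, .lo, .hi, .acc, .e,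
  .x0, .x1, .k]

/-- After the agreement up to the nearer successor, there are two ways to finish. If both successors
are points at the same offset, the rest is the common prefix of two indexed suffixes. Otherwise at
most 14τ further symbols decide, by the end of the text or by locality. -/
theorem wp_longCode (S : Setup E n τ J A K) {σ : St} (h : Ready E n τ c B σ) {i j : ℕ}
    (hi : σ.v .i = i) (hj : σ.v .j = j) (hij : i ≠ j) (hz : σ.v .z = n - max i j)
    (hlong : 32 * τ ≤ n - max i j) (hA : ∀ u < 32 * τ, E.f (i + u) = E.f (j + u)) {Q : St → Prop}
    (hQ : ∀ σ', Frame queryVars [] σ σ' → σ'.v .i = mlen E.f i j (n - max i j) →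
      σ'.clk ≤ σ.clk + 16 * τ → Q σ') : wp E longCode Q σ := by
  have hW := S.word_lin
  have hsp := S.space
  have hmn := S.m_le
  have hmp := S.m_pos
  have hτ := S.pos
  have hN := h.N_le
  simp only [longCode]
  rw [wp_seq]
  refine wp_succCode S h (y := .i) hi (by omega) fun σ₁ f1 s1 c1 => ?_
  obtain ⟨s, hs⟩ : ∃ s, σ₁.v .t = s := ⟨_, rfl⟩
  rw [hs] at s1
  have hsN := s1.1
  rw [wp_seq, wp_assign]
  simp only [Expr.ok_var, Expr.eval_var, hs]
  refine ⟨trivial, by omega, ?_⟩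
  have f2 : Frame [.x, .t, .u1] [] σ (σ₁.set .u1 s) :=
    (f1.mono (by decide) (by decide)).trans (Frame.set _ _ _ (by decide))
  rw [wp_seq]
  refine wp_succCode S (f2.ready h (by decide)) (y := .j) (i := j) (by rw [f2.v _ (by decide), hj])
    (by omega) fun σ₃ f3 s3 c3 => ?_
  obtain ⟨t, ht⟩ : ∃ t, σ₃.v .t = t := ⟨_, rfl⟩
  rw [ht, f2.v _ (by decide), f2.a _ (by decide)] at s3
  have htN := s3.1
  have fr3 : Frame [.x, .t, .u1] [] σ σ₃ := f2.trans (f3.mono (by decide) (by decide))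
  have eu1 : σ₃.v .u1 = s := by rw [f3.v _ (by decide)]; simp
  have eP : σ₃.a .P = σ.a .P := fr3.a _ (by decide)
  have ei : σ₃.v .i = i := (fr3.v _ (by decide)).trans hi
  have ej : σ₃.v .j = j := (fr3.v _ (by decide)).trans hj
  have p1 := h.inc.le hsN
  have p2 := h.inc.le htN
  have p3 := s1.2.2
  have p4 := s3.2.2
  rw [wp_seq, wp_assign, wp_seq, wp_assign, wp_seq, wp_assign]
  simp only [Expr.ok_var, Expr.eval_var, Expr.ok_sub, Expr.eval_sub, Expr.ok_arr, Expr.eval_arr,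
    St.set_v, reduceCtorEq, if_true, if_false, St.set_a, ht, eu1, eP, ei, ej]
  obtain ⟨a, ha⟩ : ∃ a, a = σ.a .P s - i := ⟨_, rfl⟩
  obtain ⟨b, hb⟩ : ∃ b, b = σ.a .P t - j := ⟨_, rfl⟩
  rw [← ha, ← hb]
  refine ⟨trivial, by omega, ⟨⟨trivial, by omega⟩, trivial, by omega⟩, by omega,
    ⟨⟨trivial, by omega⟩, trivial, by omega⟩, by omega, ?_⟩
  set σ₄ := ((σ₃.set .u2 t).set .la a).set .lb b with hσ₄
  have f4 : Frame [.x, .t, .u1, .u2, .la, .lb] [] σ σ₄ :=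
    (((fr3.mono (by decide) (by decide)).trans (Frame.set _ _ _ (by decide))).trans
      (Frame.set _ _ _ (by decide))).trans (Frame.set _ _ _ (by decide))
  have c4 : σ₄.clk ≤ σ.clk + 2 * τ := by simp [hσ₄] at c3 ⊢; omega
  have v1 : σ₄.v .i = i := (f4.v _ (by decide)).trans hi
  have v2 : σ₄.v .j = j := (f4.v _ (by decide)).trans hj
  have v3 : σ₄.v .la = a := by simp [hσ₄]
  have v4 : σ₄.v .lb = b := by simp [hσ₄]
  have v5 : σ₄.v .u1 = s := by simp [hσ₄, eu1]
  have v6 : σ₄.v .u2 = t := by simp [hσ₄]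
  have v7 : σ₄.v .N = σ.v .N := f4.v _ (by decide)
  have hR4 := f4.ready h (by decide)
  have hagree := agree_of_succ h.det h.inc h.pts hA s1 s3 (e := min a b) (by omega) (by omega)
  have hsplit : mlen E.f i j (n - max i j) =
      min a b + mlen E.f (i + min a b) (j + min a b) (n - max i j - min a b) := by
    rw [← mlen_add hagree]; congr 1; omega
  have hnear : ¬ (a = b ∧ s < σ.v .N ∧ t < σ.v .N) → wp E nearCode Q σ₄ := by
    intro hcase
    refine wp_nearCode S hR4.tau v1 v2 v3 v4 (by omega) (by omega)
      ((f4.v _ (by decide)).trans hz) fun σ₅ f5 g5 c5 => hQ σ₅ ?_ ?_ (by omega)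
    · exact (f4.mono (by decide) (by decide)).trans (f5.mono (by decide) (by decide))
    · rw [g5, hsplit]
      congr 1
      rcases le_or_gt (n - max i j - min a b) (14 * τ) with hle | hlt
      · rw [min_eq_left hle]
      · rw [min_eq_right hlt.le]
        refine (mlen_extend ?_ hlt.le).symm
        rcases lt_trichotomy a b with e | e | e
        · rw [min_eq_left e.le] at hlt hagree ⊢
          exact mlen_lt_of_succ h.loc h.c_le h.inc h.pts hagree s1 s3 (by omega) (by omega) (by omega)
            (by omega)
        -- Equal offsets with more than 14τ symbols left: both successors lie before `n`, so both
        -- are points and not the sentinel, which belongs to the other case.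
        · exfalso
          have hend : ∀ u, u ≤ σ.v .N → σ.a .P u < n → u < σ.v .N := fun u h1 h2 => by
            rcases Nat.lt_or_ge u (σ.v .N) with h3 | h3
            · exact h3
            · rw [show u = σ.v .N by omega, h.inc.1] at h2; omega
          exact hcase ⟨e, hend s hsN (by omega), hend t htN (by omega)⟩
        · rw [min_eq_right e.le] at hlt hagree ⊢
          rw [mlen_comm]
          exact mlen_lt_of_succ h.loc h.c_le h.inc h.pts (fun u hu => (hagree u hu).symm) s3 s1
            (by omega) (by omega) (by omega) (by omega)
  rw [wp_ite]
  refine ⟨by simp, fun hab => ?_, fun hab => hnear ?_⟩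
  · simp only [Cond.eval_eq, Expr.eval_var, v3, v4] at hab
    rw [wp_ite]
    refine ⟨by simp, fun hsN' => ?_, fun hsN' => hnear ?_⟩
    · simp only [Cond.eval_lt, Expr.eval_var, v5, v7] at hsN'
      rw [wp_ite]
      refine ⟨by simp, fun htN' => ?_, fun htN' => hnear ?_⟩
      · simp only [Cond.eval_lt, Expr.eval_var, v6, v7] at htN'
        have hst : s ≠ t := by rintro rfl; omega
        refine wp_farCode S hR4 v5 v6 (by omega) (by omega) hst v3 (by omega)
          fun σ₅ f5 g5 c5 => hQ σ₅ ?_ ?_ (by omega)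
        · exact (f4.mono (by decide) (by decide)).trans (f5.mono (by decide) (by decide))
        · rw [g5, hsplit, f4.a _ (by decide), min_eq_left hab.le, show i + a = σ.a .P s by omega,
            show j + a = σ.a .P t by omega]
          congr 2; omega
      · simp only [Cond.eval_lt, Expr.eval_var, v6, v7] at htN'; tauto
    · simp only [Cond.eval_lt, Expr.eval_var, v5, v7] at hsN'; tauto
  · simp only [Cond.eval_eq, Expr.eval_var, v3, v4] at hab; tauto

/-- `i := LCE(i, j)` -/
def queryCode : Stmt :=
  .ite (.eq ♯.i ♯.j) (.i ≔ ♯.n - ♯.i)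
    (.pa ≔ ♯.i ;; .pb ≔ ♯.j ;;
     .ite (.lt ♯.i ♯.j) (.z ≔ ♯.n - ♯.j) (.z ≔ ♯.n - ♯.i) ;;
     .ite (.lt ♯.z (32 * ♯.tau)) (.lim ≔ ♯.z) (.lim ≔ 32 * ♯.tau) ;; lcpCode ;;
     .ite (.lt ♯.d (32 * ♯.tau)) (.i ≔ ♯.d) longCode)

theorem wp_queryCode (S : Setup E n τ J A K) {σ : St} (h : Ready E n τ c B σ) {i j : ℕ}
    (hi : σ.v .i = i) (hj : σ.v .j = j) (hin : i < n) (hjn : j < n) {Q : St → Prop}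
    (hQ : ∀ σ', Frame queryVars [] σ σ' → σ'.v .i = lce E.T i j →
      σ'.clk ≤ σ.clk + 48 * τ → Q σ') : wp E queryCode Q σ := by
  have hW := S.word_lin
  have hτ := S.le
  have hlen := S.len
  have hlce := lce_eq E (i := i) (j := j) (by omega) (by omega)
  rw [hlen] at hlce
  rw [hlce] at hQ
  simp only [queryCode]
  rw [wp_ite]
  refine ⟨by simp, fun hc => ?_, fun hc => ?_⟩ <;> simp only [Cond.eval_eq, Expr.eval_var, hi, hj] at hc
  · rw [wp_assign]
    simp only [Expr.ok_sub, Expr.ok_var, Expr.eval_sub, Expr.eval_var, h.n, hi]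
    refine ⟨⟨trivial, trivial, by omega⟩, by omega, hQ _ (Frame.set _ _ _ (by decide)) ?_ (by simp)⟩
    subst hc
    simp only [St.set_v, if_true, max_self]
    exact (mlen_eq_iff.mpr fun _ _ => rfl).symm
  · obtain ⟨z, hz⟩ : ∃ z, z = n - max i j := ⟨_, rfl⟩
    rw [wp_seq, wp_assign, wp_seq, wp_assign, wp_seq]
    simp only [Expr.ok_var, Expr.eval_var, St.set_v, reduceCtorEq, if_false, hi, hj]
    refine ⟨trivial, by omega, trivial, by omega, ?_⟩
    set σ₁ := (σ.set .pa i).set .pb j with hσ₁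
    have f1 : Frame queryVars [] σ σ₁ :=
      (Frame.set _ _ _ (by decide)).trans (Frame.set _ _ _ (by decide))
    have i1 : σ₁.v .i = i := by simp [hσ₁, hi]
    have j1 : σ₁.v .j = j := by simp [hσ₁, hj]
    have n1 : σ₁.v .n = n := by simp [hσ₁, h.n]
    have t1 : σ₁.v .tau = τ := by simp [hσ₁, h.tau]
    have h1 : wp E (.ite (.lt ♯.i ♯.j) (.z ≔ ♯.n - ♯.j) (.z ≔ ♯.n - ♯.i)) (· = σ₁.set .z z) σ₁ := by
      simp only [wp_ite, wp_assign]
      simp only [Cond.ok_lt, Cond.eval_lt, Expr.ok_var, Expr.eval_var, Expr.ok_sub, Expr.eval_sub, i1,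
        j1, n1]
      refine ⟨⟨trivial, trivial⟩, fun h => ⟨⟨trivial, trivial, by omega⟩, by omega, ?_⟩,
        fun h => ⟨⟨trivial, trivial, by omega⟩, by omega, ?_⟩⟩
      · rw [hz, max_eq_right h.le]
      · rw [hz, max_eq_left (by omega)]
    refine h1.mono fun σ' e => ?_
    subst e
    rw [wp_seq]
    have h2 : wp E (.ite (.lt ♯.z (32 * ♯.tau)) (.lim ≔ ♯.z) (.lim ≔ 32 * ♯.tau))
        (· = (σ₁.set .z z).set .lim (min z (32 * τ))) (σ₁.set .z z) := by
      simp only [wp_ite, wp_assign]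
      simp only [Cond.ok_lt, Cond.eval_lt, Expr.ok_var, Expr.eval_var, Expr.ok_mul, Expr.eval_mul,
        Expr.ok_ofNat, Expr.eval_ofNat, St.set_v, reduceCtorEq, if_true, if_false, t1]
      refine ⟨⟨trivial, by omega, trivial, by omega⟩, fun h => ⟨trivial, by omega, ?_⟩,
        fun h => ⟨⟨by omega, trivial, by omega⟩, by omega, ?_⟩⟩
      · rw [min_eq_left h.le]
      · rw [min_eq_right (by omega)]
    refine h2.mono fun σ' e => ?_
    subst e
    rw [wp_seq]
    refine wp_lcpCode (a := i) (b := j) (L := min z (32 * τ)) (by simp [hσ₁]) (by simp [hσ₁])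
      (by simp) (by omega) (by omega) (by omega) fun σ₃ f3 d3 c3 => ?_
    have hle := mlen_le E.f i j (min z (32 * τ))
    have fr : Frame queryVars [] σ σ₃ :=
      ((f1.trans (Frame.set _ _ _ (by decide))).trans (Frame.set _ _ _ (by decide))).trans
        (f3.mono (by decide) (by decide))
    have t3 : σ₃.v .tau = τ := (fr.v _ (by decide)).trans h.tau
    have c3' : σ₃.clk ≤ σ.clk + 32 * τ := by simp [hσ₁] at c3; omega
    rw [wp_ite]
    refine ⟨by simp [t3]; omega, fun hd => ?_, fun hd => ?_⟩ <;>
      simp only [Cond.eval_lt, Expr.eval_var, Expr.eval_mul, Expr.eval_ofNat, t3, d3] at hd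
    · rw [wp_assign]
      simp only [Expr.ok_var, Expr.eval_var, d3]
      refine ⟨trivial, by omega, hQ _ (fr.trans (Frame.set _ _ _ (by decide))) ?_ (by simp; omega)⟩
      simp only [St.set_v, if_true, ← hz]
      rcases le_or_gt z (32 * τ) with hle' | hlt
      · rw [min_eq_left hle']
      · rw [min_eq_right hlt.le] at hd ⊢
        exact (mlen_extend hd hlt.le).symm
    · have hm : min z (32 * τ) = 32 * τ := by omega
      rw [hm] at hd hle
      refine wp_longCode S (fr.ready h (by decide)) (i := i) (j := j) ?_ ?_ hc ?_ (by omega)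
        (mlen_eq_iff.mp (by omega)) fun σ₅ f5 g5 c5 => hQ σ₅ (fr.trans f5) g5 (by omega)
      · rw [f3.v _ (by decide)]; simp [i1]
      · rw [f3.v _ (by decide)]; simp [j1]
      · rw [f3.v _ (by decide)]; simp [hz]

end

end LCE

namespace LCE

/-! ### Construction -/

section
variable {E : Env} {n τ J A K : ℕ}

/-- Sets the global variables, given `n` and `τ` in `i` and `j`. -/
def globalsCode : Stmt :=
  .n ≔ ♯.i ;; .tau ≔ ♯.j ;; .m ≔ ♯.n / ♯.tau ;; .h ≔ ♯.tau / 2 ;; .o ≔ ♯.n + 1 ;; .J ≔ 0 ;; .e ≔ 1 ;;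
  .while (.lt ♯.e (♯.m + 1)) (.e ≔ ♯.e + ♯.e ;; .J ≔ ♯.J + 1) ;;
  .nlam ≔ 6 * ♯.J

theorem wp_globalsCode (S : Setup E n τ J A K) {σ : St} (hi : σ.v .i = n) (hj : σ.v .j = τ)
    {Q : St → Prop}
    (hQ : ∀ σ', Ctx n τ J σ' → σ'.v .nlam = 6 * J → σ'.clk ≤ σ.clk + n → Q σ') :
    wp E globalsCode Q σ := by
  have hW := S.word_lin
  have hmn := S.m_le
  have hmp := S.m_pos
  have hτ := S.le
  simp only [globalsCode]
  rw [wp_seq, wp_assign, wp_seq, wp_assign, wp_seq, wp_assign, wp_seq, wp_assign, wp_seq, wp_assign,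
    wp_seq, wp_assign, wp_seq, wp_assign, wp_seq]
  simp only [Expr.ok_var, Expr.eval_var, Expr.ok_div, Expr.eval_div, Expr.ok_add, Expr.eval_add,
    Expr.ok_ofNat, Expr.eval_ofNat, St.set_v, reduceCtorEq, if_true, if_false, hi, hj]
  refine ⟨trivial, by omega, trivial, by omega, ⟨trivial, trivial, by omega⟩, by omega,
    ⟨trivial, by omega, by omega⟩, by omega, ⟨trivial, by omega, by omega⟩, by omega, by omega, by omega,
    by omega, by omega, ?_⟩
  refine wp_while (fun σ' => σ'.v .e = 2 ^ σ'.v .J ∧ 2 ^ σ'.v .J ≤ 2 * (n / τ))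
    (fun σ' => n / τ + 1 - σ'.v .e) 1 (by simp; omega) ?_ ?_ ?_
  · rintro σ' hf -
    have em : σ'.v .m = n / τ := by rw [hf.v _ (by decide)]; simp
    simp [em]; omega
  · rintro σ' hf ⟨h1, h2⟩ hc
    have em : σ'.v .m = n / τ := by rw [hf.v _ (by decide)]; simp
    simp only [Cond.eval_lt, Expr.eval_var, Expr.eval_add, Expr.eval_ofNat, em] at hc
    have hJ : σ'.v .J < 2 ^ σ'.v .J := Nat.lt_two_pow_self
    rw [wp_seq, wp_assign]
    simp only [wp_assign]
    simp [pow_succ]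
    and_intros <;> try omega
  · rintro σ' hf ⟨h1, h2⟩ hc hcl
    have em : σ'.v .m = n / τ := by rw [hf.v _ (by decide)]; simp
    simp only [Cond.eval_lt, Expr.eval_var, Expr.eval_add, Expr.eval_ofNat, em] at hc
    have hJ : σ'.v .J = J := by
      have a1 := S.lt_J
      have a2 := S.J_le
      have b1 : 2 ^ σ'.v .J < 2 ^ (J + 1) := by rw [pow_succ]; omega
      have b2 : 2 ^ J < 2 ^ (σ'.v .J + 1) := by rw [pow_succ]; omega
      rw [Nat.pow_lt_pow_iff_right (by norm_num)] at b1 b2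
      omega
    have hJm := S.J_le_m
    rw [wp_assign]
    simp only [Expr.ok_mul, Expr.ok_var, Expr.ok_ofNat, Expr.eval_mul, Expr.eval_var, Expr.eval_ofNat, hJ]
    refine ⟨⟨by omega, trivial, by omega⟩, by omega, hQ _ ⟨?_, ?_, ?_, ?_, ?_, ?_⟩ (by simp) ?_⟩
    · simp [hf.v]
    · simp [hf.v]
    · simp [em]
    · simp [hf.v]
    · simp [hf.v]
    · simp [hJ]
    · simp at hcl ⊢; omega

def buildCode : Stmt :=
  globalsCode ;; seedsCode ;; pointsCode ;; blkCode ;; sortCode ;; rankCode ;; lcpArrCode ;; rmqBuildCode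

/-- Bound on the number of loop iterations of the construction -/
def buildCost (n τ J K : ℕ) : ℕ :=
  n + 6 * J * ((K + 1) * (statCost n τ K (6 * J) + 1) + 1) + passCost n τ K (6 * J) 0 +
    (n / τ + 1) * (n + 1) + 128 * n * (Nat.size (128 * n) * (n + 1) + 128 * n + 1) + 128 * n +
    128 * n * (n + 1) + (4 * (128 * n) + 4) * (4 * (128 * n) + 4)

theorem wp_buildCode (S : Setup E n τ J A K) {σ : St} (hi : σ.v .i = n) (hj : σ.v .j = τ) :
    wp E buildCode (fun σ' => (∃ c B, Ready E n τ c B σ') ∧ σ'.clk ≤ σ.clk + buildCost n τ J K) σ := by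
  have hmn := S.m_le
  simp only [buildCode]
  rw [wp_seq]
  refine wp_globalsCode S hi hj fun σ₁ C1 n1 c1 => ?_
  rw [wp_seq]
  refine wp_seedsCode S C1 n1 fun σ₂ f2 s2 g2 c2 => ?_
  have C2 := C1.congr f2 (by decide)
  rw [wp_seq]
  refine wp_pointsCode S C2 ((f2.v _ (by decide)).trans n1) s2 g2 fun σ₃ f3 l3 e3 p3 c3 => ?_
  have C3 := C2.congr f3 (by decide)
  obtain ⟨N, hN⟩ : ∃ N, σ₃.v .N = N := ⟨_, rfl⟩
  rw [hN] at l3 e3 p3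
  have hinc : Increasing n N (σ₃.a .P) := by
    refine ⟨e3, fun s t hst ht => ?_⟩
    rcases Nat.eq_or_lt_of_le ht with h | h
    · rw [h, e3]; exact ((p3.mem _).mp ⟨s, by omega, rfl⟩).1
    · exact p3.lt s t hst h
  rw [wp_seq]
  refine wp_blkCode S C3 l3 hinc fun σ₄ f4 b4 c4 => ?_
  have P4 : σ₄.a .P = σ₃.a .P := f4.a _ (by decide)
  have N4 : σ₄.v .N = N := (f4.v _ (by decide)).trans hN
  have C4 := C3.congr f4 (by decide)
  rw [wp_seq]
  refine wp_sortCode S C4.n l3 (by rwa [P4]) N4 fun σ₅ f5 s5 c5 => ?_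
  have P5 : σ₅.a .P = σ₃.a .P := (f5.a _ (by decide)).trans P4
  have N5 : σ₅.v .N = N := (f5.v _ (by decide)).trans N4
  have C5 := C4.congr f5 (by decide)
  rw [P4] at s5
  rw [wp_seq]
  refine wp_rankCode S l3 N5 s5 fun σ₆ f6 r6 c6 => ?_
  have P6 : σ₆.a .P = σ₃.a .P := (f6.a _ (by decide)).trans P5
  have A6 : σ₆.a .SA = σ₅.a .SA := f6.a _ (by decide)
  have N6 : σ₆.v .N = N := (f6.v _ (by decide)).trans N5
  have C6 := C5.congr f6 (by decide)
  rw [wp_seq]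
  refine wp_lcpArrCode S C6.n l3 N6 (by rwa [P6]) (by rwa [P6, A6]) fun σ₇ f7 d7 c7 => ?_
  have N7 : σ₇.v .N = N := (f7.v _ (by decide)).trans N6
  have C7 := C6.congr f7 (by decide)
  refine wp_rmqBuildCode S l3 N7 (fun t ht => (d7 t ht).1) fun σ₈ f8 q8 c8 => ?_
  have C8 := C7.congr f8 (by decide)
  have N8 : σ₈.v .N = N := (f8.v _ (by decide)).trans N7
  have P8 : σ₈.a .P = σ₃.a .P := by rw [f8.a _ (by decide), f7.a _ (by decide), P6]
  have A8 : σ₈.a .SA = σ₅.a .SA := by rw [f8.a _ (by decide), f7.a _ (by decide), A6]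
  have L8 : σ₈.a .L = σ₇.a .L := f8.a _ (by decide)
  have R8 : σ₈.a .RK = σ₆.a .RK := by rw [f8.a _ (by decide), f7.a _ (by decide)]
  have B8 : σ₈.a .BLK = σ₄.a .BLK := by
    rw [f8.a _ (by decide), f7.a _ (by decide), f6.a _ (by decide), f5.a _ (by decide)]
  refine ⟨⟨radius τ J (6 * J), lvl E.f n τ J (σ₂.a .seed) (6 * J), C8.n, C8.tau,
    lvl_det S.pos S.le le_rfl, lvl_loc S.pos S.le _, radius_le, ?_, ?_, ?_, ?_, ?_, ?_, ?_⟩, ?_⟩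
  · rwa [N8]
  · rwa [N8, P8]
  · rwa [N8, P8]
  · rwa [N8, P8, B8]
  · rwa [N8, A8, R8]
  · rw [N8, A8, P8, L8]
    rw [P6, A6] at d7
    exact fun t ht => (d7 t ht).2
  · rwa [N8, L8]
  · have hNn : N ≤ 128 * n := by omega
    have t1 : N * (N.size * (n + 1) + N + 1) ≤
        128 * n * (Nat.size (128 * n) * (n + 1) + 128 * n + 1) :=
      Nat.mul_le_mul hNn (Nat.succ_le_succ (Nat.add_le_add
        (Nat.mul_le_mul_right _ (Nat.size_le_size hNn)) hNn))
    have t2 : N * (n + 1) ≤ 128 * n * (n + 1) := Nat.mul_le_mul_right _ hNn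
    have t3 : (4 * N + 4) * (4 * N + 4) ≤ (4 * (128 * n) + 4) * (4 * (128 * n) + 4) :=
      Nat.mul_le_mul (by omega) (by omega)
    unfold buildCost
    omega

/-! ### Costs -/

/-- Scanning costs O(n) per position, because n/τ blocks of length τ are compared. Pushing costs O(τ
+ K) per level, which over all O(n/τ) levels is O(n M). About n positions give the square. -/
theorem passCost_le (hτ : 1 ≤ τ) (hn : τ ≤ n) (hJ : J ≤ n / τ) {M cA : ℕ} (hK : K + 1 ≤ M)
    (hcA : cA ≤ 4 * (n * M)) : passCost n τ K (6 * J) cA ≤ 400 * (n * n * M) := by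
  have hm : n / τ ≤ n := Nat.div_le_self _ _
  have hmτ : n / τ * τ ≤ n := Nat.div_mul_le_self _ _
  have hM : n ≤ n * M := Nat.le_mul_of_pos_right _ (by omega)
  have hJτ : J * τ ≤ n := (Nat.mul_le_mul_right _ hJ).trans hmτ
  have hJK : J * (K + 1) ≤ n * M := Nat.mul_le_mul (by omega) hK
  have hpush : pushCost τ K (6 * J) cA ≤ 34 * (n * M) := by
    have : 6 * J * (2 * τ + 2 * (K + 1) + 1) = 12 * (J * τ) + 12 * (J * (K + 1)) + 6 * J := by ring
    unfold pushCost
    omega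
  have h1 : n / τ * (τ + 1) + pushCost τ K (6 * J) cA + 1 ≤ 37 * (n * M) := by
    rw [mul_add]; omega
  have h2 : (n + τ / 2) * (n / τ * (τ + 1) + pushCost τ K (6 * J) cA + 1) ≤ 2 * n * (37 * (n * M)) :=
    Nat.mul_le_mul (by omega) h1
  have h3 : (6 * J + 1) * (pushCost τ K (6 * J) cA + 1) ≤ 7 * n * (35 * (n * M)) :=
    Nat.mul_le_mul (by omega) (by omega)
  have h4 : n * M ≤ n * (n * M) := Nat.le_mul_of_pos_left _ (by omega)
  have e1 : 2 * n * (37 * (n * M)) = 74 * (n * (n * M)) := by ring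
  have e2 : 7 * n * (35 * (n * M)) = 245 * (n * (n * M)) := by ring
  rw [mul_assoc]
  unfold passCost
  omega

/-- The dominant term is the computation of the seeds: at most 6ℓ levels, at most D ℓ rounds per
level, and passes of cost O(n² D ℓ). Sorting is O(n² ℓ), and the remaining parts are at most
quadratic or take a single pass. -/
theorem buildCost_le (hτ : 1 ≤ τ) (hn : τ ≤ n) (hJ : J ≤ n / τ) {ℓ D : ℕ} (hℓ : 1 ≤ ℓ)
    (hJℓ : J ≤ ℓ) (hnℓ : n < 2 ^ ℓ) (hD : 1 ≤ D) (hK : K + 1 ≤ D * ℓ) :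
    buildCost n τ J K ≤ 600000 * (n * n * (D * D * (ℓ * ℓ * ℓ))) := by
  have hM : 1 ≤ D * ℓ := by omega
  obtain ⟨M, hMd⟩ : ∃ M, M = D * ℓ := ⟨_, rfl⟩
  rw [← hMd] at hM hK
  have hm : n / τ ≤ n := Nat.div_le_self _ _
  have hM' : M ≤ n * M := Nat.le_mul_of_pos_left _ (by omega)
  have hnM : n ≤ n * M := Nat.le_mul_of_pos_right _ (by omega)
  have h1 : statCost n τ K (6 * J) ≤ 400 * (n * n * M) := passCost_le hτ hn hJ hK (by omega)
  have h2 : passCost n τ K (6 * J) 0 ≤ 400 * (n * n * M) := passCost_le hτ hn hJ hK (by omega)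
  have hn1 : 1 ≤ n * n := Nat.mul_pos (by omega) (by omega)
  have hnn : n ≤ n * n := Nat.le_mul_of_pos_left _ (by omega)
  have hn2 : 1 ≤ n * n * M := Nat.mul_pos hn1 hM
  have h3 : (K + 1) * (statCost n τ K (6 * J) + 1) + 1 ≤ 402 * (n * n * (M * M)) := by
    have a1 : (K + 1) * (statCost n τ K (6 * J) + 1) ≤ M * (401 * (n * n * M)) :=
      Nat.mul_le_mul hK (by omega)
    have a2 : 1 ≤ n * n * (M * M) := Nat.mul_pos hn1 (Nat.mul_pos hM hM)
    have a3 : M * (401 * (n * n * M)) = 401 * (n * n * (M * M)) := by ring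
    omega
  have h4 : 6 * J * ((K + 1) * (statCost n τ K (6 * J) + 1) + 1) ≤ 6 * ℓ * (402 * (n * n * (M * M))) :=
    Nat.mul_le_mul (by omega) h3
  have hsize : Nat.size (128 * n) ≤ 8 * ℓ := by
    rw [Nat.size_le]
    calc 128 * n < 2 ^ 7 * 2 ^ ℓ := by omega
      _ = 2 ^ (7 + ℓ) := (pow_add _ _ _).symm
      _ ≤ 2 ^ (8 * ℓ) := Nat.pow_le_pow_right (by norm_num) (by omega)
  have hnℓ' : n ≤ n * ℓ := Nat.le_mul_of_pos_right _ (by omega)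
  have h5 : 128 * n * (Nat.size (128 * n) * (n + 1) + 128 * n + 1) ≤ 128 * n * (145 * (n * ℓ)) := by
    refine Nat.mul_le_mul_left _ ?_
    have : Nat.size (128 * n) * (n + 1) ≤ 8 * ℓ * (2 * n) := Nat.mul_le_mul hsize (by omega)
    have e : 8 * ℓ * (2 * n) = 16 * (n * ℓ) := by ring
    omega
  have h6 : (n / τ + 1) * (n + 1) ≤ 2 * n * (2 * n) := Nat.mul_le_mul (by omega) (by omega)
  have h7 : 128 * n * (n + 1) ≤ 128 * n * (2 * n) := Nat.mul_le_mul_left _ (by omega)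
  have h8 : (4 * (128 * n) + 4) * (4 * (128 * n) + 4) ≤ 516 * n * (516 * n) :=
    Nat.mul_le_mul (by omega) (by omega)
  have hX : n * n * ℓ ≤ n * n * (D * D * (ℓ * ℓ * ℓ)) := by
    refine Nat.mul_le_mul_left _ ?_
    have a1 : 1 * ℓ ≤ D * D * (ℓ * ℓ) * ℓ :=
      Nat.mul_le_mul_right _ (Nat.mul_pos (Nat.mul_pos hD hD) (Nat.mul_pos hℓ hℓ))
    have a2 : D * D * (ℓ * ℓ) * ℓ = D * D * (ℓ * ℓ * ℓ) := by ring
    omega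
  have hX1 : n * n ≤ n * n * ℓ := Nat.le_mul_of_pos_right _ hℓ
  have hX2 : n * n * M ≤ n * n * (D * D * (ℓ * ℓ * ℓ)) := by
    refine Nat.mul_le_mul_left _ ?_
    have a1 : 1 * (D * ℓ) ≤ (D * ℓ * ℓ) * (D * ℓ) := Nat.mul_le_mul_right _ (by
      have := Nat.mul_pos (Nat.mul_pos hD hℓ) hℓ; omega)
    have a2 : (D * ℓ * ℓ) * (D * ℓ) = D * D * (ℓ * ℓ * ℓ) := by ring
    omega
  have e4 : 6 * ℓ * (402 * (n * n * (M * M))) = 2412 * (n * n * (D * D * (ℓ * ℓ * ℓ))) := by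
    rw [hMd]; ring
  have e5 : 128 * n * (145 * (n * ℓ)) = 18560 * (n * n * ℓ) := by ring
  have e6 : 2 * n * (2 * n) = 4 * (n * n) := by ring
  have e7 : 128 * n * (2 * n) = 256 * (n * n) := by ring
  have e8 : 516 * n * (516 * n) = 266256 * (n * n) := by ring
  unfold buildCost
  omega

/-- The estimate log n ≤ n^δ / δ with δ = ε/3, so that the cube of the logarithm stays below a
constant times n^ε. -/
theorem log_add_one_le {ε : ℝ} (hε : 0 < ε) (hn : 1 ≤ n) :
    ((Nat.log 2 n + 1 : ℕ) : ℝ) ^ 3 ≤ (1 + 3 / (ε * Real.log 2)) ^ 3 * (n : ℝ) ^ ε := by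
  have hn' : (1 : ℝ) ≤ n := by exact_mod_cast hn
  have hl2 : 0 < Real.log 2 := Real.log_pos (by norm_num)
  have h1 : (Nat.log 2 n : ℝ) ≤ Real.log n / Real.log 2 := by
    rw [le_div_iff₀ hl2, ← Real.log_pow]
    refine Real.log_le_log (by positivity) ?_
    exact_mod_cast Nat.pow_log_le_self 2 (by omega)
  have h2 : Real.log n ≤ (n : ℝ) ^ (ε / 3) / (ε / 3) := Real.log_le_rpow_div (by linarith) (by linarith)
  have h3 : 1 ≤ (n : ℝ) ^ (ε / 3) := Real.one_le_rpow hn' (by linarith)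
  have h4 : ((Nat.log 2 n + 1 : ℕ) : ℝ) ≤ (1 + 3 / (ε * Real.log 2)) * (n : ℝ) ^ (ε / 3) := by
    push_cast
    calc (Nat.log 2 n : ℝ) + 1 ≤ (n : ℝ) ^ (ε / 3) / (ε / 3) / Real.log 2 + (n : ℝ) ^ (ε / 3) :=
          add_le_add (h1.trans (div_le_div_of_nonneg_right h2 hl2.le)) h3
      _ = _ := by field_simp; ring
  calc ((Nat.log 2 n + 1 : ℕ) : ℝ) ^ 3 ≤ ((1 + 3 / (ε * Real.log 2)) * (n : ℝ) ^ (ε / 3)) ^ 3 :=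
        pow_le_pow_left₀ (by positivity) h4 3
    _ = (1 + 3 / (ε * Real.log 2)) ^ 3 * ((n : ℝ) ^ (ε / 3)) ^ 3 := mul_pow _ _ _
    _ = _ := by
      rw [← Real.rpow_natCast ((n : ℝ) ^ (ε / 3)), ← Real.rpow_mul (by linarith)]
      congr 2; push_cast; ring

theorem cast_le_rpow {ε : ℝ} (hε : 0 < ε) (hn : 1 ≤ n) {k G C ℓ : ℕ}
    (hC : (G : ℝ) * (1 + 3 / (ε * Real.log 2)) ^ 3 ≤ C) (hℓ : ℓ = Nat.log 2 n + 1)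
    (hk : k ≤ G * (n * n * (ℓ * ℓ * ℓ))) : (k : ℝ) ≤ C * (n : ℝ) ^ (2 + ε) := by
  have hn0 : (0 : ℝ) < n := by exact_mod_cast hn
  have hlog := log_add_one_le hε hn
  rw [← hℓ] at hlog
  calc (k : ℝ) ≤ G * (n * n * (ℓ * ℓ * ℓ)) := by exact_mod_cast hk
    _ = G * (n : ℝ) ^ 2 * (ℓ : ℝ) ^ 3 := by ring
    _ ≤ G * (n : ℝ) ^ 2 * ((1 + 3 / (ε * Real.log 2)) ^ 3 * (n : ℝ) ^ ε) :=
        mul_le_mul_of_nonneg_left hlog (by positivity)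
    _ = G * (1 + 3 / (ε * Real.log 2)) ^ 3 * (n : ℝ) ^ (2 + ε) := by
        rw [Real.rpow_add hn0, Real.rpow_two]; ring
    _ ≤ C * (n : ℝ) ^ (2 + ε) := mul_le_mul_of_nonneg_right hC (by positivity)

end

/-! ### Execution on the machine -/

theorem Run.haltsIn {E : Env} {w s : ℕ} (hf : Fits E w s) {p : Stmt} {σ σ' : St} (h : Run E p σ σ')
    {m : Memory} (hr : Rep E σ m) (hd : 80 + p.depth ≤ 96) :
    ∃ k m', HaltsIn (p.code 0) E.T w s k m m' ∧ Rep E σ' m' ∧ k ≤ p.size * (σ'.clk - σ.clk + 1) := by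
  obtain ⟨k, m', h1, h2, h3⟩ := h.code_correct hf hr (P := p.code 0) (o := 0)
    (fun i _ => by rw [zero_add]) hd
  exact ⟨k, m', ⟨_, h1, by rw [Stmt.length_code, zero_add]⟩, h2, h3⟩

theorem Rep.setArgs {E : Env} {σ : St} {m : Memory} (h : Rep E σ m) {x y : ℕ} (hx : x < E.W)
    (hy : y < E.W) : Rep E ((σ.set .i x).set .j y) (setArgs m x y) where
  var z := by
    simp only [LCE.setArgs, St.set_v]
    by_cases hj : z = .j
    · subst hj; simp [show Var.j.ctorIdx = 1 from rfl]
    · have h1 : z.ctorIdx ≠ 1 := fun e => hj (Var.ctorIdx_injective e)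
      rw [Function.update_of_ne h1, if_neg hj]
      by_cases hi : z = .i
      · subst hi; simp [show Var.i.ctorIdx = 0 from rfl]
      · have h0 : z.ctorIdx ≠ 0 := fun e => hi (Var.ctorIdx_injective e)
        rw [Function.update_of_ne h0, if_neg hi, h.var]
  arr a i hi := by
    rw [LCE.setArgs, Function.update_of_ne (by omega), Function.update_of_ne (by omega), h.arr a i hi]
    rfl
  var_lt z := by
    have := h.var_lt z
    simp only [St.set_v]; split_ifs <;> assumption
  arr_lt := h.arr_lt

/-- A query changes only scratch variables and no array, so the structure is intact for the next
query and the sequence is handled by induction. At most 48τ iterations, plus one for the code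
outside loops, give the factor 49. -/
theorem answers_of_ready {E : Env} {n τ J A K c w s : ℕ} {B : Set ℕ} (S : Setup E n τ J A K)
    (hf : Fits E w s) {C : ℕ} (hC : 49 * queryCode.size ≤ C) (qs : List (ℕ × ℕ))
    (hqs : ∀ q ∈ qs, q.1 < n ∧ q.2 < n) {σ : St} {m : Memory} (hr : Rep E σ m)
    (h : Ready E n τ c B σ) : Answers (queryCode.code 0) E.T w s (C * τ) m qs := by
  induction qs generalizing σ m with
  | nil => trivial
  | cons q qs ih =>
    obtain ⟨i, j⟩ := q
    obtain ⟨hi, hj⟩ := hqs _ List.mem_cons_self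
    have hW := S.word_lin
    have hr' := hr.setArgs (x := i) (y := j) (by simp at hi; omega) (by simp at hj; omega)
    have hR : Ready E n τ c B ((σ.set .i i).set .j j) :=
      Frame.ready (vs := [.i, .j]) ((Frame.set _ _ _ (by decide)).trans (Frame.set _ _ _ (by decide))) h
        (by decide)
    obtain ⟨σ', hrun, f', v', c'⟩ := wp_queryCode S hR (i := i) (j := j) (by simp) (by simp) hi hj
      (Q := fun σ' => Frame queryVars [] ((σ.set .i i).set .j j) σ' ∧ σ'.v .i = lce E.T i j ∧
        σ'.clk ≤ σ.clk + 48 * τ) fun σ' a b c => ⟨a, b, c⟩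
    obtain ⟨k, m', h1, h2, h3⟩ := hrun.haltsIn hf hr' (by decide +kernel)
    refine ⟨k, ?_, m', h1, ?_, ih (fun q hq => hqs q (List.mem_cons_of_mem _ hq)) h2
      (f'.ready hR (by decide))⟩
    · have hτ := S.pos
      have a1 : σ'.clk - ((σ.set .i i).set .j j).clk + 1 ≤ 49 * τ := by simp; omega
      calc k ≤ queryCode.size * (49 * τ) := h3.trans (Nat.mul_le_mul_left _ a1)
        _ = 49 * queryCode.size * τ := by ring
        _ ≤ C * τ := Nat.mul_le_mul_right _ hC
    · rw [← v', ← h2.var .i]; rfl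

/-- J is the number of binary digits of n/τ, and the bit length of identifiers is a binary logarithm
rounded up. With n below 2^ℓ and symbols at most n^c, all quantities fit into (c + 16) ℓ bits. -/
theorem exists_setup {c n τ : ℕ} {T : List ℕ} (hT : T.length = n) (hτ : 1 ≤ τ) (hn : τ ≤ n)
    (hA : ∀ x ∈ T, x ≤ n ^ c) : ∃ J K, J ≤ Nat.log 2 n + 1 ∧ K + 1 ≤ (c + 6) * (Nat.log 2 n + 1) ∧
      Setup ⟨T, 2 ^ ((c + 16) * (Nat.log 2 n + 1)), 1024 * (n / τ)⟩ n τ J (n ^ c) K := by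
  obtain ⟨ℓ, hℓ⟩ : ∃ ℓ, ℓ = Nat.log 2 n + 1 := ⟨_, rfl⟩
  have hnℓ : n < 2 ^ ℓ := by rw [hℓ]; exact Nat.lt_pow_succ_log_self (by norm_num) n
  have hm := Nat.div_pos hn hτ
  have hmn : n / τ ≤ n := Nat.div_le_self _ _
  have hc : n ^ c + 2 ≤ 2 ^ (c * ℓ + 2) := by
    have h1 : n ^ c ≤ 2 ^ (c * ℓ) := by
      rw [mul_comm, pow_mul]; exact Nat.pow_le_pow_left hnℓ.le c
    have h2 : 1 ≤ 2 ^ (c * ℓ) := Nat.one_le_two_pow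
    rw [pow_add]; omega
  have hnc : (n + 1) * (n ^ c + 2) ≤ 2 ^ ℓ * 2 ^ (c * ℓ + 2) := Nat.mul_le_mul hnℓ hc
  rw [← pow_add] at hnc
  set X := (n + 1) * (n ^ c + 2) with hX
  have hX0 : 2 ≤ X := by
    have : 1 * 2 ≤ X := Nat.mul_le_mul (by omega) (by omega)
    omega
  have hK1 : 2 * X ≤ 2 ^ Nat.clog 2 (2 * X) := Nat.le_pow_clog (by norm_num) _
  have hK2 : 2 ^ (Nat.clog 2 (2 * X) - 1) < 2 * X :=
    Nat.pow_pred_clog_lt_self (b := 2) (by norm_num) (x := 2 * X) (by omega)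
  have hK3 : 0 < Nat.clog 2 (2 * X) := Nat.clog_pos (by norm_num) (by omega)
  obtain ⟨K, hK⟩ := Nat.exists_eq_add_of_lt hK3
  rw [zero_add] at hK
  rw [hK, Nat.add_sub_cancel] at hK2
  rw [hK] at hK1
  have hJ1 := Nat.lt_size_self (n / τ)
  have hJ2 : 2 ^ Nat.size (n / τ) ≤ 2 * (n / τ) := by
    obtain ⟨s, hs⟩ := Nat.exists_eq_add_of_lt (Nat.size_pos.mpr hm)
    rw [zero_add] at hs
    have : 2 ^ s ≤ n / τ := Nat.lt_size.mp (by omega)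
    rw [hs, pow_succ]; omega
  rw [← hℓ]
  refine ⟨Nat.size (n / τ), K + 1, ?_, ?_, hT, hτ, hn, hJ1, hJ2, hA, hK1, ?_, ?_, le_rfl⟩
  · rw [Nat.size_le]; omega
  · have h1 : 2 ^ K < 2 ^ (1 + (ℓ + (c * ℓ + 2))) := by rw [pow_add 2 1]; omega
    rw [Nat.pow_lt_pow_iff_right (by norm_num)] at h1
    have : (c + 6) * ℓ = c * ℓ + 6 * ℓ := by ring
    omega
  · rw [pow_succ]; omega
  · have h1 : (n + 1) * X ≤ 2 ^ ℓ * 2 ^ (ℓ + (c * ℓ + 2)) := Nat.mul_le_mul hnℓ hnc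
    calc 2048 * ((n + 1) * X) ≤ 2 ^ 11 * (2 ^ ℓ * 2 ^ (ℓ + (c * ℓ + 2))) := by omega
      _ = 2 ^ (11 + (ℓ + (ℓ + (c * ℓ + 2)))) := by rw [← pow_add, ← pow_add]
      _ ≤ 2 ^ ((c + 16) * ℓ) := Nat.pow_le_pow_right (by norm_num) (by
        have : (c + 16) * ℓ = c * ℓ + 16 * ℓ := by ring
        omega)

theorem Setup.fits {c n τ J A K w C : ℕ} {T : List ℕ}
    (S : Setup ⟨T, 2 ^ w, 1024 * (n / τ)⟩ n τ J A K) (hw : 16 * (Nat.log 2 n + 1) ≤ w)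
    (hA : A = n ^ c) (hC : 16480 ≤ C) : Fits ⟨T, 2 ^ w, 1024 * (n / τ)⟩ w (C * n / τ) where
  word := rfl
  space := by
    have h1 : C * (n / τ) ≤ C * n / τ := Nat.mul_div_le_mul_div_assoc C n τ
    have h2 := S.m_pos
    -- 16480 = 96 + 16 · 1024: the cells in front of the arrays are charged to n/τ, which is at
    -- least 1.
    have h3 : 16480 * (n / τ) ≤ C * (n / τ) := Nat.mul_le_mul_right _ hC
    simp only
    omega
  addr := by
    have h1 := S.m_le
    have h2 := S.pos
    have h3 := S.le
    have h4 : n < 2 ^ (Nat.log 2 n + 1) := Nat.lt_pow_succ_log_self (by norm_num) n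
    have h5 : 2 ^ 15 * 2 ^ (Nat.log 2 n + 1) ≤ 2 ^ w := by
      rw [← pow_add]; exact Nat.pow_le_pow_right (by norm_num) (by omega)
    simp only
    omega
  input x hx := by
    have h1 := S.sym_le x hx
    have h2 := S.word_id
    have h3 : A + 2 ≤ (n + 1) * (A + 2) := Nat.le_mul_of_pos_left _ (by omega)
    simp only at h2 ⊢
    omega

theorem Rep.zero {E : Env} (hW : 0 < E.W) : Rep E ⟨fun _ => 0, fun _ _ => 0, 0⟩ fun _ => 0 :=
  ⟨fun _ => rfl, fun _ _ _ => rfl, fun _ => hW, fun _ _ _ => hW⟩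

end LCE

theorem mainTheorem1 (c : ℕ) (ε : ℝ) (hε : 0 < ε) :
    ∃ (build query : LCE.Program) (κ C : ℕ), 1 ≤ κ ∧
      ∀ (n τ : ℕ) (T : List ℕ), T.length = n → 1 ≤ τ → τ ≤ n → (∀ x ∈ T, x ≤ n ^ c) →
        ∃ (k : ℕ) (D : LCE.Memory),
          LCE.HaltsIn build T (κ * (Nat.log 2 n + 1)) (C * n / τ) k
            (LCE.setArgs (fun _ => 0) n τ) D ∧
          (k : ℝ) ≤ C * (n : ℝ) ^ (2 + ε) ∧
          ∀ qs : List (ℕ × ℕ), (∀ q ∈ qs, q.1 < n ∧ q.2 < n) →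
            LCE.Answers query T (κ * (Nat.log 2 n + 1)) (C * n / τ) (C * τ) D qs := by
  obtain ⟨s, hs⟩ : ∃ s, s = LCE.buildCode.size := ⟨_, rfl⟩
  -- One more than the 600000 of the cost bound, to absorb the additive one in the translation from
  -- iterations to steps; `c + 6` is the factor in the bit length of identifiers.
  obtain ⟨G, hG⟩ : ∃ G, G = s * (600001 * ((c + 6) * (c + 6))) := ⟨_, rfl⟩
  obtain ⟨C, hC⟩ : ∃ C : ℕ, 16480 ≤ C ∧ 49 * LCE.queryCode.size ≤ C ∧
      (G : ℝ) * (1 + 3 / (ε * Real.log 2)) ^ 3 ≤ C := by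
    obtain ⟨C, hC⟩ := exists_nat_ge ((G : ℝ) * (1 + 3 / (ε * Real.log 2)) ^ 3)
    exact ⟨C + 16480 + 49 * LCE.queryCode.size, by omega, by omega, hC.trans (by
      push_cast; nlinarith [Nat.cast_nonneg (α := ℝ) LCE.queryCode.size])⟩
  obtain ⟨hC1, hC2, hC3⟩ := hC
  refine ⟨LCE.buildCode.code 0, LCE.queryCode.code 0, c + 16, C, by omega, ?_⟩
  intro n τ T hT hτ hn hA
  obtain ⟨J, K, hJ, hK, S⟩ := LCE.exists_setup hT hτ hn hA
  have hF := S.fits (C := C) (Nat.mul_le_mul_right _ (by omega)) rfl hC1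
  have hW := S.word_lin
  have hr := (LCE.Rep.zero (E := ⟨T, 2 ^ ((c + 16) * (Nat.log 2 n + 1)), 1024 * (n / τ)⟩)
    (by omega)).setArgs (x := n) (y := τ) (by omega) (by omega)
  obtain ⟨σ, hrun, ⟨r, B, hR⟩, hcl⟩ := LCE.wp_buildCode S
    (σ := (LCE.St.set ⟨fun _ => 0, fun _ _ => 0, 0⟩ .i n).set .j τ) (by simp) (by simp)
  obtain ⟨k, D, h1, h2, h3⟩ := hrun.haltsIn hF hr (by decide +kernel)
  rw [← hs] at h3
  refine ⟨k, D, h1, ?_, fun qs hqs => LCE.answers_of_ready S hF hC2 qs hqs h2 hR⟩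
  have hcost := LCE.buildCost_le (D := c + 6) hτ hn S.J_le_m (by omega) hJ
    (Nat.lt_pow_succ_log_self (by norm_num) n) (by omega) hK
  obtain ⟨ℓ, hℓ⟩ : ∃ ℓ, ℓ = Nat.log 2 n + 1 := ⟨_, rfl⟩
  rw [← hℓ] at hcost
  have hk : k ≤ G * (n * n * (ℓ * ℓ * ℓ)) := by
    have hpos : 1 ≤ n * n * ((c + 6) * (c + 6) * (ℓ * ℓ * ℓ)) := by
      have h1 : 0 < n := by omega
      have h2 : 0 < ℓ := by omega
      exact Nat.mul_pos (Nat.mul_pos h1 h1) (Nat.mul_pos (Nat.mul_pos (by omega) (by omega))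
        (Nat.mul_pos (Nat.mul_pos h2 h2) h2))
    simp only [LCE.St.set_clk] at hcl h3
    calc k ≤ s * (600001 * (n * n * ((c + 6) * (c + 6) * (ℓ * ℓ * ℓ)))) :=
          h3.trans (Nat.mul_le_mul_left _ (by omega))
      _ = G * (n * n * (ℓ * ℓ * ℓ)) := by rw [hG]; ring
  exact LCE.cast_le_rpow hε (hτ.trans hn) hC3 hℓ hk
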